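/- Let $(M,g)$ be a smooth, compact, connected, oriented Riemannian manifold of dimension $n+m$ (without boundary), with a foliation $\mathcal F$ with $m$-dimensional leaves. Let $\mathcal V$ be the bundle of vectors tangent to the leaves, $\mathcal H=\mathcal V^{\perp}$, and $\pi_{\mathcal V},\pi_{\mathcal H}$ the orthogonal projections. Assume that $\mathcal H$ is everywhere bracket-generating and that the foliation is Riemannian and totally geodesic: $(\mathcal L_Zg)(X,X)=0$ and $(\mathcal L_Xg)(Z,Z)=0$ for all $X\in\Gamma(\mathcal H)$, $Z\in\Gamma(\mathcal V)$. With $\nabla^g$ the Levi-Civita connection of $g$, let $\nabla$ be the Bott connection $$\nabla_XY=\pi_{\mathcal H}\nabla^g_{\pi_{\mathcal H}X}\pi_{\mathcal H}Y+\pi_{\mathcal H}[\pi_{\mathcal V}X,\pi_{\mathcal H}Y]+\pi_{\mathcal V}[\pi_{\mathcal H}X,\pi_{\mathcal V}Y]+\pi_{\mathcal V}\nabla^g_{\pi_{\mathcal V}X}\pi_{\mathcal V}Y ,$$ let $T(X,Y)=-\pi_{\mathcal V}[\pi_{\mathcal H}X,\pi_{\mathcal H}Y]$ be its torsion, and define $J$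 by $\langle J_ZX,Y\rangle_g=\langle Z,T(X,Y)\rangle_g$. For $\varepsilon>0$ let $g_\varepsilon=g|_{\mathcal H}\oplus\frac1\varepsilon g|_{\mathcal V}$, let $\nabla^\varepsilon_XY=\nabla_XY-T(X,Y)+\frac1\varepsilon J_YX$, and for differential forms $\eta$ let $\delta_{\mathcal H,\varepsilon}\eta=-\operatorname{tr}_{\mathcal H}(\nabla^\varepsilon_\times\eta)(\times,\cdot)$, where the trace is taken over $\mathcal H$ with respect to $g$ (and $\delta_{\mathcal H,\varepsilon}=0$ on functions). Let $\Delta_{\mathcal H,\varepsilon}=-\delta_{\mathcal H,\varepsilon}d-d\,\delta_{\mathcal H,\varepsilon}$ be the $\varepsilon$-horizontal Laplacian on $\Omega(M)=\bigoplus_{k=0}^{n+m}\Omega^k(M)$, the space of smooth forms. Then, for each $\varepsilon>0$, the operator $\Delta_{\mathcal H,\varepsilon}$ is symmetric on $\Omega(M)$ with respect to the $L^2$-inner product of $g_\varepsilon$ if and only if $$(\nabla_vJ)_w=-\frac1{2\varepsilon}[J_v,J_w]\qquad\text{for all }v,w\in T_xM,\ x\in M.$$ In particular, under this condition $\nabla_vJ=0$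 for every $v\in\mathcal H$. -/

import Mathlib

open Bundle Manifold MeasureTheory VectorField
open scoped ContDiff Topology

noncomputable section

namespace TGFoliation

/-! ### Vector fields, forms, metrics, distributions on a manifold of dimension `d` -/

/-- The model space of a `d`-dimensional manifold. -/
abbrev Eu (d : ℕ) : Type := EuclideanSpace ℝ (Fin d)

section Basic

variable (d : ℕ) (M : Type*) [TopologicalSpace M] [ChartedSpace (Eu d) M]

/-- Vector fields (with no regularity required). -/
abbrev VecField : Type _ := ∀ x : M, TangentSpace (𝓡 d) x

/-- Differential forms of degree `k` (with no regularity required). -/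
abbrev Form (k : ℕ) : Type _ := ∀ x : M, TangentSpace (𝓡 d) x [⋀^Fin k]→L[ℝ] ℝ

/-- Elements of `⨁ₖ Ωᵏ`, `0 ≤ k ≤ d` (with no regularity required). -/
abbrev MixedForm : Type _ := ∀ k : Fin (d + 1), Form d M k

/-- Families of subspaces of the tangent spaces. -/
abbrev Distribution : Type _ := ∀ x : M, Submodule ℝ (TangentSpace (𝓡 d) x)

/-- Smooth Riemannian metrics. -/
abbrev Metric [IsManifold (𝓡 d) ∞ M] : Type _ :=
  ContMDiffRiemannianMetric (𝓡 d) ∞ (Eu d) (fun x : M => TangentSpace (𝓡 d) x)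

/-- Families of real functions of two tangent vectors at a point; used for the bilinear forms
`g` and `g_ε`. -/
abbrev TwoTensor : Type _ :=
  ∀ x : M, TangentSpace (𝓡 d) x → TangentSpace (𝓡 d) x → ℝ

end Basic

variable {d : ℕ} {M : Type*} [TopologicalSpace M] [ChartedSpace (Eu d) M]

/-- The basis of `T_x M` given by the coordinate vectors of the preferred chart at `x`. -/
def frame (x : M) (i : Fin d) : TangentSpace (𝓡 d) x :=
  (EuclideanSpace.basisFun (Fin d) ℝ i : Eu d)

/-- Gram matrix of a bilinear form in the basis `frame x`. -/
def gram {x : M} (B : TangentSpace (𝓡 d) x → TangentSpace (𝓡 d) x → ℝ) :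
    Matrix (Fin d) (Fin d) ℝ :=
  Matrix.of fun i j => B (frame x i) (frame x j)

section Smooth

variable [IsManifold (𝓡 d) ∞ M]

/-- Smooth vector fields. -/
def IsSmoothField (X : VecField d M) : Prop :=
  ContMDiff (𝓡 d) (𝓡 d).tangent ∞ (fun x => (⟨x, X x⟩ : TangentBundle (𝓡 d) M))

/-- Smooth differential forms: smooth sections of the bundle of alternating `k`-linear forms on the
tangent spaces. -/
def IsSmoothForm {k : ℕ} (η : Form d M k) : Prop :=
  ContMDiff (𝓡 d) ((𝓡 d).prod 𝓘(ℝ, Eu d [⋀^Fin k]→L[ℝ] ℝ)) ∞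
    (fun x => TotalSpace.mk' (Eu d [⋀^Fin k]→L[ℝ] ℝ)
      (E := fun x : M => TangentSpace (𝓡 d) x [⋀^Fin k]→L[ℝ] (Bundle.Trivial M ℝ x)) x (η x))

/-- The tangent vector `v ∈ T_x M`, extended to a neighbourhood of `x` as the vector field with
constant coefficients in the preferred chart at `x`. -/
def ext {x : M} (v : TangentSpace (𝓡 d) x) : VecField d M :=
  fun y => FiberBundle.extend (Eu d) v y

/-- `V` is the tangent distribution of a foliation of codimension `n`: locally, the leaves are the
fibres of a smooth submersion to `ℝⁿ`, so `V` is the kernel of its differential. -/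
def IsFoliation (n : ℕ) (V : Distribution d M) : Prop :=
  ∀ x₀ : M, ∃ U : Set M, IsOpen U ∧ x₀ ∈ U ∧ ∃ f : M → Eu n,
    ContMDiffOn (𝓡 d) (𝓡 n) ∞ f U ∧
      ∀ x ∈ U, Function.Surjective (mfderiv (𝓡 d) (𝓡 n) f x) ∧
        V x = LinearMap.ker (mfderiv (𝓡 d) (𝓡 n) f x).toLinearMap

/-- `M` is orientable: it carries a smooth nowhere vanishing form of top degree. -/
def IsOrientable (d : ℕ) (M : Type*) [TopologicalSpace M] [ChartedSpace (Eu d) M]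
    [IsManifold (𝓡 d) ∞ M] : Prop :=
  ∃ η : Form d M d, IsSmoothForm η ∧ ∀ x, η x ≠ 0

/-! ### Horizontal distribution and projections -/

/-- The metric at `x` as a bilinear form. -/
def metricForm (g : Metric d M) (x : M) : LinearMap.BilinForm ℝ (TangentSpace (𝓡 d) x) :=
  LinearMap.mk₂ ℝ (fun v w => g.inner x v w)
    (by intros; simp) (by intros; simp) (by intros; simp) (by intros; simp)

/-- The horizontal distribution, the orthogonal complement of `V`. -/
def horizontal (g : Metric d M) (V : Distribution d M) : Distribution d M :=
  fun x => (metricForm g x).orthogonal (V x)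

theorem isCompl_horizontal (g : Metric d M) (V : Distribution d M) (x : M) :
    IsCompl (V x) (horizontal g V x) := by
  have : FiniteDimensional ℝ (TangentSpace (𝓡 d) x) :=
    inferInstanceAs (FiniteDimensional ℝ (Eu d))
  apply LinearMap.BilinForm.isCompl_orthogonal_of_restrict_nondegenerate
  · intro v w h
    change g.inner x w v = 0
    rw [g.symm]
    exact h
  · have key : ∀ v : V x, (∀ w : V x, g.inner x v w = 0) → v = 0 := by
      intro v h
      by_contra hv
      have h2 : (v : TangentSpace (𝓡 d) x) ≠ 0 := fun h0 => hv (Subtype.ext h0)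
      exact (g.pos x v h2).ne' (h v)
    refine ⟨fun v h => key v h, fun v h => key v fun w => ?_⟩
    rw [g.symm]
    exact h w

/-- Orthogonal projection to `V`. -/
def projV (g : Metric d M) (V : Distribution d M) (x : M) :
    TangentSpace (𝓡 d) x →ₗ[ℝ] TangentSpace (𝓡 d) x :=
  Submodule.projection _ _ (isCompl_horizontal g V x)

/-- Orthogonal projection to the horizontal distribution. -/
def projH (g : Metric d M) (V : Distribution d M) (x : M) :
    TangentSpace (𝓡 d) x →ₗ[ℝ] TangentSpace (𝓡 d) x :=
  Submodule.projection _ _ (isCompl_horizontal g V x).symm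

/-- Vertical part of a vector field. -/
def vert (g : Metric d M) (V : Distribution d M) (X : VecField d M) : VecField d M :=
  fun x => projV g V x (X x)

/-- Horizontal part of a vector field. -/
def hor (g : Metric d M) (V : Distribution d M) (X : VecField d M) : VecField d M :=
  fun x => projH g V x (X x)

/-- Iterated Lie brackets of smooth sections of the distribution `D`. -/
inductive IteratedBracket (D : Distribution d M) : VecField d M → Prop
  | base (X : VecField d M) (hX : IsSmoothField X) (hD : ∀ x, X x ∈ D x) : IteratedBracket D X
  | bracket (X Y : VecField d M) (hX : IteratedBracket D X) (hY : IteratedBracket D Y) :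
      IteratedBracket D (mlieBracket (𝓡 d) X Y)

/-- `D` is everywhere bracket-generating. -/
def IsBracketGenerating (D : Distribution d M) : Prop :=
  ∀ x : M, Submodule.span ℝ {v | ∃ X, IteratedBracket D X ∧ X x = v} = ⊤

/-- The canonical variation `g_ε = g_H ⊕ ε⁻¹ g_V`. -/
def gEps (g : Metric d M) (V : Distribution d M) (ε : ℝ) : TwoTensor d M :=
  fun x v w => g.inner x (projH g V x v) (projH g V x w)
    + ε⁻¹ * g.inner x (projV g V x v) (projV g V x w)

/-- `(L_X g)(Y, Z)`. -/
def lieDerivMetric (g : Metric d M) (X Y Z : VecField d M) (x : M) : ℝ :=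
  mvfderiv (𝓡 d) (fun y => g.inner y (Y y) (Z y)) x (X x)
    - g.inner x (mlieBracket (𝓡 d) X Y x) (Z x) - g.inner x (Y x) (mlieBracket (𝓡 d) X Z x)

/-- The foliation is Riemannian (`(L_Z g)(X, X) = 0`) and totally geodesic (`(L_X g)(Z, Z) = 0`),
for all horizontal `X` and vertical `Z`. -/
def IsRiemannianTotallyGeodesic (g : Metric d M) (V : Distribution d M) : Prop :=
  ∀ X Z : VecField d M, IsSmoothField X → IsSmoothField Z →
    (∀ x, X x ∈ horizontal g V x) → (∀ x, Z x ∈ V x) →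
      ∀ x, lieDerivMetric g Z X X x = 0 ∧ lieDerivMetric g X Z Z x = 0

/-! ### Connections -/

/-- The vector `u` with `⟨u, w⟩ = φ w` for all `w`, for a linear form `φ` on `T_x M`:
`u = ∑ g^{ij} φ(e_i) e_j`. -/
def sharp (g : Metric d M) (x : M) (φ : TangentSpace (𝓡 d) x → ℝ) : TangentSpace (𝓡 d) x :=
  ∑ i, ∑ j, ((gram fun v w => g.inner x v w)⁻¹ i j * φ (frame x i)) • frame x j

/-- The right hand side of the Koszul formula for `2 ⟨∇^g_X Y, Z⟩`. -/
def koszul (g : Metric d M) (X Y Z : VecField d M) (x : M) : ℝ :=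
  mvfderiv (𝓡 d) (fun y => g.inner y (Y y) (Z y)) x (X x)
    + mvfderiv (𝓡 d) (fun y => g.inner y (X y) (Z y)) x (Y x)
    - mvfderiv (𝓡 d) (fun y => g.inner y (X y) (Y y)) x (Z x)
    + g.inner x (mlieBracket (𝓡 d) X Y x) (Z x)
    - g.inner x (mlieBracket (𝓡 d) X Z x) (Y x)
    - g.inner x (mlieBracket (𝓡 d) Y Z x) (X x)

/-- The Levi-Civita connection `∇^g_X Y`. -/
def leviCivita (g : Metric d M) (X Y : VecField d M) : VecField d M :=
  fun x => sharp g x fun z => (1 / 2) * koszul g X Y (ext z) x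

/-- The Bott connection `∇_X Y`. -/
def bott (g : Metric d M) (V : Distribution d M) (X Y : VecField d M) : VecField d M :=
  fun x =>
    projH g V x (leviCivita g (hor g V X) (hor g V Y) x)
    + projH g V x (mlieBracket (𝓡 d) (vert g V X) (hor g V Y) x)
    + projV g V x (mlieBracket (𝓡 d) (hor g V X) (vert g V Y) x)
    + projV g V x (leviCivita g (vert g V X) (vert g V Y) x)

/-- The torsion of the Bott connection, `T(v, w) = - π_V [π_H v, π_H w]`. -/
def torsion (g : Metric d M) (V : Distribution d M) (x : M) (v w : TangentSpace (𝓡 d) x) :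
    TangentSpace (𝓡 d) x :=
  - projV g V x (mlieBracket (𝓡 d) (hor g V (ext v)) (hor g V (ext w)) x)

/-- `J_z v`, defined by `⟨J_z v, w⟩ = ⟨z, T(v, w)⟩`. -/
def J (g : Metric d M) (V : Distribution d M) (x : M) (z v : TangentSpace (𝓡 d) x) :
    TangentSpace (𝓡 d) x :=
  sharp g x fun w => g.inner x z (torsion g V x v w)

/-- `(∇_v J)_w u` for the Bott connection `∇`. -/
def nablaJ (g : Metric d M) (V : Distribution d M) (x : M) (v w u : TangentSpace (𝓡 d) x) :
    TangentSpace (𝓡 d) x :=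
  bott g V (ext v) (fun y => J g V y (ext w y) (ext u y)) x
    - J g V x (bott g V (ext v) (ext w) x) u
    - J g V x w (bott g V (ext v) (ext u) x)

/-- The connection `∇^ε_X Y = ∇_X Y - T(X, Y) + ε⁻¹ J_Y X`. -/
def nablaEps (g : Metric d M) (V : Distribution d M) (ε : ℝ) (X Y : VecField d M) :
    VecField d M :=
  fun x => bott g V X Y x - torsion g V x (X x) (Y x) + ε⁻¹ • J g V x (Y x) (X x)

/-! ### Operators on forms -/

/-- A form, pulled back to the model space by the inverse of the preferred chart at `x`. -/
def chartForm {k : ℕ} (η : Form d M k) (x : M) (u : Eu d) : Eu d [⋀^Fin k]→L[ℝ] ℝ :=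
  (η ((extChartAt (𝓡 d) x).symm u)).compContinuousLinearMap
    (mfderiv 𝓘(ℝ, Eu d) (𝓡 d) (extChartAt (𝓡 d) x).symm u)

/-- The exterior derivative, computed at each `x` in the preferred chart at `x`. (The tangent
space at `x` is identified with the model space by the differential of this chart.) -/
def extD {k : ℕ} (η : Form d M k) : Form d M (k + 1) :=
  fun x => extDeriv (chartForm η x) (extChartAt (𝓡 d) x x)

/-- The coefficients of `∇^ε` at `x`: the linear map `w ↦ ∇^ε_v w`, where `w` is extended with
constant coefficients in the chart at `x`. -/
def connCoeff (g : Metric d M) (V : Distribution d M) (ε : ℝ) {x : M}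
    (v : TangentSpace (𝓡 d) x) : Eu d →L[ℝ] Eu d :=
  LinearMap.toContinuousLinearMap
    ((EuclideanSpace.basisFun (Fin d) ℝ).toBasis.constr ℝ
      fun j => (nablaEps g V ε (ext v) (ext (frame x j)) x : Eu d))

/-- The covariant derivative `∇^ε_v η` of a form. In the chart at `x`, with `w₁, …, w_k` extended
with constant coefficients, this is the Leibniz rule
`(∇_v η)(w₁, …, w_k) = v (η(w₁, …, w_k)) - ∑ᵢ η(w₁, …, ∇_v wᵢ, …, w_k)`. -/
def nablaForm (g : Metric d M) (V : Distribution d M) (ε : ℝ) {k : ℕ} (η : Form d M k) (x : M)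
    (v : TangentSpace (𝓡 d) x) : Eu d [⋀^Fin k]→L[ℝ] ℝ :=
  fderiv ℝ (chartForm η x) (extChartAt (𝓡 d) x x) v
    - ContinuousAlternatingMap.fderivCompContinuousLinearMap (η x : Eu d [⋀^Fin k]→L[ℝ] ℝ)
        (ContinuousLinearMap.id ℝ (Eu d)) (connCoeff g V ε v)

/-- The `ε`-horizontal divergence `δ η = - tr_H (∇^ε_× η)(×, ·)`. The trace over the horizontal
space of a bilinear form `B` is `∑ g^{ij} B(π_H e_i, π_H e_j)`. -/
def divH (g : Metric d M) (V : Distribution d M) (ε : ℝ) {k : ℕ} (η : Form d M (k + 1)) :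
    Form d M k :=
  fun x => - ∑ i, ∑ j, ((gram fun v w => g.inner x v w)⁻¹ i j) •
    ContinuousAlternatingMap.curryLeft
      (nablaForm g V ε η x (projH g V x (frame x i)))
      (projH g V x (frame x j))

/-- The `ε`-horizontal Laplacian `- δ d - d δ` (with `δ = 0` on functions). -/
def lapH (g : Metric d M) (V : Distribution d M) (ε : ℝ) : {k : ℕ} → Form d M k → Form d M k
  | 0, η => fun x => - divH g V ε (extD η) x
  | _ + 1, η => fun x => - divH g V ε (extD η) x - extD (divH g V ε η) x

/-- The `ε`-horizontal Laplacian on `⨁ₖ Ωᵏ`. -/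
def lapMixed (g : Metric d M) (V : Distribution d M) (ε : ℝ) (α : MixedForm d M) :
    MixedForm d M :=
  fun k => lapH g V ε (α k)

/-! ### The `L²` inner product -/

/-- Gram matrix of `B` with respect to the coordinate vector fields of the preferred chart at `x`,
at the point with coordinates `u`. -/
def chartGram (B : TwoTensor d M) (x : M) (u : Eu d) : Matrix (Fin d) (Fin d) ℝ :=
  Matrix.of fun i j =>
    B ((extChartAt (𝓡 d) x).symm u)
      (mfderiv 𝓘(ℝ, Eu d) (𝓡 d) (extChartAt (𝓡 d) x).symm u
        (EuclideanSpace.basisFun (Fin d) ℝ i))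
      (mfderiv 𝓘(ℝ, Eu d) (𝓡 d) (extChartAt (𝓡 d) x).symm u
        (EuclideanSpace.basisFun (Fin d) ℝ j))

/-- The Riemannian volume `√(det B_{ij}) du` on the domain of the preferred chart at `x`, as a
measure on `M` that vanishes outside of this domain. -/
def chartVolume [MeasurableSpace M] (B : TwoTensor d M) (x : M) : Measure M :=
  Measure.map (extChartAt (𝓡 d) x).symm
    ((volume.restrict (extChartAt (𝓡 d) x).target).withDensity
      fun u => ENNReal.ofReal (Real.sqrt (chartGram B x u).det))

/-- The Riemannian volume measure of `B`: the least measure which is at least `√(det B_{ij}) du` in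
every preferred chart. (The measures of the charts agree on overlaps, so this is the measure which
is equal to `√(det B_{ij}) du` in every chart.) -/
def riemVolume [MeasurableSpace M] (B : TwoTensor d M) : Measure M :=
  ⨆ x : M, chartVolume B x

/-- Inner product induced on `k`-forms at `x` by the inner product `B` on `T_x M`:
`(1 / k!) ∑ B^{i₁ j₁} ⋯ B^{i_k j_k} α_{i₁ … i_k} β_{j₁ … j_k}`. -/
def formInner {x : M} (B : TangentSpace (𝓡 d) x → TangentSpace (𝓡 d) x → ℝ) {k : ℕ}
    (α β : TangentSpace (𝓡 d) x [⋀^Fin k]→L[ℝ] ℝ) : ℝ :=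
  (1 / (k.factorial : ℝ)) * ∑ I : Fin k → Fin d, ∑ K : Fin k → Fin d,
    (∏ a, (gram B)⁻¹ (I a) (K a)) * α (fun a => frame x (I a)) * β (fun a => frame x (K a))

/-- The `L²` inner product on `⨁ₖ Ωᵏ` defined by `B`; different degrees are orthogonal. -/
def l2Inner [MeasurableSpace M] (B : TwoTensor d M) (α β : MixedForm d M) : ℝ :=
  ∑ k, ∫ x, formInner (B x) (α k x) (β k x) ∂(riemVolume B)

/-- The `ε`-horizontal Laplacian is symmetric for the `L²` inner product of `g_ε`. -/
def IsSymmetricLap [MeasurableSpace M] (g : Metric d M) (V : Distribution d M) (ε : ℝ) : Prop :=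
  ∀ α β : MixedForm d M, (∀ k, IsSmoothForm (α k)) → (∀ k, IsSmoothForm (β k)) →
    l2Inner (gEps g V ε) (lapMixed g V ε α) β = l2Inner (gEps g V ε) α (lapMixed g V ε β)

/-- `(∇_v J)_w = - (1 / 2ε) [J_v, J_w]` for all tangent vectors `v, w` at all points. -/
def SymmetryCondition (g : Metric d M) (V : Distribution d M) (ε : ℝ) : Prop :=
  ∀ (x : M) (v w u : TangentSpace (𝓡 d) x),
    nablaJ g V x v w u
      = (-(1 / (2 * ε))) • (J g V x v (J g V x w u) - J g V x w (J g V x v u))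

end Smooth

end TGFoliation

end

/-! For horizontal X put ∇'_Z X = ∇_Z X + ε⁻¹ J_Z X. This connection preserves the horizontal bundle
and is adjoint to ∇^ε in the sense that ∇^ε_X Z = [X, Z] + ∇'_Z X. Let X_j be a local horizontal
frame, ω_jl the connection forms of ∇' and h the inverse Gram matrix of the frame. Then on forms
∇^ε_{X_j} = L_{X_j} − ∑ ω_jl ∧ ι_{X_l}. Lie derivatives commute with d, so commuting ∇^ε with d
produces, besides connection terms, only the curvature two-forms Ω_jp of ∇'. The connection terms
cancel because h is parallel, and this gives a Weitzenböck formula (`AdaptedFrame.weitzenboeck`):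
the horizontal Laplacian is a rough Laplacian plus the zeroth order term α ↦ ∑ h_ij ι_{X_i} (Ω_jp ∧
ι_{X_p} α).

The rough Laplacian is always symmetric. Since the foliation is Riemannian and totally geodesic, g_ε
is parallel for ∇^ε in horizontal directions (`LocalFoliation.fderiv_Geps`), hence the divergence of
X_j is ∑ ω_jl(X_l) and no boundary or mean curvature term survives integration by parts
(`AdaptedFrame.integral_rough`). Symmetry of the Laplacian is therefore equivalent to pointwise
symmetry of the zeroth order term. One direction is a partition of unity (`integral_fip_lapH_comm`),
the other an evaluation on test forms built from the defect of symmetry itself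
(`ip_zeroth_comm_of_integral`).

The rest is algebra at a point. Restricted to horizontal vectors, Ω with its index lowered is the
curvature of the transverse Levi-Civita connection plus ε⁻¹⟨T, T⟩, and so has the skew and pair
symmetries of a Riemannian curvature tensor (`curvLow_pair`). If Ω vanishes on vertical vectors,
these symmetries make the zeroth order term symmetric in every degree (`ip_weitz_comm`). Conversely,
symmetry on one- and two-forms, tested against vertical covectors, forces Ω(z, ·) = 0 for vertical z
(`curv_eq_zero`).

Finally Ω(X, z) = ε⁻¹ (∇_X J)_z and Ω(z, w) = 2ε⁻¹ ((∇_z J)_w + (1/2ε) [J_z, J_w]) for X horizontal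
and z, w vertical (`curv_X_vert`, `curv_vert_vert`). The factor 2 comes from (∇_z J)_w being skew in
z and w, because the torsion fields T(X_j, X_i) are Killing along the leaves (`lieG_T`). Both
components vanish exactly when the condition on ∇J holds (`jCondition_iff`). For horizontal v one
has J_v = 0, so the right-hand side of the condition vanishes, which is the last claim.

Local computations take place on open sets of ℝᵈ, where the foliation is given by closed forms θ_i,
the differentials of a local submersion. Objects on M at a point y are computed in the preferred
chart at y, so they are compared in a fixed chart by naturality under changes of coordinates
(`FolMap`). -/

open Bundle Manifold MeasureTheory VectorField
open scoped ContDiff Topology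

noncomputable section

namespace TGFoliation

/-! ### Algebra of alternating forms -/

section AltAlgebra

open ContinuousAlternatingMap

variable {E : Type*} [NormedAddCommGroup E] [NormedSpace ℝ E] {k : ℕ}

/-- Alternatization of a form-valued linear map. -/
def altern : (E →L[ℝ] E [⋀^Fin k]→L[ℝ] ℝ) →L[ℝ] E [⋀^Fin (k + 1)]→L[ℝ] ℝ :=
  alternatizeUncurryFinCLM ℝ E ℝ

/-- Contraction `ι_v α` as a continuous bilinear map. -/
def iota : E →L[ℝ] (E [⋀^Fin (k + 1)]→L[ℝ] ℝ) →L[ℝ] E [⋀^Fin k]→L[ℝ] ℝ :=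
  (curryLeftLI (𝕜 := ℝ) (E := E) (F := ℝ) (n := k)).toContinuousLinearMap.flip

/-- The wedge product `θ ∧ α` with a covector, as a continuous bilinear map. -/
def wedge : (E →L[ℝ] ℝ) →L[ℝ] (E [⋀^Fin k]→L[ℝ] ℝ) →L[ℝ] E [⋀^Fin (k + 1)]→L[ℝ] ℝ :=
  (ContinuousLinearMap.compL ℝ (E [⋀^Fin k]→L[ℝ] ℝ) (E →L[ℝ] E [⋀^Fin k]→L[ℝ] ℝ)
    (E [⋀^Fin (k + 1)]→L[ℝ] ℝ) altern) ∘L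
      ContinuousLinearMap.smulRightL ℝ E (E [⋀^Fin k]→L[ℝ] ℝ)

/-- The wedge product with the alternatization of a bilinear form. -/
def wedge2 (B : E →L[ℝ] E →L[ℝ] ℝ) (α : E [⋀^Fin k]→L[ℝ] ℝ) : E [⋀^Fin (k + 2)]→L[ℝ] ℝ :=
  altern (wedge.flip α ∘L B)

/-- The derivation of forms induced by an endomorphism. -/
def derivn (A : E →L[ℝ] E) (α : E [⋀^Fin k]→L[ℝ] ℝ) : E [⋀^Fin k]→L[ℝ] ℝ :=
  α.fderivCompContinuousLinearMap (ContinuousLinearMap.id ℝ E) A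

theorem altern_apply (f : E →L[ℝ] E [⋀^Fin k]→L[ℝ] ℝ) : altern f = alternatizeUncurryFin f := rfl

theorem iota_apply (v : E) (α : E [⋀^Fin (k + 1)]→L[ℝ] ℝ) : iota v α = α.curryLeft v := rfl

theorem iota_apply_apply (v : E) (α : E [⋀^Fin (k + 1)]→L[ℝ] ℝ) (w : Fin k → E) :
    iota v α w = α (Fin.cons v w) := rfl

theorem wedge_apply (θ : E →L[ℝ] ℝ) (α : E [⋀^Fin k]→L[ℝ] ℝ) :
    wedge θ α = altern (θ.smulRight α) := rfl

theorem wedge2_apply (B : E →L[ℝ] E →L[ℝ] ℝ) (α : E [⋀^Fin k]→L[ℝ] ℝ) :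
    wedge2 B α = altern (wedge.flip α ∘L B) := rfl

theorem wedge2_add_left (B B' : E →L[ℝ] E →L[ℝ] ℝ) (α : E [⋀^Fin k]→L[ℝ] ℝ) :
    wedge2 (B + B') α = wedge2 B α + wedge2 B' α := by
  rw [wedge2, ContinuousLinearMap.comp_add]; exact altern.map_add _ _

theorem wedge2_smul_left (c : ℝ) (B : E →L[ℝ] E →L[ℝ] ℝ) (α : E [⋀^Fin k]→L[ℝ] ℝ) :
    wedge2 (c • B) α = c • wedge2 B α := by
  rw [wedge2, ContinuousLinearMap.comp_smul]; exact altern.map_smul _ _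

theorem wedge2_zero_left (α : E [⋀^Fin k]→L[ℝ] ℝ) :
    wedge2 (0 : E →L[ℝ] E →L[ℝ] ℝ) α = 0 := by
  rw [wedge2, ContinuousLinearMap.comp_zero]; exact altern.map_zero

theorem wedge2_sum_left {ι : Type*} (s : Finset ι) (B : ι → E →L[ℝ] E →L[ℝ] ℝ)
    (α : E [⋀^Fin k]→L[ℝ] ℝ) : wedge2 (∑ i ∈ s, B i) α = ∑ i ∈ s, wedge2 (B i) α := by
  classical
  induction s using Finset.induction_on with
  | empty => simp [wedge2_zero_left]
  | insert a s ha ih => rw [Finset.sum_insert ha, Finset.sum_insert ha, wedge2_add_left, ih]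

theorem wedge2_add_right (B : E →L[ℝ] E →L[ℝ] ℝ) (α α' : E [⋀^Fin k]→L[ℝ] ℝ) :
    wedge2 B (α + α') = wedge2 B α + wedge2 B α' := by
  have : wedge.flip (α + α') ∘L B = wedge.flip α ∘L B + wedge.flip α' ∘L B := by
    ext w : 1
    exact (wedge (B w)).map_add α α'
  rw [wedge2, this]
  exact altern.map_add _ _

theorem wedge2_smul_right (c : ℝ) (B : E →L[ℝ] E →L[ℝ] ℝ) (α : E [⋀^Fin k]→L[ℝ] ℝ) :
    wedge2 B (c • α) = c • wedge2 B α := by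
  have : wedge.flip (c • α) ∘L B = c • (wedge.flip α ∘L B) := by
    ext w : 1
    exact (wedge (B w)).map_smul c α
  rw [wedge2, this]
  exact altern.map_smul _ _

theorem derivn_smul_left (c : ℝ) (A : E →L[ℝ] E) (α : E [⋀^Fin k]→L[ℝ] ℝ) :
    derivn (c • A) α = c • derivn A α := by simp [derivn]

theorem derivn_sub_left (A A' : E →L[ℝ] E) (α : E [⋀^Fin k]→L[ℝ] ℝ) :
    derivn (A - A') α = derivn A α - derivn A' α := by simp [derivn]

theorem derivn_sum_left {ι : Type*} (s : Finset ι) (A : ι → E →L[ℝ] E)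
    (α : E [⋀^Fin k]→L[ℝ] ℝ) : derivn (∑ i ∈ s, A i) α = ∑ i ∈ s, derivn (A i) α := by
  simp [derivn]

theorem derivn_apply (A : E →L[ℝ] E) (α : E [⋀^Fin k]→L[ℝ] ℝ) (v : Fin k → E) :
    derivn A α v = ∑ i, α (Function.update v i (A (v i))) := by
  rw [derivn, fderivCompContinuousLinearMap_apply]
  refine Finset.sum_congr rfl fun i _ => congrArg α (funext fun j => ?_)
  rcases eq_or_ne j i with rfl | h <;> simp [*]

theorem derivn_zero_form (A : E →L[ℝ] E) (α : E [⋀^Fin 0]→L[ℝ] ℝ) : derivn A α = 0 := by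
  ext v; simp [derivn_apply]

/-- The term of the alternation in which `v` enters the linear slot is `f v`. In all others `v` is
the first argument of the form, and the shift of the position costs a sign. The antiderivation rules
below, and Cartan's formula, come from this identity. -/
theorem iota_altern (v : E) (f : E →L[ℝ] E [⋀^Fin (k + 1)]→L[ℝ] ℝ) :
    iota v (altern f) = f v - altern (iota v ∘L f) := by
  ext w
  change _ = f v w - altern (iota v ∘L f) w
  simp only [iota_apply_apply, altern_apply, alternatizeUncurryFin_apply,
    Fin.sum_univ_succ (n := k + 1), Fin.cons_zero, Fin.val_zero, pow_zero,
    one_smul, Fin.removeNth_zero, Fin.tail_cons, Fin.cons_succ, Fin.val_succ, pow_succ,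
    mul_neg, mul_one, neg_smul, Finset.sum_neg_distrib, sub_eq_add_neg]
  congr 2
  refine Finset.sum_congr rfl fun i _ => ?_
  congr 1
  change (f (w i)) _ = (f (w i)) (Fin.cons v (i.removeNth w))
  congr 1
  exact Fin.cons_comp_succ_succAbove (β := E) v w i

/-- In degree zero the second term would contract a function. Forms are indexed by `Fin k`, so this
case has no counterpart of that term, and the same split between degree zero and positive degree
recurs throughout. -/
theorem iota_altern_zero (v : E) (f : E →L[ℝ] E [⋀^Fin 0]→L[ℝ] ℝ) :
    iota v (altern f) = f v := by
  ext w
  simp only [iota_apply_apply, altern_apply, alternatizeUncurryFin_apply]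
  simp

theorem iota_iota (v w : E) (α : E [⋀^Fin (k + 2)]→L[ℝ] ℝ) :
    iota v (iota w α) = - iota w (iota v α) := by
  have h : ∀ x, iota x (iota x α) = 0 := fun x => by
    rw [iota_apply, iota_apply]; exact curryLeft_same α x
  have := h (v + w)
  simp only [map_add, _root_.add_apply, h, zero_add, add_zero] at this
  exact eq_neg_of_add_eq_zero_right this

theorem derivn_eq_altern (A : E →L[ℝ] E) (α : E [⋀^Fin (k + 1)]→L[ℝ] ℝ) :
    derivn A α = altern (iota.flip α ∘L A) := by
  rw [derivn, fderivCompContinuousLinearMap_eq_alternatizeUncurryFin]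
  simp only [ContinuousLinearMap.comp_apply]
  rw [altern]
  congr 1

/-- Rank-one endomorphisms act as wedge after contraction. Connection matrices are sums of such
endomorphisms, up to the differential of the frame. -/
theorem derivn_smulRight (θ : E →L[ℝ] ℝ) (X : E) (α : E [⋀^Fin (k + 1)]→L[ℝ] ℝ) :
    derivn (θ.smulRight X) α = wedge θ (iota X α) := by
  rw [derivn_eq_altern, wedge_apply]
  congr 1
  ext v : 1
  simp

theorem iota_derivn (v : E) (A : E →L[ℝ] E) (α : E [⋀^Fin (k + 1)]→L[ℝ] ℝ) :
    iota v (derivn A α) = iota (A v) α + derivn A (iota v α) := by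
  cases k with
  | zero => rw [derivn_eq_altern, iota_altern_zero, derivn_zero_form]; simp
  | succ k =>
    rw [derivn_eq_altern, iota_altern, derivn_eq_altern, sub_eq_add_neg, ← map_neg]
    have : -(iota v ∘L (iota.flip α ∘L A)) = iota.flip (iota v α) ∘L A := by
      ext w : 1
      simp [iota_iota v]
    rw [this]
    rfl

theorem iota_wedge (v : E) (θ : E →L[ℝ] ℝ) (α : E [⋀^Fin (k + 1)]→L[ℝ] ℝ) :
    iota v (wedge θ α) = θ v • α - wedge θ (iota v α) := by
  rw [wedge_apply, iota_altern, wedge_apply]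
  have : iota v ∘L θ.smulRight α = θ.smulRight (iota v α) := by
    ext w : 1
    simp
  rw [this]
  rfl

theorem iota_wedge_zero (v : E) (θ : E →L[ℝ] ℝ) (α : E [⋀^Fin 0]→L[ℝ] ℝ) :
    iota v (wedge θ α) = θ v • α := by
  rw [wedge_apply, iota_altern_zero]; simp

/-- The bilinear map (v, w) ↦ θ(v) f(w) + θ(w) f(v) is symmetric, and alternating twice kills
symmetric maps. Its two summands alternate to the two sides. -/
theorem altern_wedge (θ : E →L[ℝ] ℝ) (f : E →L[ℝ] E [⋀^Fin k]→L[ℝ] ℝ) :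
    altern (wedge θ ∘L f) = - wedge θ (altern f) := by
  have h := alternatizeUncurryFin_alternatizeUncurryFinCLM_comp_of_symmetric
    (f := (ContinuousLinearMap.smulRightL ℝ E (E [⋀^Fin k]→L[ℝ] ℝ) θ) ∘L f + θ.smulRight f)
    (fun x y => by simp [add_comm])
  rw [ContinuousLinearMap.comp_add, alternatizeUncurryFin_add] at h
  rw [eq_neg_iff_add_eq_zero, ← h]
  congr 1
  rw [wedge_apply, altern_apply]
  congr 1
  ext v : 1
  simp [altern]

theorem wedge_wedge (θ φ : E →L[ℝ] ℝ) (α : E [⋀^Fin k]→L[ℝ] ℝ) :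
    wedge θ (wedge φ α) = - wedge φ (wedge θ α) := by
  rw [wedge_apply θ (α), ← altern_wedge, wedge_apply]
  congr 1
  ext v : 1
  simp

theorem wedge2_smulRight (θ φ : E →L[ℝ] ℝ) (α : E [⋀^Fin k]→L[ℝ] ℝ) :
    wedge2 (θ.smulRight φ) α = wedge θ (wedge φ α) := by
  rw [wedge2_apply, wedge_apply θ]
  congr 1
  ext v : 1
  simp

/-- Consequently only the skew part of `B` acts, which is why the curvature may be stored as a
bilinear form up to a symmetric error. -/
theorem wedge2_of_symm (B : E →L[ℝ] E →L[ℝ] ℝ) (hB : ∀ v w, B v w = B w v)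
    (α : E [⋀^Fin k]→L[ℝ] ℝ) : wedge2 B α = 0 := by
  have h := alternatizeUncurryFin_alternatizeUncurryFinCLM_comp_of_symmetric
    (f := ((ContinuousLinearMap.smulRightL ℝ E (E [⋀^Fin k]→L[ℝ] ℝ)).flip α) ∘L B)
    (fun x y => by simp [hB x y])
  rw [← h, wedge2_apply]
  rfl

theorem iota_wedge2 (v : E) (B : E →L[ℝ] E →L[ℝ] ℝ) (α : E [⋀^Fin (k + 1)]→L[ℝ] ℝ) :
    iota v (wedge2 B α) = wedge (B v - B.flip v) α + wedge2 B (iota v α) := by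
  have h : iota v ∘L (wedge.flip α ∘L B)
      = (B.flip v).smulRight α - wedge.flip (iota v α) ∘L B := by
    ext w : 1
    simp [iota_wedge]
  rw [wedge2_apply, iota_altern, map_sub, _root_.sub_apply, sub_add, h]
  congr 1
  exact _root_.map_sub (altern (E := E) (k := k + 1)) _ _

theorem iota_wedge2_zero (v : E) (B : E →L[ℝ] E →L[ℝ] ℝ) (α : E [⋀^Fin 0]→L[ℝ] ℝ) :
    iota v (wedge2 B α) = wedge (B v - B.flip v) α := by
  have h : iota v ∘L (wedge.flip α ∘L B) = (B.flip v).smulRight α := by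
    ext w : 1
    simp [iota_wedge_zero]
  rw [wedge2_apply, iota_altern, map_sub, _root_.sub_apply, h, ← wedge_apply]
  rfl

end AltAlgebra

/-! ### The inner product of forms -/

section FormProduct

variable {d : ℕ}

/-- The standard basis. -/
def eb (i : Fin d) : Eu d := EuclideanSpace.basisFun (Fin d) ℝ i

theorem eb_apply (i j : Fin d) : (eb i : Eu d) j = if j = i then 1 else 0 := by
  simp [eb]

theorem sum_eb (v : Eu d) : ∑ i, v i • eb i = v := by
  have := (EuclideanSpace.basisFun (Fin d) ℝ).sum_repr v
  simpa [eb] using this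

/-- The inner product of `k`-forms induced by an inner product on covectors with matrix `Q`. -/
def ip (Q : Matrix (Fin d) (Fin d) ℝ) : {k : ℕ} → (Eu d [⋀^Fin k]→L[ℝ] ℝ) →
    (Eu d [⋀^Fin k]→L[ℝ] ℝ) → ℝ
  | 0, α, β => α 0 * β 0
  | k + 1, α, β => (k + 1 : ℝ)⁻¹ * ∑ i, ∑ j, Q i j * ip Q (iota (eb i) α) (iota (eb j) β)

variable {Q : Matrix (Fin d) (Fin d) ℝ} {k : ℕ}

theorem ip_succ (α β : Eu d [⋀^Fin (k + 1)]→L[ℝ] ℝ) :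
    ip Q α β = (k + 1 : ℝ)⁻¹ * ∑ i, ∑ j, Q i j * ip Q (iota (eb i) α) (iota (eb j) β) := rfl

theorem ip_add_left (α α' β : Eu d [⋀^Fin k]→L[ℝ] ℝ) :
    ip Q (α + α') β = ip Q α β + ip Q α' β := by
  induction k with
  | zero => simp [ip, add_mul]
  | succ k ih => simp only [ip_succ, map_add, ih, mul_add, Finset.sum_add_distrib]

theorem ip_smul_left (c : ℝ) (α β : Eu d [⋀^Fin k]→L[ℝ] ℝ) :
    ip Q (c • α) β = c * ip Q α β := by
  induction k with
  | zero => simp [ip, mul_assoc]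
  | succ k ih =>
    simp only [ip_succ, map_smul, ih, Finset.mul_sum]
    refine Finset.sum_congr rfl fun i _ => Finset.sum_congr rfl fun j _ => by ring

theorem ip_add_right (α β β' : Eu d [⋀^Fin k]→L[ℝ] ℝ) :
    ip Q α (β + β') = ip Q α β + ip Q α β' := by
  induction k with
  | zero => simp [ip, mul_add]
  | succ k ih => simp only [ip_succ, map_add, ih, mul_add, Finset.sum_add_distrib]

theorem ip_smul_right (c : ℝ) (α β : Eu d [⋀^Fin k]→L[ℝ] ℝ) :
    ip Q α (c • β) = c * ip Q α β := by
  induction k with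
  | zero => simp [ip]; ring
  | succ k ih =>
    simp only [ip_succ, map_smul, ih, Finset.mul_sum]
    refine Finset.sum_congr rfl fun i _ => Finset.sum_congr rfl fun j _ => by ring

/-- `ip` as a bilinear map. -/
def ipL (Q : Matrix (Fin d) (Fin d) ℝ) (k : ℕ) :
    (Eu d [⋀^Fin k]→L[ℝ] ℝ) →ₗ[ℝ] (Eu d [⋀^Fin k]→L[ℝ] ℝ) →ₗ[ℝ] ℝ :=
  LinearMap.mk₂ ℝ (fun α β => ip Q α β) ip_add_left ip_smul_left ip_add_right ip_smul_right

theorem ipL_apply (α β : Eu d [⋀^Fin k]→L[ℝ] ℝ) : ipL Q k α β = ip Q α β := rfl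

theorem ip_neg_right (α β : Eu d [⋀^Fin k]→L[ℝ] ℝ) : ip Q α (-β) = - ip Q α β := by
  simp [← ipL_apply]

theorem ip_sub_left (α α' β : Eu d [⋀^Fin k]→L[ℝ] ℝ) :
    ip Q (α - α') β = ip Q α β - ip Q α' β := by simp [← ipL_apply]

theorem ip_sub_right (α β β' : Eu d [⋀^Fin k]→L[ℝ] ℝ) :
    ip Q α (β - β') = ip Q α β - ip Q α β' := by simp [← ipL_apply]

theorem ip_sum_left {ι : Type*} (s : Finset ι) (α : ι → Eu d [⋀^Fin k]→L[ℝ] ℝ)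
    (β : Eu d [⋀^Fin k]→L[ℝ] ℝ) : ip Q (∑ i ∈ s, α i) β = ∑ i ∈ s, ip Q (α i) β := by
  simp [← ipL_apply]

theorem ip_sum_right {ι : Type*} (s : Finset ι) (β : ι → Eu d [⋀^Fin k]→L[ℝ] ℝ)
    (α : Eu d [⋀^Fin k]→L[ℝ] ℝ) : ip Q α (∑ i ∈ s, β i) = ∑ i ∈ s, ip Q α (β i) := by
  simp [← ipL_apply]

theorem ip_zero_left (β : Eu d [⋀^Fin k]→L[ℝ] ℝ) : ip Q 0 β = 0 := by simp [← ipL_apply]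

theorem ip_zero_right (β : Eu d [⋀^Fin k]→L[ℝ] ℝ) : ip Q β 0 = 0 := by simp [← ipL_apply]

theorem ip_comm (hQ : ∀ i j, Q i j = Q j i) (α β : Eu d [⋀^Fin k]→L[ℝ] ℝ) :
    ip Q α β = ip Q β α := by
  induction k with
  | zero => simp [ip, mul_comm]
  | succ k ih =>
    simp only [ip_succ]
    rw [Finset.sum_comm]
    congr 1
    refine Finset.sum_congr rfl fun i _ => Finset.sum_congr rfl fun j _ => ?_
    rw [ih, hQ]

/-- The vector associated to a covector by the inner product. -/
def sharpQ (Q : Matrix (Fin d) (Fin d) ℝ) (θ : Eu d →L[ℝ] ℝ) : Eu d :=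
  ∑ i, ∑ j, (Q i j * θ (eb i)) • eb j

theorem iota_sharpQ (θ : Eu d →L[ℝ] ℝ) (β : Eu d [⋀^Fin (k + 1)]→L[ℝ] ℝ) :
    iota (sharpQ Q θ) β = ∑ i, ∑ j, (Q i j * θ (eb i)) • iota (eb j) β := by
  simp [sharpQ]

/-- Induction on the degree. The antiderivation rule produces one term with the full contraction and
one with the wedge inside, to which the induction hypothesis applies. -/
theorem ip_wedge_left (θ : Eu d →L[ℝ] ℝ) (α : Eu d [⋀^Fin k]→L[ℝ] ℝ)
    (β : Eu d [⋀^Fin (k + 1)]→L[ℝ] ℝ) :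
    ip Q (wedge θ α) β = ip Q α (iota (sharpQ Q θ) β) := by
  induction k with
  | zero =>
    rw [ip_succ]
    simp only [iota_wedge_zero, iota_sharpQ, ip_sum_right, ip_smul_right, ip_smul_left]
    simp only [Nat.cast_zero, zero_add, inv_one, one_mul]
    refine Finset.sum_congr rfl fun i _ => Finset.sum_congr rfl fun j _ => by ring
  | succ k ih =>
    have h1 : ip Q (wedge θ α) β = ((k + 1 : ℕ) + 1 : ℝ)⁻¹ *
        (ip Q α (iota (sharpQ Q θ) β) +
          ∑ i, ∑ j, Q i j * ip Q (iota (eb i) α) (iota (eb j) (iota (sharpQ Q θ) β))) := by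
      rw [ip_succ]
      congr 1
      rw [iota_sharpQ]
      simp only [iota_wedge, ip_sub_left, ip_smul_left, ih, ip_sum_right, ip_smul_right,
        ← Finset.sum_add_distrib]
      refine Finset.sum_congr rfl fun i _ => Finset.sum_congr rfl fun j _ => ?_
      rw [← iota_sharpQ, iota_iota (eb j), ip_neg_right]
      ring
    rw [h1]
    -- The remaining sum is `k + 1` further copies of the same inner product, and together with the
    -- first copy they cancel the normalising factor.
    have h2 : ∑ i, ∑ j, Q i j * ip Q (iota (eb i) α) (iota (eb j) (iota (sharpQ Q θ) β))
        = (k + 1 : ℝ) * ip Q α (iota (sharpQ Q θ) β) := by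
      rw [ip_succ, ← mul_assoc, mul_inv_cancel₀ (by positivity), one_mul]
    rw [h2]
    push_cast
    field_simp
    ring

theorem ip_wedge_right (hQ : ∀ i j, Q i j = Q j i) (θ : Eu d →L[ℝ] ℝ)
    (α : Eu d [⋀^Fin (k + 1)]→L[ℝ] ℝ) (β : Eu d [⋀^Fin k]→L[ℝ] ℝ) :
    ip Q α (wedge θ β) = ip Q (iota (sharpQ Q θ) α) β := by
  rw [ip_comm hQ, ip_wedge_left, ip_comm hQ]

/-- The inner product of forms is natural under linear isomorphisms. -/
theorem ip_comp (Q' : Matrix (Fin d) (Fin d) ℝ) (C : Eu d →L[ℝ] Eu d)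
    (hC : ∀ a b, Q' a b = ∑ i, ∑ j, Q i j * (C (eb i)) a * (C (eb j)) b)
    (α β : Eu d [⋀^Fin k]→L[ℝ] ℝ) :
    ip Q (α.compContinuousLinearMap C) (β.compContinuousLinearMap C) = ip Q' α β := by
  induction k with
  | zero =>
    have h : ∀ v : Fin 0 → Eu d, v = 0 := fun v => Subsingleton.elim _ _
    simp only [ip, ContinuousAlternatingMap.compContinuousLinearMap_apply, h]
  | succ k ih =>
    simp only [ip_succ]
    congr 1
    have h : ∀ (i : Fin d) (γ : Eu d [⋀^Fin (k + 1)]→L[ℝ] ℝ),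
        iota (eb i) (γ.compContinuousLinearMap C)
          = ∑ a, (C (eb i)) a • (iota (eb a) γ).compContinuousLinearMap C := by
      intro i γ
      have h1 : iota (eb i) (γ.compContinuousLinearMap C)
          = (iota (C (eb i)) γ).compContinuousLinearMap C := by
        rw [iota_apply, iota_apply, ContinuousAlternatingMap.curryLeft_compContinuousLinearMap]
      rw [h1]
      conv_lhs => rw [← sum_eb (C (eb i))]
      ext w
      simp [map_sum, ContinuousAlternatingMap.sum_apply]
    simp only [h, ip_sum_left, ip_sum_right, ip_smul_left, ip_smul_right, ih, hC,
      Finset.sum_mul, Finset.mul_sum]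
    have e : ∀ F : Fin d → Fin d → Fin d → Fin d → ℝ,
        ∑ i, ∑ j, ∑ a, ∑ b, F i j a b = ∑ a, ∑ b, ∑ i, ∑ j, F i j a b := by
      intro F
      calc _ = ∑ i, ∑ a, ∑ j, ∑ b, F i j a b := Finset.sum_congr rfl fun i _ => Finset.sum_comm
        _ = ∑ a, ∑ i, ∑ j, ∑ b, F i j a b := Finset.sum_comm
        _ = ∑ a, ∑ i, ∑ b, ∑ j, F i j a b :=
          Finset.sum_congr rfl fun a _ => Finset.sum_congr rfl fun i _ => Finset.sum_comm
        _ = ∑ a, ∑ b, ∑ i, ∑ j, F i j a b := Finset.sum_congr rfl fun a _ => Finset.sum_comm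
    rw [e, Finset.sum_comm]
    refine Finset.sum_congr rfl fun a _ => Finset.sum_congr rfl fun b _ =>
      Finset.sum_congr rfl fun i _ => Finset.sum_congr rfl fun j _ => by ring

end FormProduct

end TGFoliation
end

open Bundle Manifold MeasureTheory VectorField
open scoped ContDiff Topology

noncomputable section

namespace TGFoliation

/-! ### Cartan calculus for forms on a vector space -/

section Cartan

open ContinuousAlternatingMap

variable {E : Type*} [NormedAddCommGroup E] [NormedSpace ℝ E] {k : ℕ} {u : E}

theorem extDeriv_eq_altern (η : E → E [⋀^Fin k]→L[ℝ] ℝ) (u : E) :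
    extDeriv η u = altern (fderiv ℝ η u) := rfl

/-- The Lie derivative of a form along a vector field. -/
def lieForm (X : E → E) (η : E → E [⋀^Fin k]→L[ℝ] ℝ) (u : E) : E [⋀^Fin k]→L[ℝ] ℝ :=
  fderiv ℝ η u (X u) + derivn (fderiv ℝ X u) (η u)

theorem hasFDerivAt_iota {X : E → E} {η : E → E [⋀^Fin (k + 1)]→L[ℝ] ℝ}
    (hX : DifferentiableAt ℝ X u) (hη : DifferentiableAt ℝ η u) :
    HasFDerivAt (fun u => iota (X u) (η u))
      (iota (X u) ∘L fderiv ℝ η u + iota.flip (η u) ∘L fderiv ℝ X u) u := by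
  have h := (iota (E := E) (k := k)).isBoundedBilinearMap.hasFDerivAt (X u, η u)
  have h2 := h.comp u (hX.hasFDerivAt.prodMk hη.hasFDerivAt)
  refine h2.congr_fderiv ?_
  ext v : 1
  simp [ContinuousLinearMap.coe_deriv₂, IsBoundedBilinearMap.deriv]

theorem hasFDerivAt_wedge {θ : E → E →L[ℝ] ℝ} {η : E → E [⋀^Fin k]→L[ℝ] ℝ}
    (hθ : DifferentiableAt ℝ θ u) (hη : DifferentiableAt ℝ η u) :
    HasFDerivAt (fun u => wedge (θ u) (η u))
      (wedge (θ u) ∘L fderiv ℝ η u + wedge.flip (η u) ∘L fderiv ℝ θ u) u := by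
  have h := (wedge (E := E) (k := k)).isBoundedBilinearMap.hasFDerivAt (θ u, η u)
  have h2 := h.comp u (hθ.hasFDerivAt.prodMk hη.hasFDerivAt)
  refine h2.congr_fderiv ?_
  ext v : 1
  simp [ContinuousLinearMap.coe_deriv₂, IsBoundedBilinearMap.deriv]

/-- The product rule for ι_X η has two terms. Alternating the one with the derivative of `X` gives
the derivation in the Lie derivative, and `iota_altern` rewrites the one with the derivative of `η`.
-/
theorem cartan {X : E → E} {η : E → E [⋀^Fin (k + 1)]→L[ℝ] ℝ}
    (hX : DifferentiableAt ℝ X u) (hη : DifferentiableAt ℝ η u) :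
    extDeriv (fun u => iota (X u) (η u)) u = lieForm X η u - iota (X u) (extDeriv η u) := by
  rw [extDeriv_eq_altern, (hasFDerivAt_iota hX hη).fderiv, extDeriv_eq_altern, iota_altern,
    lieForm, derivn_eq_altern]
  have := (altern (E := E) (k := k)).map_add (iota (X u) ∘L fderiv ℝ η u)
    (iota.flip (η u) ∘L fderiv ℝ X u)
  rw [this]
  abel

theorem lieForm_zero_form (X : E → E) (η : E → E [⋀^Fin 0]→L[ℝ] ℝ) :
    lieForm X η u = iota (X u) (extDeriv η u) := by
  rw [extDeriv_eq_altern, iota_altern_zero, lieForm, derivn_zero_form, add_zero]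

theorem extDeriv_wedge {θ : E → E →L[ℝ] ℝ} {η : E → E [⋀^Fin k]→L[ℝ] ℝ}
    (hθ : DifferentiableAt ℝ θ u) (hη : DifferentiableAt ℝ η u) :
    extDeriv (fun u => wedge (θ u) (η u)) u =
      wedge2 (fderiv ℝ θ u) (η u) - wedge (θ u) (extDeriv η u) := by
  rw [extDeriv_eq_altern, (hasFDerivAt_wedge hθ hη).fderiv, extDeriv_eq_altern, wedge2_apply]
  have := (altern (E := E) (k := k + 1)).map_add (wedge (θ u) ∘L fderiv ℝ η u)
    (wedge.flip (η u) ∘L fderiv ℝ θ u)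
  rw [this, altern_wedge]
  abel

theorem extDeriv_fun_smul' {f : E → ℝ} {η : E → E [⋀^Fin k]→L[ℝ] ℝ}
    (hf : DifferentiableAt ℝ f u) (hη : DifferentiableAt ℝ η u) :
    extDeriv (fun u => f u • η u) u = wedge (fderiv ℝ f u) (η u) + f u • extDeriv η u := by
  rw [extDeriv_eq_altern, fderiv_fun_smul hf hη, extDeriv_eq_altern, wedge_apply]
  have h1 := (altern (E := E) (k := k)).map_add (f u • fderiv ℝ η u)
    ((fderiv ℝ f u).smulRight (η u))
  have h2 := (altern (E := E) (k := k)).map_smul (f u) (fderiv ℝ η u)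
  rw [h1, h2]
  exact add_comm _ _

theorem extDeriv_finset_sum {ι : Type*} (s : Finset ι) (η : ι → E → E [⋀^Fin k]→L[ℝ] ℝ)
    (hη : ∀ i, DifferentiableAt ℝ (η i) u) :
    extDeriv (fun u => ∑ i ∈ s, η i u) u = ∑ i ∈ s, extDeriv (η i) u := by
  simp only [extDeriv_eq_altern]
  rw [fderiv_fun_sum fun i _ => hη i]
  exact map_sum (altern (E := E) (k := k)) _ _

theorem extDeriv_fun_sub {η ζ : E → E [⋀^Fin k]→L[ℝ] ℝ}
    (hη : DifferentiableAt ℝ η u) (hζ : DifferentiableAt ℝ ζ u) :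
    extDeriv (fun u => η u - ζ u) u = extDeriv η u - extDeriv ζ u := by
  simp only [extDeriv_eq_altern]
  rw [fderiv_fun_sub hη hζ]
  exact _root_.map_sub (altern (E := E) (k := k)) _ _

variable {W : Set E}

theorem contDiffOn_fderiv {F : Type*} [NormedAddCommGroup F] [NormedSpace ℝ F] {f : E → F}
    (hW : IsOpen W) (hf : ContDiffOn ℝ ∞ f W) : ContDiffOn ℝ ∞ (fderiv ℝ f) W :=
  hf.fderiv_of_isOpen hW (by simp)

theorem _root_.ContDiffOn.differentiableAt' {F : Type*} [NormedAddCommGroup F] [NormedSpace ℝ F]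
    {f : E → F} (hf : ContDiffOn ℝ ∞ f W) (hW : IsOpen W) (hu : u ∈ W) :
    DifferentiableAt ℝ f u :=
  (hf.contDiffAt (hW.mem_nhds hu)).differentiableAt (by simp)

theorem contDiffOn_extDeriv {η : E → E [⋀^Fin k]→L[ℝ] ℝ} (hW : IsOpen W)
    (hη : ContDiffOn ℝ ∞ η W) : ContDiffOn ℝ ∞ (extDeriv η) W := by
  have h : ContDiff ℝ ∞ (altern (E := E) (k := k)) := ContinuousLinearMap.contDiff _
  exact h.comp_contDiffOn (contDiffOn_fderiv hW hη)

theorem contDiffOn_iota {X : E → E} {η : E → E [⋀^Fin (k + 1)]→L[ℝ] ℝ}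
    (hX : ContDiffOn ℝ ∞ X W) (hη : ContDiffOn ℝ ∞ η W) :
    ContDiffOn ℝ ∞ (fun u => iota (X u) (η u)) W := by
  have h : ContDiff ℝ ∞ (iota (E := E) (k := k)) := ContinuousLinearMap.contDiff _
  exact (h.comp_contDiffOn hX).clm_apply hη

theorem contDiffOn_wedge {θ : E → E →L[ℝ] ℝ} {η : E → E [⋀^Fin k]→L[ℝ] ℝ}
    (hθ : ContDiffOn ℝ ∞ θ W) (hη : ContDiffOn ℝ ∞ η W) :
    ContDiffOn ℝ ∞ (fun u => wedge (θ u) (η u)) W := by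
  have h : ContDiff ℝ ∞ (wedge (E := E) (k := k)) := ContinuousLinearMap.contDiff _
  exact (h.comp_contDiffOn hθ).clm_apply hη

set_option synthInstance.maxHeartbeats 200000 in
theorem contDiffOn_wedge2 {B : E → E →L[ℝ] E →L[ℝ] ℝ} {η : E → E [⋀^Fin k]→L[ℝ] ℝ}
    (hB : ContDiffOn ℝ ∞ B W) (hη : ContDiffOn ℝ ∞ η W) :
    ContDiffOn ℝ ∞ (fun u => wedge2 (B u) (η u)) W := by
  have h0 : ContDiff ℝ ∞ (wedge (E := E) (k := k)).flip := ContinuousLinearMap.contDiff _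
  have h1 : ContDiffOn ℝ ∞ (fun u => (wedge (E := E) (k := k)).flip (η u)) W :=
    h0.comp_contDiffOn hη
  have h2 : ContDiff ℝ ∞ (altern (E := E) (k := k + 1)) := ContinuousLinearMap.contDiff _
  exact h2.comp_contDiffOn (h1.clm_comp hB)

theorem contDiffOn_derivn {A : E → E →L[ℝ] E} {η : E → E [⋀^Fin k]→L[ℝ] ℝ}
    (hA : ContDiffOn ℝ ∞ A W) (hη : ContDiffOn ℝ ∞ η W) :
    ContDiffOn ℝ ∞ (fun u => derivn (A u) (η u)) W := by
  have h : ContDiff ℝ ∞ (fderivCompContinuousLinearMapCLM (ι := Fin k) (𝕜 := ℝ) (E := E) (F := E) ℝ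
    (ContinuousLinearMap.id ℝ E)) := ContinuousLinearMap.contDiff _
  exact (h.comp_contDiffOn hη).clm_apply hA

theorem contDiffOn_lieForm {X : E → E} {η : E → E [⋀^Fin k]→L[ℝ] ℝ} (hW : IsOpen W)
    (hX : ContDiffOn ℝ ∞ X W) (hη : ContDiffOn ℝ ∞ η W) : ContDiffOn ℝ ∞ (lieForm X η) W :=
  ((contDiffOn_fderiv hW hη).clm_apply hX).add (contDiffOn_derivn (contDiffOn_fderiv hW hX) hη)

theorem extDeriv_congr_on {η ζ : E → E [⋀^Fin k]→L[ℝ] ℝ} (hW : IsOpen W) (hu : u ∈ W)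
    (h : Set.EqOn η ζ W) : extDeriv η u = extDeriv ζ u :=
  Filter.EventuallyEq.extDeriv_eq (Filter.eventuallyEq_of_mem (hW.mem_nhds hu) h)

theorem extDeriv_extDeriv_on {η : E → E [⋀^Fin k]→L[ℝ] ℝ} (hW : IsOpen W) (hu : u ∈ W)
    (hη : ContDiffOn ℝ ∞ η W) : extDeriv (extDeriv η) u = 0 :=
  extDeriv_extDeriv_apply (hη.contDiffAt (hW.mem_nhds hu)) (by simpa using WithTop.coe_le_coe.2 (le_top (a := (2 : ℕ∞))))

/-- Formal from d² = 0 and Cartan's formula applied to `η` and to `dη`. -/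
theorem extDeriv_lieForm {X : E → E} {η : E → E [⋀^Fin k]→L[ℝ] ℝ} (hW : IsOpen W) (hu : u ∈ W)
    (hX : ContDiffOn ℝ ∞ X W) (hη : ContDiffOn ℝ ∞ η W) :
    extDeriv (lieForm X η) u = lieForm X (extDeriv η) u := by
  have hd := contDiffOn_extDeriv hW hη
  have h1 := cartan (hX.differentiableAt' hW hu) (hd.differentiableAt' hW hu)
  rw [extDeriv_extDeriv_on hW hu hη, ContinuousLinearMap.map_zero, sub_zero] at h1
  rw [← h1]
  cases k with
  | zero => exact extDeriv_congr_on hW hu fun v hv => lieForm_zero_form X η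
  | succ k =>
    have h2 : Set.EqOn (lieForm X η)
        (fun v => extDeriv (fun u => iota (X u) (η u)) v + iota (X v) (extDeriv η v)) W := by
      intro v hv
      simp only [cartan (hX.differentiableAt' hW hv) (hη.differentiableAt' hW hv), sub_add_cancel]
    rw [extDeriv_congr_on hW hu h2, extDeriv_fun_add
      ((contDiffOn_extDeriv hW (contDiffOn_iota hX hη)).differentiableAt' hW hu)
      ((contDiffOn_iota hX hd).differentiableAt' hW hu),
      extDeriv_extDeriv_on hW hu (contDiffOn_iota hX hη), zero_add]

end Cartan

/-! ### The horizontal Laplacian in a local frame -/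

/-- Local data on an open set of `ℝᵈ`: a frame `X` of the horizontal distribution, the inverse
Gram matrix `h` of the frame, the connection forms `om j l` (`∇ X_j = ∑ om j l ⊗ X_l`) of a metric
connection, and the inverse Gram matrix `Q` of the metric, parallel along horizontal vectors. -/
structure AdaptedFrame (d n : ℕ) where
  W : Set (Eu d)
  isOpen : IsOpen W
  X : Fin n → Eu d → Eu d
  h : Fin n → Fin n → Eu d → ℝ
  om : Fin n → Fin n → Eu d → Eu d →L[ℝ] ℝ
  Q : Eu d → Matrix (Fin d) (Fin d) ℝ
  smooth_X : ∀ i, ContDiffOn ℝ ∞ (X i) W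
  smooth_h : ∀ i j, ContDiffOn ℝ ∞ (h i j) W
  smooth_om : ∀ i j, ContDiffOn ℝ ∞ (om i j) W
  smooth_Q : ∀ a b, ContDiffOn ℝ ∞ (fun u => Q u a b) W
  h_symm : ∀ i j u, u ∈ W → h i j u = h j i u
  Q_symm : ∀ a b u, u ∈ W → Q u a b = Q u b a
  fderiv_h : ∀ i j u, u ∈ W →
    fderiv ℝ (h i j) u = - ∑ k, (h k j u • om k i u + h i k u • om k j u)
  fderiv_Q : ∀ j a b u, u ∈ W → fderiv ℝ (fun u => Q u a b) u (X j u) =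
    - ∑ c, ((∑ l, (om j l u).smulRight (X l u) - fderiv ℝ (X j) u) (eb c) a * Q u c b
      + Q u a c * (∑ l, (om j l u).smulRight (X l u) - fderiv ℝ (X j) u) (eb c) b)

namespace AdaptedFrame

variable {d n : ℕ} (F : AdaptedFrame d n) {k : ℕ} {u : Eu d}

/-- The connection matrix of `∇_{X_j}` in the coordinate frame. -/
def A (j : Fin n) (u : Eu d) : Eu d →L[ℝ] Eu d :=
  ∑ l, (F.om j l u).smulRight (F.X l u) - fderiv ℝ (F.X j) u

/-- The covariant derivative along `X_j`. -/
def nab (j : Fin n) (η : Eu d → Eu d [⋀^Fin k]→L[ℝ] ℝ) (u : Eu d) : Eu d [⋀^Fin k]→L[ℝ] ℝ :=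
  fderiv ℝ η u (F.X j u) - derivn (F.A j u) (η u)

/-- The horizontal trace of the covariant derivative. -/
def trNab (η : Eu d → Eu d [⋀^Fin (k + 1)]→L[ℝ] ℝ) (u : Eu d) : Eu d [⋀^Fin k]→L[ℝ] ℝ :=
  ∑ i, ∑ j, F.h i j u • iota (F.X i u) (F.nab j η u)

/-- The curvature as a bilinear form (up to a symmetric part). -/
def B (j p : Fin n) (u : Eu d) : Eu d →L[ℝ] Eu d →L[ℝ] ℝ :=
  fderiv ℝ (F.om j p) u + ∑ l, (F.om l p u).smulRight (F.om j l u)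

/-- The zeroth order term of the horizontal Laplacian. -/
def weitz (u : Eu d) (α : Eu d [⋀^Fin (k + 1)]→L[ℝ] ℝ) : Eu d [⋀^Fin (k + 1)]→L[ℝ] ℝ :=
  ∑ i, ∑ j, F.h i j u • iota (F.X i u) (∑ p, wedge2 (F.B j p u) (iota (F.X p u) α))

/-- The rough horizontal Laplacian. -/
def rough (η : Eu d → Eu d [⋀^Fin k]→L[ℝ] ℝ) (u : Eu d) : Eu d [⋀^Fin k]→L[ℝ] ℝ :=
  ∑ i, ∑ j, F.h i j u • (F.nab i (F.nab j η) u - ∑ l, F.om j l u (F.X i u) • F.nab l η u)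

theorem smooth_A (j : Fin n) : ContDiffOn ℝ ∞ (F.A j) F.W := by
  refine ContDiffOn.sub (ContDiffOn.sum fun l _ => ?_)
    (contDiffOn_fderiv F.isOpen (F.smooth_X j))
  exact (F.smooth_om j l).smulRight (F.smooth_X l)

theorem smooth_nab (j : Fin n) {η : Eu d → Eu d [⋀^Fin k]→L[ℝ] ℝ}
    (hη : ContDiffOn ℝ ∞ η F.W) : ContDiffOn ℝ ∞ (F.nab j η) F.W :=
  ((contDiffOn_fderiv F.isOpen hη).clm_apply (F.smooth_X j)).sub
    (contDiffOn_derivn (F.smooth_A j) hη)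

theorem smooth_trNab {η : Eu d → Eu d [⋀^Fin (k + 1)]→L[ℝ] ℝ}
    (hη : ContDiffOn ℝ ∞ η F.W) : ContDiffOn ℝ ∞ (F.trNab η) F.W :=
  ContDiffOn.sum fun i _ => ContDiffOn.sum fun j _ =>
    (F.smooth_h i j).smul (contDiffOn_iota (F.smooth_X i) (F.smooth_nab j hη))

theorem smooth_B (j p : Fin n) : ContDiffOn ℝ ∞ (F.B j p) F.W :=
  (contDiffOn_fderiv F.isOpen (F.smooth_om j p)).add
    (ContDiffOn.sum fun l _ => (F.smooth_om l p).smulRight (F.smooth_om j l))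

theorem smooth_weitz {η : Eu d → Eu d [⋀^Fin (k + 1)]→L[ℝ] ℝ}
    (hη : ContDiffOn ℝ ∞ η F.W) : ContDiffOn ℝ ∞ (fun u => F.weitz u (η u)) F.W :=
  ContDiffOn.sum fun i _ => ContDiffOn.sum fun j _ =>
    (F.smooth_h i j).smul (contDiffOn_iota (F.smooth_X i) (ContDiffOn.sum fun p _ =>
      contDiffOn_wedge2 (F.smooth_B j p) (contDiffOn_iota (F.smooth_X p) hη)))

/-- The summand −DX_j of the connection matrix completes the directional derivative to a Lie
derivative, and the rank-one summands become ω ∧ ι. All operators on the right have known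
commutators with d. -/
theorem nab_succ (j : Fin n) (η : Eu d → Eu d [⋀^Fin (k + 1)]→L[ℝ] ℝ) (u : Eu d) :
    F.nab j η u = lieForm (F.X j) η u - ∑ l, wedge (F.om j l u) (iota (F.X l u) (η u)) := by
  rw [nab, A, derivn_sub_left, derivn_sum_left, lieForm]
  simp only [derivn_smulRight]
  abel

theorem nab_zero (j : Fin n) (η : Eu d → Eu d [⋀^Fin 0]→L[ℝ] ℝ) (u : Eu d) :
    F.nab j η u = lieForm (F.X j) η u := by
  rw [nab, lieForm, derivn_zero_form, derivn_zero_form, sub_zero, add_zero]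

/-- The Lie derivative commutes with d, so only the terms ω ∧ ι contribute. Cartan's formula there
produces Lie derivatives, and rewriting these as covariant derivatives adds the terms ω ∧ ω that
complete dω to the curvature. -/
theorem extDeriv_nab (j : Fin n) {η : Eu d → Eu d [⋀^Fin (k + 1)]→L[ℝ] ℝ}
    (hη : ContDiffOn ℝ ∞ η F.W) (hu : u ∈ F.W) :
    extDeriv (F.nab j η) u = F.nab j (extDeriv η) u
      + ∑ l, wedge (F.om j l u) (F.nab l η u)
      - ∑ p, wedge2 (F.B j p u) (iota (F.X p u) (η u)) := by
  have hX := F.smooth_X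
  have hω := F.smooth_om
  have hW := F.isOpen
  have h1 : F.nab j η = fun u => lieForm (F.X j) η u
      - ∑ l, wedge (F.om j l u) (iota (F.X l u) (η u)) := funext fun u => F.nab_succ j η u
  have hwι : ∀ l, ContDiffOn ℝ ∞ (fun u => wedge (F.om j l u) (iota (F.X l u) (η u))) F.W :=
    fun l => contDiffOn_wedge (hω j l) (contDiffOn_iota (hX l) hη)
  rw [h1, extDeriv_fun_sub ((contDiffOn_lieForm hW (hX j) hη).differentiableAt' hW hu)
    ((ContDiffOn.sum fun l _ => hwι l).differentiableAt' hW hu),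
    extDeriv_finset_sum _ _ fun l => (hwι l).differentiableAt' hW hu,
    extDeriv_lieForm hW hu (hX j) hη, nab_succ]
  have h2 : ∀ l, extDeriv (fun u => wedge (F.om j l u) (iota (F.X l u) (η u))) u
      = wedge2 (fderiv ℝ (F.om j l) u) (iota (F.X l u) (η u))
        - wedge (F.om j l u) (F.nab l η u)
        - ∑ p, wedge2 ((F.om j l u).smulRight (F.om l p u)) (iota (F.X p u) (η u))
        + wedge (F.om j l u) (iota (F.X l u) (extDeriv η u)) := by
    intro l
    rw [extDeriv_wedge ((hω j l).differentiableAt' hW hu)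
      ((contDiffOn_iota (hX l) hη).differentiableAt' hW hu),
      cartan ((hX l).differentiableAt' hW hu) (hη.differentiableAt' hW hu), nab_succ]
    simp only [wedge2_smulRight, ContinuousLinearMap.map_sub, map_sum]
    abel
  -- The quadratic part of `B` lists its factors in the opposite order, and anticommutation of
  -- covectors supplies the minus sign.
  have h3 : ∑ p, wedge2 (F.B j p u) (iota (F.X p u) (η u))
      = ∑ l, wedge2 (fderiv ℝ (F.om j l) u) (iota (F.X l u) (η u))
        - ∑ l, ∑ p, wedge2 ((F.om j l u).smulRight (F.om l p u)) (iota (F.X p u) (η u)) := by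
    rw [Finset.sum_comm, ← Finset.sum_sub_distrib]
    refine Finset.sum_congr rfl fun p _ => ?_
    rw [B, wedge2_add_left, wedge2_sum_left, sub_eq_add_neg, ← Finset.sum_neg_distrib]
    congr 1
    refine Finset.sum_congr rfl fun l _ => ?_
    rw [wedge2_smulRight, wedge2_smulRight, wedge_wedge]
  simp only [h2, h3, Finset.sum_add_distrib, Finset.sum_sub_distrib]
  abel

/-- Differentiating the trace yields three kinds of connection terms: from dh, from the Lie
derivative along X_i, and from the commutator of d with ∇. As h is parallel they cancel in pairs.
What remains is the traced second covariant derivative, the curvature term and the trace for dη. -/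
theorem weitzenboeck {η : Eu d → Eu d [⋀^Fin (k + 1)]→L[ℝ] ℝ}
    (hη : ContDiffOn ℝ ∞ η F.W) (hu : u ∈ F.W) :
    F.trNab (extDeriv η) u + extDeriv (F.trNab η) u = F.rough η u + F.weitz u (η u) := by
  have hX := F.smooth_X
  have hW := F.isOpen
  have hι : ∀ i j, ContDiffOn ℝ ∞ (fun u => iota (F.X i u) (F.nab j η u)) F.W :=
    fun i j => contDiffOn_iota (hX i) (F.smooth_nab j hη)
  have hιh : ∀ i j, ContDiffOn ℝ ∞ (fun u => F.h i j u • iota (F.X i u) (F.nab j η u)) F.W :=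
    fun i j => (F.smooth_h i j).smul (hι i j)
  have h1 : extDeriv (F.trNab η) u
      = ∑ i, ∑ j, extDeriv (fun u => F.h i j u • iota (F.X i u) (F.nab j η u)) u := by
    unfold trNab
    rw [extDeriv_finset_sum _ _ fun i =>
      (ContDiffOn.sum fun j _ => hιh i j).differentiableAt' hW hu]
    exact Finset.sum_congr rfl fun i _ =>
      extDeriv_finset_sum _ _ fun j => (hιh i j).differentiableAt' hW hu
  have h2 : ∀ i j, extDeriv (fun u => F.h i j u • iota (F.X i u) (F.nab j η u)) u
      = (- ∑ l, F.h l j u • wedge (F.om l i u) (iota (F.X i u) (F.nab j η u))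
        + ∑ l, F.h i j u • wedge (F.om i l u) (iota (F.X l u) (F.nab j η u)))
        + (- ∑ l, F.h i l u • wedge (F.om l j u) (iota (F.X i u) (F.nab j η u))
        + ∑ l, F.h i j u • wedge (F.om j l u) (iota (F.X i u) (F.nab l η u)))
        + F.h i j u • (F.nab i (F.nab j η) u - ∑ l, F.om j l u (F.X i u) • F.nab l η u)
        + F.h i j u • iota (F.X i u) (∑ p, wedge2 (F.B j p u) (iota (F.X p u) (η u)))
        - F.h i j u • iota (F.X i u) (F.nab j (extDeriv η) u) := by
    intro i j
    have e1 : ∀ α : Eu d [⋀^Fin (k + 1)]→L[ℝ] ℝ, wedge (fderiv ℝ (F.h i j) u) (iota (F.X i u) α)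
        = - ∑ l, F.h l j u • wedge (F.om l i u) (iota (F.X i u) α)
          - ∑ l, F.h i l u • wedge (F.om l j u) (iota (F.X i u) α) := by
      intro α
      rw [F.fderiv_h i j u hu]
      simp only [map_neg, map_sum, map_add, map_smul, _root_.neg_apply, _root_.sum_apply,
        _root_.add_apply, _root_.smul_apply, Finset.sum_add_distrib]
      abel
    have e2 : lieForm (F.X i) (F.nab j η) u = F.nab i (F.nab j η) u
        + ∑ l, wedge (F.om i l u) (iota (F.X l u) (F.nab j η u)) := by
      rw [nab_succ]; abel
    rw [extDeriv_fun_smul' ((F.smooth_h i j).differentiableAt' hW hu)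
      ((hι i j).differentiableAt' hW hu), cartan ((hX i).differentiableAt' hW hu)
      ((F.smooth_nab j hη).differentiableAt' hW hu), F.extDeriv_nab j hη hu, e1, e2]
    simp only [ContinuousLinearMap.map_sub, ContinuousLinearMap.map_add, map_sum, iota_wedge, smul_sub, smul_add,
      Finset.smul_sum, Finset.sum_sub_distrib]
    abel
  -- Half of dh acts on the index `i` and cancels the connection terms of the Lie derivative; `h4`
  -- is the same for the index `j` and the commutator.
  have h3 : ∑ i, ∑ j, (- ∑ l, F.h l j u • wedge (F.om l i u) (iota (F.X i u) (F.nab j η u))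
        + ∑ l, F.h i j u • wedge (F.om i l u) (iota (F.X l u) (F.nab j η u))) = 0 := by
    simp only [Finset.sum_add_distrib, Finset.sum_neg_distrib]
    rw [neg_add_eq_zero, Finset.sum_comm]
    conv_rhs => rw [Finset.sum_comm]
    exact Finset.sum_congr rfl fun j _ => Finset.sum_comm
  have h4 : ∑ i, ∑ j, (- ∑ l, F.h i l u • wedge (F.om l j u) (iota (F.X i u) (F.nab j η u))
        + ∑ l, F.h i j u • wedge (F.om j l u) (iota (F.X i u) (F.nab l η u))) = 0 := by
    simp only [Finset.sum_add_distrib, Finset.sum_neg_distrib]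
    rw [neg_add_eq_zero]
    exact Finset.sum_congr rfl fun i _ => Finset.sum_comm
  rw [h1]
  simp only [h2, Finset.sum_add_distrib, Finset.sum_sub_distrib] at h3 h4 ⊢
  rw [h3, h4]
  simp only [trNab, rough, weitz, Finset.sum_sub_distrib, smul_sub]
  abel

/-- On functions ∇_{X_j} η = dη(X_j), so no curvature appears and the identity only rewrites the
Hessian. -/
theorem weitzenboeck_zero {η : Eu d → Eu d [⋀^Fin 0]→L[ℝ] ℝ}
    (hη : ContDiffOn ℝ ∞ η F.W) (hu : u ∈ F.W) :
    F.trNab (extDeriv η) u = F.rough η u := by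
  have hW := F.isOpen
  have h0 : ∀ j, F.nab j η = fun u => iota (F.X j u) (extDeriv η u) := fun j => by
    funext u; rw [nab_zero, lieForm_zero_form]
  have hd := contDiffOn_extDeriv hW hη
  rw [trNab, rough]
  refine Finset.sum_congr rfl fun i _ => Finset.sum_congr rfl fun j _ => ?_
  congr 1
  have h1 : F.nab i (F.nab j η) u = iota (F.X i u) (lieForm (F.X j) (extDeriv η) u) := by
    rw [nab_zero, lieForm_zero_form, ← extDeriv_lieForm hW hu (F.smooth_X j) hη]
    congr 2
    funext u
    rw [nab_zero]
  rw [h1, nab_succ, ContinuousLinearMap.map_sub, map_sum]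
  congr 1
  refine Finset.sum_congr rfl fun l _ => ?_
  rw [iota_wedge_zero, h0]

end AdaptedFrame

end TGFoliation
end

open Bundle Manifold MeasureTheory VectorField
open scoped ContDiff Topology

noncomputable section

namespace TGFoliation

/-! ### Metric compatibility and the divergence theorem -/

section Jacobi

theorem differentiable_det {d : ℕ} :
    Differentiable ℝ (fun M : Fin d → Fin d → ℝ => (Matrix.of M).det) := by
  simp only [Matrix.det_apply, Matrix.of_apply]
  fun_prop

/-- Jacobi's formula for the derivative of a determinant. -/
theorem hasDerivAt_det {d : ℕ} {M : ℝ → Matrix (Fin d) (Fin d) ℝ} {M' : Matrix (Fin d) (Fin d) ℝ}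
    {t : ℝ} (h : ∀ a b, HasDerivAt (fun s => M s a b) (M' a b) t) (hM : IsUnit (M t).det) :
    HasDerivAt (fun s => (M s).det) ((M t).det * ((M t)⁻¹ * M').trace) t := by
  set D : (Fin d → Fin d → ℝ) → ℝ := fun M => (Matrix.of M).det with hDdef
  have hD : HasFDerivAt D (fderiv ℝ D (fun a b => M t a b)) (fun a b => M t a b) :=
    (differentiable_det _).hasFDerivAt
  have h1 : HasDerivAt (fun s => (M s).det) (fderiv ℝ D (fun a b => M t a b) (fun a b => M' a b)) t := by
    have hp : HasDerivAt (fun s => (fun a b => M s a b : Fin d → Fin d → ℝ)) (fun a b => M' a b) t :=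
      hasDerivAt_pi.2 fun a => hasDerivAt_pi.2 fun b => h a b
    exact hD.comp_hasDerivAt t hp
  -- The same directional derivative of the determinant is computed along an affine line, where
  -- factoring out `M t` leaves a polynomial in `s` whose linear coefficient is the trace.
  have h2 : HasDerivAt (fun s : ℝ => (M t + s • M').det)
      (fderiv ℝ D (fun a b => M t a b) (fun a b => M' a b)) 0 := by
    have hp : HasDerivAt (fun s : ℝ => (fun a b => M t a b + s * M' a b : Fin d → Fin d → ℝ))
        (fun a b => M' a b) 0 := by
      refine hasDerivAt_pi.2 fun a => hasDerivAt_pi.2 fun b => ?_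
      simpa using ((hasDerivAt_id (0 : ℝ)).mul_const (M' a b)).const_add (M t a b)
    have hD' : HasFDerivAt D (fderiv ℝ D (fun a b => M t a b))
        ((fun s : ℝ => (fun a b => M t a b + s * M' a b : Fin d → Fin d → ℝ)) 0) := by
      simpa using hD
    exact hD'.comp_hasDerivAt (0 : ℝ) hp
  have h3 : HasDerivAt (fun s : ℝ => (M t + s • M').det) ((M t).det * ((M t)⁻¹ * M').trace) 0 := by
    have e : ∀ s : ℝ, (M t + s • M').det = (M t).det * (1 + s • ((M t)⁻¹ * M')).det := by
      intro s
      rw [← Matrix.det_mul, mul_add, mul_one, Matrix.mul_smul, Matrix.mul_nonsing_inv_cancel_left _ _ hM]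
    have e2 : (fun s : ℝ => (M t + s • M').det) = _ := funext fun s => by
      rw [e s, Matrix.det_one_add_smul]
    rw [e2]
    set p := (Matrix.det (1 + (Polynomial.X : Polynomial ℝ) • ((M t)⁻¹ * M').map Polynomial.C)).divX.divX
    have hp := p.hasDerivAt (0 : ℝ)
    have := ((((hasDerivAt_id (0 : ℝ)).const_mul ((M t)⁻¹ * M').trace).const_add 1).add
      (hp.mul ((hasDerivAt_id (0 : ℝ)).pow 2))).const_mul (M t).det
    simpa using this
  rw [← h2.unique h3]
  exact h1

end Jacobi

section Compat

variable {d k : ℕ}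

/-- The inner product of forms is compatible with a derivation for which `Q` is parallel. -/
theorem hasDerivAt_ip {Q : ℝ → Matrix (Fin d) (Fin d) ℝ} {t : ℝ} (A : Eu d →L[ℝ] Eu d)
    (hQ : ∀ a b, HasDerivAt (fun s => Q s a b)
      (- ∑ c, (A (eb c) a * Q t c b + Q t a c * A (eb c) b)) t)
    {α β : ℝ → Eu d [⋀^Fin k]→L[ℝ] ℝ} {α' β' : Eu d [⋀^Fin k]→L[ℝ] ℝ}
    (hα : HasDerivAt α α' t) (hβ : HasDerivAt β β' t) :
    HasDerivAt (fun s => ip (Q s) (α s) (β s))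
      (ip (Q t) (α' - derivn A (α t)) (β t) + ip (Q t) (α t) (β' - derivn A (β t))) t := by
  induction k with
  | zero =>
    have ev : ∀ {γ : ℝ → Eu d [⋀^Fin 0]→L[ℝ] ℝ} {γ' : Eu d [⋀^Fin 0]→L[ℝ] ℝ},
        HasDerivAt γ γ' t → HasDerivAt (fun s => γ s 0) (γ' 0) t := by
      intro γ γ' h
      exact (ContinuousAlternatingMap.apply ℝ (Eu d) ℝ (0 : Fin 0 → Eu d)).hasFDerivAt.comp_hasDerivAt t h
    refine ((ev hα).fun_mul (ev hβ)).congr_deriv ?_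
    simp [ip, derivn_zero_form]
  | succ k ih =>
    have hι : ∀ {γ : ℝ → Eu d [⋀^Fin (k + 1)]→L[ℝ] ℝ} {γ' : Eu d [⋀^Fin (k + 1)]→L[ℝ] ℝ}
        (v : Eu d), HasDerivAt γ γ' t → HasDerivAt (fun s => iota v (γ s)) (iota v γ') t := by
      intro γ γ' v h
      exact (iota (E := Eu d) (k := k) v).hasFDerivAt.comp_hasDerivAt t h
    have key := HasDerivAt.const_mul ((k : ℝ) + 1)⁻¹ (HasDerivAt.fun_sum fun i (_ : i ∈ Finset.univ) =>
      HasDerivAt.fun_sum fun j (_ : j ∈ Finset.univ) =>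
        (hQ i j).mul (ih (hι (eb i) hα) (hι (eb j) hβ)))
    refine key.congr_deriv ?_
    have hA : ∀ (v : Eu d) (γ' γ : Eu d [⋀^Fin (k + 1)]→L[ℝ] ℝ),
        iota v (γ' - derivn A γ) = iota v γ' - derivn A (iota v γ) - iota (A v) γ := by
      intro v γ' γ
      rw [ContinuousLinearMap.map_sub, iota_derivn]
      abel
    have hA2 : ∀ (v : Eu d) (γ : Eu d [⋀^Fin (k + 1)]→L[ℝ] ℝ),
        iota v γ = ∑ a, v a • iota (eb a) γ := by
      intro v γ
      conv_lhs => rw [← sum_eb v]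
      simp [_root_.sum_apply]
    rw [ip_succ, ip_succ, ← mul_add]
    congr 1
    -- Contracting a derivation produces an extra contraction with `A v`. Summed over the basis in
    -- the left factor this is the first half of the derivative of `Q`, and in the right factor
    -- (`e2`) the second half.
    have e1 : ∑ i, ∑ j, Q t i j * ip (Q t) (iota (A (eb i)) (α t)) (iota (eb j) (β t))
        = ∑ i, ∑ j, (∑ c, A (eb c) i * Q t c j) * ip (Q t) (iota (eb i) (α t)) (iota (eb j) (β t)) := by
      simp only [hA2 (A _), ip_sum_left, ip_smul_left, Finset.mul_sum, Finset.sum_mul]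
      rw [Finset.sum_congr rfl fun i _ => Finset.sum_comm, Finset.sum_comm]
      refine Finset.sum_congr rfl fun a _ => ?_
      rw [Finset.sum_comm]
      exact Finset.sum_congr rfl fun i _ => Finset.sum_congr rfl fun j _ => by ring
    have e2 : ∑ i, ∑ j, Q t i j * ip (Q t) (iota (eb i) (α t)) (iota (A (eb j)) (β t))
        = ∑ i, ∑ j, (∑ c, Q t i c * A (eb c) j) * ip (Q t) (iota (eb i) (α t)) (iota (eb j) (β t)) := by
      simp only [hA2 (A _), ip_sum_right, ip_smul_right, Finset.mul_sum, Finset.sum_mul]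
      refine Finset.sum_congr rfl fun i _ => ?_
      rw [Finset.sum_comm]
      exact Finset.sum_congr rfl fun i _ => Finset.sum_congr rfl fun j _ => by ring
    simp only [hA, ip_sub_left _ (iota (A _) _), ip_sub_right _ _ (iota (A _) _), mul_sub,
      Finset.sum_sub_distrib, e1, e2, neg_mul, Finset.sum_add_distrib, mul_add, add_mul,
      Finset.sum_neg_distrib, ← Finset.sum_mul]
    abel

end Compat

theorem contDiffOn_ip {d k : ℕ} {W : Set (Eu d)} {Q : Eu d → Matrix (Fin d) (Fin d) ℝ}
    (hQ : ∀ a b, ContDiffOn ℝ ∞ (fun u => Q u a b) W)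
    {α β : Eu d → Eu d [⋀^Fin k]→L[ℝ] ℝ} (hα : ContDiffOn ℝ ∞ α W) (hβ : ContDiffOn ℝ ∞ β W) :
    ContDiffOn ℝ ∞ (fun u => ip (Q u) (α u) (β u)) W := by
  induction k with
  | zero =>
    have ev : ∀ {γ : Eu d → Eu d [⋀^Fin 0]→L[ℝ] ℝ}, ContDiffOn ℝ ∞ γ W →
        ContDiffOn ℝ ∞ (fun s => γ s 0) W := by
      intro γ h
      exact (ContinuousAlternatingMap.apply ℝ (Eu d) ℝ (0 : Fin 0 → Eu d)).contDiff.comp_contDiffOn h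
    exact (ev hα).mul (ev hβ)
  | succ k ih =>
    exact contDiffOn_const.mul (ContDiffOn.sum fun i _ => ContDiffOn.sum fun j _ =>
      (hQ i j).mul (ih (contDiffOn_iota contDiffOn_const hα) (contDiffOn_iota contDiffOn_const hβ)))

namespace AdaptedFrame

variable {d n : ℕ} (F : AdaptedFrame d n) {k : ℕ} {u : Eu d}

theorem hasDerivAt_line {G : Type*} [NormedAddCommGroup G] [NormedSpace ℝ G] {f : Eu d → G}
    (hf : DifferentiableAt ℝ f u) (v : Eu d) :
    HasDerivAt (fun t : ℝ => f (u + t • v)) (fderiv ℝ f u v) 0 :=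
  hf.hasFDerivAt.hasLineDerivAt v

/-- The divergence of `X_j`. -/
def div (j : Fin n) (u : Eu d) : ℝ := ∑ l, F.om j l u (F.X l u)

theorem smooth_div (j : Fin n) : ContDiffOn ℝ ∞ (F.div j) F.W :=
  ContDiffOn.sum fun l _ => (F.smooth_om j l).clm_apply (F.smooth_X l)

/-- Only the derivative of `Q` in the direction X_j is prescribed, so the one-variable product rule
is applied on the straight line u + t X_j. -/
theorem fderiv_ip (j : Fin n) {α β : Eu d → Eu d [⋀^Fin k]→L[ℝ] ℝ}
    (hα : ContDiffOn ℝ ∞ α F.W) (hβ : ContDiffOn ℝ ∞ β F.W) (hu : u ∈ F.W) :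
    fderiv ℝ (fun u => ip (F.Q u) (α u) (β u)) u (F.X j u)
      = ip (F.Q u) (F.nab j α u) (β u) + ip (F.Q u) (α u) (F.nab j β u) := by
  have hW := F.isOpen
  have h1 := hasDerivAt_line ((contDiffOn_ip F.smooth_Q hα hβ).differentiableAt' hW hu) (F.X j u)
  have hQ : ∀ a b, HasDerivAt (fun s : ℝ => F.Q (u + s • F.X j u) a b)
      (- ∑ c, (F.A j u (eb c) a * F.Q (u + (0 : ℝ) • F.X j u) c b
        + F.Q (u + (0 : ℝ) • F.X j u) a c * F.A j u (eb c) b)) 0 := by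
    intro a b
    have := hasDerivAt_line ((F.smooth_Q a b).differentiableAt' hW hu) (F.X j u)
    rw [F.fderiv_Q j a b u hu] at this
    simpa only [zero_smul, add_zero, A] using this
  have h2 := hasDerivAt_ip (Q := fun s : ℝ => F.Q (u + s • F.X j u)) (F.A j u) hQ
    (hasDerivAt_line (hα.differentiableAt' hW hu) (F.X j u))
    (hasDerivAt_line (hβ.differentiableAt' hW hu) (F.X j u))
  simp only [zero_smul, add_zero] at h2
  exact h1.unique h2

/-- The flux whose divergence is the defect of symmetry of the rough Laplacian. -/
def flux (α β : Eu d → Eu d [⋀^Fin k]→L[ℝ] ℝ) (i : Fin n) (u : Eu d) : ℝ :=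
  ∑ j, F.h i j u * ip (F.Q u) (F.nab j α u) (β u)

theorem smooth_flux {α β : Eu d → Eu d [⋀^Fin k]→L[ℝ] ℝ}
    (hα : ContDiffOn ℝ ∞ α F.W) (hβ : ContDiffOn ℝ ∞ β F.W) (i : Fin n) :
    ContDiffOn ℝ ∞ (F.flux α β i) F.W :=
  ContDiffOn.sum fun j _ => (F.smooth_h i j).mul (contDiffOn_ip F.smooth_Q (F.smooth_nab j hα) hβ)

/-- This expands the divergence of the flux. Of the two connection terms in dh, one gives the
divergence of the frame times the flux and the other the correction ω_jl(X_i) ∇_{X_l} of the rough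
Laplacian. What is left over is the Dirichlet form. -/
theorem ip_rough {α β : Eu d → Eu d [⋀^Fin k]→L[ℝ] ℝ}
    (hα : ContDiffOn ℝ ∞ α F.W) (hβ : ContDiffOn ℝ ∞ β F.W) (hu : u ∈ F.W) :
    ip (F.Q u) (F.rough α u) (β u)
      + ∑ i, ∑ j, F.h i j u * ip (F.Q u) (F.nab j α u) (F.nab i β u)
      = ∑ i, (fderiv ℝ (F.flux α β i) u (F.X i u) + F.div i u * F.flux α β i u) := by
  have hW := F.isOpen
  have hip : ∀ j, ContDiffOn ℝ ∞ (fun u => ip (F.Q u) (F.nab j α u) (β u)) F.W :=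
    fun j => contDiffOn_ip F.smooth_Q (F.smooth_nab j hα) hβ
  set p : Fin n → ℝ := fun j => ip (F.Q u) (F.nab j α u) (β u) with hp
  have h1 : ∀ i, fderiv ℝ (F.flux α β i) u (F.X i u)
      = ∑ j, (F.h i j u * (ip (F.Q u) (F.nab i (F.nab j α) u) (β u)
          + ip (F.Q u) (F.nab j α u) (F.nab i β u))
        + p j * (- ∑ k, (F.h k j u * F.om k i u (F.X i u) + F.h i k u * F.om k j u (F.X i u)))) := by
    intro i
    unfold flux
    rw [fderiv_fun_sum fun j _ => ((F.smooth_h i j).mul (hip j)).differentiableAt' hW hu, sum_apply]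
    refine Finset.sum_congr rfl fun j _ => ?_
    rw [fderiv_fun_mul ((F.smooth_h i j).differentiableAt' hW hu) ((hip j).differentiableAt' hW hu),
      add_apply, smul_apply, smul_apply, F.fderiv_ip i (F.smooth_nab j hα) hβ hu, F.fderiv_h i j u hu]
    simp [hp, sum_apply]
  have h2 : ip (F.Q u) (F.rough α u) (β u)
      = ∑ i, ∑ j, F.h i j u * (ip (F.Q u) (F.nab i (F.nab j α) u) (β u)
        - ∑ l, F.om j l u (F.X i u) * p l) := by
    simp only [rough, ip_sum_left, ip_smul_left, ip_sub_left, hp]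
  have h3 : ∑ i, ∑ j, p j * ∑ k, F.h k j u * F.om k i u (F.X i u)
      = ∑ i, F.div i u * F.flux α β i u := by
    simp only [flux, div, Finset.sum_mul, Finset.mul_sum]
    rw [Finset.sum_congr rfl fun i _ => Finset.sum_comm, Finset.sum_comm]
    refine Finset.sum_congr rfl fun k _ => ?_
    rw [Finset.sum_comm]
    refine Finset.sum_congr rfl fun i _ => Finset.sum_congr rfl fun j _ => by simp only [hp]; ring
  have h4 : ∑ i, ∑ j, p j * ∑ k, F.h i k u * F.om k j u (F.X i u)
      = ∑ i, ∑ j, F.h i j u * ∑ l, F.om j l u (F.X i u) * p l := by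
    refine Finset.sum_congr rfl fun i _ => ?_
    simp only [Finset.mul_sum]
    rw [Finset.sum_comm]
    refine Finset.sum_congr rfl fun j _ => Finset.sum_congr rfl fun l _ => by ring
  simp only [h1, h2, Finset.sum_add_distrib, mul_add, mul_sub, mul_neg, Finset.sum_neg_distrib,
    Finset.sum_sub_distrib, h3, h4]
  ring

/-- The Dirichlet form is symmetric in the two forms, hence drops out, and the defect is a
divergence. -/
theorem ip_rough_sub {α β : Eu d → Eu d [⋀^Fin k]→L[ℝ] ℝ}
    (hα : ContDiffOn ℝ ∞ α F.W) (hβ : ContDiffOn ℝ ∞ β F.W) (hu : u ∈ F.W) :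
    ip (F.Q u) (F.rough α u) (β u) - ip (F.Q u) (α u) (F.rough β u)
      = ∑ i, (fderiv ℝ (F.flux α β i) u (F.X i u) + F.div i u * F.flux α β i u)
        - ∑ i, (fderiv ℝ (F.flux β α i) u (F.X i u) + F.div i u * F.flux β α i u) := by
  rw [← F.ip_rough hα hβ hu, ← F.ip_rough hβ hα hu]
  have hQ : ∀ a b, F.Q u a b = F.Q u b a := fun a b => F.Q_symm a b u hu
  have e : ∑ i, ∑ j, F.h i j u * ip (F.Q u) (F.nab j α u) (F.nab i β u)
      = ∑ i, ∑ j, F.h i j u * ip (F.Q u) (F.nab j β u) (F.nab i α u) := by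
    rw [Finset.sum_comm]
    refine Finset.sum_congr rfl fun i _ => Finset.sum_congr rfl fun j _ => ?_
    rw [ip_comm hQ, F.h_symm i j u hu]
  rw [e, ip_comm hQ (α u)]
  ring

end AdaptedFrame

/-! ### Integration by parts -/

theorem contDiff_of_zero_outside {d : ℕ} {G : Type*} [NormedAddCommGroup G] [NormedSpace ℝ G]
    {W K : Set (Eu d)} (hW : IsOpen W) (hK : IsClosed K)
    (hKW : K ⊆ W) {f : Eu d → G} (hf : ContDiffOn ℝ ∞ f W) (h0 : ∀ u ∉ K, f u = 0) :
    ContDiff ℝ ∞ f := by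
  rw [contDiff_iff_contDiffAt]
  intro u
  by_cases hu : u ∈ W
  · exact hf.contDiffAt (hW.mem_nhds hu)
  · have hu' : u ∈ Kᶜ := fun h => hu (hKW h)
    refine ContDiffAt.congr_of_eventuallyEq (contDiffAt_const (c := (0 : G))) ?_
    filter_upwards [hK.isOpen_compl.mem_nhds hu'] with v hv using h0 v hv

theorem integral_fderiv_eq_zero {d : ℕ} {f : Eu d → ℝ} (hf : ContDiff ℝ ∞ f)
    (hc : HasCompactSupport f) (v : Eu d) : ∫ u, fderiv ℝ f u v = 0 := by
  have h1 : Continuous fun u => fderiv ℝ f u v :=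
    (hf.continuous_fderiv (by simp)).clm_apply continuous_const
  have h2 : HasCompactSupport fun u => fderiv ℝ f u v := hc.fderiv_apply (𝕜 := ℝ) v
  have := integral_mul_fderiv_eq_neg_fderiv_mul_of_integrable (μ := (volume : Measure (Eu d)))
    (f := fun _ => (1 : ℝ)) (g := f) (v := v) (by simp) (by simpa using h1.integrable_of_hasCompactSupport h2)
    (by simpa using hf.continuous.integrable_of_hasCompactSupport hc) (by simp)
    (fun x _ => hf.differentiable (by simp) x)
  simpa using this

namespace AdaptedFrame

variable {d n : ℕ} (F : AdaptedFrame d n) {k : ℕ} {u : Eu d}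

/-- The Riemannian density. -/
def rho (u : Eu d) : ℝ := Real.sqrt ((F.Q u)⁻¹).det

theorem contDiffOn_rho (hpos : ∀ u ∈ F.W, 0 < (F.Q u).det) : ContDiffOn ℝ ∞ F.rho F.W := by
  have h1 : ContDiffOn ℝ ∞ (fun u => (F.Q u).det) F.W := by
    simp only [Matrix.det_apply']
    exact ContDiffOn.sum fun σ _ => contDiffOn_const.mul (contDiffOn_prod fun i _ => F.smooth_Q _ _)
  have h2 : ∀ u, F.rho u = Real.sqrt ((F.Q u).det)⁻¹ := fun u => by
    rw [rho, Matrix.det_nonsing_inv, Ring.inverse_eq_inv']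
  have h3 : ContDiffOn ℝ ∞ (fun u => Real.sqrt ((F.Q u).det)⁻¹) F.W :=
    (h1.inv fun u hu => (hpos u hu).ne').sqrt fun u hu => (inv_pos.2 (hpos u hu)).ne'
  exact h3.congr fun u _ => h2 u

/-- The derivative of `Q` is −(AQ + QAᵀ), so by Jacobi's formula det Q has logarithmic derivative −2
tr A and its power −1/2 has tr A. Taking the trace of the connection matrix separates the divergence
from the Euclidean trace of DX_j. -/
theorem fderiv_rho (hpos : ∀ u ∈ F.W, 0 < (F.Q u).det) (j : Fin n) (hu : u ∈ F.W) :
    fderiv ℝ F.rho u (F.X j u)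
      = F.rho u * (F.div j u - ∑ a, fderiv ℝ (F.X j) u (eb a) a) := by
  have hW := F.isOpen
  have h1 := hasDerivAt_line ((F.contDiffOn_rho hpos).differentiableAt' hW hu) (F.X j u)
  set A : Matrix (Fin d) (Fin d) ℝ := Matrix.of fun a c => F.A j u (eb c) a with hA
  have hQ : ∀ a b, HasDerivAt (fun s : ℝ => F.Q (u + s • F.X j u) a b)
      ((-(A * F.Q u + F.Q u * A.transpose)) a b) 0 := by
    intro a b
    have := hasDerivAt_line ((F.smooth_Q a b).differentiableAt' hW hu) (F.X j u)
    rw [F.fderiv_Q j a b u hu] at this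
    refine this.congr_deriv ?_
    simp [hA, Matrix.mul_apply, AdaptedFrame.A, Finset.sum_add_distrib]
  have hQu : F.Q (u + (0 : ℝ) • F.X j u) = F.Q u := by simp
  have hdet : IsUnit (F.Q u).det := (hpos u hu).ne'.isUnit
  have h2 := hasDerivAt_det (M := fun s : ℝ => F.Q (u + s • F.X j u)) (t := 0) hQ
    (by rw [hQu]; exact hdet)
  have htr : ((F.Q u)⁻¹ * -(A * F.Q u + F.Q u * A.transpose)).trace = - 2 * A.trace := by
    rw [mul_neg, Matrix.trace_neg, mul_add, Matrix.trace_add, Matrix.trace_mul_comm, mul_assoc,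
      Matrix.mul_nonsing_inv _ hdet, mul_one, ← mul_assoc, Matrix.nonsing_inv_mul _ hdet, one_mul,
      Matrix.trace_transpose]
    ring
  rw [hQu, htr] at h2
  have hp := hpos u hu
  have h3 : HasDerivAt (fun s : ℝ => F.rho (u + s • F.X j u)) (F.rho u * A.trace) 0 := by
    have e : (fun s : ℝ => F.rho (u + s • F.X j u))
        = fun s : ℝ => Real.sqrt ((F.Q (u + s • F.X j u)).det)⁻¹ := by
      funext s; rw [rho, Matrix.det_nonsing_inv, Ring.inverse_eq_inv']
    have e' : F.rho u = Real.sqrt ((F.Q u).det)⁻¹ := by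
      rw [rho, Matrix.det_nonsing_inv, Ring.inverse_eq_inv']
    rw [e]
    have h4 := h2.inv (by rw [hQu]; exact hp.ne')
    have h5 := h4.sqrt (by simp only [Pi.inv_apply, hQu]; exact (inv_pos.2 hp).ne')
    refine h5.congr_deriv ?_
    simp only [Pi.inv_apply, hQu]
    rw [e']
    have hs : Real.sqrt ((F.Q u).det)⁻¹ * Real.sqrt ((F.Q u).det)⁻¹ = ((F.Q u).det)⁻¹ :=
      Real.mul_self_sqrt (inv_pos.2 hp).le
    have hs0 : Real.sqrt ((F.Q u).det)⁻¹ ≠ 0 := (Real.sqrt_pos.2 (inv_pos.2 hp)).ne'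
    rw [div_eq_iff (by positivity)]
    calc _ = ((F.Q u).det)⁻¹ * (2 * A.trace) := by field_simp
      _ = _ := by linear_combination (-(2 * A.trace)) * hs
  have h6 : A.trace = F.div j u - ∑ a, fderiv ℝ (F.X j) u (eb a) a := by
    simp only [Matrix.trace, hA, Matrix.diag, Matrix.of_apply, AdaptedFrame.A, div]
    have : ∀ a, (∑ l, (F.om j l u).smulRight (F.X l u) - fderiv ℝ (F.X j) u) (eb a) a
        = ∑ l, F.om j l u (eb a) * F.X l u a - fderiv ℝ (F.X j) u (eb a) a := by
      intro a; simp [sum_apply]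
    simp only [this, Finset.sum_sub_distrib]
    congr 1
    rw [Finset.sum_comm]
    refine Finset.sum_congr rfl fun l _ => ?_
    conv_rhs => rw [← sum_eb (F.X l u), map_sum]
    exact Finset.sum_congr rfl fun a _ => by simp [mul_comm]
  rw [← h6]
  exact h1.unique h3

/-- The divergence theorem for a horizontal vector field with compact support. -/
theorem integral_div (hpos : ∀ u ∈ F.W, 0 < (F.Q u).det) {K : Set (Eu d)} (hK : IsCompact K)
    (hKW : K ⊆ F.W) (i : Fin n) {f : Eu d → ℝ} (hf : ContDiffOn ℝ ∞ f F.W)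
    (h0 : ∀ u ∉ K, f u = 0) :
    ∫ u, (fderiv ℝ f u (F.X i u) + F.div i u * f u) * F.rho u = 0 := by
  have hW := F.isOpen
  have hg : ∀ a, ContDiff ℝ ∞ (fun u => f u * F.rho u * F.X i u a) := by
    intro a
    have hXa : ContDiffOn ℝ ∞ (fun u => F.X i u a) F.W :=
      (EuclideanSpace.proj (𝕜 := ℝ) a).contDiff.comp_contDiffOn (F.smooth_X i)
    exact contDiff_of_zero_outside hW hK.isClosed hKW
      ((hf.mul (F.contDiffOn_rho hpos)).mul hXa) fun u hu => by simp [h0 u hu]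
  have hc : ∀ a, HasCompactSupport (fun u => f u * F.rho u * F.X i u a) := fun a =>
    HasCompactSupport.intro hK fun u hu => by simp [h0 u hu]
  -- The integrand is the Euclidean divergence of f ρ X_i: the trace of DX_i cancels against the one
  -- in the derivative of ρ.
  have h1 : ∀ u, (fderiv ℝ f u (F.X i u) + F.div i u * f u) * F.rho u
      = ∑ a, fderiv ℝ (fun u => f u * F.rho u * F.X i u a) u (eb a) := by
    intro u
    by_cases hu : u ∈ F.W
    · have hfd := hf.differentiableAt' hW hu
      have hrd := (F.contDiffOn_rho hpos).differentiableAt' hW hu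
      have hXd := (F.smooth_X i).differentiableAt' hW hu
      have hXa : ∀ a, HasFDerivAt (fun u => F.X i u a)
          ((EuclideanSpace.proj (𝕜 := ℝ) a) ∘L fderiv ℝ (F.X i) u) u := fun a =>
        (EuclideanSpace.proj (𝕜 := ℝ) a).hasFDerivAt.comp u hXd.hasFDerivAt
      have e : ∀ a, fderiv ℝ (fun u => f u * F.rho u * F.X i u a) u (eb a)
          = F.X i u a * fderiv ℝ f u (eb a) * F.rho u + F.X i u a * fderiv ℝ F.rho u (eb a) * f u
            + f u * F.rho u * fderiv ℝ (F.X i) u (eb a) a := by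
        intro a
        have hm : DifferentiableAt ℝ (fun u => f u * F.rho u) u := hfd.mul hrd
        rw [fderiv_fun_mul hm (hXa a).differentiableAt, fderiv_fun_mul hfd hrd,
          (hXa a).fderiv]
        simp
        ring
      have e2 : ∀ φ : Eu d →L[ℝ] ℝ, ∑ a, F.X i u a * φ (eb a) = φ (F.X i u) := by
        intro φ
        conv_rhs => rw [← sum_eb (F.X i u), map_sum]
        simp
      simp only [e, Finset.sum_add_distrib, ← Finset.sum_mul, ← Finset.mul_sum, e2,
        F.fderiv_rho hpos i hu]
      ring
    -- Outside `W` the frame and the density carry no information, but there `f` vanishes on a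
    -- neighbourhood.
    · have hu' : u ∉ K := fun h => hu (hKW h)
      have hnear : ∀ {g : Eu d → ℝ}, (∀ v ∉ K, g v = 0) → fderiv ℝ g u = 0 := by
        intro g hg
        have : g =ᶠ[𝓝 u] fun _ => 0 := by
          filter_upwards [hK.isClosed.isOpen_compl.mem_nhds hu'] with v hv using hg v hv
        rw [this.fderiv_eq]; simp
      rw [hnear h0, h0 u hu']
      have : ∀ a, fderiv ℝ (fun u => f u * F.rho u * F.X i u a) u = 0 := fun a =>
        hnear fun v hv => by simp [h0 v hv]
      simp [this]
  simp only [h1]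
  rw [integral_finsetSum]
  · exact Finset.sum_eq_zero fun a _ => integral_fderiv_eq_zero (hg a) (hc a) _
  · intro a _
    exact (((hg a).continuous_fderiv (by simp)).clm_apply continuous_const).integrable_of_hasCompactSupport
      ((hc a).fderiv_apply (𝕜 := ℝ) _)

end AdaptedFrame

end TGFoliation
end

open Bundle Manifold MeasureTheory VectorField
open scoped ContDiff Topology

noncomputable section

namespace TGFoliation

/-! ### Symmetry of the zeroth order term -/

section Sums

variable {n : ℕ}

theorem sum_rotate (f : Fin n → Fin n → Fin n → Fin n → ℝ) :
    ∑ j, ∑ q, ∑ r, ∑ s, f r s j q = ∑ j, ∑ q, ∑ r, ∑ s, f j q r s := by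
  simp only [← Fintype.sum_prod_type']
  refine Finset.sum_nbij' (fun x => (x.2.2.1, x.2.2.2, x.1, x.2.1))
    (fun x => (x.2.2.1, x.2.2.2, x.1, x.2.1)) ?_ ?_ ?_ ?_ ?_ <;> simp

theorem sum_reverse (f : Fin n → Fin n → Fin n → Fin n → ℝ) :
    ∑ j, ∑ q, ∑ r, ∑ s, f s r q j = ∑ j, ∑ q, ∑ r, ∑ s, f j q r s := by
  simp only [← Fintype.sum_prod_type']
  refine Finset.sum_nbij' (fun x => (x.2.2.2, x.2.2.1, x.2.1, x.1))
    (fun x => (x.2.2.2, x.2.2.1, x.2.1, x.1)) ?_ ?_ ?_ ?_ ?_ <;> simp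

/-- The sums match after relabelling. Exchanging the index pairs handles the first term by pair
symmetry. Reversing all four indices handles the other two, by pair symmetry together with both skew
symmetries. `N` and `P` will be inner products of α with θ ∧ ι β and θ ∧ θ ∧ ι ι β. -/
theorem sum_curvature {R : Fin n → Fin n → Fin n → Fin n → ℝ} {h : Fin n → Fin n → ℝ}
    (h1 : ∀ j q r s, R q j r s = - R j q r s)
    (h2 : ∀ j q r s, R j q s r = - R j q r s) (h3 : ∀ j q r s, R r s j q = R j q r s)
    (N : Fin n → Fin n → ℝ) (P : Fin n → Fin n → Fin n → Fin n → ℝ) :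
    ∑ j, ∑ q, ∑ r, ∑ s, R j q r s * (h r j * N q s - h s j * N q r + P q j s r)
      = ∑ j, ∑ q, ∑ r, ∑ s, R j q r s * (h j r * N s q - h j s * N r q + P r s j q) := by
  have e1 : ∀ j q r s, R s r q j = R j q r s := fun j q r s => by
    rw [h1, h2, neg_neg, h3]
  have a := sum_rotate fun j q r s => R j q r s * (h j r * N s q)
  have b := sum_reverse fun j q r s => R j q r s * (h j s * N r q)
  have c := sum_reverse fun j q r s => R j q r s * P r s j q
  simp only [h3] at a
  simp only [e1] at b c
  simp only [mul_add, mul_sub, Finset.sum_add_distrib, Finset.sum_sub_distrib, ← a, ← b, ← c]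

theorem sum_contract (h : Fin n → Fin n → ℝ) (R : Fin n → Fin n → Fin n → ℝ)
    (f : Fin n → Fin n → Fin n → ℝ) :
    ∑ p, ∑ r, ∑ s, (∑ q, h p q * R q r s) * f p r s
      = ∑ q, ∑ r, ∑ s, R q r s * ∑ p, h p q * f p r s := by
  simp only [Finset.mul_sum, Finset.sum_mul]
  rw [Finset.sum_congr rfl fun p _ => Finset.sum_congr rfl fun r _ => Finset.sum_comm,
    Finset.sum_congr rfl fun p _ => Finset.sum_comm, Finset.sum_comm]
  refine Finset.sum_congr rfl fun q _ => ?_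
  rw [Finset.sum_comm]
  refine Finset.sum_congr rfl fun r _ => ?_
  rw [Finset.sum_comm]
  exact Finset.sum_congr rfl fun s _ => Finset.sum_congr rfl fun p _ => by ring

end Sums

namespace AdaptedFrame

variable {d n : ℕ} (F : AdaptedFrame d n) {k : ℕ} {u : Eu d}

/-- The curvature two-forms. -/
def curv (j p : Fin n) (u v w : Eu d) : ℝ := F.B j p u v w - F.B j p u w v

theorem curv_eq (j p : Fin n) (u v w : Eu d) :
    F.curv j p u v w = fderiv ℝ (F.om j p) u v w - fderiv ℝ (F.om j p) u w v
      + ∑ l, (F.om j l u w * F.om l p u v - F.om j l u v * F.om l p u w) := by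
  simp only [curv, B, _root_.add_apply, _root_.sum_apply, ContinuousLinearMap.smulRight_apply,
    _root_.smul_apply, smul_eq_mul, Finset.sum_sub_distrib]
  have : ∀ v w, ∑ l, F.om j l u v * F.om l p u w = ∑ l, F.om l p u w * F.om j l u v :=
    fun v w => Finset.sum_congr rfl fun l _ => mul_comm _ _
  rw [this v w, this w v]
  abel

theorem curv_skew (j p : Fin n) (u v w : Eu d) : F.curv j p u w v = - F.curv j p u v w := by
  simp [curv]

/-- The curvature is skew with respect to `h`. -/
theorem sum_h_curv (hu : u ∈ F.W) (i j : Fin n) (v w : Eu d) :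
    ∑ k, F.h i k u * F.curv k j u v w = - ∑ k, F.h j k u * F.curv k i u v w := by
  have hW := F.isOpen
  have hd : ∀ v w, fderiv ℝ (fderiv ℝ (F.h i j)) u v w
      = -∑ k, (F.h k j u * fderiv ℝ (F.om k i) u v w + fderiv ℝ (F.h k j) u v * F.om k i u w
        + (F.h i k u * fderiv ℝ (F.om k j) u v w + fderiv ℝ (F.h i k) u v * F.om k j u w)) := by
    intro v w
    have e : fderiv ℝ (F.h i j) =ᶠ[𝓝 u]
        fun u => -∑ k, (F.h k j u • F.om k i u + F.h i k u • F.om k j u) := by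
      filter_upwards [hW.mem_nhds hu] with y hy using F.fderiv_h i j y hy
    have hsm : ∀ i j k l, HasFDerivAt (fun u => F.h i j u • F.om k l u)
        (F.h i j u • fderiv ℝ (F.om k l) u + (fderiv ℝ (F.h i j) u).smulRight (F.om k l u)) u :=
      fun i j k l => ((F.smooth_h i j).differentiableAt' hW hu).hasFDerivAt.fun_smul
        ((F.smooth_om k l).differentiableAt' hW hu).hasFDerivAt
    have e2 := (HasFDerivAt.fun_sum fun k (_ : k ∈ Finset.univ) =>
      (hsm k j k i).fun_add (hsm i k k j)).fun_neg
    rw [e.fderiv_eq, e2.fderiv]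
    simp [_root_.sum_apply]
  -- Second derivatives of h commute. Differentiating the equation for dh and taking the skew part
  -- is therefore the integrability condition, which is the claim.
  have hs : fderiv ℝ (fderiv ℝ (F.h i j)) u v w = fderiv ℝ (fderiv ℝ (F.h i j)) u w v :=
    (((F.smooth_h i j).contDiffAt (hW.mem_nhds hu)).isSymmSndFDerivAt
      (by rw [minSmoothness_of_isRCLikeNormedField]; exact WithTop.coe_le_coe.2 (le_top : (2 : ℕ∞) ≤ ⊤))).eq v w
  rw [hd, hd] at hs
  have hh : ∀ i j v, fderiv ℝ (F.h i j) u v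
      = -∑ k, (F.h k j u * F.om k i u v + F.h i k u * F.om k j u v) := by
    intro i j v
    rw [F.fderiv_h i j u hu]
    simp [_root_.sum_apply]
  have sw : ∀ k j, F.h k j u = F.h j k u := fun k j => F.h_symm k j u hu
  simp only [hh] at hs
  simp only [curv_eq, mul_add, Finset.sum_add_distrib, mul_sub, Finset.sum_sub_distrib,
    Finset.mul_sum, neg_mul, Finset.sum_neg_distrib, add_mul, Finset.sum_mul] at hs ⊢
  have c1 : ∀ (i j : Fin n) (v w : Eu d), ∑ x, ∑ y, F.h i y u * F.om y x u v * F.om x j u w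
      = ∑ x, ∑ y, F.h i x u * (F.om x y u v * F.om y j u w) := by
    intro i j v w
    rw [Finset.sum_comm]
    exact Finset.sum_congr rfl fun x _ => Finset.sum_congr rfl fun y _ => by ring
  have c2 : ∀ (i j : Fin n) (v w : Eu d), ∑ x, ∑ y, F.h y j u * F.om y x u v * F.om x i u w
      = ∑ x, ∑ y, F.h j x u * (F.om x y u v * F.om y i u w) := by
    intro i j v w
    rw [← c1]
    exact Finset.sum_congr rfl fun x _ => Finset.sum_congr rfl fun y _ => by rw [sw]
  have c3 : ∀ (v w : Eu d), ∑ x, ∑ y, F.h x y u * F.om y j u v * F.om x i u w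
      = ∑ x, ∑ y, F.h y x u * F.om y i u w * F.om x j u v := by
    intro v w
    rw [Finset.sum_comm]
    exact Finset.sum_congr rfl fun x _ => Finset.sum_congr rfl fun y _ => by ring
  have c4 : ∀ v w, ∑ k, F.h k j u * fderiv ℝ (F.om k i) u v w
      = ∑ k, F.h j k u * fderiv ℝ (F.om k i) u v w :=
    fun v w => Finset.sum_congr rfl fun x _ => by rw [sw]
  simp only [c1, c2, c4] at hs
  linarith [c3 v w, c3 w v]

section Frame

variable {θ : Fin n → Eu d →L[ℝ] ℝ}

/-- The vector ∑ h_ij X_i is metrically dual to θ_j, so the outer contraction moves to the other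
argument as a wedge with θ_j. -/
theorem ip_weitz (hu : u ∈ F.W) (hs : ∀ j, sharpQ (F.Q u) (θ j) = ∑ i, F.h i j u • F.X i u)
    (α β : Eu d [⋀^Fin (k + 1)]→L[ℝ] ℝ) :
    ip (F.Q u) (F.weitz u α) β
      = ∑ j, ∑ p, ip (F.Q u) (wedge2 (F.B j p u) (iota (F.X p u) α)) (wedge (θ j) β) := by
  rw [weitz, Finset.sum_comm, ip_sum_left]
  refine Finset.sum_congr rfl fun j _ => ?_
  have : ∀ γ : Eu d [⋀^Fin (k + 2)]→L[ℝ] ℝ, ∑ i, F.h i j u • iota (F.X i u) γ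
      = iota (sharpQ (F.Q u) (θ j)) γ := by
    intro γ
    rw [hs]
    simp only [map_sum, ContinuousLinearMap.map_smul, _root_.sum_apply, _root_.smul_apply]
  rw [this, ← ip_wedge_right fun a b => F.Q_symm a b u hu, ip_sum_left]

/-- The curvature is twice the skew part of `B`, so `B` minus half of it is symmetric and acts by
zero. This is where the factor 1/2 comes from. -/
theorem wedge2_eq_of_curv (j p : Fin n) {c : Fin n → Fin n → ℝ}
    (hc : ∀ v w, F.curv j p u v w = ∑ r, ∑ s, c r s * (θ r v * θ s w))
    (γ : Eu d [⋀^Fin k]→L[ℝ] ℝ) :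
    wedge2 (F.B j p u) γ = (1 / 2 : ℝ) • ∑ r, ∑ s, c r s • wedge (θ r) (wedge (θ s) γ) := by
  set C : Eu d →L[ℝ] Eu d →L[ℝ] ℝ := ∑ r, ∑ s, c r s • (θ r).smulRight (θ s) with hC
  have h1 : F.B j p u = (F.B j p u - (1 / 2 : ℝ) • C) + (1 / 2 : ℝ) • C := by abel
  have h2 : ∀ v w, C v w = F.curv j p u v w := by
    intro v w
    rw [hc, hC]
    simp [_root_.sum_apply]
  rw [h1, wedge2_add_left, wedge2_of_symm, zero_add, wedge2_smul_left, hC, wedge2_sum_left]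
  · simp only [wedge2_sum_left, wedge2_smul_left, wedge2_smulRight]
  · intro v w
    simp only [_root_.sub_apply, _root_.smul_apply, h2, smul_eq_mul]
    rw [F.curv_skew j p u v w, curv]
    ring

theorem ip_weitz_of_curv (hu : u ∈ F.W)
    (hs : ∀ j, sharpQ (F.Q u) (θ j) = ∑ i, F.h i j u • F.X i u)
    {R : Fin n → Fin n → Fin n → Fin n → ℝ}
    (hR : ∀ j p v w, F.curv j p u v w
      = ∑ r, ∑ s, (∑ q, F.h p q u * R j q r s) * (θ r v * θ s w))
    (α β : Eu d [⋀^Fin (k + 1)]→L[ℝ] ℝ) :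
    ip (F.Q u) (F.weitz u α) β = (1 / 2) * ∑ j, ∑ q, ∑ r, ∑ s, R j q r s *
      ip (F.Q u) (wedge (θ r) (wedge (θ s) (iota (sharpQ (F.Q u) (θ q)) α))) (wedge (θ j) β) := by
  rw [F.ip_weitz hu hs, Finset.mul_sum]
  refine Finset.sum_congr rfl fun j _ => ?_
  simp only [F.wedge2_eq_of_curv j _ (hR j _), ip_smul_left, ip_sum_left, ← Finset.mul_sum]
  congr 1
  have e : ∀ q r s, ip (F.Q u) (wedge (θ r) (wedge (θ s) (iota (sharpQ (F.Q u) (θ q)) α)))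
      (wedge (θ j) β) = ∑ p, F.h p q u *
        ip (F.Q u) (wedge (θ r) (wedge (θ s) (iota (F.X p u) α))) (wedge (θ j) β) := by
    intro q r s
    rw [hs, map_sum, _root_.sum_apply, map_sum, map_sum, ip_sum_left]
    refine Finset.sum_congr rfl fun p _ => ?_
    rw [ContinuousLinearMap.map_smul, _root_.smul_apply, ContinuousLinearMap.map_smul,
      ContinuousLinearMap.map_smul, ip_smul_left]
  simp only [e]
  exact sum_contract (fun p q => F.h p q u) (R j) fun p r s =>
      ip (F.Q u) (wedge (θ r) (wedge (θ s) (iota (F.X p u) α))) (wedge (θ j) β)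

/-- Normal ordering of the two operator words that arise from moving the zeroth order term to either
side: wedges are brought to the left of contractions. On one-forms the term with two contractions is
absent; `wedge_iota_succ` includes it. -/
theorem wedge_iota_one {a : Fin n → Eu d} (hθa : ∀ i j, θ i (a j) = F.h i j u)
    (hsy : ∀ i j, F.h i j u = F.h j i u) (j q r s : Fin n) (β : Eu d [⋀^Fin 1]→L[ℝ] ℝ) :
    wedge (θ q) (iota (a s) (iota (a r) (wedge (θ j) β)))
        = F.h r j u • wedge (θ q) (iota (a s) β) - F.h s j u • wedge (θ q) (iota (a r) β) ∧
    iota (a j) (wedge (θ r) (wedge (θ s) (iota (a q) β)))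
        = F.h j r u • wedge (θ s) (iota (a q) β) - F.h j s u • wedge (θ r) (iota (a q) β) := by
  constructor
  · rw [iota_wedge, ContinuousLinearMap.map_sub, iota_wedge_zero, hθa, hθa, hsy j r, hsy j s,
      ContinuousLinearMap.map_sub, ContinuousLinearMap.map_smul, ContinuousLinearMap.map_smul,
      ContinuousLinearMap.map_smul]
  · rw [iota_wedge, iota_wedge_zero, hθa, hθa, ContinuousLinearMap.map_smul, hsy r, hsy s]

theorem wedge_iota_succ {a : Fin n → Eu d} (hθa : ∀ i j, θ i (a j) = F.h i j u)
    (hsy : ∀ i j, F.h i j u = F.h j i u) (j q r s : Fin n) (β : Eu d [⋀^Fin (k + 2)]→L[ℝ] ℝ) :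
    wedge (θ q) (iota (a s) (iota (a r) (wedge (θ j) β)))
        = F.h r j u • wedge (θ q) (iota (a s) β) - F.h s j u • wedge (θ q) (iota (a r) β)
          + wedge (θ q) (wedge (θ j) (iota (a s) (iota (a r) β))) ∧
    iota (a j) (wedge (θ r) (wedge (θ s) (iota (a q) β)))
        = F.h j r u • wedge (θ s) (iota (a q) β) - F.h j s u • wedge (θ r) (iota (a q) β)
          + wedge (θ r) (wedge (θ s) (iota (a j) (iota (a q) β))) := by
  constructor
  · rw [iota_wedge, ContinuousLinearMap.map_sub, iota_wedge, hθa, hθa, hsy j r, hsy j s,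
      ContinuousLinearMap.map_sub, ContinuousLinearMap.map_sub, ContinuousLinearMap.map_smul,
      ContinuousLinearMap.map_smul, ContinuousLinearMap.map_smul]
    abel
  · rw [iota_wedge, iota_wedge, hθa, hθa, ContinuousLinearMap.map_sub,
      ContinuousLinearMap.map_smul, hsy r, hsy s]
    abel

theorem theta_sharpQ (hθ : ∀ i j, θ i (F.X j u) = if i = j then 1 else 0)
    (hs : ∀ j, sharpQ (F.Q u) (θ j) = ∑ i, F.h i j u • F.X i u) (i j : Fin n) :
    θ i (sharpQ (F.Q u) (θ j)) = F.h i j u := by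
  simp only [hs, map_sum, map_smul, hθ, smul_eq_mul]
  simp

/-- Separates the degree from the curvature: once both pairings are written in normal order through
the same `N` and `P`, the index identity `sum_curvature` finishes. -/
theorem ip_weitz_comm_aux (hu : u ∈ F.W)
    (hs : ∀ j, sharpQ (F.Q u) (θ j) = ∑ i, F.h i j u • F.X i u)
    {R : Fin n → Fin n → Fin n → Fin n → ℝ}
    (hR : ∀ j p v w, F.curv j p u v w
      = ∑ r, ∑ s, (∑ q, F.h p q u * R j q r s) * (θ r v * θ s w))
    (h1 : ∀ j q r s, R q j r s = - R j q r s) (h2 : ∀ j q r s, R j q s r = - R j q r s)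
    (h3 : ∀ j q r s, R r s j q = R j q r s) (α β : Eu d [⋀^Fin (k + 1)]→L[ℝ] ℝ)
    (N : Fin n → Fin n → ℝ) (P : Fin n → Fin n → Fin n → Fin n → ℝ)
    (hf : ∀ j q r s, ip (F.Q u) α (wedge (θ q) (iota (sharpQ (F.Q u) (θ s))
        (iota (sharpQ (F.Q u) (θ r)) (wedge (θ j) β))))
      = F.h r j u * N q s - F.h s j u * N q r + P q j s r)
    (hg : ∀ j q r s, ip (F.Q u) α (iota (sharpQ (F.Q u) (θ j)) (wedge (θ r) (wedge (θ s)
        (iota (sharpQ (F.Q u) (θ q)) β))))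
      = F.h j r u * N s q - F.h j s u * N r q + P r s j q) :
    ip (F.Q u) (F.weitz u α) β = ip (F.Q u) α (F.weitz u β) := by
  have hQ : ∀ a b, F.Q u a b = F.Q u b a := fun a b => F.Q_symm a b u hu
  rw [ip_comm hQ α, F.ip_weitz_of_curv hu hs hR, F.ip_weitz_of_curv hu hs hR]
  have hf' : ∀ j q r s, ip (F.Q u) (wedge (θ r) (wedge (θ s) (iota (sharpQ (F.Q u) (θ q)) α)))
      (wedge (θ j) β) = F.h r j u * N q s - F.h s j u * N q r + P q j s r := by
    intro j q r s
    rw [← hf, ip_wedge_left, ip_wedge_left, ip_wedge_right hQ]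
  have hg' : ∀ j q r s, ip (F.Q u) (wedge (θ r) (wedge (θ s) (iota (sharpQ (F.Q u) (θ q)) β)))
      (wedge (θ j) α) = F.h j r u * N s q - F.h j s u * N r q + P r s j q := by
    intro j q r s
    rw [← hg, ip_comm hQ, ip_wedge_left]
  simp only [hf', hg']
  rw [sum_curvature (h := fun i j => F.h i j u) h1 h2 h3 N P]

/-- Symmetry of the zeroth order term for a curvature with the Riemannian symmetries. -/
theorem ip_weitz_comm (hu : u ∈ F.W) (hθ : ∀ i j, θ i (F.X j u) = if i = j then 1 else 0)
    (hs : ∀ j, sharpQ (F.Q u) (θ j) = ∑ i, F.h i j u • F.X i u)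
    {R : Fin n → Fin n → Fin n → Fin n → ℝ}
    (hR : ∀ j p v w, F.curv j p u v w
      = ∑ r, ∑ s, (∑ q, F.h p q u * R j q r s) * (θ r v * θ s w))
    (h1 : ∀ j q r s, R q j r s = - R j q r s) (h2 : ∀ j q r s, R j q s r = - R j q r s)
    (h3 : ∀ j q r s, R r s j q = R j q r s) :
    ∀ {k : ℕ} (α β : Eu d [⋀^Fin (k + 1)]→L[ℝ] ℝ),
      ip (F.Q u) (F.weitz u α) β = ip (F.Q u) α (F.weitz u β)
  | 0, α, β => by
    have g := F.wedge_iota_one (F.theta_sharpQ hθ hs) fun i j => F.h_symm i j u hu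
    refine F.ip_weitz_comm_aux hu hs hR h1 h2 h3 α β
      (fun q s => ip (F.Q u) α (wedge (θ q) (iota (sharpQ (F.Q u) (θ s)) β))) (fun _ _ _ _ => 0)
      (fun j q r s => ?_) (fun j q r s => ?_)
    · rw [(g j q r s β).1, ip_sub_right, ip_smul_right, ip_smul_right, add_zero]
    · rw [(g j q r s β).2, ip_sub_right, ip_smul_right, ip_smul_right, add_zero]
  | k + 1, α, β => by
    have g := F.wedge_iota_succ (k := k) (F.theta_sharpQ hθ hs) fun i j => F.h_symm i j u hu
    refine F.ip_weitz_comm_aux hu hs hR h1 h2 h3 α β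
      (fun q s => ip (F.Q u) α (wedge (θ q) (iota (sharpQ (F.Q u) (θ s)) β)))
      (fun q j s r => ip (F.Q u) α (wedge (θ q) (wedge (θ j) (iota (sharpQ (F.Q u) (θ s))
        (iota (sharpQ (F.Q u) (θ r)) β)))))
      (fun j q r s => ?_) (fun j q r s => ?_)
    · rw [(g j q r s β).1, ip_add_right, ip_sub_right, ip_smul_right, ip_smul_right]
    · rw [(g j q r s β).2, ip_add_right, ip_sub_right, ip_smul_right, ip_smul_right]

/-- The constant function one, as a form of degree zero. -/
def oneForm (d : ℕ) : Eu d [⋀^Fin 0]→L[ℝ] ℝ :=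
  ContinuousAlternatingMap.constOfIsEmpty ℝ (Eu d) (Fin 0) (1 : ℝ)

theorem ip_oneForm : ip (F.Q u) (oneForm d) (oneForm d) = 1 := by
  simp [ip, oneForm]

/-- Contraction sees only the skew part of `B`, that is the curvature. With `a = θ q` the right-hand
side is the Ricci contraction ∑ h_ij Ω_jq(X_i, b♯). -/
theorem ip_weitz_one (hu : u ∈ F.W) (a b : Eu d →L[ℝ] ℝ) :
    ip (F.Q u) (F.weitz u (wedge a (oneForm d))) (wedge b (oneForm d))
      = ∑ i, ∑ j, F.h i j u * ∑ p, a (F.X p u) * F.curv j p u (F.X i u) (sharpQ (F.Q u) b) := by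
  rw [ip_wedge_right fun a b => F.Q_symm a b u hu, weitz]
  simp only [map_sum, ContinuousLinearMap.map_smul, ip_sum_left, ip_smul_left,
    iota_wedge_zero, wedge2_smul_right, iota_wedge2_zero, ip_smul_left, ip_oneForm, mul_one, smul_eq_mul,
    _root_.sub_apply, ContinuousLinearMap.flip_apply, curv, _root_.smul_apply]

/-- On two-forms the pairing also contains the curvature on the two vectors dual to `a'` and `b'`.
Choosing these vertical isolates the components of the curvature that have to vanish. -/
theorem ip_weitz_two (hu : u ∈ F.W) (a b a' b' : Eu d →L[ℝ] ℝ) :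
    ip (F.Q u) (F.weitz u (wedge a (wedge b (oneForm d)))) (wedge a' (wedge b' (oneForm d)))
      = ∑ i, ∑ j, F.h i j u * ∑ p,
        (a (F.X p u) * (F.curv j p u (F.X i u) (sharpQ (F.Q u) a') * b (sharpQ (F.Q u) b')
            - b (sharpQ (F.Q u) a') * F.curv j p u (F.X i u) (sharpQ (F.Q u) b')
            + b (F.X i u) * F.curv j p u (sharpQ (F.Q u) a') (sharpQ (F.Q u) b'))
          - b (F.X p u) * (F.curv j p u (F.X i u) (sharpQ (F.Q u) a') * a (sharpQ (F.Q u) b')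
            - a (sharpQ (F.Q u) a') * F.curv j p u (F.X i u) (sharpQ (F.Q u) b')
            + a (F.X i u) * F.curv j p u (sharpQ (F.Q u) a') (sharpQ (F.Q u) b'))) := by
  set z := sharpQ (F.Q u) a'
  set w := sharpQ (F.Q u) b'
  have e : ∀ (c : Eu d →L[ℝ] ℝ) (i j p : Fin n),
      ip (F.Q u) (iota w (iota z (iota (F.X i u) (wedge2 (F.B j p u) (wedge c (oneForm d))))))
        (oneForm d) = F.curv j p u (F.X i u) z * c w - c z * F.curv j p u (F.X i u) w
          + c (F.X i u) * F.curv j p u z w := by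
    intro c i j p
    rw [iota_wedge2, iota_wedge_zero, wedge2_smul_right]
    simp only [ContinuousLinearMap.map_add, ContinuousLinearMap.map_smul, iota_wedge, iota_wedge_zero,
      ContinuousLinearMap.map_sub, iota_wedge2_zero, smul_smul, ip_add_left, ip_sub_left, ip_smul_left, ip_oneForm, mul_one,
      _root_.sub_apply, ContinuousLinearMap.flip_apply, curv]
  have hQ : ∀ a b, F.Q u a b = F.Q u b a := fun a b => F.Q_symm a b u hu
  have hz : sharpQ (F.Q u) a' = z := rfl
  have hw : sharpQ (F.Q u) b' = w := rfl
  rw [ip_wedge_right hQ, ip_wedge_right hQ, weitz, hz, hw]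
  simp only [map_sum, ContinuousLinearMap.map_smul, ip_sum_left, ip_smul_left]
  refine Finset.sum_congr rfl fun i _ => Finset.sum_congr rfl fun j _ => ?_
  congr 1
  refine Finset.sum_congr rfl fun p _ => ?_
  rw [iota_wedge, iota_wedge_zero, sub_eq_add_neg, wedge2_add_right, wedge2_smul_right,
    ContinuousLinearMap.map_smul, ← neg_smul, wedge2_smul_right]
  simp only [ContinuousLinearMap.map_add, ContinuousLinearMap.map_smul, ip_add_left, ip_smul_left, e]
  ring

/-- Symmetry of the zeroth order term forces the curvature to be horizontal. -/
theorem curv_eq_zero (hu : u ∈ F.W) (hθ : ∀ i j, θ i (F.X j u) = if i = j then 1 else 0)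
    (hs : ∀ j, sharpQ (F.Q u) (θ j) = ∑ i, F.h i j u • F.X i u)
    {H : Fin n → Fin n → ℝ} (hH : ∀ i k, ∑ j, H i j * F.h j k u = if i = k then 1 else 0)
    (hflat : ∀ z, (∀ i, θ i z = 0) →
      ∃ ζ : Eu d →L[ℝ] ℝ, sharpQ (F.Q u) ζ = z ∧ ∀ p, ζ (F.X p u) = 0)
    (hsym1 : ∀ α β : Eu d [⋀^Fin 1]→L[ℝ] ℝ,
      ip (F.Q u) (F.weitz u α) β = ip (F.Q u) α (F.weitz u β))
    (hsym2 : ∀ α β : Eu d [⋀^Fin 2]→L[ℝ] ℝ,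
      ip (F.Q u) (F.weitz u α) β = ip (F.Q u) α (F.weitz u β))
    (j r : Fin n) {z : Eu d} (hz : ∀ i, θ i z = 0) (v : Eu d) : F.curv j r u z v = 0 := by
  have hQ : ∀ a b, F.Q u a b = F.Q u b a := fun a b => F.Q_symm a b u hu
  have hsy : ∀ i j, F.h i j u = F.h j i u := fun i j => F.h_symm i j u hu
  obtain ⟨ζ, hζ, hζX⟩ := hflat z hz
  set Y : Fin n → Eu d := fun j => sharpQ (F.Q u) (θ j) with hY
  have hζY : ∀ j, ζ (Y j) = 0 := fun j => by simp [hY, hs, hζX]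
  -- One-forms: the zeroth order term kills ζ, which annihilates the horizontal frame. Pairing with
  -- θ_q therefore shows that the mixed Ricci contraction vanishes.
  have ric : ∀ q, ∑ i, ∑ j, F.h i j u * F.curv j q u (F.X i u) z = 0 := by
    intro q
    have h := hsym1 (wedge (θ q) (oneForm d)) (wedge ζ (oneForm d))
    rw [ip_comm hQ (wedge (θ q) _), F.ip_weitz_one hu, F.ip_weitz_one hu, hζ] at h
    simpa [hθ, hζX] using h
  -- Since h is invertible it suffices to treat the curvature with its index contracted with h.
  have inv : ∀ w, (∀ q r, ∑ j, F.h q j u * F.curv j r u z w = 0) →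
      ∀ j r, F.curv j r u z w = 0 := by
    intro w h j r
    have : F.curv j r u z w = ∑ q, H j q * ∑ k, F.h q k u * F.curv k r u z w := by
      simp only [Finset.mul_sum]
      rw [Finset.sum_comm]
      simp only [← mul_assoc, ← Finset.sum_mul, hH]
      simp
    rw [this]
    simp [h]
  -- Two-forms against ζ ∧ ξ with both covectors vertical: symmetry makes the contracted curvature
  -- symmetric in `q` and `r`, while `sum_h_curv` makes it skew.
  have vv : ∀ w, (∀ i, θ i w = 0) → ∀ j r, F.curv j r u z w = 0 := by
    intro w hw
    obtain ⟨ξ, hξ, hξX⟩ := hflat w hw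
    refine inv w fun q r => ?_
    have h := hsym2 (wedge (θ r) (wedge (θ q) (oneForm d))) (wedge ζ (wedge ξ (oneForm d)))
    rw [ip_comm hQ (wedge (θ r) _), F.ip_weitz_two hu, F.ip_weitz_two hu, hζ, hξ] at h
    simp [hθ, hζX, hξX, hz, hw, mul_sub, Finset.sum_sub_distrib] at h
    have h' := F.sum_h_curv hu q r z w
    linarith
  -- Two-forms against ζ ∧ θ_s: apart from the wanted component, only mixed Ricci contractions
  -- survive, and these vanish by `ric`. Skewness in `q` and `r` concludes as before.
  have vh : ∀ s j r, F.curv j r u z (Y s) = 0 := by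
    intro s
    refine inv _ fun q r => ?_
    have h := hsym2 (wedge (θ r) (wedge (θ q) (oneForm d))) (wedge ζ (wedge (θ s) (oneForm d)))
    rw [ip_comm hQ (wedge (θ r) _), F.ip_weitz_two hu, F.ip_weitz_two hu, hζ] at h
    change _ = ∑ i, ∑ j, F.h i j u * ∑ p, (ζ (F.X p u) * _ - _ * (_ * ζ (Y q) - ζ (Y r) * _
      + ζ (F.X i u) * _)) at h
    have ric' : ∀ c q : Fin n, ∑ i, ∑ j, F.h i j u * (F.curv j q u (F.X i u) z * θ c (Y s)) = 0 := by
      intro c q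
      simp only [← mul_assoc, ← Finset.sum_mul, ric, zero_mul]
    simp only [hζX, hζY, zero_mul, mul_zero, sub_zero, add_zero, hz, hθ, mul_add, mul_sub, ite_mul,
      one_mul, mul_ite, mul_one, Finset.sum_sub_distrib, Finset.sum_add_distrib, Finset.sum_ite_eq,
      Finset.sum_ite_eq', Finset.mem_univ, if_true, Finset.sum_const_zero] at h
    have h' := F.sum_h_curv hu q r z (Y s)
    have e1 := ric' q r
    have e2 := ric' r q
    simp only [hY] at h' e1 e2 ⊢
    have s1 : ∀ (c q : Fin n) (w : Eu d), (∑ i, ∑ j, if c = i then F.h i j u * F.curv j q u z w else 0)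
        = ∑ j, F.h c j u * F.curv j q u z w := by
      intro c q w
      rw [Finset.sum_comm]
      simp
    simp [s1, mul_assoc] at h
    linarith
  have hX : ∀ s, F.X s u = ∑ i, H s i • Y i := by
    intro s
    simp only [hY, hs, Finset.smul_sum, smul_smul]
    rw [Finset.sum_comm]
    have hH' : ∀ j, ∑ i, H s i * F.h j i u = if s = j then 1 else 0 := fun j => by
      rw [← hH]
      exact Finset.sum_congr rfl fun i _ => by rw [hsy]
    simp [← Finset.sum_smul, hH']
  have hc : ∀ j r, ∃ φ : Eu d →L[ℝ] ℝ, ∀ w, F.curv j r u z w = φ w := fun j r =>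
    ⟨F.B j r u z - (F.B j r u).flip z, fun w => by simp [curv]⟩
  obtain ⟨φ, hφ⟩ := hc j r
  -- The last argument is split into a vertical vector, treated by `vv`, and a combination of the
  -- frame, hence of the vectors `Y i`, treated by `vh`.
  have hv : v = (v - ∑ s, θ s v • F.X s u) + ∑ s, θ s v • F.X s u := by abel
  have h0 : φ (v - ∑ s, θ s v • F.X s u) = 0 := by
    rw [← hφ]
    refine vv _ (fun i => ?_) j r
    simp [hθ]
  have h1 : ∀ s, φ (F.X s u) = 0 := by
    intro s
    rw [hX, map_sum]
    exact Finset.sum_eq_zero fun i _ => by rw [map_smul, ← hφ, vh, smul_zero]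
  rw [hφ, hv, map_add, h0, zero_add, map_sum]
  exact Finset.sum_eq_zero fun s _ => by rw [map_smul, h1, smul_zero]

end Frame

end AdaptedFrame

end TGFoliation
end

open Bundle Manifold MeasureTheory VectorField
open scoped ContDiff Topology

noncomputable section

namespace TGFoliation

/-! ### Matrices of bilinear forms -/

section MatrixInverse

variable {d : ℕ} {ι : Type*} [Fintype ι] [DecidableEq ι] {W : Set (Eu d)}

theorem contDiffOn_det {M : Eu d → Matrix ι ι ℝ}
    (hM : ∀ i j, ContDiffOn ℝ ∞ (fun u => M u i j) W) : ContDiffOn ℝ ∞ (fun u => (M u).det) W := by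
  simp only [Matrix.det_apply']
  exact ContDiffOn.sum fun σ _ => contDiffOn_const.mul (contDiffOn_prod fun i _ => hM _ _)

theorem contDiffOn_matrix_inv {M : Eu d → Matrix ι ι ℝ}
    (hM : ∀ i j, ContDiffOn ℝ ∞ (fun u => M u i j) W) (hdet : ∀ u ∈ W, (M u).det ≠ 0) (i j : ι) :
    ContDiffOn ℝ ∞ (fun u => (M u)⁻¹ i j) W := by
  have h1 : ∀ u, (M u)⁻¹ i j = ((M u).det)⁻¹ * ((M u).updateRow j (Pi.single i 1)).det := by
    intro u
    rw [Matrix.inv_def, Matrix.smul_apply, Matrix.adjugate_apply, Ring.inverse_eq_inv', smul_eq_mul]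
  simp only [h1]
  refine ((contDiffOn_det hM).inv hdet).mul (contDiffOn_det fun a b => ?_)
  by_cases hab : a = j
  · subst hab
    simpa using contDiffOn_const
  · simpa [hab] using hM a b

/-- Differentiate M M⁻¹ = 1, which holds near `u`, and solve for the derivative of the inverse. -/
theorem fderiv_matrix_inv {M : Eu d → Matrix ι ι ℝ} (hW : IsOpen W)
    (hM : ∀ i j, ContDiffOn ℝ ∞ (fun u => M u i j) W) (hdet : ∀ u ∈ W, (M u).det ≠ 0) (i j : ι)
    {u : Eu d} (hu : u ∈ W) (v : Eu d) : fderiv ℝ (fun u => (M u)⁻¹ i j) u v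
      = - ((M u)⁻¹ * (Matrix.of fun a b => fderiv ℝ (fun u => M u a b) u v) * (M u)⁻¹) i j := by
  set D := Matrix.of fun a b => fderiv ℝ (fun u => M u a b) u v with hD
  set D' := Matrix.of fun a b => fderiv ℝ (fun u => (M u)⁻¹ a b) u v with hD'
  have hI := contDiffOn_matrix_inv hM hdet
  have h0 : D * (M u)⁻¹ + M u * D' = 0 := by
    ext a b
    have hc : (fun u => ∑ c, M u a c * (M u)⁻¹ c b) =ᶠ[𝓝 u]
        fun _ => (1 : Matrix ι ι ℝ) a b := by
      filter_upwards [hW.mem_nhds hu] with y hy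
      rw [← Matrix.mul_nonsing_inv (M y) (hdet y hy).isUnit, Matrix.mul_apply]
    have h1 : fderiv ℝ (fun u => ∑ c, M u a c * (M u)⁻¹ c b) u v = 0 := by
      rw [hc.fderiv_eq]; simp
    rw [fderiv_fun_sum fun c _ => ((hM a c).mul (hI c b)).differentiableAt' hW hu,
      _root_.sum_apply] at h1
    rw [Matrix.add_apply, Matrix.mul_apply, Matrix.mul_apply, ← Finset.sum_add_distrib,
      Matrix.zero_apply, ← h1]
    refine Finset.sum_congr rfl fun c _ => ?_
    rw [fderiv_fun_mul ((hM a c).differentiableAt' hW hu) ((hI c b).differentiableAt' hW hu)]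
    simp [hD, hD']
    ring
  have h2 : D' = -((M u)⁻¹ * D * (M u)⁻¹) := by
    have := congrArg (fun N => (M u)⁻¹ * N) h0
    simp only [mul_add, mul_zero, ← mul_assoc, Matrix.nonsing_inv_mul _ (hdet u hu).isUnit,
      one_mul] at this
    exact eq_neg_of_add_eq_zero_right this
  have := congrFun (congrFun h2 i) j
  simpa [hD'] using this

/-- The Gram matrix of a bilinear form on the model space. -/
def gramE (B : Eu d →L[ℝ] Eu d →L[ℝ] ℝ) : Matrix (Fin d) (Fin d) ℝ :=
  Matrix.of fun i j => B (eb i) (eb j)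

theorem gramE_posDef {B : Eu d →L[ℝ] Eu d →L[ℝ] ℝ} (hs : ∀ v w, B v w = B w v)
    (hp : ∀ v, v ≠ 0 → 0 < B v v) : (gramE B).PosDef := by
  refine Matrix.PosDef.of_dotProduct_mulVec_pos ?_ fun x hx => ?_
  · ext i j; simp [gramE, hs (eb j)]
  · have h0 : (∑ i, x i • eb i : Eu d) ≠ 0 := by
      intro h
      apply hx
      funext i
      have := congrArg (fun v : Eu d => v i) h
      simpa [eb_apply] using this
    have := hp _ h0
    simp only [map_sum, map_smul, _root_.sum_apply, _root_.smul_apply, smul_eq_mul] at this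
    simp only [dotProduct, Matrix.mulVec, gramE, Matrix.of_apply, Pi.star_apply, star_trivial]
    refine this.trans_eq (Finset.sum_congr rfl fun i _ => ?_)
    rw [Finset.mul_sum, Finset.mul_sum]
    refine Finset.sum_congr rfl fun j _ => ?_
    rw [hs]
    ring

theorem gramE_det_pos {B : Eu d →L[ℝ] Eu d →L[ℝ] ℝ} (hs : ∀ v w, B v w = B w v)
    (hp : ∀ v, v ≠ 0 → 0 < B v v) : 0 < (gramE B).det := (gramE_posDef hs hp).det_pos

theorem sharpQ_gramE {B : Eu d →L[ℝ] Eu d →L[ℝ] ℝ} (hdet : (gramE B).det ≠ 0)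
    {v : Eu d} {φ : Eu d →L[ℝ] ℝ} (h : ∀ w, B v w = φ w) : sharpQ (gramE B)⁻¹ φ = v := by
  have h1 : ∀ i, φ (eb i) = ∑ a, v a * gramE B a i := by
    intro i
    rw [← h]
    conv_lhs => rw [← sum_eb v]
    simp [_root_.sum_apply, gramE]
  rw [sharpQ, Finset.sum_comm]
  conv_rhs => rw [← sum_eb v]
  refine Finset.sum_congr rfl fun j _ => ?_
  rw [← Finset.sum_smul]
  congr 1
  simp only [h1, Finset.mul_sum]
  rw [Finset.sum_comm]
  have : ∀ a, ∑ i, (gramE B)⁻¹ i j * (v a * gramE B a i) = v a * (gramE B * (gramE B)⁻¹) a j := by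
    intro a
    rw [Matrix.mul_apply, Finset.mul_sum]
    exact Finset.sum_congr rfl fun i _ => by ring
  simp only [this, Matrix.mul_nonsing_inv _ hdet.isUnit, Matrix.one_apply]
  simp

theorem apply_sharpQ_gramE {B : Eu d →L[ℝ] Eu d →L[ℝ] ℝ} (hdet : (gramE B).det ≠ 0)
    (φ : Eu d →L[ℝ] ℝ) (w : Eu d) :
    B (sharpQ (gramE B)⁻¹ φ) w = φ w := by
  have h1 : ∀ a, B (sharpQ (gramE B)⁻¹ φ) (eb a) = φ (eb a) := by
    intro a
    simp only [sharpQ, map_sum, map_smul, _root_.sum_apply, _root_.smul_apply, smul_eq_mul]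
    have : ∀ i, ∑ j, (gramE B)⁻¹ i j * φ (eb i) * B (eb j) (eb a)
        = φ (eb i) * ((gramE B)⁻¹ * gramE B) i a := by
      intro i
      rw [Matrix.mul_apply, Finset.mul_sum]
      exact Finset.sum_congr rfl fun j _ => by rw [gramE, Matrix.of_apply]; ring
    simp only [this, Matrix.nonsing_inv_mul _ hdet.isUnit, Matrix.one_apply]
    simp
  rw [← sum_eb w, map_sum, map_sum]
  exact Finset.sum_congr rfl fun a _ => by rw [map_smul, map_smul, h1]

end MatrixInverse

section Leibniz

variable {d : ℕ} {u : Eu d}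

theorem fderiv_apply_field {φ : Eu d → Eu d →L[ℝ] ℝ} {Y : Eu d → Eu d}
    (hφ : DifferentiableAt ℝ φ u) (hY : DifferentiableAt ℝ Y u) (v : Eu d) :
    fderiv ℝ (fun u => φ u (Y u)) u v = fderiv ℝ φ u v (Y u) + φ u (fderiv ℝ Y u v) := by
  rw [fderiv_clm_apply hφ hY]
  simp [add_comm]

theorem fderiv_bilin_apply {B : Eu d → Eu d →L[ℝ] Eu d →L[ℝ] ℝ} {Y Z : Eu d → Eu d}
    (hB : DifferentiableAt ℝ B u) (hY : DifferentiableAt ℝ Y u) (hZ : DifferentiableAt ℝ Z u)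
    (v : Eu d) : fderiv ℝ (fun u => B u (Y u) (Z u)) u v
      = fderiv ℝ B u v (Y u) (Z u) + B u (fderiv ℝ Y u v) (Z u) + B u (Y u) (fderiv ℝ Z u v) := by
  rw [fderiv_apply_field (hB.clm_apply hY) hZ, fderiv_clm_apply hB hY]
  simp [add_comm]

theorem fderiv_eq_zero_on {W : Set (Eu d)} (hW : IsOpen W) (hu : u ∈ W) {f : Eu d → ℝ} {c : ℝ}
    (h : ∀ y ∈ W, f y = c) (v : Eu d) : fderiv ℝ f u v = 0 := by
  have : f =ᶠ[𝓝 u] fun _ => c := by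
    filter_upwards [hW.mem_nhds hu] with y hy using h y hy
  rw [this.fderiv_eq]; simp

end Leibniz

/-! ### Local data of a totally geodesic Riemannian foliation -/

/-- An open set of `ℝᵈ` with a metric `G` and a foliation `⋂ ker θ_i`, given by closed forms `θ_i`,
that is Riemannian and totally geodesic, with the dual frame `X` of the horizontal distribution. -/
structure LocalFoliation (d n : ℕ) where
  W : Set (Eu d)
  isOpen : IsOpen W
  G : Eu d → Eu d →L[ℝ] Eu d →L[ℝ] ℝ
  θ : Fin n → Eu d → Eu d →L[ℝ] ℝ
  X : Fin n → Eu d → Eu d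
  smooth_G : ContDiffOn ℝ ∞ G W
  smooth_θ : ∀ i, ContDiffOn ℝ ∞ (θ i) W
  smooth_X : ∀ i, ContDiffOn ℝ ∞ (X i) W
  G_symm : ∀ u ∈ W, ∀ v w, G u v w = G u w v
  G_pos : ∀ u ∈ W, ∀ v, v ≠ 0 → 0 < G u v v
  closed : ∀ u ∈ W, ∀ i v w, fderiv ℝ (θ i) u v w = fderiv ℝ (θ i) u w v
  θ_X : ∀ u ∈ W, ∀ i j, θ i u (X j u) = if i = j then 1 else 0
  G_X : ∀ u ∈ W, ∀ i z, (∀ k, θ k u z = 0) → G u (X i u) z = 0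
  riem : ∀ u ∈ W, ∀ z, (∀ k, θ k u z = 0) →
    ∀ i j, fderiv ℝ (fun u => G u (X i u) (X j u)) u z = 0
  geod : ∀ u ∈ W, ∀ z, (∀ k, θ k u z = 0) →
    ∀ j, fderiv ℝ G u (X j u) z z + 2 * G u (fderiv ℝ (X j) u z) z = 0

namespace LocalFoliation

variable {d n : ℕ} (S : LocalFoliation d n) {u : Eu d}

/-- Vertical vectors. -/
def IsVert (u z : Eu d) : Prop := ∀ k, S.θ k u z = 0

/-- The Gram matrix of the horizontal frame. -/
def H (i j : Fin n) (u : Eu d) : ℝ := S.G u (S.X i u) (S.X j u)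

/-- The horizontal part. -/
def hpart (u v : Eu d) : Eu d := ∑ i, S.θ i u v • S.X i u

/-- The vertical part. -/
def vpart (u v : Eu d) : Eu d := v - S.hpart u v

/-- The torsion of the Bott connection on the frame, `T(X_k, X_q) = -[X_k, X_q]`. -/
def T (k q : Fin n) (u : Eu d) : Eu d :=
  fderiv ℝ (S.X k) u (S.X q u) - fderiv ℝ (S.X q) u (S.X k u)

variable {S}

theorem vpart_vert (hu : u ∈ S.W) (v : Eu d) : S.IsVert u (S.vpart u v) := by
  intro k
  simp [vpart, hpart, S.θ_X u hu]

theorem vpart_of_vert {z : Eu d} (hz : S.IsVert u z) : S.vpart u z = z := by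
  simp [vpart, hpart, hz _]

theorem vpart_X (hu : u ∈ S.W) (i : Fin n) : S.vpart u (S.X i u) = 0 := by
  simp [vpart, hpart, S.θ_X u hu]

theorem hpart_add_vpart (v : Eu d) : S.hpart u v + S.vpart u v = v := by simp [vpart]

theorem diffG (hu : u ∈ S.W) : DifferentiableAt ℝ S.G u := S.smooth_G.differentiableAt' S.isOpen hu

theorem diffX (hu : u ∈ S.W) (i : Fin n) : DifferentiableAt ℝ (S.X i) u :=
  (S.smooth_X i).differentiableAt' S.isOpen hu

theorem diffθ (hu : u ∈ S.W) (i : Fin n) : DifferentiableAt ℝ (S.θ i) u :=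
  (S.smooth_θ i).differentiableAt' S.isOpen hu

theorem smooth_H (i j : Fin n) : ContDiffOn ℝ ∞ (S.H i j) S.W :=
  (S.smooth_G.clm_apply (S.smooth_X i)).clm_apply (S.smooth_X j)

theorem smooth_DX (i j : Fin n) : ContDiffOn ℝ ∞ (fun u => fderiv ℝ (S.X i) u (S.X j u)) S.W :=
  (contDiffOn_fderiv S.isOpen (S.smooth_X i)).clm_apply (S.smooth_X j)

theorem smooth_T (k q : Fin n) : ContDiffOn ℝ ∞ (S.T k q) S.W := (smooth_DX k q).sub (smooth_DX q k)

theorem smooth_vpart (v : Eu d) : ContDiffOn ℝ ∞ (fun u => S.vpart u v) S.W :=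
  contDiffOn_const.sub (ContDiffOn.sum fun i _ =>
    ((S.smooth_θ i).clm_apply contDiffOn_const).smul (S.smooth_X i))

theorem H_symm (hu : u ∈ S.W) (i j : Fin n) : S.H i j u = S.H j i u := S.G_symm u hu _ _

theorem T_skew (k q : Fin n) (u : Eu d) : S.T q k u = - S.T k q u := by simp [T]

theorem G_X' (hu : u ∈ S.W) (i : Fin n) {z : Eu d} (hz : S.IsVert u z) : S.G u z (S.X i u) = 0 := by
  rw [S.G_symm u hu, S.G_X u hu i z hz]

theorem G_X_apply (hu : u ∈ S.W) (i : Fin n) (v : Eu d) :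
    S.G u (S.X i u) v = ∑ k, S.H i k u * S.θ k u v := by
  conv_lhs => rw [← hpart_add_vpart (S := S) (u := u) v, map_add, S.G_X u hu i _ (vpart_vert hu v)]
  simp only [hpart, map_sum, map_smul, add_zero, smul_eq_mul, H]
  exact Finset.sum_congr rfl fun k _ => mul_comm _ _

theorem fderiv_G_symm (hu : u ∈ S.W) (v a b : Eu d) :
    fderiv ℝ S.G u v a b = fderiv ℝ S.G u v b a := by
  have h := fderiv_eq_zero_on S.isOpen hu (f := fun u => S.G u a b - S.G u b a) (c := 0)
    (fun y hy => by rw [S.G_symm y hy]; ring) v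
  have hd : ∀ a b : Eu d, DifferentiableAt ℝ (fun u => S.G u a b) u := fun a b =>
    ((diffG hu).clm_apply (differentiableAt_const a)).clm_apply (differentiableAt_const b)
  have e : ∀ a b, fderiv ℝ (fun u => S.G u a b) u v = fderiv ℝ S.G u v a b := by
    intro a b
    rw [fderiv_bilin_apply (diffG hu) (differentiableAt_const a) (differentiableAt_const b)]
    simp
  rw [fderiv_fun_sub (hd a b) (hd b a), _root_.sub_apply, e, e] at h
  linarith

theorem fderiv_H (hu : u ∈ S.W) (i j : Fin n) (v : Eu d) : fderiv ℝ (S.H i j) u v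
    = fderiv ℝ S.G u v (S.X i u) (S.X j u) + S.G u (fderiv ℝ (S.X i) u v) (S.X j u)
      + S.G u (S.X i u) (fderiv ℝ (S.X j) u v) :=
  fderiv_bilin_apply (diffG hu) (diffX hu i) (diffX hu j) v

theorem fderiv_H_symm (hu : u ∈ S.W) (i j : Fin n) (v : Eu d) :
    fderiv ℝ (S.H i j) u v = fderiv ℝ (S.H j i) u v := by
  rw [fderiv_H hu, fderiv_H hu, fderiv_G_symm hu, S.G_symm u hu (fderiv ℝ (S.X i) u v),
    S.G_symm u hu (S.X i u)]
  ring

theorem fderiv_H_vert (hu : u ∈ S.W) (i j : Fin n) {z : Eu d} (hz : S.IsVert u z) :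
    fderiv ℝ (S.H i j) u z = 0 := S.riem u hu z hz i j

theorem fderiv_θ_X (hu : u ∈ S.W) (i j : Fin n) (v : Eu d) :
    fderiv ℝ (S.θ i) u v (S.X j u) = - S.θ i u (fderiv ℝ (S.X j) u v) := by
  have h := fderiv_eq_zero_on S.isOpen hu (f := fun u => S.θ i u (S.X j u)) (fun y hy => S.θ_X y hy i j) v
  rw [fderiv_apply_field (diffθ hu i) (diffX hu j)] at h
  linarith

/-- The forms θ_i are closed and take constant values on the frame, so they vanish on its brackets.
This is the bracket relation that makes the frame basic. -/
theorem T_vert (hu : u ∈ S.W) (k q : Fin n) : S.IsVert u (S.T k q u) := by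
  intro i
  have h := S.closed u hu i (S.X k u) (S.X q u)
  rw [fderiv_θ_X hu, fderiv_θ_X hu] at h
  rw [T, map_sub]
  linarith

section Vertical

variable {Z : Eu d → Eu d}

theorem fderiv_θ_vert (hu : u ∈ S.W) (hZs : ContDiffOn ℝ ∞ Z S.W)
    (hZ : ∀ y ∈ S.W, S.IsVert y (Z y)) (i : Fin n) (v : Eu d) :
    fderiv ℝ (S.θ i) u v (Z u) = - S.θ i u (fderiv ℝ Z u v) := by
  have h := fderiv_eq_zero_on S.isOpen hu (f := fun u => S.θ i u (Z u)) (fun y hy => hZ y hy i) v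
  rw [fderiv_apply_field (diffθ hu i) (hZs.differentiableAt' S.isOpen hu)] at h
  linarith

/-- The bracket of a vertical field with a field of the frame is vertical. -/
theorem lie_vert (hu : u ∈ S.W) (hZs : ContDiffOn ℝ ∞ Z S.W)
    (hZ : ∀ y ∈ S.W, S.IsVert y (Z y)) (j : Fin n) :
    S.IsVert u (fderiv ℝ Z u (S.X j u) - fderiv ℝ (S.X j) u (Z u)) := by
  intro i
  have h := S.closed u hu i (S.X j u) (Z u)
  rw [fderiv_θ_X hu, fderiv_θ_vert hu hZs hZ] at h
  rw [map_sub]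
  linarith

end Vertical

/-- The Lie derivative of `G` along a vector field. -/
def lieG (S : LocalFoliation d n) (Y : Eu d → Eu d) (u a b : Eu d) : ℝ :=
  fderiv ℝ S.G u (Y u) a b + S.G u (fderiv ℝ Y u a) b + S.G u a (fderiv ℝ Y u b)

theorem lieG_vert_self (hu : u ∈ S.W) (j : Fin n) {z : Eu d} (hz : S.IsVert u z) :
    S.lieG (S.X j) u z z = 0 := by
  have := S.geod u hu z hz j
  rw [lieG, S.G_symm u hu z]
  linarith

theorem lieG_symm (hu : u ∈ S.W) (Y : Eu d → Eu d) (a b : Eu d) :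
    S.lieG Y u a b = S.lieG Y u b a := by
  rw [lieG, lieG, fderiv_G_symm hu, S.G_symm u hu a, S.G_symm u hu _ b]
  ring

theorem IsVert.add {z w : Eu d} (hz : S.IsVert u z) (hw : S.IsVert u w) : S.IsVert u (z + w) :=
  fun k => by rw [map_add, hz, hw, add_zero]

/-- Polarisation of the totally geodesic condition. -/
theorem lieG_vert (hu : u ∈ S.W) (j : Fin n) {z w : Eu d} (hz : S.IsVert u z)
    (hw : S.IsVert u w) : S.lieG (S.X j) u z w = 0 := by
  have h := lieG_vert_self hu j (hz.add hw)
  have h1 := lieG_vert_self hu j hz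
  have h2 := lieG_vert_self hu j hw
  have h3 := lieG_symm hu (S.X j) z w
  simp only [lieG, map_add, _root_.add_apply] at h h1 h2 h3 ⊢
  linarith

end LocalFoliation

end TGFoliation
end

open Bundle Manifold MeasureTheory VectorField
open scoped ContDiff Topology

noncomputable section

namespace TGFoliation

theorem contDiffOn_smul_field {E F : Type*} [NormedAddCommGroup E] [NormedSpace ℝ E]
    [NormedAddCommGroup F] [NormedSpace ℝ F] {W : Set E} {f : E → F} {c : E → ℝ}
    (hc : ContDiffOn ℝ ∞ c W) (hf : ContDiffOn ℝ ∞ f W) :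
    ContDiffOn ℝ ∞ (fun u => c u • f u) W := hc.smul hf

theorem contDiffOn_const_smul_field {E F : Type*} [NormedAddCommGroup E] [NormedSpace ℝ E]
    [NormedAddCommGroup F] [NormedSpace ℝ F] {W : Set E} {f : E → F} (c : ℝ)
    (hf : ContDiffOn ℝ ∞ f W) : ContDiffOn ℝ ∞ (fun u => c • f u) W := hf.const_smul c

namespace LocalFoliation

variable {d n : ℕ} (S : LocalFoliation d n) {u : Eu d}

/-! ### The adapted connection of a totally geodesic Riemannian foliation -/

/-- The Gram matrix of the horizontal frame, as a matrix. -/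
def Hm (u : Eu d) : Matrix (Fin n) (Fin n) ℝ := Matrix.of fun i j => S.H i j u

/-- The inverse Gram matrix of the horizontal frame. -/
def h (i j : Fin n) (u : Eu d) : ℝ := (S.Hm u)⁻¹ i j

/-- The Christoffel symbols of the first kind of the transverse metric. -/
def chr1 (k i j : Fin n) (u : Eu d) : ℝ :=
  (1 / 2) * (fderiv ℝ (S.H i j) u (S.X k u) + fderiv ℝ (S.H k j) u (S.X i u)
    - fderiv ℝ (S.H k i) u (S.X j u))

/-- The Christoffel symbols of the transverse metric. -/
def chr (p k i : Fin n) (u : Eu d) : ℝ := ∑ j, S.chr1 k i j u * S.h j p u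

/-- The matrix of `J` in the horizontal frame: `J_z X_k = ∑ ψ_k^l(z) X_l`. -/
def psi (k l : Fin n) (u : Eu d) : Eu d →L[ℝ] ℝ := ∑ q, S.h l q u • S.G u (S.T k q u)

/-- The connection forms of `∇^ε` on the horizontal frame. -/
def om (ε : ℝ) (j l : Fin n) (u : Eu d) : Eu d →L[ℝ] ℝ :=
  ∑ k, S.chr l k j u • S.θ k u + ε⁻¹ • S.psi j l u

/-- The metric `g_ε`. -/
def Geps (ε : ℝ) (u : Eu d) : Eu d →L[ℝ] Eu d →L[ℝ] ℝ :=
  ε⁻¹ • S.G u + (1 - ε⁻¹) • ∑ i, ∑ k, S.H i k u • (S.θ i u).smulRight (S.θ k u)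

variable {S}

theorem Hm_posDef (hu : u ∈ S.W) : (S.Hm u).PosDef := by
  refine Matrix.PosDef.of_dotProduct_mulVec_pos ?_ fun x hx => ?_
  · ext i j; simp [Hm, H_symm hu j]
  · have h0 : (∑ i, x i • S.X i u : Eu d) ≠ 0 := by
      intro h
      apply hx
      funext i
      have := congrArg (S.θ i u) h
      simpa [S.θ_X u hu] using this
    have := S.G_pos u hu _ h0
    simp only [map_sum, map_smul, _root_.sum_apply, _root_.smul_apply, smul_eq_mul] at this
    simp only [dotProduct, Matrix.mulVec, Hm, H, Matrix.of_apply, Pi.star_apply, star_trivial]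
    refine this.trans_eq (Finset.sum_congr rfl fun i _ => ?_)
    rw [Finset.mul_sum, Finset.mul_sum]
    refine Finset.sum_congr rfl fun j _ => ?_
    rw [S.G_symm u hu]
    ring

theorem Hm_det (hu : u ∈ S.W) : (S.Hm u).det ≠ 0 := (Hm_posDef hu).det_pos.ne'

theorem smooth_h (i j : Fin n) : ContDiffOn ℝ ∞ (S.h i j) S.W :=
  contDiffOn_matrix_inv (fun i j => smooth_H i j) (fun _ hu => Hm_det hu) i j

theorem h_symm (hu : u ∈ S.W) (i j : Fin n) : S.h i j u = S.h j i u := by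
  have h1 : (S.Hm u).transpose = S.Hm u := by ext i j; simp [Hm, H_symm hu j]
  have h2 : ((S.Hm u)⁻¹).transpose = (S.Hm u)⁻¹ := by rw [Matrix.transpose_nonsing_inv, h1]
  exact congrFun (congrFun h2 j) i

theorem H_mul_h (hu : u ∈ S.W) (i k : Fin n) :
    ∑ j, S.H i j u * S.h j k u = if i = k then 1 else 0 := by
  have := congrFun (congrFun (Matrix.mul_nonsing_inv (S.Hm u) (Hm_det hu).isUnit) i) k
  rwa [Matrix.mul_apply, Matrix.one_apply] at this

theorem h_mul_H (hu : u ∈ S.W) (i k : Fin n) :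
    ∑ j, S.h i j u * S.H j k u = if i = k then 1 else 0 := by
  have := congrFun (congrFun (Matrix.nonsing_inv_mul (S.Hm u) (Hm_det hu).isUnit) i) k
  rwa [Matrix.mul_apply, Matrix.one_apply] at this

theorem chr1_symm (hu : u ∈ S.W) (k i j : Fin n) : S.chr1 k i j u = S.chr1 i k j u := by
  rw [chr1, chr1, fderiv_H_symm hu k i]; ring

theorem chr_symm (hu : u ∈ S.W) (p k i : Fin n) : S.chr p k i u = S.chr p i k u := by
  simp only [chr, chr1_symm hu k i]

theorem chr_lower (hu : u ∈ S.W) (k i j : Fin n) :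
    ∑ p, S.chr p k i u * S.H p j u = S.chr1 k i j u := by
  simp only [chr, Finset.sum_mul, mul_assoc]
  rw [Finset.sum_comm]
  simp only [← Finset.mul_sum, h_mul_H hu]
  simp

theorem psi_lower (hu : u ∈ S.W) (k j : Fin n) (v : Eu d) :
    ∑ l, S.psi k l u v * S.H l j u = S.G u (S.T k j u) v := by
  have : ∀ l, S.psi k l u v * S.H l j u = ∑ q, S.G u (S.T k q u) v * (S.h q l u * S.H l j u) := by
    intro l
    simp only [psi, _root_.sum_apply, _root_.smul_apply, smul_eq_mul, Finset.sum_mul]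
    exact Finset.sum_congr rfl fun q _ => by rw [h_symm hu l q]; ring
  simp only [this]
  rw [Finset.sum_comm]
  simp only [← Finset.mul_sum, h_mul_H hu]
  simp

theorem psi_X (hu : u ∈ S.W) (k l i : Fin n) : S.psi k l u (S.X i u) = 0 := by
  simp only [psi, _root_.sum_apply, _root_.smul_apply, G_X' hu i (T_vert hu k _), smul_zero,
    Finset.sum_const_zero]

theorem smooth_psi (k l : Fin n) : ContDiffOn ℝ ∞ (S.psi k l) S.W :=
  ContDiffOn.sum fun q _ => (smooth_h l q).smul (S.smooth_G.clm_apply (smooth_T k q))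

theorem smooth_chr1 (k i j : Fin n) : ContDiffOn ℝ ∞ (S.chr1 k i j) S.W := by
  have h1 : ∀ i j k, ContDiffOn ℝ ∞ (fun u => fderiv ℝ (S.H i j) u (S.X k u)) S.W := fun i j k =>
    (contDiffOn_fderiv S.isOpen (smooth_H i j)).clm_apply (S.smooth_X k)
  exact contDiffOn_const.mul (((h1 i j k).add (h1 k j i)).sub (h1 k i j))

theorem smooth_chr (p k i : Fin n) : ContDiffOn ℝ ∞ (S.chr p k i) S.W :=
  ContDiffOn.sum fun j _ => (smooth_chr1 k i j).mul (smooth_h j p)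

theorem smooth_om (ε : ℝ) (j l : Fin n) : ContDiffOn ℝ ∞ (S.om ε j l) S.W :=
  (ContDiffOn.sum fun k _ => (smooth_chr l k j).smul (S.smooth_θ k)).add
    ((smooth_psi j l).const_smul ε⁻¹)

theorem om_X (hu : u ∈ S.W) (ε : ℝ) (j l a : Fin n) : S.om ε j l u (S.X a u) = S.chr l a j u := by
  simp [om, psi_X hu, S.θ_X u hu, _root_.sum_apply]

theorem om_vert (ε : ℝ) (j l : Fin n) {z : Eu d} (hz : S.IsVert u z) :
    S.om ε j l u z = ε⁻¹ * S.psi j l u z := by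
  simp [om, hz _, _root_.sum_apply]

/-- Compatibility of the connection forms with the horizontal metric. The Christoffel part is metric
by the usual symmetrisation, and the part from J contributes G(T_ij + T_ji, v) = 0. -/
theorem fderiv_H_eq (hu : u ∈ S.W) (ε : ℝ) (i j : Fin n) (v : Eu d) : fderiv ℝ (S.H i j) u v
    = ∑ l, (S.om ε i l u v * S.H l j u + S.om ε j l u v * S.H i l u) := by
  have e1 : ∀ i j : Fin n, ∑ l, S.om ε i l u v * S.H l j u
      = ∑ k, S.chr1 k i j u * S.θ k u v + ε⁻¹ * S.G u (S.T i j u) v := by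
    intro i j
    rw [← psi_lower hu]
    simp only [om, _root_.add_apply, _root_.sum_apply, _root_.smul_apply, smul_eq_mul, add_mul,
      Finset.sum_add_distrib, ← chr_lower hu, Finset.sum_mul, Finset.mul_sum]
    congr 1
    · rw [Finset.sum_comm]
      exact Finset.sum_congr rfl fun k _ => Finset.sum_congr rfl fun l _ => by ring
    · exact Finset.sum_congr rfl fun k _ => by ring
  have e2 : ∀ l, S.om ε j l u v * S.H i l u = S.om ε j l u v * S.H l i u := fun l => by
    rw [H_symm hu i l]
  rw [Finset.sum_add_distrib]
  simp only [e2, e1, T_skew i j]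
  -- Because the foliation is Riemannian, H is constant along the leaves and only its horizontal
  -- derivatives remain.
  have e3 : fderiv ℝ (S.H i j) u v = ∑ k, fderiv ℝ (S.H i j) u (S.X k u) * S.θ k u v := by
    conv_lhs => rw [← hpart_add_vpart (S := S) (u := u) v, map_add,
      fderiv_H_vert hu _ _ (vpart_vert hu v), add_zero, hpart, map_sum]
    exact Finset.sum_congr rfl fun k _ => by rw [map_smul, smul_eq_mul, mul_comm]
  have e4 : ∀ k, fderiv ℝ (S.H i j) u (S.X k u) = S.chr1 k i j u + S.chr1 k j i u := by
    intro k
    rw [chr1, chr1, fderiv_H_symm hu j i]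
    ring
  rw [e3]
  simp only [e4, add_mul, Finset.sum_add_distrib, map_neg, _root_.neg_apply]
  ring

theorem fderiv_h (hu : u ∈ S.W) (ε : ℝ) (i j : Fin n) : fderiv ℝ (S.h i j) u
    = - ∑ k, (S.h k j u • S.om ε k i u + S.h i k u • S.om ε k j u) := by
  ext v
  have e := fderiv_matrix_inv (M := S.Hm) S.isOpen (fun i j => smooth_H i j)
    (fun _ hu => Hm_det hu) i j hu v
  change fderiv ℝ (S.h i j) u v = _ at e
  rw [e]
  set O : Matrix (Fin n) (Fin n) ℝ := Matrix.of fun i l => S.om ε i l u v with hO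
  have hD : (Matrix.of fun a b => fderiv ℝ (fun u => S.Hm u a b) u v)
      = O * S.Hm u + S.Hm u * O.transpose := by
    ext a b
    change fderiv ℝ (S.H a b) u v = _
    rw [fderiv_H_eq hu ε, Finset.sum_add_distrib, Matrix.add_apply, Matrix.mul_apply,
      Matrix.mul_apply]
    congr 1
    exact Finset.sum_congr rfl fun l _ => mul_comm _ _
  have hU := (Hm_det hu).isUnit
  have : (S.Hm u)⁻¹ * (O * S.Hm u + S.Hm u * O.transpose) * (S.Hm u)⁻¹
      = (S.Hm u)⁻¹ * O + O.transpose * (S.Hm u)⁻¹ := by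
    rw [mul_add, add_mul, ← mul_assoc, mul_assoc _ (S.Hm u), Matrix.mul_nonsing_inv _ hU, mul_one,
      ← mul_assoc, Matrix.nonsing_inv_mul _ hU, one_mul]
  rw [hD, this, Matrix.add_apply, Matrix.mul_apply, Matrix.mul_apply]
  simp only [_root_.neg_apply, _root_.sum_apply, _root_.add_apply, _root_.smul_apply, smul_eq_mul,
    Finset.sum_add_distrib, hO, Matrix.of_apply, Matrix.transpose_apply]
  change -(∑ k, S.h i k u * _ + ∑ k, _ * S.h k j u) = _
  rw [add_comm]
  congr 2
  exact Finset.sum_congr rfl fun l _ => mul_comm _ _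

section Metric

variable {ε : ℝ}

theorem Geps_apply (v w : Eu d) : S.Geps ε u v w
    = ε⁻¹ * S.G u v w + (1 - ε⁻¹) * ∑ i, ∑ k, S.H i k u * (S.θ i u v * S.θ k u w) := by
  simp [Geps, _root_.sum_apply]

theorem Geps_symm (hu : u ∈ S.W) (v w : Eu d) : S.Geps ε u v w = S.Geps ε u w v := by
  rw [Geps_apply, Geps_apply, S.G_symm u hu, Finset.sum_comm]
  congr 2
  exact Finset.sum_congr rfl fun i _ => Finset.sum_congr rfl fun k _ => by
    rw [H_symm hu]; ring

theorem Geps_vert (v : Eu d) {z : Eu d} (hz : S.IsVert u z) :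
    S.Geps ε u v z = ε⁻¹ * S.G u v z := by
  simp [Geps_apply, hz _]

theorem Geps_X (hu : u ∈ S.W) (a : Fin n) (v : Eu d) :
    S.Geps ε u (S.X a u) v = S.G u (S.X a u) v := by
  rw [Geps_apply, G_X_apply hu]
  simp only [S.θ_X u hu, ite_mul, one_mul, zero_mul, mul_ite, mul_zero, Finset.sum_ite_irrel,
    Finset.sum_const_zero, Finset.sum_ite_eq', Finset.mem_univ, if_true]
  ring

theorem Geps_hpart (hu : u ∈ S.W) (v w : Eu d) :
    S.Geps ε u (S.hpart u v) w = S.G u (S.hpart u v) w := by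
  simp only [hpart, map_sum, map_smul, _root_.sum_apply, _root_.smul_apply, Geps_X hu]

theorem Geps_split (hu : u ∈ S.W) (v w : Eu d) : S.Geps ε u v w
    = S.G u (S.hpart u v) (S.hpart u w) + ε⁻¹ * S.G u (S.vpart u v) (S.vpart u w) := by
  conv_lhs => rw [← hpart_add_vpart (S := S) (u := u) v, map_add, _root_.add_apply, Geps_hpart hu,
    Geps_symm hu, Geps_vert _ (vpart_vert hu v), S.G_symm u hu w]
  have h1 : ∀ z, S.IsVert u z → S.G u (S.hpart u v) z = 0 := by
    intro z hz
    simp only [hpart, map_sum, map_smul, _root_.sum_apply, _root_.smul_apply, S.G_X u hu _ z hz,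
      smul_zero, Finset.sum_const_zero]
  have h2 : ∀ z, S.IsVert u z → S.G u z (S.hpart u w) = 0 := by
    intro z hz
    simp only [hpart, map_sum, map_smul, G_X' hu _ hz, smul_zero, Finset.sum_const_zero]
  conv_lhs => rw [← hpart_add_vpart (S := S) (u := u) w, map_add, map_add,
    h1 _ (vpart_vert hu w), h2 _ (vpart_vert hu v)]
  ring

theorem Geps_pos (hu : u ∈ S.W) (hε : 0 < ε) {v : Eu d} (hv : v ≠ 0) : 0 < S.Geps ε u v v := by
  rw [Geps_split hu]
  have hn : ∀ w, 0 ≤ S.G u w w := fun w => by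
    rcases eq_or_ne w 0 with rfl | hw
    · simp
    · exact (S.G_pos u hu w hw).le
  by_cases h0 : S.hpart u v = 0
  · have h1 : S.vpart u v ≠ 0 := fun h1 => hv (by
      rw [← hpart_add_vpart (S := S) (u := u) v, h0, h1, add_zero])
    have := mul_pos (inv_pos.2 hε) (S.G_pos u hu _ h1)
    linarith [hn (S.hpart u v)]
  · have := mul_nonneg (inv_pos.2 hε).le (hn (S.vpart u v))
    linarith [S.G_pos u hu _ h0]

theorem smooth_Geps : ContDiffOn ℝ ∞ (S.Geps ε) S.W := by
  have h1 : ContDiffOn ℝ ∞ (fun u => ε⁻¹ • S.G u) S.W := contDiffOn_const_smul_field _ S.smooth_G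
  have h2 : ∀ i k, ContDiffOn ℝ ∞ (fun u => S.H i k u • (S.θ i u).smulRight (S.θ k u)) S.W :=
    fun i k => contDiffOn_smul_field (smooth_H i k) ((S.smooth_θ i).smulRight (S.smooth_θ k))
  exact h1.add (contDiffOn_const_smul_field _ (ContDiffOn.sum fun i _ => ContDiffOn.sum fun k _ =>
    h2 i k))

theorem diffGeps (hu : u ∈ S.W) : DifferentiableAt ℝ (S.Geps ε) u :=
  smooth_Geps.differentiableAt' S.isOpen hu

theorem fderiv_Geps_symm (hu : u ∈ S.W) (v a b : Eu d) :
    fderiv ℝ (S.Geps ε) u v a b = fderiv ℝ (S.Geps ε) u v b a := by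
  have h := fderiv_eq_zero_on S.isOpen hu (f := fun u => S.Geps ε u a b - S.Geps ε u b a) (c := 0)
    (fun y hy => by rw [Geps_symm hy]; ring) v
  have hd : ∀ a b : Eu d, DifferentiableAt ℝ (fun u => S.Geps ε u a b) u := fun a b =>
    ((diffGeps hu).clm_apply (differentiableAt_const a)).clm_apply (differentiableAt_const b)
  have e : ∀ a b, fderiv ℝ (fun u => S.Geps ε u a b) u v = fderiv ℝ (S.Geps ε) u v a b := by
    intro a b
    rw [fderiv_bilin_apply (diffGeps hu) (differentiableAt_const a) (differentiableAt_const b)]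
    simp
  rw [fderiv_fun_sub (hd a b) (hd b a), _root_.sub_apply, e, e] at h
  linarith

/-- The connection matrix of `∇^ε_{X_j}`. -/
def conn (S : LocalFoliation d n) (ε : ℝ) (j : Fin n) (u : Eu d) : Eu d →L[ℝ] Eu d :=
  ∑ l, (S.om ε j l u).smulRight (S.X l u) - fderiv ℝ (S.X j) u

theorem conn_apply (j : Fin n) (v : Eu d) : S.conn ε j u v
    = ∑ l, S.om ε j l u v • S.X l u - fderiv ℝ (S.X j) u v := by
  simp [conn, _root_.sum_apply]

set_option synthInstance.maxHeartbeats 200000 in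
/-- Horizontal derivatives of `g_ε`. -/
theorem fderiv_Geps (hu : u ∈ S.W) (j : Fin n) (v w : Eu d) :
    fderiv ℝ (S.Geps ε) u (S.X j u) v w
      = S.Geps ε u (S.conn ε j u v) w + S.Geps ε u v (S.conn ε j u w) := by
  -- Φ is the derivative of g_ε along X_j, corrected by the connection. It is bilinear and
  -- symmetric, so it may be checked on pairs of horizontal and vertical vectors.
  set Φ : Eu d →L[ℝ] Eu d →L[ℝ] ℝ := fderiv ℝ (S.Geps ε) u (S.X j u)
    - (S.Geps ε u) ∘L (S.conn ε j u) - ((S.Geps ε u).flip ∘L (S.conn ε j u)).flip with hΦ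
  have hΦa : ∀ v w, Φ v w = fderiv ℝ (S.Geps ε) u (S.X j u) v w
      - S.Geps ε u (S.conn ε j u v) w - S.Geps ε u v (S.conn ε j u w) := fun v w => by simp [hΦ]
  have hsym : ∀ v w, Φ v w = Φ w v := by
    intro v w
    rw [hΦa, hΦa, fderiv_Geps_symm hu, Geps_symm hu w, Geps_symm hu v]
    ring
  have hT : ∀ a, fderiv ℝ (S.X j) u (S.X a u) - fderiv ℝ (S.X a) u (S.X j u) = S.T j a u :=
    fun a => rfl
  have hsum : ∀ (c : Fin n → ℝ) (w : Eu d), S.Geps ε u (∑ l, c l • S.X l u) w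
      = ∑ l, c l * S.G u (S.X l u) w := by
    intro c w
    simp only [map_sum, map_smul, _root_.sum_apply, _root_.smul_apply, Geps_X hu, smul_eq_mul]
  -- Horizontal pairs: metricity of the transverse Christoffel symbols, since the brackets of the
  -- frame are vertical.
  have hXX : ∀ a b, Φ (S.X a u) (S.X b u) = 0 := by
    intro a b
    have h1 := fderiv_bilin_apply (diffGeps (S := S) (ε := ε) hu) (diffX hu a) (diffX hu b) (S.X j u)
    have h2 : fderiv ℝ (fun u => S.Geps ε u (S.X a u) (S.X b u)) u (S.X j u)
        = fderiv ℝ (S.H a b) u (S.X j u) := by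
      have : (fun u => S.Geps ε u (S.X a u) (S.X b u)) =ᶠ[𝓝 u] S.H a b := by
        filter_upwards [S.isOpen.mem_nhds hu] with y hy using Geps_X hy a _
      rw [this.fderiv_eq]
    have h3 : ∀ a b, S.Geps ε u (S.conn ε j u (S.X a u)) (S.X b u)
        = S.chr1 a j b u - S.Geps ε u (fderiv ℝ (S.X j) u (S.X a u)) (S.X b u) := by
      intro a b
      rw [conn_apply, map_sub, _root_.sub_apply, hsum]
      simp only [om_X hu]
      rw [← chr_lower hu]
      rfl
    have h4 : ∀ a b, S.Geps ε u (fderiv ℝ (S.X j) u (S.X a u)) (S.X b u)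
        = S.Geps ε u (fderiv ℝ (S.X a) u (S.X j u)) (S.X b u) := by
      intro a b
      have : S.Geps ε u (S.T j a u) (S.X b u) = 0 := by
        rw [Geps_symm hu, Geps_X hu, S.G_X u hu b _ (T_vert hu j a)]
      rw [← hT, map_sub, _root_.sub_apply] at this
      linarith
    have h5 : fderiv ℝ (S.H a b) u (S.X j u) = S.chr1 a j b u + S.chr1 b j a u := by
      rw [chr1, chr1, fderiv_H_symm hu b a, fderiv_H_symm hu j b, fderiv_H_symm hu j a]
      ring
    rw [hΦa, Geps_symm hu (S.X a u), h3, h3, h4, h4]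
    rw [h2, h5, Geps_symm hu (S.X a u)] at h1
    linarith
  -- Mixed pairs: the term ε⁻¹ J of the connection contributes ε⁻¹⟨T(X_j, X_a), z⟩, which is exactly
  -- the g_ε-product of the torsion with `z`. This balance fixes the coefficient ε⁻¹ in ∇^ε.
  have hXZ : ∀ a z, S.IsVert u z → Φ (S.X a u) z = 0 := by
    intro a z hz
    have hv := fun y (hy : y ∈ S.W) => vpart_vert (S := S) hy z
    have hZd := (smooth_vpart (S := S) z).differentiableAt' S.isOpen hu
    have hZu : S.vpart u z = z := vpart_of_vert hz
    have h1 := fderiv_bilin_apply (diffGeps (S := S) (ε := ε) hu) (diffX hu a) hZd (S.X j u)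
    have h2 : fderiv ℝ (fun u => S.Geps ε u (S.X a u) (S.vpart u z)) u (S.X j u) = 0 :=
      fderiv_eq_zero_on S.isOpen hu (c := 0) (fun y hy => by
        rw [Geps_X hy, S.G_X y hy a _ (hv y hy)]) _
    have h3 := lie_vert hu (smooth_vpart z) hv j
    rw [hZu] at h1 h3
    have h4 : S.Geps ε u (S.X a u) (fderiv ℝ (fun u => S.vpart u z) u (S.X j u))
        = S.Geps ε u (S.X a u) (fderiv ℝ (S.X j) u z) := by
      have := S.G_X u hu a _ h3
      rw [← Geps_X (ε := ε) hu, map_sub] at this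
      linarith
    have h5 : S.Geps ε u (S.conn ε j u (S.X a u)) z
        = - S.Geps ε u (fderiv ℝ (S.X j) u (S.X a u)) z := by
      rw [conn_apply, map_sub, _root_.sub_apply, hsum]
      simp only [S.G_X u hu _ z hz, mul_zero, Finset.sum_const_zero, zero_sub]
    have h6 : S.Geps ε u (S.X a u) (S.conn ε j u z)
        = ε⁻¹ * S.G u (S.T j a u) z - S.Geps ε u (S.X a u) (fderiv ℝ (S.X j) u z) := by
      rw [conn_apply, map_sub, Geps_symm hu, hsum]
      simp only [om_vert ε j _ hz, mul_assoc, ← Finset.mul_sum]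
      rw [← psi_lower hu]
      rfl
    have h7 : S.Geps ε u (fderiv ℝ (S.X j) u (S.X a u)) z
        - S.Geps ε u (fderiv ℝ (S.X a) u (S.X j u)) z = ε⁻¹ * S.G u (S.T j a u) z := by
      rw [← Geps_vert _ hz, ← hT, map_sub, _root_.sub_apply]
    rw [hΦa, h5, h6]
    rw [h2, h4] at h1
    linarith
  -- Vertical pairs: this is the totally geodesic condition, multiplied by ε⁻¹.
  have hZZ : ∀ z w, S.IsVert u z → S.IsVert u w → Φ z w = 0 := by
    intro z w hz hw
    have hv := fun z y (hy : y ∈ S.W) => vpart_vert (S := S) hy z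
    have hZd := fun z => (smooth_vpart (S := S) z).differentiableAt' S.isOpen hu
    have h1 := fderiv_bilin_apply (diffGeps (S := S) (ε := ε) hu) (hZd z) (hZd w) (S.X j u)
    have h1' := fderiv_bilin_apply (diffG (S := S) hu) (hZd z) (hZd w) (S.X j u)
    have h2 : fderiv ℝ (fun u => S.Geps ε u (S.vpart u z) (S.vpart u w)) u (S.X j u)
        = ε⁻¹ * fderiv ℝ (fun u => S.G u (S.vpart u z) (S.vpart u w)) u (S.X j u) := by
      have : (fun u => S.Geps ε u (S.vpart u z) (S.vpart u w))
          =ᶠ[𝓝 u] fun u => ε⁻¹ • S.G u (S.vpart u z) (S.vpart u w) := by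
        filter_upwards [S.isOpen.mem_nhds hu] with y hy using Geps_vert _ (hv w y hy)
      rw [this.fderiv_eq, fderiv_fun_const_smul (((diffG hu).clm_apply (hZd z)).clm_apply (hZd w))]
      rfl
    rw [vpart_of_vert hz, vpart_of_vert hw] at h1 h1'
    have h3 := lieG_vert hu j hz hw
    rw [lieG] at h3
    have h4 : ∀ z w, S.IsVert u w → S.Geps ε u (S.conn ε j u z) w
        = - (ε⁻¹ * S.G u (fderiv ℝ (S.X j) u z) w) := by
      intro z w hw
      rw [conn_apply, map_sub, _root_.sub_apply, hsum, Geps_vert _ hw]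
      simp only [S.G_X u hu _ w hw, mul_zero, Finset.sum_const_zero, zero_sub]
    have h5 : ∀ a z, S.IsVert u z → S.Geps ε u z a = ε⁻¹ * S.G u z a := by
      intro a z hz
      rw [Geps_symm hu, Geps_vert _ hz, S.G_symm u hu]
    rw [h2, h1', Geps_vert _ hw, h5 _ z hz] at h1
    rw [hΦa, h4 _ _ hw, Geps_symm hu z, h4 _ _ hz, S.G_symm u hu _ z]
    linear_combination (-1 : ℝ) * h1 + ε⁻¹ * h3
  have hXw : ∀ a w, Φ (S.X a u) w = 0 := by
    intro a w
    rw [← hpart_add_vpart (S := S) (u := u) w, map_add, hXZ a _ (vpart_vert hu w), hpart, map_sum]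
    simp [hXX]
  have h0 : Φ v w = 0 := by
    rw [← hpart_add_vpart (S := S) (u := u) v, map_add, _root_.add_apply, hpart, map_sum,
      _root_.sum_apply, Finset.sum_eq_zero fun i _ => by rw [map_smul, _root_.smul_apply, hXw, smul_zero],
      zero_add, ← hpart_add_vpart (S := S) (u := u) w, map_add, hZZ _ _ (vpart_vert hu v) (vpart_vert hu w),
      hpart, map_sum, Finset.sum_eq_zero fun i _ => by rw [map_smul, hsym, hXw, smul_zero], zero_add]
  rw [hΦa] at h0
  linarith

theorem gramE_Geps_det (hε : 0 < ε) (hu : u ∈ S.W) : 0 < (gramE (S.Geps ε u)).det :=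
  gramE_det_pos (Geps_symm hu) fun _ hv => Geps_pos hu hε hv

theorem smooth_gramE (a b : Fin d) : ContDiffOn ℝ ∞ (fun u => gramE (S.Geps ε u) a b) S.W :=
  (smooth_Geps.clm_apply contDiffOn_const).clm_apply contDiffOn_const

theorem fderiv_gramE_inv (hε : 0 < ε) (hu : u ∈ S.W) (j : Fin n) (a b : Fin d) :
    fderiv ℝ (fun u => (gramE (S.Geps ε u))⁻¹ a b) u (S.X j u)
      = - ∑ c, (S.conn ε j u (eb c) a * (gramE (S.Geps ε u))⁻¹ c b
        + (gramE (S.Geps ε u))⁻¹ a c * S.conn ε j u (eb c) b) := by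
  rw [fderiv_matrix_inv (M := fun u => gramE (S.Geps ε u)) S.isOpen smooth_gramE
    (fun _ hu => (gramE_Geps_det hε hu).ne') a b hu]
  set g := gramE (S.Geps ε u) with hg
  have hU : IsUnit g.det := (gramE_Geps_det hε hu).ne'.isUnit
  set C : Matrix (Fin d) (Fin d) ℝ := Matrix.of fun a c => S.conn ε j u (eb c) a with hC
  have hD : (Matrix.of fun a b => fderiv ℝ (fun u => gramE (S.Geps ε u) a b) u (S.X j u))
      = C.transpose * g + g * C := by
    ext a b
    have e : fderiv ℝ (fun u => gramE (S.Geps ε u) a b) u (S.X j u)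
        = fderiv ℝ (S.Geps ε) u (S.X j u) (eb a) (eb b) := by
      have := fderiv_bilin_apply (diffGeps (S := S) (ε := ε) hu) (differentiableAt_const (eb a))
        (differentiableAt_const (eb b)) (S.X j u)
      change fderiv ℝ (fun u => S.Geps ε u (eb a) (eb b)) u (S.X j u) = _
      simpa using this
    rw [Matrix.of_apply, e, fderiv_Geps hu, Matrix.add_apply, Matrix.mul_apply, Matrix.mul_apply]
    congr 1
    · conv_lhs => rw [← sum_eb (S.conn ε j u (eb a))]
      simp [hC, hg, gramE, _root_.sum_apply]
    · conv_lhs => rw [← sum_eb (S.conn ε j u (eb b))]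
      simp [hC, hg, gramE, mul_comm]
  have h2 : g⁻¹ * (C.transpose * g + g * C) * g⁻¹ = g⁻¹ * C.transpose + C * g⁻¹ := by
    rw [mul_add, add_mul, ← mul_assoc, mul_assoc _ g, Matrix.mul_nonsing_inv _ hU, mul_one,
      ← mul_assoc, Matrix.nonsing_inv_mul _ hU, one_mul]
  rw [hD, h2, Matrix.add_apply, Matrix.mul_apply, Matrix.mul_apply, Finset.sum_add_distrib, add_comm]
  rfl

/-- The frame adapted to `∇^ε`. -/
def toFrame (S : LocalFoliation d n) (hε : 0 < ε) : AdaptedFrame d n where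
  W := S.W
  isOpen := S.isOpen
  X := S.X
  h := S.h
  om := S.om ε
  Q u := (gramE (S.Geps ε u))⁻¹
  smooth_X := S.smooth_X
  smooth_h := smooth_h
  smooth_om := smooth_om ε
  smooth_Q := contDiffOn_matrix_inv smooth_gramE fun _ hu => (gramE_Geps_det hε hu).ne'
  h_symm i j _ hu := h_symm hu i j
  Q_symm a b u hu := by
    have h1 : (gramE (S.Geps ε u)).transpose = gramE (S.Geps ε u) := by
      ext a b; simp [gramE, Geps_symm hu (eb b)]
    have h2 : ((gramE (S.Geps ε u))⁻¹).transpose = (gramE (S.Geps ε u))⁻¹ := by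
      rw [Matrix.transpose_nonsing_inv, h1]
    exact congrFun (congrFun h2 b) a
  fderiv_h i j _ hu := fderiv_h hu ε i j
  fderiv_Q j a b _ hu := fderiv_gramE_inv hε hu j a b

theorem sharpQ_theta (hε : 0 < ε) (hu : u ∈ S.W) (j : Fin n) :
    sharpQ (gramE (S.Geps ε u))⁻¹ (S.θ j u) = ∑ i, S.h i j u • S.X i u := by
  refine sharpQ_gramE (gramE_Geps_det hε hu).ne' fun w => ?_
  simp only [map_sum, map_smul, _root_.sum_apply, _root_.smul_apply, Geps_X hu, G_X_apply hu,
    smul_eq_mul, Finset.mul_sum]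
  rw [Finset.sum_comm]
  simp only [h_symm hu _ j, ← mul_assoc, ← Finset.sum_mul, h_mul_H hu]
  simp

theorem exists_flat (hε : 0 < ε) (hu : u ∈ S.W) {z : Eu d} (hz : S.IsVert u z) :
    ∃ ζ : Eu d →L[ℝ] ℝ, sharpQ (gramE (S.Geps ε u))⁻¹ ζ = z ∧ ∀ p, ζ (S.X p u) = 0 :=
  ⟨S.Geps ε u z, sharpQ_gramE (gramE_Geps_det hε hu).ne' fun _ => rfl, fun p => by
    rw [Geps_symm hu, Geps_X hu, S.G_X u hu p z hz]⟩

end Metric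

end LocalFoliation

end TGFoliation
end

open Bundle Manifold MeasureTheory VectorField
open scoped ContDiff Topology

noncomputable section

namespace TGFoliation

/-- The pair symmetry of curvature tensors. -/
theorem pair_symm {n : ℕ} {K : Fin n → Fin n → Fin n → Fin n → ℝ}
    (h1 : ∀ j q r s, K q j r s = - K j q r s) (h2 : ∀ j q r s, K j q s r = - K j q r s)
    (h3 : ∀ j q r s, K j q r s + K r q s j + K s q j r = 0) (j q r s : Fin n) :
    K r s j q = K j q r s := by
  -- The classical octahedron argument: the four cyclic shifts of the Bianchi identity are combined
  -- by means of the two skew symmetries.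
  have a := h3 j q r s
  have b := h3 q r s j
  have c := h3 r s j q
  have e := h3 s j q r
  linarith [h1 j q r s, h2 j q r s, h1 r q s j, h2 r q s j, h1 s q j r, h2 s q j r,
    h1 q r s j, h1 s r j q, h2 s r j q, h1 j r q s, h2 j r q s, h1 r s j q, h2 r s j q,
    h1 j s q r, h2 j s q r, h1 q s r j, h2 q s r j, h1 s j q r, h2 s j q r, h1 q j r s, h2 q j r s,
    h2 q r s j, h1 r j s q, h2 r j s q, h2 q r j s, h2 j r s q, h1 s q r j, h2 s q r j]

namespace LocalFoliation

variable {d n : ℕ} {S : LocalFoliation d n} {u : Eu d}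

set_option synthInstance.maxHeartbeats 200000

/-! ### Curvature of the adapted connection -/

theorem gramE_G_det (hu : u ∈ S.W) : (gramE (S.G u)).det ≠ 0 :=
  (gramE_det_pos (S.G_symm u hu) (S.G_pos u hu)).ne'

/-- The Christoffel term `∇^g_a b` of vectors with constant coefficients, as a covector. -/
def lcForm (S : LocalFoliation d n) (u a b : Eu d) : Eu d →L[ℝ] ℝ :=
  (1 / 2 : ℝ) • (fderiv ℝ S.G u a b + fderiv ℝ S.G u b a - ((fderiv ℝ S.G u).flip a).flip b)

/-- The Christoffel term `∇^g_a b` of vectors with constant coefficients. -/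
def lc (S : LocalFoliation d n) (u a b : Eu d) : Eu d := sharpQ (gramE (S.G u))⁻¹ (S.lcForm u a b)

theorem lcForm_apply (a b c : Eu d) : S.lcForm u a b c
    = (1 / 2) * (fderiv ℝ S.G u a b c + fderiv ℝ S.G u b a c - fderiv ℝ S.G u c a b) := by
  simp [lcForm]

theorem G_lc (hu : u ∈ S.W) (a b c : Eu d) : S.G u (S.lc u a b) c = S.lcForm u a b c :=
  apply_sharpQ_gramE (gramE_G_det hu) _ c

theorem lcForm_symm (hu : u ∈ S.W) (a b : Eu d) : S.lcForm u a b = S.lcForm u b a := by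
  ext c
  rw [lcForm_apply, lcForm_apply, fderiv_G_symm hu c a b]
  ring

theorem lc_symm (hu : u ∈ S.W) (a b : Eu d) : S.lc u a b = S.lc u b a := by
  rw [lc, lc, lcForm_symm hu]

/-- The second derivative. -/
def hess {F : Type*} [NormedAddCommGroup F] [NormedSpace ℝ F] (f : Eu d → F) (u v w : Eu d) : F :=
  fderiv ℝ (fderiv ℝ f) u v w

theorem hess_symm {F : Type*} [NormedAddCommGroup F] [NormedSpace ℝ F] {W : Set (Eu d)}
    (hW : IsOpen W) (hu : u ∈ W) {f : Eu d → F} (hf : ContDiffOn ℝ ∞ f W) (v w : Eu d) :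
    hess f u v w = hess f u w v :=
  ((hf.contDiffAt (hW.mem_nhds hu)).isSymmSndFDerivAt
    (by rw [minSmoothness_of_isRCLikeNormedField]
        exact WithTop.coe_le_coe.2 (le_top : (2 : ℕ∞) ≤ ⊤))).eq v w

theorem fderiv_fderiv_apply {F : Type*} [NormedAddCommGroup F] [NormedSpace ℝ F] {W : Set (Eu d)}
    (hW : IsOpen W) (hu : u ∈ W) {f : Eu d → F} (hf : ContDiffOn ℝ ∞ f W) {Y : Eu d → Eu d}
    (hY : ContDiffOn ℝ ∞ Y W) (v : Eu d) :
    fderiv ℝ (fun u => fderiv ℝ f u (Y u)) u v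
      = hess f u v (Y u) + fderiv ℝ f u (fderiv ℝ Y u v) := by
  rw [fderiv_clm_apply ((contDiffOn_fderiv hW hf).differentiableAt' hW hu)
    (hY.differentiableAt' hW hu), hess]
  simp [add_comm]

/-- The torsion fields are Killing in vertical directions. -/
theorem lieG_T (hu : u ∈ S.W) (j i : Fin n) {z : Eu d} (hz : S.IsVert u z) :
    fderiv ℝ S.G u (S.T j i u) z z + 2 * S.G u (fderiv ℝ (S.T j i) u z) z = 0 := by
  have hW := S.isOpen
  have hv := fun y (hy : y ∈ S.W) => vpart_vert (S := S) hy z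
  have hZs := smooth_vpart (S := S) z
  set Z : Eu d → Eu d := fun u => S.vpart u z with hZ
  have hZu : Z u = z := vpart_of_vert hz
  have hZd := hZs.differentiableAt' hW hu
  have hDX : ∀ j, ContDiffOn ℝ ∞ (fun y => fderiv ℝ (S.X j) y (Z y)) S.W := fun j =>
    (contDiffOn_fderiv hW (S.smooth_X j)).clm_apply hZs
  have hDG : ∀ j, ContDiffOn ℝ ∞ (fun y => fderiv ℝ S.G y (S.X j y)) S.W := fun j =>
    (contDiffOn_fderiv hW S.smooth_G).clm_apply (S.smooth_X j)
  -- The totally geodesic condition for X_j is evaluated on the vertical field `Z` extending `z` and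
  -- differentiated in the direction `v`.
  have key : ∀ j v, (hess S.G u v (S.X j u) z z
        + fderiv ℝ S.G u (fderiv ℝ (S.X j) u v) z z + fderiv ℝ S.G u (S.X j u) (fderiv ℝ Z u v) z
        + fderiv ℝ S.G u (S.X j u) z (fderiv ℝ Z u v))
      + 2 * (fderiv ℝ S.G u v (fderiv ℝ (S.X j) u z) z
        + S.G u (hess (S.X j) u v z + fderiv ℝ (S.X j) u (fderiv ℝ Z u v)) z
        + S.G u (fderiv ℝ (S.X j) u z) (fderiv ℝ Z u v)) = 0 := by
    intro j v
    have h0 := fderiv_eq_zero_on hW hu (f := fun y => fderiv ℝ S.G y (S.X j y) (Z y) (Z y)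
      + 2 * S.G y (fderiv ℝ (S.X j) y (Z y)) (Z y)) (c := 0)
      (fun y hy => S.geod y hy _ (hv y hy) j) v
    have d1 : DifferentiableAt ℝ (fun y => fderiv ℝ S.G y (S.X j y) (Z y) (Z y)) u :=
      (((hDG j).clm_apply hZs).clm_apply hZs).differentiableAt' hW hu
    have d2 : DifferentiableAt ℝ (fun y => S.G y (fderiv ℝ (S.X j) y (Z y)) (Z y)) u :=
      ((S.smooth_G.clm_apply (hDX j)).clm_apply hZs).differentiableAt' hW hu
    rw [fderiv_fun_add d1 (d2.const_mul 2), fderiv_const_mul d2, _root_.add_apply,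
      _root_.smul_apply, fderiv_bilin_apply ((hDG j).differentiableAt' hW hu) hZd hZd,
      fderiv_bilin_apply (diffG hu) ((hDX j).differentiableAt' hW hu) hZd,
      fderiv_fderiv_apply hW hu S.smooth_G (S.smooth_X j),
      fderiv_fderiv_apply hW hu (S.smooth_X j) hZs] at h0
    simpa only [hZu, _root_.add_apply, smul_eq_mul] using h0
  have hT : fderiv ℝ (S.T j i) u z = (hess (S.X j) u z (S.X i u)
        + fderiv ℝ (S.X j) u (fderiv ℝ (S.X i) u z))
      - (hess (S.X i) u z (S.X j u)
        + fderiv ℝ (S.X i) u (fderiv ℝ (S.X j) u z)) := by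
    unfold T
    rw [fderiv_fun_sub ((smooth_DX j i).differentiableAt' hW hu)
      ((smooth_DX i j).differentiableAt' hW hu), _root_.sub_apply,
      fderiv_fderiv_apply hW hu (S.smooth_X j) (S.smooth_X i),
      fderiv_fderiv_apply hW hu (S.smooth_X i) (S.smooth_X j)]
  -- The Lie derivative along a bracket is the commutator of Lie derivatives. Subtracting `k2` from
  -- `k1` cancels the symmetric second derivatives of `G`. The terms with derivatives of `Z` form
  -- Lie derivatives of `G` on the brackets [X, Z], which are vertical, and vanish by `b1` and `b2`.
  have k1 := key j (S.X i u)
  have k2 := key i (S.X j u)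
  have hB := fun j => lie_vert hu hZs hv j
  simp only [hZu] at hB
  have b1 := lieG_vert hu j (hB i) hz
  have b2 := lieG_vert hu i (hB j) hz
  have s0 := DFunLike.congr_fun
    (DFunLike.congr_fun (hess_symm hW hu S.smooth_G (S.X i u) (S.X j u)) z) z
  have s1 := hess_symm hW hu (S.smooth_X j) (S.X i u) z
  have s2 := hess_symm hW hu (S.smooth_X i) (S.X j u) z
  rw [hT, T]
  rw [s1] at k1
  rw [s2] at k2
  have q1 := fderiv_G_symm hu (S.X j u) z (fderiv ℝ Z u (S.X i u))
  have q2 := fderiv_G_symm hu (S.X i u) z (fderiv ℝ Z u (S.X j u))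
  rw [S.G_symm u hu (fderiv ℝ (S.X j) u z)] at k1
  rw [S.G_symm u hu (fderiv ℝ (S.X i) u z)] at k2
  simp only [lieG, map_sub, map_add, _root_.sub_apply, _root_.add_apply] at b1 b2 k1 k2 ⊢
  have g1 := S.G_symm u hu (fderiv ℝ (S.X i) u z) (fderiv ℝ (S.X j) u z)
  linarith

theorem fderiv_h_vert (hu : u ∈ S.W) (i j : Fin n) {z : Eu d} (hz : S.IsVert u z) :
    fderiv ℝ (S.h i j) u z = 0 := by
  have e := fderiv_matrix_inv (M := S.Hm) S.isOpen (fun i j => smooth_H i j)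
    (fun _ hu => Hm_det hu) i j hu z
  have h0 : (Matrix.of fun a b => fderiv ℝ (fun u => S.Hm u a b) u z) = 0 := by
    ext a b
    exact fderiv_H_vert hu a b hz
  rw [h0] at e
  refine Eq.trans e ?_
  simp

/-- The transverse Christoffel symbols are basic. -/
theorem fderiv_chr_vert (hu : u ∈ S.W) (p k i : Fin n) {z : Eu d} (hz : S.IsVert u z) :
    fderiv ℝ (S.chr p k i) u z = 0 := by
  have hW := S.isOpen
  have hv := fun y (hy : y ∈ S.W) => vpart_vert (S := S) hy z
  have hZs := smooth_vpart (S := S) z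
  have hZu : S.vpart u z = z := vpart_of_vert hz
  have hs : ∀ i j k, ContDiffOn ℝ ∞ (fun y => fderiv ℝ (S.H i j) y (S.X k y)) S.W := fun i j k =>
    (contDiffOn_fderiv hW (smooth_H i j)).clm_apply (S.smooth_X k)
  -- For vertical Z, both Z H and [X_k, Z] H vanish, the bracket being vertical; hence Z (X_k H) =
  -- 0.
  have h1 : ∀ i j k, fderiv ℝ (fun y => fderiv ℝ (S.H i j) y (S.X k y)) u z = 0 := by
    intro i j k
    have h0 := fderiv_eq_zero_on hW hu (f := fun y => fderiv ℝ (S.H i j) y (S.vpart y z)) (c := 0)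
      (fun y hy => fderiv_H_vert hy i j (hv y hy)) (S.X k u)
    rw [fderiv_fderiv_apply hW hu (smooth_H i j) hZs, hZu] at h0
    have hl := lie_vert hu hZs hv k
    rw [hZu] at hl
    have h2 := fderiv_H_vert hu i j hl
    rw [map_sub] at h2
    rw [fderiv_fderiv_apply hW hu (smooth_H i j) (S.smooth_X k),
      hess_symm hW hu (smooth_H i j) z]
    linarith
  have h2 : ∀ k i j, fderiv ℝ (S.chr1 k i j) u z = 0 := by
    intro k i j
    unfold chr1
    have d := fun i j k => (hs i j k).differentiableAt' hW hu
    rw [fderiv_const_mul (((d i j k).fun_add (d k j i)).fun_sub (d k i j)),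
      fderiv_fun_sub ((d i j k).fun_add (d k j i)) (d k i j), fderiv_fun_add (d i j k) (d k j i)]
    simp [h1]
  unfold chr
  rw [fderiv_fun_sum fun j _ => ((smooth_chr1 k i j).mul (smooth_h j p)).differentiableAt' hW hu,
    _root_.sum_apply]
  refine Finset.sum_eq_zero fun j _ => ?_
  rw [fderiv_fun_mul ((smooth_chr1 k i j).differentiableAt' hW hu)
    ((smooth_h j p).differentiableAt' hW hu)]
  simp [h2, fderiv_h_vert hu j p hz]

theorem fderiv_psi_X (hu : u ∈ S.W) (k l i : Fin n) (v : Eu d) :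
    fderiv ℝ (S.psi k l) u v (S.X i u) = - S.psi k l u (fderiv ℝ (S.X i) u v) := by
  have h := fderiv_eq_zero_on S.isOpen hu (f := fun u => S.psi k l u (S.X i u)) (fun y hy => psi_X hy k l i) v
  rw [fderiv_apply_field ((smooth_psi k l).differentiableAt' S.isOpen hu) (diffX hu i)] at h
  linarith

theorem psi_vpart (hu : u ∈ S.W) (k l : Fin n) (w : Eu d) :
    S.psi k l u (S.vpart u w) = S.psi k l u w := by
  conv_rhs => rw [← hpart_add_vpart (S := S) (u := u) w, map_add, hpart, map_sum]
  simp [psi_X hu]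

/-- The vertical covariant derivative of `ψ`. -/
def vJ (S : LocalFoliation d n) (k l : Fin n) (u a b : Eu d) : ℝ :=
  fderiv ℝ (S.psi k l) u a b - S.psi k l u (S.lc u a b)

/-- Expanding the Levi-Civita term leaves, for each `q`, half the Lie derivative of `G` along T_kq
evaluated on (z, z), which is zero because torsion fields are Killing along the leaves. -/
theorem vJ_self (hu : u ∈ S.W) (k l : Fin n) {z : Eu d} (hz : S.IsVert u z) :
    S.vJ k l u z z = 0 := by
  have hW := S.isOpen
  have hGT : ∀ q, ContDiffOn ℝ ∞ (fun y => S.G y (S.T k q y)) S.W := fun q =>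
    S.smooth_G.clm_apply (smooth_T k q)
  have e1 : fderiv ℝ (S.psi k l) u z z
      = ∑ q, S.h l q u * (fderiv ℝ S.G u z (S.T k q u) z + S.G u (fderiv ℝ (S.T k q) u z) z) := by
    unfold psi
    have hd : ∀ q, DifferentiableAt ℝ (fun y => S.h l q y • S.G y (S.T k q y)) u := fun q =>
      ((smooth_h l q).smul (hGT q)).differentiableAt' hW hu
    rw [fderiv_fun_sum fun q _ => hd q, _root_.sum_apply, _root_.sum_apply]
    refine Finset.sum_congr rfl fun q _ => ?_
    rw [fderiv_fun_smul ((smooth_h l q).differentiableAt' hW hu) ((hGT q).differentiableAt' hW hu),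
      _root_.add_apply, ContinuousLinearMap.smulRight_apply, fderiv_h_vert hu l q hz, zero_smul,
      add_zero, fderiv_clm_apply (diffG hu) ((smooth_T k q).differentiableAt' hW hu)]
    simp [add_comm, mul_add]
  have e2 : S.psi k l u (S.lc u z z)
      = ∑ q, S.h l q u * (fderiv ℝ S.G u z z (S.T k q u)
        - (1 / 2) * fderiv ℝ S.G u (S.T k q u) z z) := by
    simp only [psi, _root_.sum_apply, _root_.smul_apply, smul_eq_mul]
    refine Finset.sum_congr rfl fun q _ => ?_
    rw [S.G_symm u hu, G_lc hu, lcForm_apply]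
    ring
  rw [vJ, e1, e2, ← Finset.sum_sub_distrib]
  refine Finset.sum_eq_zero fun q _ => ?_
  have := lieG_T hu k q hz
  rw [fderiv_G_symm hu z z]
  linear_combination (S.h l q u / 2) * this

theorem vJ_add (hu : u ∈ S.W) (k l : Fin n) (z w : Eu d) :
    S.vJ k l u (z + w) (z + w) = S.vJ k l u z z + S.vJ k l u z w + S.vJ k l u w z + S.vJ k l u w w := by
  have h : ∀ a b, S.psi k l u (S.lc u a b) = ∑ q, S.h l q u * S.lcForm u a b (S.T k q u) := by
    intro a b
    simp only [psi, _root_.sum_apply, _root_.smul_apply, smul_eq_mul]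
    exact Finset.sum_congr rfl fun q _ => by rw [S.G_symm u hu, G_lc hu]
  simp only [vJ, h, lcForm_apply, map_add, _root_.add_apply, mul_add, mul_sub, Finset.sum_add_distrib,
    Finset.sum_sub_distrib]
  ring

/-- Polarisation of `vJ_self`. This skewness makes dψ(z, w) equal to twice the covariant derivative.
-/
theorem vJ_skew (hu : u ∈ S.W) (k l : Fin n) {z w : Eu d} (hz : S.IsVert u z) (hw : S.IsVert u w) :
    S.vJ k l u w z = - S.vJ k l u z w := by
  have h := vJ_add hu k l z w
  rw [vJ_self hu k l (hz.add hw), vJ_self hu k l hz, vJ_self hu k l hw] at h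
  linarith

/-- The covariant derivative of `J`, in the horizontal frame. -/
def dJ (S : LocalFoliation d n) (k l : Fin n) (u v w : Eu d) : ℝ :=
  ∑ q, S.θ q u v * (fderiv ℝ (S.psi k l) u (S.X q u) (S.vpart u w)
      + S.psi k l u (fderiv ℝ (S.X q) u (S.vpart u w))
      + ∑ p, (S.psi k p u w * S.chr l q p u - S.psi p l u w * S.chr p q k u))
    + S.vJ k l u (S.vpart u v) (S.vpart u w)

variable {ε : ℝ}

/-- As dθ_k = 0, the exterior derivative falls only on the Christoffel symbols and on ψ. -/
theorem fderiv_om (hu : u ∈ S.W) (j l : Fin n) (v w : Eu d) :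
    fderiv ℝ (S.om ε j l) u v w - fderiv ℝ (S.om ε j l) u w v
      = ∑ k, (fderiv ℝ (S.chr l k j) u v * S.θ k u w - fderiv ℝ (S.chr l k j) u w * S.θ k u v)
        + ε⁻¹ * (fderiv ℝ (S.psi j l) u v w - fderiv ℝ (S.psi j l) u w v) := by
  have hW := S.isOpen
  have hs : ∀ k, ContDiffOn ℝ ∞ (fun u => S.chr l k j u • S.θ k u) S.W := fun k =>
    (smooth_chr l k j).smul (S.smooth_θ k)
  have hp := (smooth_psi (S := S) j l).differentiableAt' hW hu
  have e : ∀ v w, fderiv ℝ (S.om ε j l) u v w = ∑ k, (fderiv ℝ (S.chr l k j) u v * S.θ k u w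
      + S.chr l k j u * fderiv ℝ (S.θ k) u v w) + ε⁻¹ * fderiv ℝ (S.psi j l) u v w := by
    intro v w
    unfold om
    have hsum : DifferentiableAt ℝ (fun u => ∑ k, S.chr l k j u • S.θ k u) u :=
      (ContDiffOn.sum fun k _ => hs k).differentiableAt' hW hu
    have hp' : DifferentiableAt ℝ (fun u => ε⁻¹ • S.psi j l u) u := hp.const_smul ε⁻¹
    rw [fderiv_fun_add hsum hp', fderiv_fun_const_smul hp, fderiv_fun_sum fun k _ => (hs k).differentiableAt' hW hu]
    simp only [_root_.add_apply, _root_.sum_apply, _root_.smul_apply, smul_eq_mul]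
    congr 1
    refine Finset.sum_congr rfl fun k _ => ?_
    rw [fderiv_fun_smul ((smooth_chr l k j).differentiableAt' hW hu) (diffθ hu k)]
    simp [add_comm]
  rw [e, e]
  simp only [S.closed u hu _ w v, Finset.sum_add_distrib, Finset.sum_sub_distrib]
  ring

variable (hε : 0 < ε)

theorem curv_toFrame (hu : u ∈ S.W) (j p : Fin n) (v w : Eu d) :
    (S.toFrame hε).curv j p u v w
      = ∑ k, (fderiv ℝ (S.chr p k j) u v * S.θ k u w - fderiv ℝ (S.chr p k j) u w * S.θ k u v)
        + ε⁻¹ * (fderiv ℝ (S.psi j p) u v w - fderiv ℝ (S.psi j p) u w v)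
        + ∑ l, (S.om ε j l u w * S.om ε l p u v - S.om ε j l u v * S.om ε l p u w) := by
  rw [AdaptedFrame.curv_eq, ← fderiv_om hu]
  rfl

/-- The transverse Christoffel symbols are basic, so their derivatives do not contribute in the
vertical direction. The terms linear in ψ assemble to the horizontal covariant derivative of J. -/
theorem curv_X_vert (hu : u ∈ S.W) (j p q : Fin n) {z : Eu d} (hz : S.IsVert u z) :
    (S.toFrame hε).curv j p u (S.X q u) z = ε⁻¹ * S.dJ j p u (S.X q u) z := by
  rw [curv_toFrame hε hu, dJ]
  simp only [S.θ_X u hu, hz _, fderiv_chr_vert hu _ _ _ hz, mul_zero, zero_mul, sub_zero,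
    Finset.sum_const_zero, zero_add, vpart_of_vert hz, vpart_X hu, om_X hu, om_vert ε _ _ hz,
    fderiv_psi_X hu, ite_mul, one_mul, Finset.sum_ite_eq', Finset.mem_univ, if_true]
  have h0 : S.vJ j p u 0 z = 0 := by
    have : S.psi j p u (S.lc u 0 z) = 0 := by
      have : S.lcForm u 0 z = 0 := by ext c; simp [lcForm_apply]
      simp [lc, this, sharpQ]
    simp [vJ, this]
  rw [h0]
  simp only [mul_add, Finset.mul_sum, add_zero, sub_neg_eq_add]
  congr 1
  exact Finset.sum_congr rfl fun l _ => by ring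

/-- The exterior derivative of ε⁻¹ψ gives 2ε⁻¹ ∇J by skewness, and the quadratic term gives ε⁻²
times a commutator. Their ratio is the constant 1/(2ε). -/
theorem curv_vert_vert (hu : u ∈ S.W) (j p : Fin n) {z w : Eu d} (hz : S.IsVert u z)
    (hw : S.IsVert u w) : (S.toFrame hε).curv j p u z w
      = 2 * ε⁻¹ * (S.dJ j p u z w + 1 / (2 * ε)
        * ∑ l, (S.psi l p u z * S.psi j l u w - S.psi l p u w * S.psi j l u z)) := by
  rw [curv_toFrame hε hu, dJ]
  simp only [hz _, hw _, mul_zero, zero_mul, sub_zero, Finset.sum_const_zero, zero_add,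
    vpart_of_vert hz, vpart_of_vert hw, om_vert ε _ _ hz, om_vert ε _ _ hw]
  have h1 : fderiv ℝ (S.psi j p) u z w - fderiv ℝ (S.psi j p) u w z = 2 * S.vJ j p u z w := by
    have := vJ_skew hu j p hz hw
    simp only [vJ, lc_symm hu w z] at this ⊢
    linarith
  have h2 : ∑ l, (ε⁻¹ * S.psi j l u w * (ε⁻¹ * S.psi l p u z)
      - ε⁻¹ * S.psi j l u z * (ε⁻¹ * S.psi l p u w))
      = ε⁻¹ * ε⁻¹ * ∑ l, (S.psi l p u z * S.psi j l u w - S.psi l p u w * S.psi j l u z) := by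
    rw [Finset.mul_sum]
    exact Finset.sum_congr rfl fun l _ => by ring
  rw [h1, h2]
  field_simp

/-- The condition on the covariant derivative of `J`, in the horizontal frame. -/
def JCondition (S : LocalFoliation d n) (ε : ℝ) (u : Eu d) : Prop :=
  ∀ k l v w, S.dJ k l u v w
    = -(1 / (2 * ε)) * ∑ p, (S.psi p l u v * S.psi k p u w - S.psi p l u w * S.psi k p u v)

theorem dJ_decomp (hu : u ∈ S.W) (k l : Fin n) (v w : Eu d) : S.dJ k l u v w
    = ∑ q, S.θ q u v * S.dJ k l u (S.X q u) (S.vpart u w) + S.dJ k l u (S.vpart u v) (S.vpart u w) := by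
  have hvv : ∀ w, S.vpart u (S.vpart u w) = S.vpart u w := fun w => vpart_of_vert (vpart_vert hu w)
  have h0 : ∀ w, S.vJ k l u 0 w = 0 := by
    intro w
    have : S.psi k l u (S.lc u 0 w) = 0 := by
      have : S.lcForm u 0 w = 0 := by ext c; simp [lcForm_apply]
      simp [lc, this, sharpQ]
    simp [vJ, this]
  have hz := fun q => vpart_vert hu v q
  simp only [dJ, hvv, vpart_X hu, h0, hz, zero_mul, Finset.sum_const_zero, zero_add, add_zero,
    S.θ_X u hu, ite_mul, one_mul, Finset.sum_ite_eq', Finset.mem_univ, if_true, psi_vpart hu]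

theorem curv_add (F : AdaptedFrame d n) (j p : Fin n) (a v w : Eu d) :
    F.curv j p u a (v + w) = F.curv j p u a v + F.curv j p u a w := by
  simp [AdaptedFrame.curv]; ring

theorem curv_sum (F : AdaptedFrame d n) (j p : Fin n) (a : Eu d) (c : Fin n → ℝ)
    (v : Fin n → Eu d) :
    F.curv j p u a (∑ q, c q • v q) = ∑ q, c q * F.curv j p u a (v q) := by
  simp [AdaptedFrame.curv, _root_.sum_apply, mul_sub]

/-- The components of the curvature with a vertical argument are the components of the condition on
J: ψ vanishes on horizontal vectors, so the mixed component says that ∇J vanishes horizontally, and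
the vertical one carries the commutator. -/
theorem jCondition_iff (hu : u ∈ S.W) : S.JCondition ε u ↔
    ∀ j p z, S.IsVert u z → ∀ v, (S.toFrame hε).curv j p u z v = 0 := by
  have hsk := fun j p => (S.toFrame hε).curv_skew j p u
  constructor
  · intro hJ j p z hz v
    rw [← hpart_add_vpart (S := S) (u := u) v, curv_add, hpart, curv_sum,
      curv_vert_vert hε hu j p hz (vpart_vert hu v), hJ, Finset.sum_eq_zero]
    · ring
    · intro q _
      rw [hsk, curv_X_vert hε hu j p q hz, hJ]
      simp [psi_X hu]
  · intro h k l v w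
    have hε' := hε.ne'
    have hw := vpart_vert hu w
    have hv := vpart_vert hu v
    have h1 : ∀ q, S.dJ k l u (S.X q u) (S.vpart u w) = 0 := by
      intro q
      have := h k l _ hw (S.X q u)
      rw [hsk, curv_X_vert hε hu k l q hw, neg_eq_zero] at this
      exact (mul_eq_zero.1 this).resolve_left (inv_ne_zero hε')
    have h2 := h k l _ hv (S.vpart u w)
    rw [curv_vert_vert hε hu k l hv hw] at h2
    have h3 := (mul_eq_zero.1 h2).resolve_left (mul_ne_zero two_ne_zero (inv_ne_zero hε'))
    simp only [psi_vpart hu] at h3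
    rw [dJ_decomp hu]
    simp only [h1, mul_zero, Finset.sum_const_zero, zero_add]
    linarith

/-- The curvature with all indices lowered. -/
def curvLow (S : LocalFoliation d n) (hε : 0 < ε) (u : Eu d) (j q r s : Fin n) : ℝ :=
  ∑ p, (S.toFrame hε).curv j p u (S.X r u) (S.X s u) * S.H p q u

/-- `sum_h_curv` states skewness with the index contracted with h, that is of H⁻¹C. Multiplying by H
on both sides transfers it to CH. -/
theorem curvLow_skew (hu : u ∈ S.W) (j q r s : Fin n) :
    S.curvLow hε u q j r s = - S.curvLow hε u j q r s := by
  set C : Matrix (Fin n) (Fin n) ℝ :=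
    Matrix.of fun j p => (S.toFrame hε).curv j p u (S.X r u) (S.X s u) with hC
  have hU := (Hm_det hu).isUnit
  have h1 : (S.Hm u)⁻¹ * C = -((S.Hm u)⁻¹ * C).transpose := by
    ext i j
    have := (S.toFrame hε).sum_h_curv hu i j (S.X r u) (S.X s u)
    rw [Matrix.mul_apply, Matrix.neg_apply, Matrix.transpose_apply, Matrix.mul_apply]
    exact this
  have hHt : (S.Hm u).transpose = S.Hm u := by ext i j; simp [Hm, H_symm hu j]
  have h2 : C * S.Hm u = -(C * S.Hm u).transpose := by
    calc C * S.Hm u = S.Hm u * ((S.Hm u)⁻¹ * C) * S.Hm u := by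
          rw [← mul_assoc, Matrix.mul_nonsing_inv _ hU, one_mul]
      _ = -(S.Hm u * (C.transpose * (S.Hm u)⁻¹) * S.Hm u) := by
          rw [h1, Matrix.transpose_mul, Matrix.transpose_nonsing_inv, hHt, mul_neg, neg_mul]
      _ = -(C * S.Hm u).transpose := by
          rw [mul_assoc, mul_assoc, Matrix.nonsing_inv_mul _ hU, mul_one, Matrix.transpose_mul, hHt]
  have := congrFun (congrFun h2 q) j
  rwa [Matrix.neg_apply, Matrix.transpose_apply, Matrix.mul_apply, Matrix.mul_apply] at this

theorem curvLow_skew' (j q r s : Fin n) :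
    S.curvLow hε u j q s r = - S.curvLow hε u j q r s := by
  simp only [curvLow, (S.toFrame hε).curv_skew _ _ u (S.X r u), neg_mul, Finset.sum_neg_distrib]

theorem fderiv_chr_symm (hu : u ∈ S.W) (p k i : Fin n) (v : Eu d) :
    fderiv ℝ (S.chr p k i) u v = fderiv ℝ (S.chr p i k) u v := by
  have : S.chr p k i =ᶠ[𝓝 u] S.chr p i k := by
    filter_upwards [S.isOpen.mem_nhds hu] with y hy using chr_symm hy p k i
  rw [this.fderiv_eq]

theorem curv_X_X (hu : u ∈ S.W) (j p r s : Fin n) :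
    (S.toFrame hε).curv j p u (S.X r u) (S.X s u)
      = (fderiv ℝ (S.chr p s j) u (S.X r u) - fderiv ℝ (S.chr p r j) u (S.X s u)
        + ∑ l, (S.chr l s j u * S.chr p r l u - S.chr l r j u * S.chr p s l u))
        + ε⁻¹ * S.psi j p u (S.T r s u) := by
  rw [curv_toFrame hε hu]
  simp only [S.θ_X u hu, om_X hu, fderiv_psi_X hu, mul_ite, mul_one, mul_zero,
    Finset.sum_sub_distrib, Finset.sum_ite_eq', Finset.sum_ite_eq, Finset.mem_univ, if_true, T,
    map_sub]
  ring

/-- The term ε⁻¹⟨T_jq, T_rs⟩ is pair symmetric by itself. The remainder is the curvature of the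
transverse Levi-Civita connection, whose Bianchi identity follows from the symmetry of the
Christoffel symbols, so `pair_symm` applies to it. -/
theorem curvLow_pair (hu : u ∈ S.W) (j q r s : Fin n) :
    S.curvLow hε u r s j q = S.curvLow hε u j q r s := by
  have hK : ∀ j q r s, S.curvLow hε u j q r s
      = ∑ p, (fderiv ℝ (S.chr p s j) u (S.X r u) - fderiv ℝ (S.chr p r j) u (S.X s u)
        + ∑ l, (S.chr l s j u * S.chr p r l u - S.chr l r j u * S.chr p s l u)) * S.H p q u
        + ε⁻¹ * S.G u (S.T j q u) (S.T r s u) := by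
    intro j q r s
    rw [← psi_lower hu, Finset.mul_sum, ← Finset.sum_add_distrib]
    refine Finset.sum_congr rfl fun p _ => ?_
    rw [curv_X_X hε hu]
    ring
  have h := pair_symm (K := fun j q r s => S.curvLow hε u j q r s
      - ε⁻¹ * S.G u (S.T j q u) (S.T r s u)) ?_ ?_ ?_ j q r s
  · simp only [S.G_symm u hu (S.T r s u)] at h
    linarith
  · intro j q r s
    simp only [curvLow_skew hε hu j q, T_skew j q, map_neg, _root_.neg_apply]
    ring
  · intro j q r s
    simp only [curvLow_skew' hε j q r s, T_skew r s, map_neg]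
    ring
  · intro j q r s
    simp only [hK, add_sub_cancel_right]
    rw [← Finset.sum_add_distrib, ← Finset.sum_add_distrib]
    refine Finset.sum_eq_zero fun p _ => ?_
    rw [fderiv_chr_symm hu p s j, fderiv_chr_symm hu p r j, fderiv_chr_symm hu p s r]
    simp only [Finset.sum_sub_distrib, chr_symm hu _ s j, chr_symm hu _ r j, chr_symm hu _ s r]
    ring

/-- The condition on `J` implies the symmetry of the zeroth order term. -/
theorem ip_weitz_comm_of_jCondition (hu : u ∈ S.W) (hJ : S.JCondition ε u) {k : ℕ}
    (α β : Eu d [⋀^Fin (k + 1)]→L[ℝ] ℝ) :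
    ip ((S.toFrame hε).Q u) ((S.toFrame hε).weitz u α) β
      = ip ((S.toFrame hε).Q u) α ((S.toFrame hε).weitz u β) := by
  rw [jCondition_iff hε hu] at hJ
  have hsk := fun j p => (S.toFrame hε).curv_skew j p u
  refine (S.toFrame hε).ip_weitz_comm hu (θ := fun i => S.θ i u) (S.θ_X u hu)
    (fun j => sharpQ_theta hε hu j) (R := fun j q r s => S.curvLow hε u j q r s)
    (fun j p v w => ?_) (curvLow_skew hε hu) (curvLow_skew' hε) (curvLow_pair hε hu) α β
  have e1 : ∀ r s, ∑ q, (S.toFrame hε).h p q u * S.curvLow hε u j q r s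
      = (S.toFrame hε).curv j p u (S.X r u) (S.X s u) := by
    intro r s
    change ∑ q, S.h p q u * S.curvLow hε u j q r s = _
    simp only [curvLow, Finset.mul_sum]
    rw [Finset.sum_comm]
    have : ∀ a, ∑ q, S.h p q u * ((S.toFrame hε).curv j a u (S.X r u) (S.X s u) * S.H a q u)
        = (S.toFrame hε).curv j a u (S.X r u) (S.X s u) * if p = a then 1 else 0 := by
      intro a
      rw [← h_mul_H hu, Finset.mul_sum]
      exact Finset.sum_congr rfl fun q _ => by rw [H_symm hu a q]; ring
    simp [this]
  simp only [e1]
  -- The curvature vanishes on vertical vectors, so each argument may be replaced by its expansion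
  -- in the horizontal frame.
  have e2 : ∀ a b, (S.toFrame hε).curv j p u a b
      = ∑ s, S.θ s u b * (S.toFrame hε).curv j p u a (S.X s u) := by
    intro a b
    conv_lhs => rw [← hpart_add_vpart (S := S) (u := u) b, curv_add, hsk j p (S.vpart u b) a,
      hJ j p _ (vpart_vert hu b), neg_zero, add_zero, hpart, curv_sum]
  rw [e2, Finset.sum_comm]
  refine Finset.sum_congr rfl fun s _ => ?_
  rw [hsk, e2, mul_neg, Finset.mul_sum, ← Finset.sum_neg_distrib]
  refine Finset.sum_congr rfl fun r _ => ?_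
  rw [hsk j p (S.X r u)]
  ring

/-- The symmetry of the zeroth order term implies the condition on `J`. -/
theorem jCondition_of_ip_weitz_comm (hu : u ∈ S.W)
    (h1 : ∀ α β : Eu d [⋀^Fin 1]→L[ℝ] ℝ, ip ((S.toFrame hε).Q u) ((S.toFrame hε).weitz u α) β
      = ip ((S.toFrame hε).Q u) α ((S.toFrame hε).weitz u β))
    (h2 : ∀ α β : Eu d [⋀^Fin 2]→L[ℝ] ℝ, ip ((S.toFrame hε).Q u) ((S.toFrame hε).weitz u α) β
      = ip ((S.toFrame hε).Q u) α ((S.toFrame hε).weitz u β)) : S.JCondition ε u := by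
  rw [jCondition_iff hε hu]
  intro j p z hz v
  exact (S.toFrame hε).curv_eq_zero hu (θ := fun i => S.θ i u) (S.θ_X u hu)
    (fun j => sharpQ_theta hε hu j) (H := fun i j => S.H i j u) (H_mul_h hu)
    (fun z hz => exists_flat hε hu hz) h1 h2 j p hz v

end LocalFoliation

end TGFoliation
end

/-! ### Naturality under changes of foliated coordinates. -/

open Bundle Manifold MeasureTheory VectorField
open scoped ContDiff Topology

noncomputable section

namespace TGFoliation

set_option synthInstance.maxHeartbeats 200000

/-- A local isometry between two open sets that maps the foliation data to each other. -/
structure FolMap {d n : ℕ} (S S' : LocalFoliation d n) where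
  O : Set (Eu d)
  isOpen : IsOpen O
  τ : Eu d → Eu d
  smooth : ContDiffOn ℝ ∞ τ O
  sub : O ⊆ S.W
  maps : ∀ u ∈ O, τ u ∈ S'.W
  surj : ∀ u ∈ O, Function.Surjective (fderiv ℝ τ u)
  map_G : ∀ u ∈ O, ∀ v w, S'.G (τ u) (fderiv ℝ τ u v) (fderiv ℝ τ u w) = S.G u v w
  map_θ : ∀ u ∈ O, ∀ i v, S'.θ i (τ u) (fderiv ℝ τ u v) = S.θ i u v

namespace FolMap

open LocalFoliation

variable {d n : ℕ} {S S' : LocalFoliation d n} (f : FolMap S S') {u : Eu d}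

theorem isVert_iff (hu : u ∈ f.O) (z : Eu d) :
    S'.IsVert (f.τ u) (fderiv ℝ f.τ u z) ↔ S.IsVert u z := by
  simp only [IsVert, f.map_θ u hu]

/-- The difference of the two vectors is vertical because the forms correspond, and orthogonal to
vertical vectors because the metrics do. Hence its norm is zero. -/
theorem map_X (hu : u ∈ f.O) (i : Fin n) : fderiv ℝ f.τ u (S.X i u) = S'.X i (f.τ u) := by
  obtain ⟨y, hy⟩ : ∃ y, y = fderiv ℝ f.τ u (S.X i u) - S'.X i (f.τ u) := ⟨_, rfl⟩
  have hv : S'.IsVert (f.τ u) y := fun k => by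
    rw [hy, ContinuousLinearMap.map_sub, f.map_θ u hu, S.θ_X u (f.sub hu), S'.θ_X _ (f.maps u hu),
      sub_self]
  obtain ⟨z, hz⟩ := f.surj u hu y
  have hzv : S.IsVert u z := (f.isVert_iff hu z).1 (hz ▸ hv)
  by_contra hne
  have h0 : y ≠ 0 := fun h => hne (sub_eq_zero.1 (hy ▸ h))
  refine (S'.G_pos _ (f.maps u hu) y h0).ne' ?_
  have h1 : S'.G (f.τ u) (fderiv ℝ f.τ u (S.X i u)) y = 0 := by
    rw [← hz, f.map_G u hu, S.G_X u (f.sub hu) i z hzv]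
  have h2 := S'.G_X _ (f.maps u hu) i y hv
  have : S'.G (f.τ u) y y = S'.G (f.τ u) (fderiv ℝ f.τ u (S.X i u)) y
      - S'.G (f.τ u) (S'.X i (f.τ u)) y := by
    rw [← _root_.sub_apply, ← ContinuousLinearMap.map_sub, ← hy]
  rw [this, h1, h2, sub_zero]

theorem map_H (hu : u ∈ f.O) (i j : Fin n) : S'.H i j (f.τ u) = S.H i j u := by
  rw [H, ← f.map_X hu, ← f.map_X hu, f.map_G u hu, H]

theorem map_h (hu : u ∈ f.O) (i j : Fin n) : S'.h i j (f.τ u) = S.h i j u := by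
  have : S'.Hm (f.τ u) = S.Hm u := by ext i j; simp [Hm, f.map_H hu]
  rw [h, this, h]

theorem diffτ (hu : u ∈ f.O) : DifferentiableAt ℝ f.τ u := f.smooth.differentiableAt' f.isOpen hu

/-- Derivatives of functions that correspond to each other. -/
theorem fderiv_comp {F : Type*} [NormedAddCommGroup F] [NormedSpace ℝ F] (hu : u ∈ f.O)
    {a a' : Eu d → F} (h : ∀ y ∈ f.O, a' (f.τ y) = a y) (ha : DifferentiableAt ℝ a' (f.τ u))
    (v : Eu d) : fderiv ℝ a' (f.τ u) (fderiv ℝ f.τ u v) = fderiv ℝ a u v := by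
  have : a =ᶠ[𝓝 u] a' ∘ f.τ := by
    filter_upwards [f.isOpen.mem_nhds hu] with y hy using (h y hy).symm
  rw [this.fderiv_eq, _root_.fderiv_comp u ha (f.diffτ hu)]
  rfl

theorem map_chr (hu : u ∈ f.O) (p k i : Fin n) : S'.chr p k i (f.τ u) = S.chr p k i u := by
  have e : ∀ i j k, fderiv ℝ (S'.H i j) (f.τ u) (S'.X k (f.τ u))
      = fderiv ℝ (S.H i j) u (S.X k u) := fun i j k => by
    rw [← f.map_X hu]
    exact f.fderiv_comp hu (fun y hy => f.map_H hy i j)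
      ((smooth_H i j).differentiableAt' S'.isOpen (f.maps u hu)) _
  simp only [chr, chr1, e, f.map_h hu]

theorem fderiv_X (hu : u ∈ f.O) (i : Fin n) (v : Eu d) :
    fderiv ℝ (S'.X i) (f.τ u) (fderiv ℝ f.τ u v)
      = hess f.τ u v (S.X i u) + fderiv ℝ f.τ u (fderiv ℝ (S.X i) u v) := by
  rw [f.fderiv_comp hu (a := fun y => fderiv ℝ f.τ y (S.X i y))
    (fun y hy => (f.map_X hy i).symm) (diffX (f.maps u hu) i)]
  exact fderiv_fderiv_apply f.isOpen hu f.smooth ((S.smooth_X i).mono f.sub) v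

/-- The Hessian of the coordinate change enters both derivatives of the frame and cancels by its
symmetry, as always for brackets. -/
theorem map_T (hu : u ∈ f.O) (k q : Fin n) :
    fderiv ℝ f.τ u (S.T k q u) = S'.T k q (f.τ u) := by
  rw [T, T, ← f.map_X hu, ← f.map_X hu, f.fderiv_X hu, f.fderiv_X hu,
    hess_symm f.isOpen hu f.smooth (S.X q u), ContinuousLinearMap.map_sub]
  abel

theorem map_psi (hu : u ∈ f.O) (k l : Fin n) (v : Eu d) :
    S'.psi k l (f.τ u) (fderiv ℝ f.τ u v) = S.psi k l u v := by
  simp only [psi, _root_.sum_apply, _root_.smul_apply, f.map_h hu, ← f.map_T hu, f.map_G u hu]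

theorem map_om (hu : u ∈ f.O) (ε : ℝ) (j l : Fin n) (v : Eu d) :
    S'.om ε j l (f.τ u) (fderiv ℝ f.τ u v) = S.om ε j l u v := by
  simp only [om, _root_.add_apply, _root_.sum_apply, _root_.smul_apply, f.map_chr hu,
    f.map_θ u hu, f.map_psi hu]

theorem fderiv_om (hu : u ∈ f.O) (ε : ℝ) (j l : Fin n) (v w : Eu d) :
    fderiv ℝ (S.om ε j l) u v w
      = fderiv ℝ (S'.om ε j l) (f.τ u) (fderiv ℝ f.τ u v) (fderiv ℝ f.τ u w)
        + S'.om ε j l (f.τ u) (hess f.τ u v w) := by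
  have hs := (smooth_om (S := S) ε j l).differentiableAt' S.isOpen (f.sub hu)
  have hs' := (smooth_om (S := S') ε j l).differentiableAt' S'.isOpen (f.maps u hu)
  have hsc : DifferentiableAt ℝ (fun y => S'.om ε j l (f.τ y)) u := hs'.comp u (f.diffτ hu)
  have hL : DifferentiableAt ℝ (fun y => fderiv ℝ f.τ y w) u :=
    ((contDiffOn_fderiv f.isOpen f.smooth).clm_apply contDiffOn_const).differentiableAt' f.isOpen hu
  have e1 : fderiv ℝ (fun y => S.om ε j l y w) u v = fderiv ℝ (S.om ε j l) u v w := by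
    rw [fderiv_apply_field hs (differentiableAt_const w)]; simp
  have e2 : (fun y => S.om ε j l y w) =ᶠ[𝓝 u] fun y => S'.om ε j l (f.τ y) (fderiv ℝ f.τ y w) := by
    filter_upwards [f.isOpen.mem_nhds hu] with y hy using (f.map_om hy ε j l w).symm
  have e3 := fderiv_fderiv_apply f.isOpen hu f.smooth (Y := fun _ => w) contDiffOn_const v
  rw [← e1, e2.fderiv_eq, fderiv_apply_field hsc hL, e3,
    ← f.fderiv_comp hu (fun y _ => rfl) hs']
  simp

/-- The connection forms pull back, and the Hessian term in their derivatives is symmetric, hence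
invisible after skewing. -/
theorem map_curv (hu : u ∈ f.O) {ε : ℝ} (hε : 0 < ε) (j p : Fin n) (v w : Eu d) :
    (S'.toFrame hε).curv j p (f.τ u) (fderiv ℝ f.τ u v) (fderiv ℝ f.τ u w)
      = (S.toFrame hε).curv j p u v w := by
  rw [AdaptedFrame.curv_eq, AdaptedFrame.curv_eq]
  change fderiv ℝ (S'.om ε j p) _ _ _ - fderiv ℝ (S'.om ε j p) _ _ _
    + ∑ l, (S'.om ε j l _ _ * S'.om ε l p _ _ - S'.om ε j l _ _ * S'.om ε l p _ _)
    = fderiv ℝ (S.om ε j p) _ _ _ - fderiv ℝ (S.om ε j p) _ _ _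
    + ∑ l, (S.om ε j l _ _ * S.om ε l p _ _ - S.om ε j l _ _ * S.om ε l p _ _)
  simp only [f.map_om hu, f.fderiv_om hu, hess_symm f.isOpen hu f.smooth w v]
  ring

theorem jCondition (hu : u ∈ f.O) {ε : ℝ} (hε : 0 < ε) (h : S'.JCondition ε (f.τ u)) :
    S.JCondition ε u := by
  rw [jCondition_iff hε (f.sub hu)]
  rw [jCondition_iff hε (f.maps u hu)] at h
  intro j p z hz v
  rw [← f.map_curv hu hε]
  exact h j p _ ((f.isVert_iff hu z).2 hz) _

/-- The connection matrix is not a tensor. Its Hessian term compensates the derivative of the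
pullback in `map_nab`. -/
theorem map_A (hu : u ∈ f.O) {ε : ℝ} (hε : 0 < ε) (j : Fin n) (v : Eu d) :
    (S'.toFrame hε).A j (f.τ u) (fderiv ℝ f.τ u v)
      = fderiv ℝ f.τ u ((S.toFrame hε).A j u v) - hess f.τ u (S.X j u) v := by
  have e : ∀ (S : LocalFoliation d n) (u v : Eu d),
      (S.toFrame hε).A j u v = ∑ l, S.om ε j l u v • S.X l u - fderiv ℝ (S.X j) u v := by
    intro S u v
    simp only [AdaptedFrame.A, _root_.sub_apply, _root_.sum_apply,
      ContinuousLinearMap.smulRight_apply]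
    rfl
  rw [e, e, f.fderiv_X hu]
  simp only [f.map_om hu, ← f.map_X hu, ContinuousLinearMap.map_sub, map_sum,
    ContinuousLinearMap.map_smul, hess_symm f.isOpen hu f.smooth (S.X j u) v]
  abel

variable {k : ℕ}

/-- Naturality of the covariant derivative of forms. -/
theorem map_nab (hu : u ∈ f.O) {ε : ℝ} (hε : 0 < ε) (j : Fin n)
    {η η' : Eu d → Eu d [⋀^Fin k]→L[ℝ] ℝ} (hη' : DifferentiableAt ℝ η' (f.τ u))
    (h : η =ᶠ[𝓝 u] fun y => (η' (f.τ y)).compContinuousLinearMap (fderiv ℝ f.τ y)) :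
    (S.toFrame hε).nab j η u
      = ((S'.toFrame hε).nab j η' (f.τ u)).compContinuousLinearMap (fderiv ℝ f.τ u) := by
  have hL : DifferentiableAt ℝ (fderiv ℝ f.τ) u :=
    (contDiffOn_fderiv f.isOpen f.smooth).differentiableAt' f.isOpen hu
  have hc : DifferentiableAt ℝ (fun y => η' (f.τ y)) u := hη'.comp u (f.diffτ hu)
  have e0 : η u = (η' (f.τ u)).compContinuousLinearMap (fderiv ℝ f.τ u) := h.self_of_nhds
  have eX : ∀ S : LocalFoliation d n, (S.toFrame hε).X = S.X := fun _ => rfl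
  ext v
  rw [AdaptedFrame.nab, AdaptedFrame.nab, h.fderiv_eq,
    fderiv_continuousAlternatingMapCompContinuousLinearMap hc hL, e0, eX, eX, ← f.map_X hu]
  have e1 : fderiv ℝ (fun y => η' (f.τ y)) u (S.X j u)
      = fderiv ℝ η' (f.τ u) (fderiv ℝ f.τ u (S.X j u)) :=
    (f.fderiv_comp hu (fun y _ => rfl) hη' _).symm
  simp only [_root_.add_apply, _root_.sub_apply, ContinuousLinearMap.comp_apply,
    ContinuousAlternatingMap.compContinuousLinearMapCLM_apply, ContinuousAlternatingMap.sub_apply,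
    ContinuousAlternatingMap.add_apply,
    ContinuousAlternatingMap.fderivCompContinuousLinearMap_apply,
    ContinuousAlternatingMap.compContinuousLinearMap_apply, derivn_apply, e1]
  have e2 : ∀ i, (fun a => (Function.update (fun _ => fderiv ℝ f.τ u) i
      (fderiv ℝ (fderiv ℝ f.τ) u (S.X j u)) a) (v a))
      = Function.update (fun a => fderiv ℝ f.τ u (v a)) i (hess f.τ u (S.X j u) (v i)) := by
    intro i
    funext a
    by_cases h : a = i
    · subst h; simp [hess]
    · simp [h]
  have e3 : ∀ i, (⇑(fderiv ℝ f.τ u) ∘ Function.update v i ((S.toFrame hε).A j u (v i)))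
      = Function.update (fun a => fderiv ℝ f.τ u (v a)) i
        (fderiv ℝ f.τ u ((S.toFrame hε).A j u (v i))) := by
    intro i
    funext a
    by_cases h : a = i
    · subst h; simp
    · simp [h]
  simp only [e2, e3, f.map_A hu hε, Function.comp_def, AlternatingMap.map_update_sub,
    ContinuousAlternatingMap.map_update_sub, Finset.sum_sub_distrib]
  abel

theorem map_trNab (hu : u ∈ f.O) {ε : ℝ} (hε : 0 < ε)
    {η η' : Eu d → Eu d [⋀^Fin (k + 1)]→L[ℝ] ℝ} (hη' : DifferentiableAt ℝ η' (f.τ u))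
    (h : η =ᶠ[𝓝 u] fun y => (η' (f.τ y)).compContinuousLinearMap (fderiv ℝ f.τ y)) :
    (S.toFrame hε).trNab η u
      = ((S'.toFrame hε).trNab η' (f.τ u)).compContinuousLinearMap (fderiv ℝ f.τ u) := by
  have eX : ∀ S : LocalFoliation d n, (S.toFrame hε).X = S.X := fun _ => rfl
  have eh : ∀ S : LocalFoliation d n, (S.toFrame hε).h = S.h := fun _ => rfl
  ext v
  simp only [AdaptedFrame.trNab, f.map_nab hu hε _ hη' h, eX, eh, f.map_h hu, ← f.map_X hu,
    ContinuousAlternatingMap.sum_apply, ContinuousAlternatingMap.smul_apply,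
    ContinuousAlternatingMap.compContinuousLinearMap_apply, iota_apply_apply]
  refine Finset.sum_congr rfl fun i _ => Finset.sum_congr rfl fun j _ => ?_
  congr 2
  funext a
  refine Fin.cases ?_ (fun b => ?_) a <;> simp

end FolMap

end TGFoliation

end

/-! ### Changes of coordinates and differentials of charts. -/

open Bundle Manifold MeasureTheory VectorField
open scoped ContDiff Topology

noncomputable section

namespace TGFoliation

set_option synthInstance.maxHeartbeats 200000

section Charts

variable {d : ℕ} {M : Type*} [TopologicalSpace M] [ChartedSpace (Eu d) M]

/-- The change of coordinates. -/
def trans (c y : M) (u : Eu d) : Eu d := extChartAt (𝓡 d) y ((extChartAt (𝓡 d) c).symm u)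

/-- The domain of the change of coordinates. -/
def overlap (c y : M) : Set (Eu d) :=
  (extChartAt (𝓡 d) c).target ∩ (extChartAt (𝓡 d) c).symm ⁻¹' (extChartAt (𝓡 d) y).source

/-- The differential of the inverse of the chart at `c`. -/
def C (c : M) (u : Eu d) : Eu d →L[ℝ] Eu d :=
  mfderiv 𝓘(ℝ, Eu d) (𝓡 d) (extChartAt (𝓡 d) c).symm u

theorem isOpen_target (c : M) : IsOpen (extChartAt (𝓡 d) c).target := isOpen_extChartAt_target c

theorem isOpen_overlap (c y : M) : IsOpen (overlap (d := d) c y) :=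
  (continuousOn_extChartAt_symm c).isOpen_inter_preimage (isOpen_target c) (isOpen_extChartAt_source y)

variable {u : Eu d} {c y z x : M}

theorem symm_mem_source (hu : u ∈ (extChartAt (𝓡 d) c).target) :
    (extChartAt (𝓡 d) c).symm u ∈ (extChartAt (𝓡 d) c).source :=
  (extChartAt (𝓡 d) c).map_target hu

theorem mem_overlap_self (hu : u ∈ (extChartAt (𝓡 d) c).target) :
    u ∈ overlap c ((extChartAt (𝓡 d) c).symm u) := ⟨hu, mem_extChartAt_source _⟩

theorem symm_trans (hu : u ∈ overlap c y) :
    (extChartAt (𝓡 d) y).symm (trans c y u) = (extChartAt (𝓡 d) c).symm u :=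
  (extChartAt (𝓡 d) y).left_inv hu.2

theorem trans_mem_target (hu : u ∈ overlap c y) : trans c y u ∈ (extChartAt (𝓡 d) y).target :=
  (extChartAt (𝓡 d) y).map_source hu.2

theorem trans_trans (hu : u ∈ overlap c y) : trans y z (trans c y u) = trans c z u := by
  rw [trans, symm_trans hu, trans]

theorem trans_symm (hu : u ∈ overlap c y) : trans y c (trans c y u) = u := by
  rw [trans, symm_trans hu]; exact (extChartAt (𝓡 d) c).right_inv hu.1

theorem trans_mem_overlap (hu : u ∈ overlap c y) : trans c y u ∈ overlap y c :=
  ⟨trans_mem_target hu, by rw [Set.mem_preimage, symm_trans hu]; exact symm_mem_source hu.1⟩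

theorem trans_mem_overlap' (hu : u ∈ overlap c y) (hz : u ∈ overlap c z) :
    trans c y u ∈ overlap y z :=
  ⟨trans_mem_target hu, by rw [Set.mem_preimage, symm_trans hu]; exact hz.2⟩

theorem fderiv_trans_self (hu : u ∈ (extChartAt (𝓡 d) c).target) :
    fderiv ℝ (trans (d := d) c c) u = ContinuousLinearMap.id ℝ _ := by
  have : trans (d := d) c c =ᶠ[𝓝 u] id := by
    filter_upwards [(isOpen_target c).mem_nhds hu] with w hw
    exact (extChartAt (𝓡 d) c).right_inv hw
  rw [this.fderiv_eq, fderiv_id]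

variable [IsManifold (𝓡 d) ∞ M]

theorem contMDiffAt_symm (hu : u ∈ (extChartAt (𝓡 d) c).target) :
    ContMDiffAt 𝓘(ℝ, Eu d) (𝓡 d) ∞ (extChartAt (𝓡 d) c).symm u :=
  (contMDiffOn_extChartAt_symm c).contMDiffAt ((isOpen_target c).mem_nhds hu)

theorem contMDiffAt_chart (hy : y ∈ (extChartAt (𝓡 d) c).source) :
    ContMDiffAt (𝓡 d) 𝓘(ℝ, Eu d) ∞ (extChartAt (𝓡 d) c) y :=
  (contMDiffOn_extChartAt (x := c)).contMDiffAt
    ((chartAt (Eu d) c).open_source.mem_nhds (by simpa using hy))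

theorem smooth_trans (c y : M) : ContDiffOn ℝ ∞ (trans (d := d) c y) (overlap c y) := fun u hu =>
  ((contMDiffAt_chart hu.2).comp u (contMDiffAt_symm hu.1)).contDiffAt.contDiffWithinAt

theorem diff_trans (hu : u ∈ overlap c y) : DifferentiableAt ℝ (trans (d := d) c y) u :=
  (smooth_trans c y).differentiableAt' (isOpen_overlap c y) hu

/-- Chain rule for the changes of coordinates. -/
theorem fderiv_trans_trans (hu : u ∈ overlap c y) (hz : u ∈ overlap c z) :
    fderiv ℝ (trans (d := d) c z) u
      = (fderiv ℝ (trans y z) (trans c y u)).comp (fderiv ℝ (trans c y) u) := by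
  have : trans (d := d) c z =ᶠ[𝓝 u] trans y z ∘ trans c y := by
    filter_upwards [(isOpen_overlap c y).mem_nhds hu] with w hw using (trans_trans hw).symm
  rw [this.fderiv_eq, _root_.fderiv_comp u (diff_trans (trans_mem_overlap' hu hz)) (diff_trans hu)]

theorem fderiv_trans_inv (hu : u ∈ overlap c y) (v : Eu d) :
    fderiv ℝ (trans (d := d) y c) (trans c y u) (fderiv ℝ (trans c y) u v) = v := by
  have := fderiv_trans_trans hu (z := c) ⟨hu.1, symm_mem_source hu.1⟩
  rw [fderiv_trans_self hu.1] at this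
  exact (DFunLike.congr_fun this v).symm

theorem fderiv_trans_surj (hu : u ∈ overlap c y) :
    Function.Surjective (fderiv ℝ (trans (d := d) c y) u) := fun v =>
  ⟨fderiv ℝ (trans y c) (trans c y u) v, by
    have := fderiv_trans_inv (trans_mem_overlap hu) v
    rwa [trans_symm hu] at this⟩

/-- The tangent space at a point is identified with ℝᵈ by the preferred chart there. The
differential of the inverse chart is thus the differential of the change of coordinates to the
preferred chart of the image point. -/
theorem C_eq (hu : u ∈ (extChartAt (𝓡 d) c).target) :
    C c u = fderiv ℝ (trans c ((extChartAt (𝓡 d) c).symm u)) u := by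
  refine (((contMDiffAt_symm hu).mdifferentiableAt (by simp)).mfderiv).trans ?_
  simp only [modelWithCornersSelf_coe, Set.range_id, fderivWithin_univ]
  rfl

theorem C_comp (hu : u ∈ overlap c y) : C c u = (C y (trans c y u)).comp (fderiv ℝ (trans c y) u) := by
  rw [C_eq hu.1, C_eq (trans_mem_target hu), symm_trans hu]
  exact fderiv_trans_trans hu (mem_overlap_self hu.1)

theorem C_comp_apply (hu : u ∈ overlap c y) (v : Eu d) :
    C y (trans c y u) (fderiv ℝ (trans c y) u v) = C c u v := by
  rw [C_comp hu]; rfl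

theorem C_self (c : M) : C c (extChartAt (𝓡 d) c c) = ContinuousLinearMap.id ℝ (Eu d) := by
  rw [C_eq (mem_extChartAt_target c), extChartAt_to_inv, fderiv_trans_self (mem_extChartAt_target c)]

theorem C_inj (hu : u ∈ (extChartAt (𝓡 d) c).target) : Function.Injective (C c u) := by
  rw [C_eq hu]
  exact Function.LeftInverse.injective (fderiv_trans_inv (mem_overlap_self hu))

theorem C_surj (hu : u ∈ (extChartAt (𝓡 d) c).target) : Function.Surjective (C c u) := by
  rw [C_eq hu]
  exact fderiv_trans_surj (mem_overlap_self hu)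

/-- The base point of the chart. -/
abbrev pt (x : M) : Eu d := extChartAt (𝓡 d) x x

/-! ### Vector fields in charts -/


/-- The link between the trivialisations of the tangent bundle, which define smoothness and
extensions of vectors, and the differentials `C` used in all computations. -/
theorem symmL_eq (hu : u ∈ (extChartAt (𝓡 d) c).target) (w : Eu d) :
    (trivializationAt (Eu d) (TangentSpace (𝓡 d)) c).symmL ℝ ((extChartAt (𝓡 d) c).symm u) w
      = C c u w := by
  have h := symm_mem_source hu
  have e := TangentBundle.symmL_trivializationAt (𝕜 := ℝ) (I := 𝓡 d) (x₀ := c)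
    (x := (extChartAt (𝓡 d) c).symm u) (by simpa using h)
  have e2 : mfderivWithin 𝓘(ℝ, Eu d) (𝓡 d) (extChartAt (𝓡 d) c).symm (Set.range (𝓡 d))
      (extChartAt (𝓡 d) c ((extChartAt (𝓡 d) c).symm u)) = C c u := by
    rw [(extChartAt (𝓡 d) c).right_inv hu]
    simp only [modelWithCornersSelf_coe, Set.range_id, mfderivWithin_univ]
    rfl
  exact (DFunLike.congr_fun e w).trans (DFunLike.congr_fun e2 w)

theorem trivializationAt_C (hu : u ∈ (extChartAt (𝓡 d) c).target) (w : Eu d) :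
    (trivializationAt (Eu d) (TangentSpace (𝓡 d)) c
      ⟨(extChartAt (𝓡 d) c).symm u, (C c u w : Eu d)⟩).2 = w := by
  have h : (extChartAt (𝓡 d) c).symm u
      ∈ (trivializationAt (Eu d) (TangentSpace (𝓡 d) : M → Type) c).baseSet := by
    have := symm_mem_source hu
    simpa using this
  have e := symmL_eq hu w
  have := (trivializationAt (Eu d) (TangentSpace (𝓡 d)) c).continuousLinearMapAt_symmL (R := ℝ) h w
  rw [e] at this
  rwa [Trivialization.continuousLinearMapAt_apply, Trivialization.coe_linearMapAt_of_mem _ h] at this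

theorem contMDiffAt_of_rep {X : VecField d M} {Y : Eu d → Eu d} (hu : u ∈ (extChartAt (𝓡 d) c).target)
    (hY : ∀ᶠ w in 𝓝 u, C c w (Y w) = X ((extChartAt (𝓡 d) c).symm w))
    (hs : ContDiffAt ℝ ∞ Y u) :
    ContMDiffAt (𝓡 d) (𝓡 d).tangent ∞ (fun x => (⟨x, X x⟩ : TangentBundle (𝓡 d) M))
      ((extChartAt (𝓡 d) c).symm u) := by
  have h0 := symm_mem_source hu
  have h : (extChartAt (𝓡 d) c).symm u
      ∈ (trivializationAt (Eu d) (TangentSpace (𝓡 d) : M → Type) c).baseSet := by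
    simpa using h0
  refine (Trivialization.contMDiffAt_section_iff (n := ∞) (IB := 𝓡 d) (s := X)
    (trivializationAt (Eu d) (TangentSpace (𝓡 d)) c) h).2 ?_
  have hr := (extChartAt (𝓡 d) c).right_inv hu
  have h1 : ContMDiffAt (𝓡 d) 𝓘(ℝ, Eu d) ∞ (Y ∘ extChartAt (𝓡 d) c)
      ((extChartAt (𝓡 d) c).symm u) :=
    ContMDiffAt.comp _ (by rw [hr]; exact hs.contMDiffAt) (contMDiffAt_chart h0)
  refine h1.congr_of_eventuallyEq ?_
  have hc := (continuousAt_extChartAt' (I := 𝓡 d) h0)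
  rw [ContinuousAt, hr] at hc
  filter_upwards [hc.eventually hY, (isOpen_extChartAt_source c).mem_nhds h0] with y hy hys
  rw [(extChartAt (𝓡 d) c).left_inv hys] at hy
  have := trivializationAt_C ((extChartAt (𝓡 d) c).map_source hys) (Y (extChartAt (𝓡 d) c y))
  rw [(extChartAt (𝓡 d) c).left_inv hys, hy] at this
  exact this

end Charts

end TGFoliation

end

/-! ### Pullbacks of forms; forms, metric and brackets in charts. -/

open Bundle Manifold MeasureTheory VectorField
open scoped ContDiff Topology

noncomputable section

namespace TGFoliation

set_option synthInstance.maxHeartbeats 200000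

section Pullback

variable {d k : ℕ}

/-- The identity map acts as a derivation by multiplication with the degree; it is a sum of rank-one
maps. -/
theorem sum_wedge_iota (β : Eu d [⋀^Fin (k + 1)]→L[ℝ] ℝ) :
    ∑ i, wedge (EuclideanSpace.proj i) (iota (eb i) β) = ((k : ℝ) + 1) • β := by
  have h : ∑ i, (EuclideanSpace.proj i : Eu d →L[ℝ] ℝ).smulRight (eb i)
      = ContinuousLinearMap.id ℝ (Eu d) := by
    ext v : 1
    simp only [_root_.sum_apply, ContinuousLinearMap.smulRight_apply]
    exact sum_eb v
  have h2 : derivn (ContinuousLinearMap.id ℝ (Eu d)) β = ((k : ℝ) + 1) • β := by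
    ext v
    simp [derivn_apply]
  rw [← h2, ← h, derivn_sum_left]
  exact Finset.sum_congr rfl fun i _ => (derivn_smulRight _ _ _).symm

/-- Writes a pullback through pullbacks of lower degree, so that joint smoothness in the form and
the linear map follows by induction on the degree. -/
theorem compContinuousLinearMap_succ (α : Eu d [⋀^Fin (k + 1)]→L[ℝ] ℝ) (L : Eu d →L[ℝ] Eu d) :
    α.compContinuousLinearMap L = ((k : ℝ) + 1)⁻¹ • ∑ i, wedge (EuclideanSpace.proj i)
      ((iota (L (eb i)) α).compContinuousLinearMap L) := by
  rw [← inv_smul_smul₀ (by positivity : (k : ℝ) + 1 ≠ 0) (α.compContinuousLinearMap L),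
    ← sum_wedge_iota (α.compContinuousLinearMap L)]
  congr 1
  refine Finset.sum_congr rfl fun i _ => congrArg _ ?_
  exact ContinuousAlternatingMap.curryLeft_compContinuousLinearMap _ _ _

theorem compContinuousLinearMap_zero_form (α : Eu d [⋀^Fin 0]→L[ℝ] ℝ) (L : Eu d →L[ℝ] Eu d) :
    α.compContinuousLinearMap L = α := by
  ext v
  exact congrArg α (Subsingleton.elim _ _)

theorem contDiffAt_compContinuousLinearMap_succ {F : Type*} [NormedAddCommGroup F]
    [NormedSpace ℝ F] {x : F} {L : F → Eu d →L[ℝ] Eu d} {α : F → Eu d [⋀^Fin (k + 1)]→L[ℝ] ℝ}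
    (h : ∀ i, ContDiffAt ℝ ∞
      (fun w => (iota (L w (eb i)) (α w)).compContinuousLinearMap (L w)) x) :
    ContDiffAt ℝ ∞ (fun w => (α w).compContinuousLinearMap (L w)) x := by
  simp only [compContinuousLinearMap_succ]
  refine ContDiffAt.const_smul _ (ContDiffAt.sum fun i _ => ?_)
  have hw : ContDiff ℝ ∞ (wedge (E := Eu d) (k := k) (EuclideanSpace.proj i)) :=
    ContinuousLinearMap.contDiff _
  exact hw.contDiffAt.comp x (h i)

theorem contDiffAt_iota {F : Type*} [NormedAddCommGroup F]
    [NormedSpace ℝ F] {x : F} {Y : F → Eu d} {α : F → Eu d [⋀^Fin (k + 1)]→L[ℝ] ℝ}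
    (hY : ContDiffAt ℝ ∞ Y x) (hα : ContDiffAt ℝ ∞ α x) :
    ContDiffAt ℝ ∞ (fun w => iota (Y w) (α w)) x := by
  have h : ContDiff ℝ ∞ (iota (E := Eu d) (k := k)) := ContinuousLinearMap.contDiff _
  exact (h.contDiffAt.comp x hY).clm_apply hα

theorem contDiffAt_compContinuousLinearMap {F : Type*} [NormedAddCommGroup F] [NormedSpace ℝ F]
    {x : F} {L : F → Eu d →L[ℝ] Eu d} (hL : ContDiffAt ℝ ∞ L x) :
    ∀ {k : ℕ} {α : F → Eu d [⋀^Fin k]→L[ℝ] ℝ}, ContDiffAt ℝ ∞ α x →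
      ContDiffAt ℝ ∞ (fun w => (α w).compContinuousLinearMap (L w)) x
  | 0, α, hα => by simpa only [compContinuousLinearMap_zero_form] using hα
  | k + 1, α, hα => contDiffAt_compContinuousLinearMap_succ fun i =>
      contDiffAt_compContinuousLinearMap hL
        (contDiffAt_iota (hL.clm_apply contDiffAt_const) hα)

end Pullback

section ChartObjects

variable {d : ℕ} {M : Type*} [TopologicalSpace M] [ChartedSpace (Eu d) M]
variable {u : Eu d} {c y z x : M} {k : ℕ}

/-! ### Forms in charts -/

theorem chartForm_eq (η : Form d M k) (c : M) (u : Eu d) : chartForm η c u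
    = (show Eu d [⋀^Fin k]→L[ℝ] ℝ from η ((extChartAt (𝓡 d) c).symm u)).compContinuousLinearMap
      (C c u) := rfl

variable [IsManifold (𝓡 d) ∞ M]

theorem chartForm_trans (η : Form d M k) (hu : u ∈ overlap c y) : chartForm η c u
    = (chartForm η y (trans c y u)).compContinuousLinearMap (fderiv ℝ (trans c y) u) := by
  rw [chartForm_eq, chartForm_eq, C_comp hu, symm_trans hu]
  rfl

theorem chartForm_pt (η : Form d M k) (x : M) : chartForm η x (pt x) = η x := by
  rw [chartForm_eq, C_self, extChartAt_to_inv]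
  rfl

theorem trivializationAt_form (η : Form d M k) (hu : u ∈ (extChartAt (𝓡 d) c).target) :
    (trivializationAt (Eu d [⋀^Fin k]→L[ℝ] ℝ)
      (fun x : M => TangentSpace (𝓡 d) x [⋀^Fin k]→L[ℝ] (Bundle.Trivial M ℝ x)) c
      ⟨(extChartAt (𝓡 d) c).symm u, η ((extChartAt (𝓡 d) c).symm u)⟩).2 = chartForm η c u := by
  ext v
  have : ∀ i, (trivializationAt (Eu d) (TangentSpace (𝓡 d)) c).symmL ℝ
      ((extChartAt (𝓡 d) c).symm u) (v i) = C c u (v i) := fun i => symmL_eq hu (v i)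
  have e : (trivializationAt ℝ (Bundle.Trivial M ℝ) c).continuousLinearMapAt ℝ
      ((extChartAt (𝓡 d) c).symm u) = ContinuousLinearMap.id ℝ ℝ :=
    Bundle.Trivial.continuousLinearMapAt_trivialization ℝ M ℝ _
  change (trivializationAt ℝ (Bundle.Trivial M ℝ) c).continuousLinearMapAt ℝ
    ((extChartAt (𝓡 d) c).symm u) (η ((extChartAt (𝓡 d) c).symm u) fun i =>
      (trivializationAt (Eu d) (TangentSpace (𝓡 d)) c).symmL ℝ
      ((extChartAt (𝓡 d) c).symm u) (v i)) = _
  rw [e]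
  exact congrArg (η ((extChartAt (𝓡 d) c).symm u)) (funext this)

/-- The trivialisation at `x` is built from the preferred chart at `x`, so it suffices to look at
each point in its own chart. -/
theorem isSmoothForm_iff {η : Form d M k} :
    IsSmoothForm η ↔ ∀ x, ContDiffAt ℝ ∞ (chartForm η x) (pt x) := by
  refine forall_congr' fun x => (contMDiffAt_section (n := ∞) (IB := 𝓡 d)
    (F := Eu d [⋀^Fin k]→L[ℝ] ℝ)
    (E := fun x : M => TangentSpace (𝓡 d) x [⋀^Fin k]→L[ℝ] (Bundle.Trivial M ℝ x))
    (s := η) x).trans ?_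
  have h0 := mem_extChartAt_source (I := 𝓡 d) x
  constructor
  · intro h1
    have hx := mem_extChartAt_target (I := 𝓡 d) x
    have h1' : ContMDiffAt (𝓡 d) 𝓘(ℝ, Eu d [⋀^Fin k]→L[ℝ] ℝ) ∞
      (fun y => (trivializationAt (Eu d [⋀^Fin k]→L[ℝ] ℝ)
        (fun x : M => TangentSpace (𝓡 d) x [⋀^Fin k]→L[ℝ] (Bundle.Trivial M ℝ x)) x ⟨y, η y⟩).2)
      ((extChartAt (𝓡 d) x).symm (pt x)) := by rw [extChartAt_to_inv]; exact h1
    have h2 := (h1'.comp (pt x) (contMDiffAt_symm hx)).contDiffAt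
    refine h2.congr_of_eventuallyEq ?_
    filter_upwards [(isOpen_target x).mem_nhds hx] with w hw
    exact (trivializationAt_form η hw).symm
  · intro h
    have h1 : ContMDiffAt (𝓡 d) 𝓘(ℝ, Eu d [⋀^Fin k]→L[ℝ] ℝ) ∞
        (chartForm η x ∘ extChartAt (𝓡 d) x) x :=
      ContMDiffAt.comp _ h.contMDiffAt (contMDiffAt_chart h0)
    refine h1.congr_of_eventuallyEq ?_
    filter_upwards [(isOpen_extChartAt_source x).mem_nhds h0] with y hys
    have := trivializationAt_form η ((extChartAt (𝓡 d) x).map_source hys)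
    rw [(extChartAt (𝓡 d) x).left_inv hys] at this
    exact this

theorem contDiffAt_chartForm_of_trans {η : Form d M k} (hu : u ∈ overlap c y)
    (h : ContDiffAt ℝ ∞ (chartForm η y) (trans c y u)) : ContDiffAt ℝ ∞ (chartForm η c) u := by
  have ht := (smooth_trans c y).contDiffAt ((isOpen_overlap c y).mem_nhds hu)
  have hD := (contDiffOn_fderiv (isOpen_overlap c y) (smooth_trans c y)).contDiffAt
    ((isOpen_overlap c y).mem_nhds hu)
  have h2 : ContDiffAt ℝ ∞ (fun w => (chartForm η y (trans c y w)).compContinuousLinearMap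
    (fderiv ℝ (trans c y) w)) u := contDiffAt_compContinuousLinearMap hD (h.comp u ht)
  refine h2.congr_of_eventuallyEq ?_
  filter_upwards [(isOpen_overlap c y).mem_nhds hu] with w hw using chartForm_trans η hw

theorem contDiffOn_chartForm {η : Form d M k} (hη : IsSmoothForm η) (c : M) :
    ContDiffOn ℝ ∞ (chartForm η c) (extChartAt (𝓡 d) c).target := fun _ hu =>
  (contDiffAt_chartForm_of_trans (mem_overlap_self hu)
    (isSmoothForm_iff.1 hη _)).contDiffWithinAt

/-! ### The metric in charts -/

/-- The metric, on the model space. -/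
def inn (g : Metric d M) (y : M) : Eu d →L[ℝ] Eu d →L[ℝ] ℝ := g.inner y

/-- The metric in the chart at `c`. -/
def chartMetric (g : Metric d M) (c : M) (u : Eu d) : Eu d →L[ℝ] Eu d →L[ℝ] ℝ :=
  (inn g ((extChartAt (𝓡 d) c).symm u)).bilinearComp (C c u) (C c u)

theorem chartMetric_apply (g : Metric d M) (c : M) (u : Eu d) (v w : Eu d) : chartMetric g c u v w
    = inn g ((extChartAt (𝓡 d) c).symm u) (C c u v) (C c u w) := rfl

theorem inn_symm (g : Metric d M) (y : M) (v w : Eu d) : inn g y v w = inn g y w v := g.symm y v w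

theorem inn_pos (g : Metric d M) (y : M) {v : Eu d} (hv : v ≠ 0) : 0 < inn g y v v := g.pos y v hv

theorem chartMetric_pos (g : Metric d M) (hu : u ∈ (extChartAt (𝓡 d) c).target) {v : Eu d}
    (hv : v ≠ 0) : 0 < chartMetric g c u v v :=
  inn_pos g _ fun h => hv (C_inj hu (h.trans (map_zero _).symm))

theorem chartMetric_trans (g : Metric d M) (hu : u ∈ overlap c y) (v w : Eu d) :
    chartMetric g y (trans c y u) (fderiv ℝ (trans c y) u v) (fderiv ℝ (trans c y) u w)
      = chartMetric g c u v w := by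
  rw [chartMetric_apply, chartMetric_apply, C_comp_apply hu, C_comp_apply hu, symm_trans hu]

theorem chartMetric_pt (g : Metric d M) (x : M) : chartMetric g x (pt x) = inn g x := by
  ext v w
  rw [chartMetric_apply, C_self, extChartAt_to_inv]; rfl

theorem smooth_chartMetric (g : Metric d M) (c : M) :
    ContDiffOn ℝ ∞ (chartMetric g c) (extChartAt (𝓡 d) c).target := by
  rw [contDiffOn_clm_apply]
  intro v
  rw [contDiffOn_clm_apply]
  intro w u hu
  -- The coordinate fields of the chart at `c` are smooth sections, and the metric coefficients are
  -- its values on pairs of them.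
  have hs : ∀ v : Eu d, ContMDiffAt (𝓡 d) (𝓡 d).tangent ∞
      (fun x => (⟨x, (C c (extChartAt (𝓡 d) c x) v : Eu d)⟩ : TangentBundle (𝓡 d) M))
      ((extChartAt (𝓡 d) c).symm u) := fun v => by
    refine contMDiffAt_of_rep (Y := fun _ => v) (X := fun x => (C c (extChartAt (𝓡 d) c x) v : Eu d))
      hu ?_ contDiffAt_const
    filter_upwards [(isOpen_target c).mem_nhds hu] with w hw
    rw [(extChartAt (𝓡 d) c).right_inv hw]
  have h1 := ContMDiffAt.clm_bundle_apply₂ (F₃ := ℝ) (E₃ := Bundle.Trivial M ℝ)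
    (g.contMDiff ((extChartAt (𝓡 d) c).symm u)) (hs v) (hs w)
  have h2 := (((contMDiffAt_section (n := ∞) (IB := 𝓡 d) (F := ℝ) (E := Bundle.Trivial M ℝ) _).1
    h1).comp u (contMDiffAt_symm hu)).contDiffAt
  refine (h2.congr_of_eventuallyEq ?_).contDiffWithinAt
  filter_upwards [(isOpen_target c).mem_nhds hu] with a ha
  rw [chartMetric_apply]
  conv_lhs => rw [← (extChartAt (𝓡 d) c).right_inv ha]
  rw [(extChartAt (𝓡 d) c).left_inv (symm_mem_source ha)]
  rfl

/-! ### Derivatives in charts -/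

theorem mfderiv_C {F : Type*} [NormedAddCommGroup F] [NormedSpace ℝ F] {f : M → F}
    (hu : u ∈ (extChartAt (𝓡 d) c).target)
    (hf : MDifferentiableAt (𝓡 d) 𝓘(ℝ, F) f ((extChartAt (𝓡 d) c).symm u)) (v : Eu d) :
    (mfderiv (𝓡 d) 𝓘(ℝ, F) f ((extChartAt (𝓡 d) c).symm u) (C c u v) : F)
      = fderiv ℝ (f ∘ (extChartAt (𝓡 d) c).symm) u v := by
  have := mfderiv_comp u hf ((contMDiffAt_symm hu).mdifferentiableAt (by simp))
  rw [mfderiv_eq_fderiv] at this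
  exact (DFunLike.congr_fun this v).symm

theorem mvfderiv_C {f : M → ℝ} (hu : u ∈ (extChartAt (𝓡 d) c).target)
    (hf : MDifferentiableAt (𝓡 d) 𝓘(ℝ, ℝ) f ((extChartAt (𝓡 d) c).symm u)) (v : Eu d) :
    mvfderiv (𝓡 d) f ((extChartAt (𝓡 d) c).symm u) (C c u v)
      = fderiv ℝ (f ∘ (extChartAt (𝓡 d) c).symm) u v :=
  mfderiv_C hu hf v

/-- Brackets are natural under pullback by the inverse chart, whose differential is invertible on
the target; on ℝᵈ the bracket is given by derivatives. -/
theorem mlieBracket_C {X Y : VecField d M} (hu : u ∈ (extChartAt (𝓡 d) c).target)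
    {Xc Yc : Eu d → Eu d} (hX : ∀ᶠ w in 𝓝 u, C c w (Xc w) = X ((extChartAt (𝓡 d) c).symm w))
    (hY : ∀ᶠ w in 𝓝 u, C c w (Yc w) = Y ((extChartAt (𝓡 d) c).symm w))
    (hXs : ContDiffAt ℝ ∞ Xc u) (hYs : ContDiffAt ℝ ∞ Yc u) :
    (mlieBracket (𝓡 d) X Y ((extChartAt (𝓡 d) c).symm u) : Eu d)
      = C c u (fderiv ℝ Yc u (Xc u) - fderiv ℝ Xc u (Yc u)) := by
  have hXm := (contMDiffAt_of_rep hu hX hXs).mdifferentiableAt (by simp)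
  have hYm := (contMDiffAt_of_rep hu hY hYs).mdifferentiableAt (by simp)
  have : IsManifold (𝓡 d) (minSmoothness ℝ 2) M :=
    IsManifold.of_le (n := ∞) (by
      rw [minSmoothness_of_isRCLikeNormedField]; exact WithTop.coe_le_coe.2 (le_top : (2 : ℕ∞) ≤ ⊤))
  have key := mpullback_mlieBracket (n := ∞) hXm hYm (contMDiffAt_symm hu)
    (by rw [minSmoothness_of_isRCLikeNormedField]; exact WithTop.coe_le_coe.2 (le_top : (2 : ℕ∞) ≤ ⊤))
  have hinv : ∀ w ∈ (extChartAt (𝓡 d) c).target, (C c w).IsInvertible := fun w hw =>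
    ⟨ContinuousLinearEquiv.ofBijective (C c w) (LinearMap.ker_eq_bot.2 (C_inj hw))
      (LinearMap.range_eq_top.2 (C_surj hw)), rfl⟩
  have hpb : ∀ {X : VecField d M} {Xc : Eu d → Eu d},
      (∀ᶠ w in 𝓝 u, C c w (Xc w) = X ((extChartAt (𝓡 d) c).symm w)) →
      mpullback 𝓘(ℝ, Eu d) (𝓡 d) (extChartAt (𝓡 d) c).symm X =ᶠ[𝓝 u] Xc := by
    intro X Xc h
    filter_upwards [h, (isOpen_target c).mem_nhds hu] with w hw hwt
    exact ((hinv w hwt).inverse_apply_eq).2 hw.symm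
  have e := (hpb hX).mlieBracket_vectorField_eq (hpb hY)
  have h3 := (hinv u hu).inverse_apply_eq.1 (key.trans e)
  have e4 : ∀ Xc Yc : Π x : Eu d, TangentSpace 𝓘(ℝ, Eu d) x,
      mlieBracket 𝓘(ℝ, Eu d) Xc Yc u = lieBracket ℝ Xc Yc u := fun Xc Yc => by
    rw [← mlieBracketWithin_univ, mlieBracketWithin_eq_lieBracketWithin]
    exact congrFun lieBracketWithin_univ u
  exact h3.trans (congrArg (C c u) (e4 Xc Yc))

end ChartObjects

end TGFoliation

end

open Bundle Manifold MeasureTheory VectorField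
open scoped ContDiff Topology

noncomputable section

namespace TGFoliation

set_option synthInstance.maxHeartbeats 200000

/-! ### Construction of the horizontal frame -/

/-- An open set of `ℝᵈ` with a metric and a foliation given by independent closed forms. -/
structure PreFoliation (d n : ℕ) where
  W : Set (Eu d)
  isOpen : IsOpen W
  G : Eu d → Eu d →L[ℝ] Eu d →L[ℝ] ℝ
  θ : Fin n → Eu d → Eu d →L[ℝ] ℝ
  smooth_G : ContDiffOn ℝ ∞ G W
  smooth_θ : ∀ i, ContDiffOn ℝ ∞ (θ i) W
  G_symm : ∀ u ∈ W, ∀ v w, G u v w = G u w v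
  G_pos : ∀ u ∈ W, ∀ v, v ≠ 0 → 0 < G u v v
  closed : ∀ u ∈ W, ∀ i v w, fderiv ℝ (θ i) u v w = fderiv ℝ (θ i) u w v
  surj : ∀ u ∈ W, ∀ a : Fin n → ℝ, ∃ v, ∀ i, θ i u v = a i

namespace PreFoliation

variable {d n : ℕ} (P : PreFoliation d n) {u : Eu d}

/-- The gradients of the forms. -/
def grad (i : Fin n) (u : Eu d) : Eu d := sharpQ (gramE (P.G u))⁻¹ (P.θ i u)

/-- The matrix `⟨θ_i, θ_j⟩`. -/
def K (u : Eu d) : Matrix (Fin n) (Fin n) ℝ := Matrix.of fun i j => P.θ i u (P.grad j u)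

/-- The horizontal frame dual to the forms. -/
def X (i : Fin n) (u : Eu d) : Eu d := ∑ j, (P.K u)⁻¹ i j • P.grad j u

/-- The vertical part. -/
def vpart (u v : Eu d) : Eu d := v - ∑ i, P.θ i u v • P.X i u

variable {P}

theorem gramE_det (hu : u ∈ P.W) : (gramE (P.G u)).det ≠ 0 :=
  (gramE_det_pos (P.G_symm u hu) (P.G_pos u hu)).ne'

theorem G_grad (hu : u ∈ P.W) (i : Fin n) (w : Eu d) : P.G u (P.grad i u) w = P.θ i u w :=
  apply_sharpQ_gramE (gramE_det hu) _ w

theorem K_symm (hu : u ∈ P.W) (i j : Fin n) : P.K u i j = P.K u j i := by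
  simp only [K, Matrix.of_apply]
  rw [← G_grad hu, P.G_symm u hu, G_grad hu]

/-- Joint surjectivity of the forms makes their gradients independent, so their Gram matrix is
positive definite and the dual horizontal frame exists. -/
theorem K_posDef (hu : u ∈ P.W) : (P.K u).PosDef := by
  refine Matrix.PosDef.of_dotProduct_mulVec_pos ?_ fun x hx => ?_
  · ext i j; simp [K_symm hu i j]
  · have e : ∀ v, P.G u (∑ i, x i • P.grad i u) v = ∑ i, x i * P.θ i u v := fun v => by
      simp [_root_.sum_apply, G_grad hu]
    have h0 : (∑ i, x i • P.grad i u : Eu d) ≠ 0 := by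
      intro h
      apply hx
      -- Evaluating on a vector with θ_i(v) = x_i turns the vanishing of the combination into ∑ x_i²
      -- = 0.
      obtain ⟨v, hv⟩ := P.surj u hu x
      have h1 := e v
      rw [h] at h1
      simp only [map_zero, _root_.zero_apply, hv] at h1
      funext i
      have := (Finset.sum_eq_zero_iff_of_nonneg fun i _ => mul_self_nonneg (x i)).1 h1.symm i
        (Finset.mem_univ i)
      simpa using this
    have := P.G_pos u hu _ h0
    rw [e] at this
    simp only [map_sum, map_smul, smul_eq_mul] at this
    simpa only [dotProduct, Matrix.mulVec, K, Matrix.of_apply, Pi.star_apply, star_trivial,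
      mul_comm] using this

theorem K_det (hu : u ∈ P.W) : (P.K u).det ≠ 0 := (K_posDef hu).det_pos.ne'

theorem θ_X (hu : u ∈ P.W) (i j : Fin n) : P.θ i u (P.X j u) = if i = j then 1 else 0 := by
  have h := congrFun (congrFun (Matrix.nonsing_inv_mul _ (K_det hu).isUnit) j) i
  rw [Matrix.mul_apply, Matrix.one_apply] at h
  simp only [X, map_sum, map_smul, smul_eq_mul]
  rw [show (if i = j then (1 : ℝ) else 0) = if j = i then 1 else 0 by simp [eq_comm], ← h]
  exact Finset.sum_congr rfl fun k _ => by rw [K_symm hu k i]; rfl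

theorem G_X (hu : u ∈ P.W) (i : Fin n) {z : Eu d} (hz : ∀ k, P.θ k u z = 0) :
    P.G u (P.X i u) z = 0 := by
  simp [X, _root_.sum_apply, G_grad hu, hz]

theorem smooth_grad (i : Fin n) : ContDiffOn ℝ ∞ (P.grad i) P.W := by
  have hg : ∀ a b, ContDiffOn ℝ ∞ (fun u => gramE (P.G u) a b) P.W := fun a b =>
    (P.smooth_G.clm_apply (contDiffOn_const (c := eb a))).clm_apply (contDiffOn_const (c := eb b))
  have hinv : ∀ a b, ContDiffOn ℝ ∞ (fun u => (gramE (P.G u))⁻¹ a b) P.W :=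
    contDiffOn_matrix_inv hg fun u hu => gramE_det hu
  have hθ : ∀ a, ContDiffOn ℝ ∞ (fun u => P.θ i u (eb a)) P.W := fun a =>
    (P.smooth_θ i).clm_apply contDiffOn_const
  have hs : ∀ a b, ContDiffOn ℝ ∞
      (fun u => ((gramE (P.G u))⁻¹ a b * P.θ i u (eb a)) • (eb b : Eu d)) P.W := fun a b =>
    ((hinv a b).mul (hθ a)).smul contDiffOn_const
  have e : P.grad i = fun u => ∑ a, ∑ b, ((gramE (P.G u))⁻¹ a b * P.θ i u (eb a)) • (eb b : Eu d) :=
    rfl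
  rw [e]
  exact ContDiffOn.sum fun a _ => ContDiffOn.sum fun b _ => hs a b

theorem smooth_X (i : Fin n) : ContDiffOn ℝ ∞ (P.X i) P.W := by
  have hinv : ∀ a b, ContDiffOn ℝ ∞ (fun u => (P.K u)⁻¹ a b) P.W :=
    contDiffOn_matrix_inv (fun a b => (P.smooth_θ a).clm_apply (smooth_grad b)) fun u hu => K_det hu
  exact ContDiffOn.sum fun a _ => (hinv i a).smul (smooth_grad a)

theorem smooth_vpart (v : Eu d) : ContDiffOn ℝ ∞ (fun u => P.vpart u v) P.W :=
  contDiffOn_const.sub (ContDiffOn.sum fun i _ =>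
    ((P.smooth_θ i).clm_apply contDiffOn_const).smul (smooth_X i))

theorem θ_vpart (hu : u ∈ P.W) (v : Eu d) (k : Fin n) : P.θ k u (P.vpart u v) = 0 := by
  simp [vpart, θ_X hu]

theorem vpart_of_vert {z : Eu d} (hz : ∀ k, P.θ k u z = 0) : P.vpart u z = z := by
  simp [vpart, hz]

/-- The bracket of a vertical field with a horizontal field with constant coefficients is
vertical. -/
theorem lie_vert (hu : u ∈ P.W) {Z Y : Eu d → Eu d} (hZs : ContDiffOn ℝ ∞ Z P.W)
    (hZ : ∀ y ∈ P.W, ∀ k, P.θ k y (Z y) = 0) (hYs : ContDiffOn ℝ ∞ Y P.W) {a : Fin n → ℝ}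
    (hY : ∀ y ∈ P.W, ∀ k, P.θ k y (Y y) = a k) (k : Fin n) :
    P.θ k u (fderiv ℝ Y u (Z u) - fderiv ℝ Z u (Y u)) = 0 := by
  have hθ := (P.smooth_θ k).differentiableAt' P.isOpen hu
  have h1 := fderiv_eq_zero_on P.isOpen hu (fun y hy => hZ y hy k) (Y u)
  have h2 := fderiv_eq_zero_on P.isOpen hu (fun y hy => hY y hy k) (Z u)
  rw [fderiv_apply_field hθ (hZs.differentiableAt' P.isOpen hu)] at h1
  rw [fderiv_apply_field hθ (hYs.differentiableAt' P.isOpen hu)] at h2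
  rw [ContinuousLinearMap.map_sub]
  linarith [P.closed u hu k (Y u) (Z u)]

/-- The Lie derivative `(L_X G)(Y, Z)`. -/
def lieMetric (G : Eu d → Eu d →L[ℝ] Eu d →L[ℝ] ℝ) (X Y Z : Eu d → Eu d) (u : Eu d) : ℝ :=
  fderiv ℝ (fun u => G u (Y u) (Z u)) u (X u)
    - G u (fderiv ℝ Y u (X u) - fderiv ℝ X u (Y u)) (Z u)
    - G u (Y u) (fderiv ℝ Z u (X u) - fderiv ℝ X u (Z u))

/-- The local foliation, if it is Riemannian and totally geodesic. -/
def toLocalFoliation (P : PreFoliation d n)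
    (hR : ∀ Y Z : Eu d → Eu d, ContDiffOn ℝ ∞ Y P.W → ContDiffOn ℝ ∞ Z P.W →
      (∀ y ∈ P.W, ∀ z, (∀ k, P.θ k y z = 0) → P.G y (Y y) z = 0) →
      (∀ y ∈ P.W, ∀ k, P.θ k y (Z y) = 0) →
      ∀ u ∈ P.W, lieMetric P.G Z Y Y u = 0 ∧ lieMetric P.G Y Z Z u = 0) : LocalFoliation d n where
  W := P.W
  isOpen := P.isOpen
  G := P.G
  θ := P.θ
  X := P.X
  smooth_G := P.smooth_G
  smooth_θ := P.smooth_θ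
  smooth_X := smooth_X
  G_symm := P.G_symm
  G_pos := P.G_pos
  closed := P.closed
  θ_X _ hu := θ_X hu
  G_X _ hu i _ hz := G_X hu i hz
  riem u hu z hz i j := by
    have hW := P.isOpen
    -- If θ_k(Y) is constant, then the bracket of `Y` with a vertical field is vertical and hence
    -- orthogonal to `Y`. The Lie derivative condition reduces to constancy of |Y|² along the
    -- leaves.
    have key : ∀ (Y : Eu d → Eu d) (a : Fin n → ℝ), ContDiffOn ℝ ∞ Y P.W →
        (∀ y ∈ P.W, ∀ z, (∀ k, P.θ k y z = 0) → P.G y (Y y) z = 0) →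
        (∀ y ∈ P.W, ∀ k, P.θ k y (Y y) = a k) → fderiv ℝ (fun u => P.G u (Y u) (Y u)) u z = 0 := by
      intro Y a hYs hY hYa
      have h := (hR Y (fun u => P.vpart u z) hYs (smooth_vpart z) hY
        (fun y hy k => θ_vpart hy z k) u hu).1
      have hv := lie_vert hu (smooth_vpart z) (fun y hy k => θ_vpart hy z k) hYs hYa
      have h1 := hY u hu _ hv
      have h2 := h1
      rw [P.G_symm u hu] at h2
      rw [lieMetric, h1, h2, vpart_of_vert hz] at h
      linarith
    have hXs := smooth_X (P := P)
    have hx : ∀ i, ∀ y ∈ P.W, ∀ z, (∀ k, P.θ k y z = 0) → P.G y (P.X i y) z = 0 :=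
      fun i y hy z hz => G_X hy i hz
    have hii := key (P.X i) _ (hXs i) (hx i) fun y hy k => θ_X hy k i
    have hjj := key (P.X j) _ (hXs j) (hx j) fun y hy k => θ_X hy k j
    -- Polarisation: the hypothesis concerns squares only, so it is also applied to X_i + X_j.
    have hij := key (fun y => P.X i y + P.X j y)
      (fun k => (if k = i then 1 else 0) + if k = j then 1 else 0) ((hXs i).add (hXs j))
      (fun y hy z hz => by
        rw [ContinuousLinearMap.map_add, _root_.add_apply, hx i y hy z hz, hx j y hy z hz, add_zero])
      fun y hy k => by rw [ContinuousLinearMap.map_add, θ_X hy, θ_X hy]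
    have hs : ∀ i j, DifferentiableAt ℝ (fun u => P.G u (P.X i u) (P.X j u)) u := fun i j =>
      ((P.smooth_G.clm_apply (hXs i)).clm_apply (hXs j)).differentiableAt' hW hu
    have e : (fun u => P.G u (P.X i u + P.X j u) (P.X i u + P.X j u)) =ᶠ[𝓝 u]
        fun u => P.G u (P.X i u) (P.X i u) + P.G u (P.X j u) (P.X j u)
          + 2 * P.G u (P.X i u) (P.X j u) := by
      filter_upwards [hW.mem_nhds hu] with y hy
      simp only [ContinuousLinearMap.map_add, _root_.add_apply, P.G_symm y hy (P.X j y) (P.X i y)]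
      ring
    have hd1 : DifferentiableAt ℝ (fun u => P.G u (P.X i u) (P.X i u) + P.G u (P.X j u) (P.X j u)) u :=
      (hs i i).add (hs j j)
    have hd2 : DifferentiableAt ℝ (fun u => 2 * P.G u (P.X i u) (P.X j u)) u := (hs i j).const_mul 2
    rw [e.fderiv_eq, fderiv_fun_add hd1 hd2, fderiv_fun_add (hs i i) (hs j j),
      fderiv_const_mul (hs i j)] at hij
    simp only [_root_.add_apply, _root_.smul_apply, smul_eq_mul, hii, hjj] at hij
    linarith
  geod u hu z hz j := by
    have hW := P.isOpen
    obtain ⟨Z, hZ⟩ : ∃ Z : Eu d → Eu d, Z = fun u => P.vpart u z := ⟨_, rfl⟩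
    have hZs : ContDiffOn ℝ ∞ Z P.W := hZ ▸ smooth_vpart z
    have h := (hR (P.X j) Z (smooth_X j) hZs (fun y hy z hz => G_X hy j hz)
      (fun y hy k => by rw [hZ]; exact θ_vpart hy z k) u hu).2
    have hZu : Z u = z := by rw [hZ]; exact vpart_of_vert hz
    have hZd := hZs.differentiableAt' hW hu
    rw [lieMetric, fderiv_bilin_apply (P.smooth_G.differentiableAt' hW hu) hZd hZd, hZu] at h
    simp only [ContinuousLinearMap.map_sub, _root_.sub_apply] at h
    rw [P.G_symm u hu z, P.G_symm u hu z] at h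
    linarith

end PreFoliation

end TGFoliation

end

/-! ### From the foliation on M to local data in charts. -/

open Bundle Manifold MeasureTheory VectorField
open scoped ContDiff Topology

noncomputable section

namespace TGFoliation

set_option synthInstance.maxHeartbeats 200000

section FoliationCharts

variable {d n : ℕ} {M : Type*} [TopologicalSpace M] [ChartedSpace (Eu d) M]
variable {u : Eu d} {c y z x : M} {k : ℕ} 

/-- The function `Y` represents the vector field `X` near `u`, in the chart at `c`. -/
def IsRep (c : M) (u : Eu d) (X : VecField d M) (Y : Eu d → Eu d) : Prop :=
  ContDiffAt ℝ ∞ Y u ∧ ∀ᶠ w in 𝓝 u, C c w (Y w) = X ((extChartAt (𝓡 d) c).symm w)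

variable [IsManifold (𝓡 d) ∞ M]

theorem mdifferentiableAt_of_rep {F : M → ℝ} {Fr : Eu d → ℝ} (hu : u ∈ (extChartAt (𝓡 d) c).target)
    (hF : ∀ᶠ w in 𝓝 u, F ((extChartAt (𝓡 d) c).symm w) = Fr w) (hd : DifferentiableAt ℝ Fr u) :
    MDifferentiableAt (𝓡 d) 𝓘(ℝ, ℝ) F ((extChartAt (𝓡 d) c).symm u) := by
  have h0 := symm_mem_source hu
  have hr := (extChartAt (𝓡 d) c).right_inv hu
  have h1 : MDifferentiableAt (𝓡 d) 𝓘(ℝ, ℝ) (Fr ∘ extChartAt (𝓡 d) c)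
      ((extChartAt (𝓡 d) c).symm u) :=
    MDifferentiableAt.comp _ (by rw [hr]; exact hd.mdifferentiableAt)
      ((contMDiffAt_chart h0).mdifferentiableAt (by simp))
  refine h1.congr_of_eventuallyEq ?_
  have hc := (continuousAt_extChartAt' (I := 𝓡 d) h0)
  rw [ContinuousAt, hr] at hc
  filter_upwards [hc.eventually hF, (isOpen_extChartAt_source c).mem_nhds h0] with y hy hys
  rw [(extChartAt (𝓡 d) c).left_inv hys] at hy
  exact hy

theorem mvfderiv_of_rep {F : M → ℝ} {Fr : Eu d → ℝ} (hu : u ∈ (extChartAt (𝓡 d) c).target)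
    (hF : ∀ᶠ w in 𝓝 u, F ((extChartAt (𝓡 d) c).symm w) = Fr w) (hd : DifferentiableAt ℝ Fr u)
    (v : Eu d) :
    mvfderiv (𝓡 d) F ((extChartAt (𝓡 d) c).symm u) (C c u v) = fderiv ℝ Fr u v := by
  rw [mvfderiv_C hu (mdifferentiableAt_of_rep hu hF hd)]
  exact DFunLike.congr_fun (Filter.EventuallyEq.fderiv_eq hF) v

theorem lieDerivMetric_C (g : Metric d M) {X Y Z : VecField d M} {Xc Yc Zc : Eu d → Eu d}
    (hu : u ∈ (extChartAt (𝓡 d) c).target) (hX : IsRep c u X Xc) (hY : IsRep c u Y Yc)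
    (hZ : IsRep c u Z Zc) : lieDerivMetric g X Y Z ((extChartAt (𝓡 d) c).symm u)
      = PreFoliation.lieMetric (chartMetric g c) Xc Yc Zc u := by
  have hF : ∀ᶠ w in 𝓝 u, g.inner ((extChartAt (𝓡 d) c).symm w)
      (Y ((extChartAt (𝓡 d) c).symm w)) (Z ((extChartAt (𝓡 d) c).symm w))
      = chartMetric g c w (Yc w) (Zc w) := by
    filter_upwards [hY.2, hZ.2] with w h1 h2
    rw [chartMetric_apply, h1, h2]
    rfl
  have hd : DifferentiableAt ℝ (fun w => chartMetric g c w (Yc w) (Zc w)) u :=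
    ((((smooth_chartMetric g c).differentiableAt' (isOpen_target c) hu).clm_apply
      (hY.1.differentiableAt (by simp))).clm_apply (hZ.1.differentiableAt (by simp)))
  have e1 : mvfderiv (𝓡 d) (fun y => g.inner y (Y y) (Z y)) ((extChartAt (𝓡 d) c).symm u)
      (X ((extChartAt (𝓡 d) c).symm u))
      = fderiv ℝ (fun w => chartMetric g c w (Yc w) (Zc w)) u (Xc u) := by
    rw [← hX.2.self_of_nhds]
    exact mvfderiv_of_rep hu hF hd (Xc u)
  have e2 := mlieBracket_C hu hX.2 hY.2 hX.1 hY.1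
  have e3 := mlieBracket_C hu hX.2 hZ.2 hX.1 hZ.1
  rw [PreFoliation.lieMetric, chartMetric_apply, chartMetric_apply, ← e2, ← e3,
    hY.2.self_of_nhds, hZ.2.self_of_nhds, ← e1]
  rfl

/-- The hypothesis on the foliation concerns global fields, so a local field is cut off by a bump
function. The last clause says that the result is everywhere zero or a multiple of the given field,
which preserves being horizontal or vertical. -/
theorem exists_field [T2Space M] {W : Set (Eu d)} (hW : IsOpen W)
    (hWt : W ⊆ (extChartAt (𝓡 d) c).target) {Y : Eu d → Eu d} (hY : ContDiffOn ℝ ∞ Y W)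
    (hu : u ∈ W) : ∃ X : VecField d M, IsSmoothField X ∧ IsRep c u X Y ∧
      ∀ y, X y = 0 ∨ ∃ w ∈ W, ∃ t : ℝ, y = (extChartAt (𝓡 d) c).symm w ∧
        X y = (t • C c w (Y w) : Eu d) := by
  have hus := symm_mem_source (hWt hu)
  have hr := (extChartAt (𝓡 d) c).right_inv (hWt hu)
  obtain ⟨N, hN⟩ : ∃ N, N = (extChartAt (𝓡 d) c).source ∩ extChartAt (𝓡 d) c ⁻¹' W := ⟨_, rfl⟩
  have hNo : IsOpen N := hN ▸
    (continuousOn_extChartAt c).isOpen_inter_preimage (isOpen_extChartAt_source c) hW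
  have hpN : (extChartAt (𝓡 d) c).symm u ∈ N := by
    rw [hN]; exact ⟨hus, by rw [Set.mem_preimage, hr]; exact hu⟩
  obtain ⟨χ, hχ⟩ := (SmoothBumpFunction.nhds_basis_tsupport (I := 𝓡 d)
    ((extChartAt (𝓡 d) c).symm u)).mem_iff.1 (hNo.mem_nhds hpN)
  obtain ⟨s, hs⟩ : ∃ s : VecField d M, s = fun y =>
    (C c (extChartAt (𝓡 d) c y) (Y (extChartAt (𝓡 d) c y)) : Eu d) := ⟨_, rfl⟩
  have hsm : ContMDiffOn (𝓡 d) (𝓡 d).tangent ∞ (fun x => (⟨x, s x⟩ : TangentBundle (𝓡 d) M)) N := by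
    intro y hy
    rw [hN] at hy
    have hyt := (extChartAt (𝓡 d) c).map_source hy.1
    have := contMDiffAt_of_rep (X := s) (Y := Y) hyt (by
      filter_upwards [(isOpen_target c).mem_nhds hyt] with w hw
      rw [hs]
      simp only [(extChartAt (𝓡 d) c).right_inv hw]) (hY.contDiffAt (hW.mem_nhds hy.2))
    rw [(extChartAt (𝓡 d) c).left_inv hy.1] at this
    exact this.contMDiffWithinAt
  refine ⟨(χ : M → ℝ) • s, ?_, ⟨hY.contDiffAt (hW.mem_nhds hu), ?_⟩, fun y => ?_⟩
  · exact ContMDiffOn.smul_section_of_tsupport χ.contMDiff.contMDiffOn hNo hχ.2 hsm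
  · have hc := (contMDiffAt_symm (hWt hu)).continuousAt
    filter_upwards [hc.eventually χ.eventuallyEq_one, (isOpen_target c).mem_nhds (hWt hu)] with w h1 hw
    have : (((χ : M → ℝ) • s) ((extChartAt (𝓡 d) c).symm w) : Eu d)
        = χ ((extChartAt (𝓡 d) c).symm w) • (s ((extChartAt (𝓡 d) c).symm w) : Eu d) := rfl
    refine Eq.trans ?_ this.symm
    rw [h1, hs]
    simp only [(extChartAt (𝓡 d) c).right_inv hw]
    exact (one_smul ℝ (C c w (Y w))).symm
  · by_cases hy : y ∈ N
    · right
      rw [hN] at hy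
      refine ⟨extChartAt (𝓡 d) c y, hy.2, χ y, ((extChartAt (𝓡 d) c).left_inv hy.1).symm, ?_⟩
      rw [hs]; rfl
    · left
      have : χ y = 0 := image_eq_zero_of_notMem_tsupport fun h => hy (hχ.2 h)
      change χ y • s y = 0
      rw [this, zero_smul]

/-- A local submersion that defines the foliation `V`. -/
structure Submersion (n : ℕ) (V : Distribution d M) where
  U : Set M
  isOpen : IsOpen U
  f : M → Eu n
  smooth : ContMDiffOn (𝓡 d) (𝓡 n) ∞ f U
  surj : ∀ x ∈ U, Function.Surjective (mfderiv (𝓡 d) (𝓡 n) f x)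
  ker : ∀ x ∈ U, V x = LinearMap.ker (mfderiv (𝓡 d) (𝓡 n) f x).toLinearMap

variable {V : Distribution d M}

theorem exists_submersion (hV : IsFoliation n V) (x : M) : ∃ P : Submersion n V, x ∈ P.U := by
  obtain ⟨U, hU, hx, f, hf, h⟩ := hV x
  exact ⟨⟨U, hU, f, hf, fun y hy => (h y hy).1, fun y hy => (h y hy).2⟩, hx⟩

namespace Submersion

variable (P : Submersion n V)

/-- The domain of the submersion in the chart at `c`. -/
def W (c : M) : Set (Eu d) := (extChartAt (𝓡 d) c).target ∩ (extChartAt (𝓡 d) c).symm ⁻¹' P.U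

/-- The submersion in the chart at `c`. -/
def fc (c : M) (u : Eu d) : Eu n := P.f ((extChartAt (𝓡 d) c).symm u)

/-- The differentials of the components of the submersion. -/
def θ (c : M) (i : Fin n) (u : Eu d) : Eu d →L[ℝ] ℝ :=
  (EuclideanSpace.proj i : Eu n →L[ℝ] ℝ).comp (fderiv ℝ (P.fc c) u)

theorem isOpen_W (c : M) : IsOpen (P.W c) :=
  (continuousOn_extChartAt_symm c).isOpen_inter_preimage (isOpen_target c) P.isOpen

theorem smooth_fc (c : M) : ContDiffOn ℝ ∞ (P.fc c) (P.W c) := fun u hu =>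
  ((P.smooth.contMDiffAt (P.isOpen.mem_nhds hu.2)).comp u
    (contMDiffAt_symm hu.1)).contDiffAt.contDiffWithinAt

variable {P}

theorem fderiv_fc (hu : u ∈ P.W c) (v : Eu d) : fderiv ℝ (P.fc c) u v
    = mfderiv (𝓡 d) (𝓡 n) P.f ((extChartAt (𝓡 d) c).symm u) (C c u v) :=
  (mfderiv_C hu.1 ((P.smooth.contMDiffAt (P.isOpen.mem_nhds hu.2)).mdifferentiableAt (by simp)) v).symm

theorem θ_apply (i : Fin n) (v : Eu d) : P.θ c i u v = fderiv ℝ (P.fc c) u v i := rfl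

theorem mem_V_iff (hu : u ∈ P.W c) (v : Eu d) :
    (C c u v : Eu d) ∈ (V ((extChartAt (𝓡 d) c).symm u) : Submodule ℝ (TangentSpace (𝓡 d) _))
      ↔ ∀ i, P.θ c i u v = 0 := by
  rw [P.ker _ hu.2]
  refine (LinearMap.mem_ker (f := (mfderiv (𝓡 d) (𝓡 n) P.f
    ((extChartAt (𝓡 d) c).symm u)).toLinearMap)).trans ?_
  have : ((mfderiv (𝓡 d) (𝓡 n) P.f ((extChartAt (𝓡 d) c).symm u)) (C c u v) : Eu n) = 0
      ↔ ∀ i, P.θ c i u v = 0 := by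
    rw [← fderiv_fc hu]
    constructor
    · intro h i; rw [θ_apply, h]; rfl
    · intro h; exact PiLp.ext h
  exact this

theorem smooth_θ (i : Fin n) : ContDiffOn ℝ ∞ (P.θ c i) (P.W c) :=
  contDiffOn_const.clm_comp (contDiffOn_fderiv (P.isOpen_W c) (P.smooth_fc c))

theorem fderiv_θ (hu : u ∈ P.W c) (i : Fin n) (v w : Eu d) :
    fderiv ℝ (P.θ c i) u v w = LocalFoliation.hess (P.fc c) u v w i := by
  have hd := (contDiffOn_fderiv (P.isOpen_W c) (P.smooth_fc c)).differentiableAt' (P.isOpen_W c) hu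
  have : P.θ c i = fun u => (EuclideanSpace.proj i : Eu n →L[ℝ] ℝ).comp (fderiv ℝ (P.fc c) u) := rfl
  rw [this, fderiv_clm_comp (differentiableAt_const _) hd]
  simp [LocalFoliation.hess]

variable (P)

/-- The foliation in the chart at `c`. -/
def pre (g : Metric d M) (c : M) : PreFoliation d n where
  W := P.W c
  isOpen := P.isOpen_W c
  G := chartMetric g c
  θ := P.θ c
  smooth_G := (smooth_chartMetric g c).mono Set.inter_subset_left
  smooth_θ := smooth_θ
  G_symm u _ v w := inn_symm g _ _ _
  G_pos u hu v hv := chartMetric_pos g hu.1 hv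
  closed u hu i v w := by
    rw [fderiv_θ hu, fderiv_θ hu, LocalFoliation.hess_symm (P.isOpen_W c) hu (P.smooth_fc c)]
  surj u hu a := by
    obtain ⟨v, hv⟩ := P.surj _ hu.2 (WithLp.toLp 2 a : Eu n)
    obtain ⟨v', hv'⟩ := C_surj hu.1 v
    refine ⟨v', fun i => ?_⟩
    rw [θ_apply, fderiv_fc hu, hv']
    exact congrArg (fun w : Eu n => w i) hv

/-- The Riemannian totally geodesic foliation in the chart at `c`. -/
def loc [T2Space M] (g : Metric d M) (hg : IsRiemannianTotallyGeodesic g V) (c : M) :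
    LocalFoliation d n :=
  (P.pre g c).toLocalFoliation (by
    intro Y Z hY hZ hYh hZv u hu
    -- Lie derivatives of the metric are local, so the condition at `u` is read off global
    -- extensions that agree with the given fields near `u`.
    obtain ⟨Yg, hYs, hYr, hYm⟩ := exists_field (P.isOpen_W c) Set.inter_subset_left hY hu
    obtain ⟨Zg, hZs, hZr, hZm⟩ := exists_field (P.isOpen_W c) Set.inter_subset_left hZ hu
    have h := hg Yg Zg hYs hZs (fun x => by
      rcases hYm x with h | ⟨w, hw, t, rfl, h⟩
      · rw [h]; exact zero_mem _
      · rw [h]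
        refine Submodule.smul_mem (horizontal g V ((extChartAt (𝓡 d) c).symm w)) t ?_
        intro v hv
        obtain ⟨v', rfl⟩ := C_surj hw.1 v
        have h2 := hYh w hw v' ((mem_V_iff hw v').1 hv)
        rw [(P.pre g c).G_symm w hw] at h2
        exact h2) (fun x => by
      rcases hZm x with h | ⟨w, hw, t, rfl, h⟩
      · rw [h]; exact zero_mem _
      · rw [h]
        exact Submodule.smul_mem (V ((extChartAt (𝓡 d) c).symm w)) t
          ((mem_V_iff hw _).2 (hZv w hw))) ((extChartAt (𝓡 d) c).symm u)
    exact ⟨(lieDerivMetric_C g hu.1 hZr hYr hYr).symm.trans h.1,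
      (lieDerivMetric_C g hu.1 hYr hZr hZr).symm.trans h.2⟩)

/-- The change of coordinates as a map of foliations. -/
def folMap [T2Space M] (g : Metric d M) (hg : IsRiemannianTotallyGeodesic g V) (c y : M) :
    FolMap (P.loc g hg c) (P.loc g hg y) where
  O := overlap c y ∩ P.W c
  isOpen := (isOpen_overlap c y).inter (P.isOpen_W c)
  τ := trans c y
  smooth := (smooth_trans c y).mono Set.inter_subset_left
  sub := Set.inter_subset_right
  maps u hu := ⟨trans_mem_target hu.1, by rw [Set.mem_preimage, symm_trans hu.1]; exact hu.2.2⟩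
  surj u hu := fderiv_trans_surj hu.1
  map_G u hu v w := chartMetric_trans g hu.1 v w
  map_θ u hu i v := by
    have hw : trans c y u ∈ P.W y :=
      ⟨trans_mem_target hu.1, by rw [Set.mem_preimage, symm_trans hu.1]; exact hu.2.2⟩
    change fderiv ℝ (P.fc y) (trans c y u) (fderiv ℝ (trans c y) u v) i = fderiv ℝ (P.fc c) u v i
    rw [fderiv_fc hw, fderiv_fc hu.2, C_comp_apply hu.1, symm_trans hu.1]

end Submersion

end FoliationCharts

end TGFoliation

end

open Bundle Manifold MeasureTheory VectorField
open scoped ContDiff Topology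

noncomputable section

namespace TGFoliation

set_option synthInstance.maxHeartbeats 200000

namespace LocalFoliation

variable {d n : ℕ} {S : LocalFoliation d n} {u : Eu d}

/-! ### The Bott connection -/

theorem hpart_add (v w : Eu d) : S.hpart u (v + w) = S.hpart u v + S.hpart u w := by
  simp [hpart, add_smul, Finset.sum_add_distrib]

theorem hpart_smul (c : ℝ) (v : Eu d) : S.hpart u (c • v) = c • S.hpart u v := by
  simp [hpart, mul_smul, Finset.smul_sum]

theorem vpart_add (v w : Eu d) : S.vpart u (v + w) = S.vpart u v + S.vpart u w := by
  rw [vpart, hpart_add, vpart, vpart]; abel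

theorem vpart_smul (c : ℝ) (v : Eu d) : S.vpart u (c • v) = c • S.vpart u v := by
  rw [vpart, hpart_smul, vpart, smul_sub]

theorem vpart_neg (v : Eu d) : S.vpart u (-v) = - S.vpart u v := by
  rw [← neg_one_smul ℝ, vpart_smul, neg_one_smul]

theorem vpart_sub (v w : Eu d) : S.vpart u (v - w) = S.vpart u v - S.vpart u w := by
  rw [sub_eq_add_neg, vpart_add, vpart_neg, sub_eq_add_neg]

theorem vpart_zero : S.vpart u 0 = 0 := by simp [vpart, hpart]

theorem vpart_sum {ι : Type*} (s : Finset ι) (f : ι → Eu d) :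
    S.vpart u (∑ i ∈ s, f i) = ∑ i ∈ s, S.vpart u (f i) := by
  classical
  induction s using Finset.induction_on with
  | empty => simp [vpart_zero]
  | insert a s ha ih => rw [Finset.sum_insert ha, Finset.sum_insert ha, vpart_add, ih]

theorem θ_hpart (hu : u ∈ S.W) (p : Fin n) (v : Eu d) : S.θ p u (S.hpart u v) = S.θ p u v := by
  simp [hpart, S.θ_X u hu]

theorem vpart_hpart (hu : u ∈ S.W) (v : Eu d) : S.vpart u (S.hpart u v) = 0 := by
  rw [hpart, vpart_sum]
  simp [vpart_smul, vpart_X hu]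

/-- Two vectors agree if their horizontal coefficients and vertical parts agree. -/
theorem ext_parts {v w : Eu d} (h : ∀ p, S.θ p u v = S.θ p u w) (h' : S.vpart u v = S.vpart u w) :
    v = w := by
  rw [← hpart_add_vpart (S := S) (u := u) v, ← hpart_add_vpart (S := S) (u := u) w, h', hpart, hpart]
  simp only [h]

theorem θ_eq (hu : u ∈ S.W) (p : Fin n) (v : Eu d) :
    S.θ p u v = ∑ j, S.G u v (S.X j u) * S.h j p u := by
  simp only [S.G_symm u hu v, G_X_apply hu, Finset.sum_mul]
  rw [Finset.sum_comm]
  have : ∀ k j, S.H j k u * S.θ k u v * S.h j p u = S.θ k u v * (S.H k j u * S.h j p u) :=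
    fun k j => by rw [H_symm hu j k]; ring
  simp only [this, ← Finset.mul_sum, H_mul_h hu]
  simp

theorem lc_sum_left {ι : Type*} (s : Finset ι) (c : ι → ℝ) (a : ι → Eu d) (b : Eu d) :
    S.lc u (∑ i ∈ s, c i • a i) b = ∑ i ∈ s, c i • S.lc u (a i) b := by
  have e : S.lcForm u (∑ i ∈ s, c i • a i) b = ∑ i ∈ s, c i • S.lcForm u (a i) b := by
    ext w
    simp only [lcForm_apply, map_sum, map_smul, _root_.sum_apply, _root_.smul_apply, smul_eq_mul,
      Finset.mul_sum, ← Finset.sum_add_distrib, ← Finset.sum_sub_distrib]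
    exact Finset.sum_congr rfl fun i _ => by ring
  have h : ∀ (Q : Matrix (Fin d) (Fin d) ℝ) (φ : ι → Eu d →L[ℝ] ℝ),
      sharpQ Q (∑ i ∈ s, c i • φ i) = ∑ i ∈ s, c i • sharpQ Q (φ i) := by
    intro Q φ
    clear e
    classical
    induction s using Finset.induction_on with
    | empty => simp [sharpQ]
    | insert a s ha ih =>
      rw [Finset.sum_insert ha, Finset.sum_insert ha, ← ih]
      simp [sharpQ, mul_add, add_smul, Finset.sum_add_distrib, Finset.smul_sum, smul_smul,
        mul_left_comm]
  rw [lc, e, h]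
  rfl

theorem lc_sum_right (hu : u ∈ S.W) {ι : Type*} (s : Finset ι) (c : ι → ℝ) (a : ι → Eu d) (b : Eu d) :
    S.lc u b (∑ i ∈ s, c i • a i) = ∑ i ∈ s, c i • S.lc u b (a i) := by
  rw [lc_symm hu, lc_sum_left]
  simp only [lc_symm hu b]

/-- The Koszul formula on the horizontal frame: brackets of the frame are vertical and drop out of
horizontal pairings, leaving the transverse Christoffel symbols. -/
theorem chr_eq (hu : u ∈ S.W) (p k i : Fin n) :
    S.θ p u (fderiv ℝ (S.X i) u (S.X k u) + S.lc u (S.X k u) (S.X i u)) = S.chr p k i u := by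
  rw [θ_eq hu, chr]
  refine Finset.sum_congr rfl fun j _ => ?_
  congr 1
  have hT : ∀ a b c, S.G u (fderiv ℝ (S.X a) u (S.X b u)) (S.X c u)
      = S.G u (fderiv ℝ (S.X b) u (S.X a u)) (S.X c u) := fun a b c => by
    have := G_X' hu c (T_vert hu a b)
    rw [T, ContinuousLinearMap.map_sub, _root_.sub_apply] at this
    linarith
  rw [ContinuousLinearMap.map_add, _root_.add_apply, G_lc hu, lcForm_apply, chr1, fderiv_H hu,
    fderiv_H hu, fderiv_H hu, S.G_symm u hu (S.X i u), S.G_symm u hu (S.X k u) (fderiv _ _ _ _),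
    S.G_symm u hu (S.X k u) (fderiv _ _ _ _)]
  linarith [hT i k j, hT j k i, hT j i k, hT k j i]

/-- The horizontal part of a vector field. -/
def hf (S : LocalFoliation d n) (A : Eu d → Eu d) (u : Eu d) : Eu d := S.hpart u (A u)

/-- The vertical part of a vector field. -/
def vf (S : LocalFoliation d n) (A : Eu d → Eu d) (u : Eu d) : Eu d := S.vpart u (A u)

/-- The coefficient functions of the horizontal part of a vector field. -/
def cf (S : LocalFoliation d n) (A : Eu d → Eu d) (i : Fin n) (u : Eu d) : ℝ := S.θ i u (A u)

/-- The Bott connection. -/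
def bott (S : LocalFoliation d n) (A B : Eu d → Eu d) (u : Eu d) : Eu d :=
  S.hpart u (fderiv ℝ (S.hf B) u (S.hf A u) + S.lc u (S.hf A u) (S.hf B u))
    + S.hpart u (fderiv ℝ (S.hf B) u (S.vf A u) - fderiv ℝ (S.vf A) u (S.hf B u))
    + S.vpart u (fderiv ℝ (S.vf B) u (S.hf A u) - fderiv ℝ (S.hf A) u (S.vf B u))
    + S.vpart u (fderiv ℝ (S.vf B) u (S.vf A u) + S.lc u (S.vf A u) (S.vf B u))

variable {A B : Eu d → Eu d}

theorem smooth_cf (hA : ContDiffOn ℝ ∞ A S.W) (i : Fin n) : ContDiffOn ℝ ∞ (S.cf A i) S.W :=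
  (S.smooth_θ i).clm_apply hA

theorem smooth_hf (hA : ContDiffOn ℝ ∞ A S.W) : ContDiffOn ℝ ∞ (S.hf A) S.W := by
  have hs : ∀ i, ContDiffOn ℝ ∞ (fun u => S.cf A i u • S.X i u) S.W := fun i =>
    (smooth_cf hA i).smul (S.smooth_X i)
  have e : S.hf A = fun u => ∑ i, S.cf A i u • S.X i u := rfl
  rw [e]
  exact ContDiffOn.sum fun i _ => hs i

theorem smooth_vf (hA : ContDiffOn ℝ ∞ A S.W) : ContDiffOn ℝ ∞ (S.vf A) S.W :=
  hA.sub (smooth_hf hA)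

theorem hf_eq (A : Eu d → Eu d) (u : Eu d) : S.hf A u = ∑ i, S.cf A i u • S.X i u := rfl

theorem fderiv_hf (hu : u ∈ S.W) (hA : ContDiffOn ℝ ∞ A S.W) (v : Eu d) :
    fderiv ℝ (S.hf A) u v
      = ∑ i, (fderiv ℝ (S.cf A i) u v • S.X i u + S.cf A i u • fderiv ℝ (S.X i) u v) := by
  have hW := S.isOpen
  have e : S.hf A = fun u => ∑ i, S.cf A i u • S.X i u := rfl
  have hs : ∀ i, DifferentiableAt ℝ (fun u => S.cf A i u • S.X i u) u := fun i =>
    ((smooth_cf hA i).smul (S.smooth_X i)).differentiableAt' hW hu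
  rw [e, fderiv_fun_sum fun i _ => hs i, _root_.sum_apply]
  refine Finset.sum_congr rfl fun i _ => ?_
  rw [fderiv_fun_smul ((smooth_cf hA i).differentiableAt' hW hu) (diffX hu i)]
  simp [add_comm]

theorem vert_vf (hu : u ∈ S.W) (A : Eu d → Eu d) : S.IsVert u (S.vf A u) := vpart_vert hu _

theorem hf_add_vf (A : Eu d → Eu d) (u : Eu d) : S.hf A u + S.vf A u = A u := hpart_add_vpart _

/-- Horizontally the Bott connection is the pullback of the transverse Levi-Civita connection: along
the leaves it only differentiates the coefficients in the basic frame. -/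
theorem θ_bott (hu : u ∈ S.W) (hA : ContDiffOn ℝ ∞ A S.W) (hB : ContDiffOn ℝ ∞ B S.W) (p : Fin n) :
    S.θ p u (S.bott A B u) = fderiv ℝ (S.cf B p) u (A u)
      + ∑ k, ∑ i, S.cf A k u * S.cf B i u * S.chr p k i u := by
  have h1 : S.θ p u (fderiv ℝ (S.hf B) u (S.hf A u) + S.lc u (S.hf A u) (S.hf B u))
      = fderiv ℝ (S.cf B p) u (S.hf A u)
        + ∑ k, ∑ i, S.cf A k u * S.cf B i u * S.chr p k i u := by
    rw [hf_eq B, lc_sum_right hu, fderiv_hf hu hB]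
    rw [ContinuousLinearMap.map_add, map_sum, map_sum]
    simp only [ContinuousLinearMap.map_add, ContinuousLinearMap.map_smul, S.θ_X u hu, smul_eq_mul,
      mul_ite, mul_one, mul_zero, Finset.sum_add_distrib, Finset.sum_ite_eq, Finset.mem_univ, if_true]
    rw [add_assoc, ← Finset.sum_add_distrib]
    congr 1
    rw [Finset.sum_comm]
    refine Finset.sum_congr rfl fun i _ => ?_
    rw [hf_eq A, lc_sum_left, map_sum, map_sum, map_sum, Finset.mul_sum, Finset.mul_sum,
      ← Finset.sum_add_distrib]
    refine Finset.sum_congr rfl fun k _ => ?_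
    rw [← chr_eq hu, ContinuousLinearMap.map_add]
    simp only [ContinuousLinearMap.map_smul, smul_eq_mul]
    ring
  have h2 : S.θ p u (fderiv ℝ (S.hf B) u (S.vf A u) - fderiv ℝ (S.vf A) u (S.hf B u))
      = fderiv ℝ (S.cf B p) u (S.vf A u) := by
    have hv : ∀ i, S.θ p u (fderiv ℝ (S.vf A) u (S.X i u)) = S.θ p u (fderiv ℝ (S.X i) u (S.vf A u)) :=
      fun i => by
        have := lie_vert hu (smooth_vf hA) (fun y hy => vert_vf hy A) i p
        rw [ContinuousLinearMap.map_sub] at this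
        linarith
    rw [hf_eq B, fderiv_hf hu hB, map_sum, ContinuousLinearMap.map_sub, map_sum, map_sum]
    simp only [ContinuousLinearMap.map_add, ContinuousLinearMap.map_smul, S.θ_X u hu, smul_eq_mul, hv,
      mul_ite, mul_one, mul_zero, Finset.sum_add_distrib, Finset.sum_ite_eq, Finset.mem_univ, if_true]
    ring
  rw [bott]
  simp only [ContinuousLinearMap.map_add, θ_hpart hu, vpart_vert hu _ p, add_zero]
  have h3 : fderiv ℝ (S.cf B p) u (A u)
      = fderiv ℝ (S.cf B p) u (S.hf A u) + fderiv ℝ (S.cf B p) u (S.vf A u) := by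
    rw [← ContinuousLinearMap.map_add, hf_add_vf]
  rw [← ContinuousLinearMap.map_add, h1, h2, h3]
  ring

/-- Derivatives of the horizontal coefficients of `A` multiply frame vectors and are killed by the
vertical projection. This leaves brackets with the frame and the leafwise Christoffel term. -/
theorem vpart_bott (hu : u ∈ S.W) (hA : ContDiffOn ℝ ∞ A S.W) :
    S.vpart u (S.bott A B u) = S.vpart u (fderiv ℝ (S.vf B) u (A u)
      - ∑ k, S.cf A k u • fderiv ℝ (S.X k) u (S.vf B u) + S.lc u (S.vf A u) (S.vf B u)) := by
  have hvv : ∀ v, S.vpart u (S.vpart u v) = S.vpart u v := fun v => vpart_of_vert (vpart_vert hu v)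
  rw [bott, vpart_add, vpart_add, vpart_add, vpart_hpart hu, vpart_hpart hu, hvv, hvv, zero_add,
    zero_add]
  rw [fderiv_hf hu hA]
  have h3 : fderiv ℝ (S.vf B) u (A u)
      = fderiv ℝ (S.vf B) u (S.hf A u) + fderiv ℝ (S.vf B) u (S.vf A u) := by
    rw [← ContinuousLinearMap.map_add, hf_add_vf]
  rw [h3]
  simp only [vpart_add, vpart_sub, vpart_sum, vpart_smul, vpart_X hu, ContinuousLinearMap.map_add,
    smul_zero, zero_add]
  abel

/-- The Bott connection, applied to fields that are constant or horizontal. -/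
theorem fderiv_vf_of_horizontal (hu : u ∈ S.W) (hB : ∀ y ∈ S.W, S.vf B y = 0) (v : Eu d) :
    fderiv ℝ (S.vf B) u v = 0 := by
  have : S.vf B =ᶠ[𝓝 u] fun _ => 0 := by
    filter_upwards [S.isOpen.mem_nhds hu] with y hy using hB y hy
  rw [this.fderiv_eq]; simp

/-- The torsion of the Bott connection. -/
def tor (S : LocalFoliation d n) (u v w : Eu d) : Eu d :=
  ∑ i, ∑ j, (S.θ i u v * S.θ j u w) • S.T i j u

/-- The endomorphisms `J_z`. -/
def Jop (S : LocalFoliation d n) (u z v : Eu d) : Eu d :=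
  ∑ k, ∑ l, (S.θ k u v * S.psi k l u z) • S.X l u

theorem θ_tor (hu : u ∈ S.W) (p : Fin n) (v w : Eu d) : S.θ p u (S.tor u v w) = 0 := by
  simp [tor, T_vert hu _ _ p]

theorem vpart_tor (hu : u ∈ S.W) (v w : Eu d) : S.vpart u (S.tor u v w) = S.tor u v w :=
  vpart_of_vert fun p => θ_tor hu p v w

theorem θ_Jop (hu : u ∈ S.W) (p : Fin n) (z v : Eu d) :
    S.θ p u (S.Jop u z v) = ∑ k, S.θ k u v * S.psi k p u z := by
  simp [Jop, S.θ_X u hu]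

theorem vpart_Jop (hu : u ∈ S.W) (z v : Eu d) : S.vpart u (S.Jop u z v) = 0 := by
  simp [Jop, vpart_sum, vpart_smul, vpart_X hu]

theorem G_Jop (hu : u ∈ S.W) (z v w : Eu d) :
    S.G u (S.Jop u z v) w = S.G u z (S.tor u v w) := by
  simp only [Jop, tor, map_sum, map_smul, _root_.sum_apply, _root_.smul_apply, smul_eq_mul,
    G_X_apply hu]
  refine Finset.sum_congr rfl fun k _ => ?_
  have : ∀ l, S.θ k u v * S.psi k l u z * ∑ q, S.H l q u * S.θ q u w
      = ∑ q, S.θ k u v * S.θ q u w * (S.psi k l u z * S.H l q u) := fun l => by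
    rw [Finset.mul_sum]
    exact Finset.sum_congr rfl fun q _ => by ring
  rw [Finset.sum_congr rfl fun l _ => this l, Finset.sum_comm]
  refine Finset.sum_congr rfl fun q _ => ?_
  rw [← Finset.mul_sum, psi_lower hu, S.G_symm u hu z]

theorem cf_const (w : Eu d) (i : Fin n) (u : Eu d) : S.cf (fun _ => w) i u = S.θ i u w := rfl

theorem fderiv_cf_const (hu : u ∈ S.W) (w : Eu d) (p : Fin n) (v : Eu d) :
    fderiv ℝ (S.cf (fun _ => w) p) u v = fderiv ℝ (S.θ p) u v w := by
  have := fderiv_apply_field (diffθ hu p) (differentiableAt_const w) v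
  rw [show S.cf (fun _ => w) p = fun y => S.θ p y w from rfl, this]
  simp

/-- The connection `∇^ε`, along horizontal vectors. -/
theorem bott_sub_tor (hu : u ∈ S.W) (ε : ℝ) {v : Eu d} (hv : S.vpart u v = 0) (w : Eu d) :
    S.bott (fun _ => v) (fun _ => w) u - S.tor u v w + ε⁻¹ • S.Jop u w v
      = ∑ j, S.θ j u v • S.conn ε j u w := by
  have hc : ∀ w : Eu d, ContDiffOn ℝ ∞ (fun _ : Eu d => w) S.W := fun w => contDiffOn_const
  have hvX : v = ∑ j, S.θ j u v • S.X j u := by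
    conv_lhs => rw [← hpart_add_vpart (S := S) (u := u) v, hv, add_zero, hpart]
  refine ext_parts (S := S) (u := u) (fun p => ?_) ?_
  -- Horizontal components: closedness of θ_p exchanges its two arguments, after which the
  -- derivative falls on the frame as in the connection matrix.
  · have e : fderiv ℝ (S.θ p) u v w = - ∑ j, S.θ j u v * S.θ p u (fderiv ℝ (S.X j) u w) := by
      rw [S.closed u hu]
      conv_lhs => rw [hvX]
      rw [map_sum, ← Finset.sum_neg_distrib]
      refine Finset.sum_congr rfl fun j _ => ?_
      rw [ContinuousLinearMap.map_smul, fderiv_θ_X hu]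
      simp
    simp only [ContinuousLinearMap.map_add, ContinuousLinearMap.map_sub,
      ContinuousLinearMap.map_smul, θ_tor hu, θ_Jop hu, θ_bott hu (hc v) (hc w), fderiv_cf_const hu,
      cf_const, map_sum, conn_apply, S.θ_X u hu, e, smul_eq_mul, mul_ite, mul_one, mul_zero,
      Finset.sum_ite_eq, Finset.mem_univ, if_true, mul_sub, Finset.sum_sub_distrib]
    have e2 : ∀ j, S.om ε j p u w = ∑ i, S.chr p i j u * S.θ i u w + ε⁻¹ * S.psi j p u w := fun j => by
      simp [om]
    have e3 : ∑ j, S.θ j u v * S.om ε j p u w = ∑ k, ∑ i, S.θ k u v * S.θ i u w * S.chr p k i u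
        + ε⁻¹ * ∑ k, S.θ k u v * S.psi k p u w := by
      rw [Finset.mul_sum, ← Finset.sum_add_distrib]
      refine Finset.sum_congr rfl fun j _ => ?_
      rw [e2, mul_add, Finset.mul_sum]
      congr 1
      · exact Finset.sum_congr rfl fun i _ => by rw [chr_symm hu p i j]; ring
      · ring
    rw [e3]
    ring
  · have hvf : S.vf (fun _ => v) u = 0 := hv
    have hlc : S.lc u 0 (S.vf (fun _ => w) u) = 0 := by
      have : S.lcForm u 0 (S.vf (fun _ => w) u) = 0 := by ext c; simp [lcForm_apply]
      simp [lc, this, sharpQ]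
    have e1 : fderiv ℝ (S.vf fun _ => w) u v = - fderiv ℝ (S.hf fun _ => w) u v := by
      have : S.vf (fun _ => w) = fun y => w - S.hf (fun _ => w) y := rfl
      rw [this, fderiv_const_sub]; rfl
    have e2 : S.vf (fun _ => w) u = w - ∑ i, S.θ i u w • S.X i u := rfl
    rw [vpart_add, vpart_sub, vpart_bott hu (hc v), hvf, hlc, add_zero, vpart_smul, vpart_Jop hu,
      smul_zero, add_zero, vpart_tor hu, e1, fderiv_hf hu (hc w), e2]
    have e3 : ∀ i, fderiv ℝ (S.X i) u v = ∑ k, S.θ k u v • fderiv ℝ (S.X i) u (S.X k u) := fun i => by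
      conv_lhs => rw [hvX]
      simp
    simp only [vpart_sub, vpart_add, vpart_neg, vpart_sum, vpart_smul, vpart_X hu, smul_zero, zero_add,
      conn_apply, ContinuousLinearMap.map_sub, map_sum, ContinuousLinearMap.map_smul, zero_sub, cf_const,
      Finset.sum_const_zero, e3]
    -- Vertical components: the terms DX_i(X_k) are weighted by θ_i(w) θ_k(v), and subtracting the
    -- torsion replaces them by DX_k(X_i), as the connection matrix requires.
    have e4 : S.tor u v w = S.vpart u (S.tor u v w) := (vpart_tor hu v w).symm
    rw [e4, tor]
    simp only [vpart_sum, vpart_smul, T, vpart_sub, smul_sub, Finset.smul_sum, smul_smul,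
      Finset.sum_sub_distrib, smul_neg, Finset.sum_neg_distrib]
    rw [Finset.sum_comm (f := fun i k => (S.θ i u w * S.θ k u v) •
      S.vpart u (fderiv ℝ (S.X i) u (S.X k u)))]
    simp only [mul_comm (S.θ _ u w)]
    abel

/-- The covariant derivative of `J`. -/
def nablaJop (S : LocalFoliation d n) (u v w a : Eu d) : Eu d :=
  S.bott (fun _ => v) (fun y => S.Jop y w a) u - S.Jop u (S.bott (fun _ => v) (fun _ => w) u) a
    - S.Jop u w (S.bott (fun _ => v) (fun _ => a) u)

theorem smooth_Jop (w a : Eu d) : ContDiffOn ℝ ∞ (fun y => S.Jop y w a) S.W := by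
  have hs : ∀ k l, ContDiffOn ℝ ∞ (fun u => (S.θ k u a * S.psi k l u w) • S.X l u) S.W :=
    fun k l => (((S.smooth_θ k).clm_apply contDiffOn_const).mul
      ((smooth_psi k l).clm_apply contDiffOn_const)).smul (S.smooth_X l)
  have e : (fun y => S.Jop y w a) = fun u => ∑ k, ∑ l, (S.θ k u a * S.psi k l u w) • S.X l u := rfl
  rw [e]
  exact ContDiffOn.sum fun k _ => ContDiffOn.sum fun l _ => hs k l

theorem vpart_nablaJop (hu : u ∈ S.W) (v w a : Eu d) : S.vpart u (S.nablaJop u v w a) = 0 := by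
  have hB : ∀ y ∈ S.W, S.vf (fun y => S.Jop y w a) y = 0 := fun y hy => vpart_Jop hy w a
  have hlc : S.lc u (S.vf (fun _ => v) u) 0 = 0 := by
    have : S.lcForm u (S.vf (fun _ => v) u) 0 = 0 := by ext c; simp [lcForm_apply]
    simp [lc, this, sharpQ]
  rw [nablaJop, vpart_sub, vpart_sub, vpart_Jop hu, vpart_Jop hu, vpart_bott hu contDiffOn_const,
    fderiv_vf_of_horizontal hu hB, hB u hu, hlc]
  simp [vpart_zero]

/-- Leibniz rule: the derivatives of the coefficients θ_k(a) cancel against those in the covariant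
derivative of the constant field `a`, and the remaining coefficients are the components of ∇J. -/
theorem θ_nablaJop (hu : u ∈ S.W) (v w a : Eu d) (l : Fin n) :
    S.θ l u (S.nablaJop u v w a) = ∑ k, S.θ k u a * S.dJ k l u v w := by
  have hW := S.isOpen
  have hc : ∀ w : Eu d, ContDiffOn ℝ ∞ (fun _ : Eu d => w) S.W := fun w => contDiffOn_const
  have hψ : ∀ k l, DifferentiableAt ℝ (S.psi k l) u := fun k l =>
    (smooth_psi k l).differentiableAt' hW hu
  have hcJ : ∀ p, ∀ y ∈ S.W, S.cf (fun y => S.Jop y w a) p y = ∑ k, S.θ k y a * S.psi k p y w :=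
    fun p y hy => θ_Jop hy p w a
  have h1 : fderiv ℝ (S.cf (fun y => S.Jop y w a) l) u v
      = ∑ k, (fderiv ℝ (S.θ k) u v a * S.psi k l u w + S.θ k u a * fderiv ℝ (S.psi k l) u v w) := by
    have e : S.cf (fun y => S.Jop y w a) l =ᶠ[𝓝 u] fun y => ∑ k, S.θ k y a * S.psi k l y w := by
      filter_upwards [hW.mem_nhds hu] with y hy using hcJ l y hy
    have d1 : ∀ k, DifferentiableAt ℝ (fun y => S.θ k y a) u := fun k =>
      (diffθ hu k).clm_apply (differentiableAt_const a)
    have d2 : ∀ k, DifferentiableAt ℝ (fun y => S.psi k l y w) u := fun k =>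
      (hψ k l).clm_apply (differentiableAt_const w)
    have d3 : ∀ k, DifferentiableAt ℝ (fun y => S.θ k y a * S.psi k l y w) u := fun k =>
      (d1 k).mul (d2 k)
    rw [e.fderiv_eq, fderiv_fun_sum fun k _ => d3 k, _root_.sum_apply]
    refine Finset.sum_congr rfl fun k _ => ?_
    rw [fderiv_fun_mul (d1 k) (d2 k)]
    have e1 : fderiv ℝ (fun y => S.θ k y a) u v = fderiv ℝ (S.θ k) u v a := by
      rw [fderiv_apply_field (diffθ hu k) (differentiableAt_const a)]; simp
    have e2 : fderiv ℝ (fun y => S.psi k l y w) u v = fderiv ℝ (S.psi k l) u v w := by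
      rw [fderiv_apply_field (hψ k l) (differentiableAt_const w)]; simp
    simp only [_root_.add_apply, _root_.smul_apply, e1, e2, smul_eq_mul]
    ring
  -- The derivative of the vertical part of the constant field `w` appears in both terms on the left
  -- and cancels; what remains depends on `w` through its vertical part.
  have h2 : ∀ k, fderiv ℝ (S.psi k l) u v w - S.psi k l u (S.bott (fun _ => v) (fun _ => w) u)
      = ∑ q, S.θ q u v * (fderiv ℝ (S.psi k l) u (S.X q u) (S.vpart u w)
        + S.psi k l u (fderiv ℝ (S.X q) u (S.vpart u w))) + S.vJ k l u (S.vpart u v) (S.vpart u w) := by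
    intro k
    have e1 : fderiv ℝ (S.psi k l) u v w = fderiv ℝ (S.psi k l) u v (S.vpart u w)
        + S.psi k l u (fderiv ℝ (S.vf fun _ => w) u v) := by
      have e : (fun y => S.psi k l y w) =ᶠ[𝓝 u] fun y => S.psi k l y (S.vf (fun _ => w) y) := by
        filter_upwards [hW.mem_nhds hu] with y hy
        exact (psi_vpart hy k l w).symm
      have e' := e.fderiv_eq (𝕜 := ℝ)
      have := DFunLike.congr_fun e' v
      rw [fderiv_apply_field (hψ k l) (differentiableAt_const w),
        fderiv_apply_field (hψ k l) ((smooth_vf (hc w)).differentiableAt' hW hu)] at this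
      have e3 : S.vf (fun _ => w) u = S.vpart u w := rfl
      simpa [e3] using this
    have e2 : S.psi k l u (S.bott (fun _ => v) (fun _ => w) u)
        = S.psi k l u (fderiv ℝ (S.vf fun _ => w) u v)
          - ∑ q, S.θ q u v * S.psi k l u (fderiv ℝ (S.X q) u (S.vpart u w))
          + S.psi k l u (S.lc u (S.vpart u v) (S.vpart u w)) := by
      rw [← psi_vpart hu, vpart_bott hu (hc v), psi_vpart hu]
      simp only [ContinuousLinearMap.map_add, ContinuousLinearMap.map_sub, map_sum,
        ContinuousLinearMap.map_smul, cf_const, smul_eq_mul]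
      rfl
    have e3 : fderiv ℝ (S.psi k l) u v (S.vpart u w)
        = ∑ q, S.θ q u v * fderiv ℝ (S.psi k l) u (S.X q u) (S.vpart u w)
          + fderiv ℝ (S.psi k l) u (S.vpart u v) (S.vpart u w) := by
      conv_lhs => rw [← hpart_add_vpart (S := S) (u := u) v, ContinuousLinearMap.map_add, hpart]
      simp [_root_.sum_apply]
    rw [e1, e2, e3, vJ]
    simp only [mul_add, Finset.sum_add_distrib]
    ring
  rw [nablaJop, ContinuousLinearMap.map_sub, ContinuousLinearMap.map_sub, θ_Jop hu, θ_Jop hu,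
    θ_bott hu (hc v) (smooth_Jop w a), h1]
  simp only [hcJ _ u hu, θ_bott hu (hc v) (hc a), fderiv_cf_const hu, cf_const]
  have h3 : ∀ k, S.dJ k l u v w = (fderiv ℝ (S.psi k l) u v w
      - S.psi k l u (S.bott (fun _ => v) (fun _ => w) u))
      + ∑ q, ∑ p, S.θ q u v * (S.psi k p u w * S.chr l q p u - S.psi p l u w * S.chr p q k u) := by
    intro k
    rw [h2, dJ]
    simp only [mul_add, Finset.sum_add_distrib, Finset.mul_sum]
    ring
  simp only [h3]
  have h4 : ∑ q, ∑ p, S.θ q u v * (∑ k, S.θ k u a * S.psi k p u w) * S.chr l q p u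
      = ∑ k, S.θ k u a * ∑ q, ∑ p, S.θ q u v * (S.psi k p u w * S.chr l q p u) := by
    simp only [Finset.mul_sum, Finset.sum_mul]
    rw [Finset.sum_congr rfl fun q _ => Finset.sum_comm]
    rw [Finset.sum_comm]
    exact Finset.sum_congr rfl fun k _ => Finset.sum_congr rfl fun q _ =>
      Finset.sum_congr rfl fun p _ => by ring
  have h5 : ∑ k, (∑ q, ∑ p, S.θ q u v * S.θ p u a * S.chr k q p u) * S.psi k l u w
      = ∑ k, S.θ k u a * ∑ q, ∑ p, S.θ q u v * (S.psi p l u w * S.chr p q k u) := by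
    simp only [Finset.mul_sum, Finset.sum_mul]
    rw [Finset.sum_comm, Finset.sum_congr rfl fun q _ => Finset.sum_comm, Finset.sum_comm]
    exact Finset.sum_congr rfl fun k _ => Finset.sum_congr rfl fun q _ =>
      Finset.sum_congr rfl fun p _ => by ring
  rw [h4]
  simp only [mul_sub, mul_add, add_mul, Finset.sum_sub_distrib, Finset.sum_add_distrib, h5]
  ring

end LocalFoliation

end TGFoliation

end

/-! ### Projections, Levi-Civita and Bott connections of M in charts. -/

open Bundle Manifold MeasureTheory VectorField
open scoped ContDiff Topology

noncomputable section

namespace TGFoliation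

set_option synthInstance.maxHeartbeats 200000

section Pointwise

variable {d n : ℕ} {M : Type*} [TopologicalSpace M] [ChartedSpace (Eu d) M]
  [IsManifold (𝓡 d) ∞ M] {u : Eu d} {c y z x : M} {k : ℕ} {V : Distribution d M}

theorem ext_C (v : Eu d) (hu : u ∈ (extChartAt (𝓡 d) x).target) :
    C x u v = (ext (x := x) v ((extChartAt (𝓡 d) x).symm u) : Eu d) := by
  have h1 := trivializationAt_C (mem_extChartAt_target (I := 𝓡 d) x) v
  rw [C_self, extChartAt_to_inv] at h1
  have h := symm_mem_source hu
  have e := symmL_eq hu v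
  have e1 : (ext (x := x) v ((extChartAt (𝓡 d) x).symm u) : Eu d)
      = (trivializationAt (Eu d) (TangentSpace (𝓡 d)) x).symm ((extChartAt (𝓡 d) x).symm u)
        (trivializationAt (Eu d) (TangentSpace (𝓡 d)) x ⟨x, v⟩).2 := rfl
  have h1' : (trivializationAt (Eu d) (TangentSpace (𝓡 d)) x ⟨x, v⟩).2 = v := h1
  rw [e1, h1', ← e]
  exact Trivialization.symmL_apply _ (by simpa using h) v

theorem ext_self (v : Eu d) : (ext (x := x) v x : Eu d) = v :=
  FiberBundle.extend_apply_self (F := Eu d) (E := (TangentSpace (𝓡 d) : M → Type _)) v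

theorem projV_eq (g : Metric d M) {a b : TangentSpace (𝓡 d) y} (ha : a ∈ V y)
    (hb : b ∈ horizontal g V y) : projV g V y (a + b) = a := by
  rw [map_add, projV, Submodule.projection_apply_of_mem_left _ ha,
    Submodule.projection_apply_of_mem_right _ hb, add_zero]

theorem projH_eq (g : Metric d M) {a b : TangentSpace (𝓡 d) y} (ha : a ∈ V y)
    (hb : b ∈ horizontal g V y) : projH g V y (a + b) = b := by
  rw [map_add, projH, Submodule.projection_apply_of_mem_left _ hb,
    Submodule.projection_apply_of_mem_right _ ha, zero_add]

theorem sharp_eq (g : Metric d M) {a : Eu d} {φ : TangentSpace (𝓡 d) x → ℝ}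
    (h : ∀ w : Eu d, φ w = inn g x a w) : (sharp g x φ : Eu d) = a := by
  have hdet : (gramE (inn g x)).det ≠ 0 :=
    (gramE_det_pos (inn_symm g x) fun v hv => inn_pos g x hv).ne'
  refine Eq.trans ?_ (sharpQ_gramE hdet (v := a) (φ := inn g x a) fun w => rfl)
  have : (sharp g x φ : Eu d)
      = ∑ i, ∑ j, ((gramE (inn g x))⁻¹ i j * φ (eb i : Eu d)) • (eb j : Eu d) := rfl
  rw [this, sharpQ]
  exact Finset.sum_congr rfl fun i _ => Finset.sum_congr rfl fun j _ => by rw [h]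

variable [T2Space M] (P : Submersion n V) (g : Metric d M) (hg : IsRiemannianTotallyGeodesic g V)

namespace Submersion

variable {P} {g} {hg}

theorem vert_mem (hu : u ∈ P.W c) (v : Eu d) :
    (C c u ((P.loc g hg c).vpart u v) : Eu d) ∈ (V ((extChartAt (𝓡 d) c).symm u) :
      Submodule ℝ (TangentSpace (𝓡 d) _)) :=
  (mem_V_iff hu _).2 (LocalFoliation.vpart_vert (S := P.loc g hg c) hu v)

theorem hor_mem (hu : u ∈ P.W c) (v : Eu d) :
    (C c u ((P.loc g hg c).hpart u v) : Eu d) ∈ (horizontal g V ((extChartAt (𝓡 d) c).symm u) :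
      Submodule ℝ (TangentSpace (𝓡 d) _)) := by
  intro w hw
  obtain ⟨w', rfl⟩ := C_surj hu.1 w
  have h := (mem_V_iff hu w').1 hw
  have h2 : (P.loc g hg c).G u w' ((P.loc g hg c).hpart u v) = 0 := by
    rw [LocalFoliation.hpart, map_sum]
    refine Finset.sum_eq_zero fun i _ => ?_
    rw [ContinuousLinearMap.map_smul, LocalFoliation.G_X' (S := P.loc g hg c) hu i h, smul_zero]
  exact h2

theorem C_parts (v : Eu d) : C c u v
    = C c u ((P.loc g hg c).vpart u v) + C c u ((P.loc g hg c).hpart u v) := by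
  rw [← ContinuousLinearMap.map_add, add_comm, LocalFoliation.hpart_add_vpart]

theorem projV_C (hu : u ∈ P.W c) (v : Eu d) :
    (projV g V ((extChartAt (𝓡 d) c).symm u) (C c u v : Eu d) : Eu d)
      = C c u ((P.loc g hg c).vpart u v) :=
  (congrArg (fun w : Eu d => (projV g V ((extChartAt (𝓡 d) c).symm u) w : Eu d))
    (C_parts (P := P) (g := g) (hg := hg) v)).trans (projV_eq g (vert_mem hu v) (hor_mem hu v))

theorem projH_C (hu : u ∈ P.W c) (v : Eu d) :
    (projH g V ((extChartAt (𝓡 d) c).symm u) (C c u v : Eu d) : Eu d)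
      = C c u ((P.loc g hg c).hpart u v) :=
  (congrArg (fun w : Eu d => (projH g V ((extChartAt (𝓡 d) c).symm u) w : Eu d))
    (C_parts (P := P) (g := g) (hg := hg) v)).trans (projH_eq g (vert_mem hu v) (hor_mem hu v))

theorem pt_mem (hx : x ∈ P.U) : pt x ∈ P.W x :=
  ⟨mem_extChartAt_target x, by rw [Set.mem_preimage, extChartAt_to_inv]; exact hx⟩

theorem projV_pt (hx : x ∈ P.U) (v : Eu d) :
    (projV g V x (v : Eu d) : Eu d) = (P.loc g hg x).vpart (pt x) v := by
  have := projV_C (g := g) (hg := hg) (pt_mem hx) v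
  rw [C_self, extChartAt_to_inv] at this
  exact this

theorem projH_pt (hx : x ∈ P.U) (v : Eu d) :
    (projH g V x (v : Eu d) : Eu d) = (P.loc g hg x).hpart (pt x) v := by
  have := projH_C (g := g) (hg := hg) (pt_mem hx) v
  rw [C_self, extChartAt_to_inv] at this
  exact this

variable (P)

/-- The function `Y` represents the vector field `X` in the chart at `c`. -/
def Rep (c : M) (X : VecField d M) (Y : Eu d → Eu d) : Prop :=
  ContDiffOn ℝ ∞ Y (P.W c) ∧ ∀ w ∈ P.W c, C c w (Y w) = X ((extChartAt (𝓡 d) c).symm w)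

variable {P} {A B : VecField d M} {Ac Bc : Eu d → Eu d}

theorem Rep.isRep (hA : P.Rep c A Ac) (hu : u ∈ P.W c) : IsRep c u A Ac :=
  ⟨hA.1.contDiffAt ((P.isOpen_W c).mem_nhds hu), by
    filter_upwards [(P.isOpen_W c).mem_nhds hu] with w hw using hA.2 w hw⟩

theorem rep_ext (v : Eu d) : P.Rep x (ext (x := x) v) fun _ => v :=
  ⟨contDiffOn_const, fun _ hw => ext_C v hw.1⟩

theorem Rep.vert (hA : P.Rep c A Ac) : P.Rep c (vert g V A) ((P.loc g hg c).vf Ac) :=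
  ⟨LocalFoliation.smooth_vf (S := P.loc g hg c) hA.1, fun w hw => by
    have := projV_C (g := g) (hg := hg) hw (Ac w)
    rw [hA.2 w hw] at this
    exact this.symm⟩

theorem Rep.hor (hA : P.Rep c A Ac) : P.Rep c (hor g V A) ((P.loc g hg c).hf Ac) :=
  ⟨LocalFoliation.smooth_hf (S := P.loc g hg c) hA.1, fun w hw => by
    have := projH_C (g := g) (hg := hg) hw (Ac w)
    rw [hA.2 w hw] at this
    exact this.symm⟩

theorem Rep.pt (hA : P.Rep x A Ac) (hx : x ∈ P.U) : Ac (pt x) = A x := by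
  have := hA.2 _ (pt_mem hx)
  rw [C_self, extChartAt_to_inv] at this
  exact this

theorem Rep.mlieBracket (hA : P.Rep x A Ac) (hB : P.Rep x B Bc) (hx : x ∈ P.U) :
    (mlieBracket (𝓡 d) A B x : Eu d)
      = fderiv ℝ Bc (TGFoliation.pt x) (Ac (TGFoliation.pt x))
        - fderiv ℝ Ac (TGFoliation.pt x) (Bc (TGFoliation.pt x)) := by
  have hA' := hA.isRep (pt_mem hx)
  have hB' := hB.isRep (pt_mem hx)
  have := mlieBracket_C (mem_extChartAt_target (I := 𝓡 d) x) hA'.2 hB'.2 hA'.1 hB'.1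
  rw [C_self, extChartAt_to_inv] at this
  exact this

theorem Rep.mvfderiv_inner {X : VecField d M} {Xc : Eu d → Eu d} (hA : P.Rep x A Ac)
    (hB : P.Rep x B Bc) (hX : P.Rep x X Xc) (hx : x ∈ P.U) :
    mvfderiv (𝓡 d) (fun y => g.inner y (A y) (B y)) x (X x)
      = fderiv ℝ (fun w => (P.loc g hg x).G w (Ac w) (Bc w)) (TGFoliation.pt x)
        (Xc (TGFoliation.pt x)) := by
  have hu := mem_extChartAt_target (I := 𝓡 d) x
  have hF : ∀ᶠ w in 𝓝 (TGFoliation.pt x), g.inner ((extChartAt (𝓡 d) x).symm w)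
      (A ((extChartAt (𝓡 d) x).symm w)) (B ((extChartAt (𝓡 d) x).symm w))
      = (P.loc g hg x).G w (Ac w) (Bc w) := by
    filter_upwards [(P.isOpen_W x).mem_nhds (pt_mem hx)] with w hw
    change _ = chartMetric g x w (Ac w) (Bc w)
    rw [chartMetric_apply, hA.2 w hw, hB.2 w hw]
    rfl
  have hd : DifferentiableAt ℝ (fun w => (P.loc g hg x).G w (Ac w) (Bc w)) (TGFoliation.pt x) :=
    ((LocalFoliation.diffG (S := P.loc g hg x) (pt_mem hx)).clm_apply
      (hA.1.differentiableAt' (P.isOpen_W x) (pt_mem hx))).clm_apply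
      (hB.1.differentiableAt' (P.isOpen_W x) (pt_mem hx))
  have := mvfderiv_of_rep (F := fun y => g.inner y (A y) (B y)) hu hF hd (Xc (TGFoliation.pt x))
  rw [hX.pt hx] at this ⊢
  rw [C_self, extChartAt_to_inv] at this
  exact this

theorem G_pt (v w : Eu d) : (P.loc g hg x).G (pt x) v w = inn g x v w :=
  DFunLike.congr_fun (DFunLike.congr_fun (chartMetric_pt g x) v) w

/-- In coordinates the brackets in the Koszul formula cancel all derivatives of the two fields
except one. Testing against a field with constant coefficients leaves the directional derivative and
the Christoffel term. -/
theorem Rep.leviCivita (hA : P.Rep x A Ac) (hB : P.Rep x B Bc) (hx : x ∈ P.U) :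
    (leviCivita g A B x : Eu d) = fderiv ℝ Bc (TGFoliation.pt x) (Ac (TGFoliation.pt x))
      + (P.loc g hg x).lc (TGFoliation.pt x) (Ac (TGFoliation.pt x)) (Bc (TGFoliation.pt x)) := by
  have hu : TGFoliation.pt x ∈ (P.loc g hg x).W := pt_mem hx
  refine sharp_eq g fun z => ?_
  have hz : P.Rep x (ext (x := x) z) fun _ => z := rep_ext z
  have hdA := hA.1.differentiableAt' (P.isOpen_W x) (pt_mem hx)
  have hdB := hB.1.differentiableAt' (P.isOpen_W x) (pt_mem hx)
  have hdz : DifferentiableAt ℝ (fun _ : Eu d => z) (TGFoliation.pt x) := differentiableAt_const z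
  have hG := LocalFoliation.diffG hu
  have i1 : ∀ v w : Eu d, g.inner x v w = (P.loc g hg x).G (TGFoliation.pt x) v w := fun v w =>
    (G_pt v w).symm
  have e1 := hB.mvfderiv_inner (g := g) (hg := hg) hz hA hx
  have e2 := hA.mvfderiv_inner (g := g) (hg := hg) hz hB hx
  have e3 := hA.mvfderiv_inner (g := g) (hg := hg) hB hz hx
  have l1 := hA.mlieBracket hB hx
  have l2 := hA.mlieBracket hz hx
  have l3 := hB.mlieBracket hz hx
  rw [fderiv_bilin_apply hG hdB hdz] at e1
  rw [fderiv_bilin_apply hG hdA hdz] at e2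
  rw [fderiv_bilin_apply hG hdA hdB] at e3
  have kz : koszul g A B (ext (x := x) z) x
      = mvfderiv (𝓡 d) (fun y => g.inner y (B y) (ext (x := x) z y)) x (A x)
      + mvfderiv (𝓡 d) (fun y => g.inner y (A y) (ext (x := x) z y)) x (B x)
      - mvfderiv (𝓡 d) (fun y => g.inner y (A y) (B y)) x (ext (x := x) z x)
      + inn g x (VectorField.mlieBracket (𝓡 d) A B x) (ext (x := x) z x)
      - inn g x (VectorField.mlieBracket (𝓡 d) A (ext (x := x) z) x) (B x)
      - inn g x (VectorField.mlieBracket (𝓡 d) B (ext (x := x) z) x) (A x) := rfl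
  rw [kz, e1, e2, e3, l1, l2, l3, ← hA.pt hx, ← hB.pt hx, ← hz.pt hx, ← G_pt (P := P) (hg := hg),
    ← G_pt (P := P) (hg := hg), ← G_pt (P := P) (hg := hg), ← G_pt (P := P) (hg := hg),
    ContinuousLinearMap.map_add, _root_.add_apply, LocalFoliation.G_lc hu,
    LocalFoliation.lcForm_apply]
  have hs := (P.loc g hg x).G_symm _ hu
  simp only [ContinuousLinearMap.map_sub, _root_.sub_apply, fderiv_const_apply,
    ContinuousLinearMap.map_zero, _root_.zero_apply]
  rw [hs (fderiv ℝ Bc (TGFoliation.pt x) z), hs (fderiv ℝ Ac (TGFoliation.pt x) z)]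
  ring

theorem Rep.bott (hA : P.Rep x A Ac) (hB : P.Rep x B Bc) (hx : x ∈ P.U) :
    (bott g V A B x : Eu d) = (P.loc g hg x).bott Ac Bc (TGFoliation.pt x) := by
  have e : (TGFoliation.bott g V A B x : Eu d)
    = (projH g V x (TGFoliation.leviCivita g (TGFoliation.hor g V A) (TGFoliation.hor g V B) x) : Eu d)
    + (projH g V x (VectorField.mlieBracket (𝓡 d) (TGFoliation.vert g V A) (TGFoliation.hor g V B) x) : Eu d)
    + (projV g V x (VectorField.mlieBracket (𝓡 d) (TGFoliation.hor g V A) (TGFoliation.vert g V B) x) : Eu d)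
    + (projV g V x (TGFoliation.leviCivita g (TGFoliation.vert g V A) (TGFoliation.vert g V B) x) : Eu d) := rfl
  rw [e, LocalFoliation.bott, ← projH_pt hx, ← projH_pt hx, ← projV_pt hx, ← projV_pt hx]
  have hAh := hA.hor (g := g) (hg := hg)
  have hBh := hB.hor (g := g) (hg := hg)
  have hAv := hA.vert (g := g) (hg := hg)
  have hBv := hB.vert (g := g) (hg := hg)
  have l1 := hAh.leviCivita (g := g) (hg := hg) hBh hx
  have l2 := hAv.mlieBracket hBh hx
  have l3 := hAh.mlieBracket hBv hx
  have l4 := hAv.leviCivita (g := g) (hg := hg) hBv hx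
  rw [← l1, ← l2, ← l3, ← l4]
  rfl

end Submersion

end Pointwise

end TGFoliation

end

/-! ### Torsion, J, its covariant derivative and the divergence at a point of M. -/

open Bundle Manifold MeasureTheory VectorField
open scoped ContDiff Topology

noncomputable section

namespace TGFoliation

set_option synthInstance.maxHeartbeats 200000

namespace LocalFoliation

variable {d n : ℕ} {S : LocalFoliation d n} {u : Eu d}

theorem vpart_bracket_hf (hu : u ∈ S.W) (v w : Eu d) :
    S.vpart u (fderiv ℝ (S.hf fun _ => w) u (S.hf (fun _ => v) u)
      - fderiv ℝ (S.hf fun _ => v) u (S.hf (fun _ => w) u)) = - S.tor u v w := by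
  have hc : ∀ w : Eu d, ContDiffOn ℝ ∞ (fun _ : Eu d => w) S.W := fun w => contDiffOn_const
  rw [fderiv_hf hu (hc v), fderiv_hf hu (hc w), hf_eq, hf_eq, ← vpart_tor hu, tor]
  simp only [vpart_sub, vpart_sum, vpart_add, vpart_smul, vpart_X hu, smul_zero, zero_add, map_sum,
    ContinuousLinearMap.map_smul, T, cf_const, Finset.smul_sum, smul_smul, smul_sub,
    Finset.sum_sub_distrib, neg_sub]
  rw [Finset.sum_comm]
  congr 1
  exact Finset.sum_congr rfl fun i _ => Finset.sum_congr rfl fun j _ => by rw [mul_comm]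

/-- Both sides are horizontal, so the equation may be compared on the coefficients θ_l, and tested
on the frame. -/
theorem jCondition_iff_nablaJop (hu : u ∈ S.W) {ε : ℝ} : S.JCondition ε u ↔
    ∀ v w a, S.nablaJop u v w a
      = (-(1 / (2 * ε))) • (S.Jop u v (S.Jop u w a) - S.Jop u w (S.Jop u v a)) := by
  have key : ∀ v w a l, S.θ l u ((-(1 / (2 * ε))) • (S.Jop u v (S.Jop u w a)
      - S.Jop u w (S.Jop u v a))) = ∑ k, S.θ k u a * (-(1 / (2 * ε)) *
      ∑ p, (S.psi p l u v * S.psi k p u w - S.psi p l u w * S.psi k p u v)) := by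
    intro v w a l
    rw [ContinuousLinearMap.map_smul, ContinuousLinearMap.map_sub, θ_Jop hu, θ_Jop hu]
    simp only [θ_Jop hu, smul_eq_mul, Finset.sum_mul]
    rw [← Finset.sum_sub_distrib, Finset.mul_sum]
    simp only [← Finset.sum_sub_distrib, Finset.mul_sum]
    rw [Finset.sum_comm]
    exact Finset.sum_congr rfl fun i _ => Finset.sum_congr rfl fun j _ => by ring
  constructor
  · intro h v w a
    refine ext_parts (S := S) (u := u) (fun l => ?_) ?_
    · rw [θ_nablaJop hu, key]
      exact Finset.sum_congr rfl fun k _ => by rw [h k l v w]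
    · rw [vpart_nablaJop hu, vpart_smul, vpart_sub, vpart_Jop hu, vpart_Jop hu, sub_zero, smul_zero]
  · intro h k l v w
    have := congrArg (S.θ l u) (h v w (S.X k u))
    rw [θ_nablaJop hu, key] at this
    simpa only [S.θ_X u hu, ite_mul, one_mul, zero_mul, Finset.sum_ite_eq', Finset.mem_univ,
      if_true] using this

theorem psi_of_horizontal (hu : u ∈ S.W) {v : Eu d} (hv : S.vpart u v = 0) (k l : Fin n) :
    S.psi k l u v = 0 := by
  rw [← psi_vpart hu, hv, ContinuousLinearMap.map_zero]

theorem Jop_of_horizontal (hu : u ∈ S.W) {v : Eu d} (hv : S.vpart u v = 0) (a : Eu d) :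
    S.Jop u v a = 0 := by
  simp [Jop, psi_of_horizontal hu hv]

theorem Jop_zero (a : Eu d) : S.Jop u a 0 = 0 := by simp [Jop]

end LocalFoliation

namespace FolMap

variable {d n : ℕ} {S S' : LocalFoliation d n} (f : FolMap S S') {u : Eu d}

theorem map_Jop (hu : u ∈ f.O) (z v : Eu d) :
    S'.Jop (f.τ u) (fderiv ℝ f.τ u z) (fderiv ℝ f.τ u v) = fderiv ℝ f.τ u (S.Jop u z v) := by
  simp only [LocalFoliation.Jop, map_sum, ContinuousLinearMap.map_smul, f.map_psi hu, f.map_X hu,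
    f.map_θ u hu]

end FolMap

section Pointwise

variable {d n : ℕ} {M : Type*} [TopologicalSpace M] [ChartedSpace (Eu d) M]
  [IsManifold (𝓡 d) ∞ M] {u : Eu d} {c y z x : M} {k : ℕ} {V : Distribution d M}

variable [T2Space M] {P : Submersion n V} {g : Metric d M} {hg : IsRiemannianTotallyGeodesic g V}

/-- The projections, tensors and fields at a point, on the model space. -/
def pV (g : Metric d M) (V : Distribution d M) (x : M) (v : Eu d) : Eu d := projV g V x v

/-- The horizontal projection, on the model space. -/
def pH (g : Metric d M) (V : Distribution d M) (x : M) (v : Eu d) : Eu d := projH g V x v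

/-- The torsion, on the model space. -/
def tensT (g : Metric d M) (V : Distribution d M) (x : M) (v w : Eu d) : Eu d := torsion g V x v w

/-- The tensor `J`, on the model space. -/
def tensJ (g : Metric d M) (V : Distribution d M) (x : M) (v w : Eu d) : Eu d := J g V x v w

/-- The covariant derivative of `J`, on the model space. -/
def tensDJ (g : Metric d M) (V : Distribution d M) (x : M) (v w a : Eu d) : Eu d := nablaJ g V x v w a

/-- Constant extension of vectors of the model space. -/
def extc (x : M) (v : Eu d) : VecField d M := ext (x := x) v

/-- The value of a vector field, in the model space. -/
def val (A : VecField d M) (x : M) : Eu d := A x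

/-- The value of a form, on the model space. -/
def fval (η : Form d M k) (x : M) : Eu d [⋀^Fin k]→L[ℝ] ℝ := η x

/-- The coefficients of `∇^ε`, on the model space. -/
def connE (g : Metric d M) (V : Distribution d M) (ε : ℝ) (x : M) (v : Eu d) : Eu d →L[ℝ] Eu d :=
  connCoeff g V ε (x := x) v

/-- The covariant derivative of a form, on the model space. -/
def nabE (g : Metric d M) (V : Distribution d M) (ε : ℝ) (η : Form d M k) (x : M) (v : Eu d) :
    Eu d [⋀^Fin k]→L[ℝ] ℝ := nablaForm g V ε η x v

namespace Submersion

theorem pV_pt (hx : x ∈ P.U) (v : Eu d) : pV g V x v = (P.loc g hg x).vpart (pt x) v := projV_pt hx v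

theorem pH_pt (hx : x ∈ P.U) (v : Eu d) : pH g V x v = (P.loc g hg x).hpart (pt x) v := projH_pt hx v

theorem rep_extc (v : Eu d) : P.Rep x (extc x v) fun _ => v := rep_ext v

theorem val_extc (v : Eu d) : val (extc x v) x = v := ext_self v

theorem val_bott {A B : VecField d M} {Ac Bc : Eu d → Eu d} (hA : P.Rep x A Ac)
    (hB : P.Rep x B Bc) (hx : x ∈ P.U) :
    val (bott g V A B) x = (P.loc g hg x).bott Ac Bc (pt x) := hA.bott hB hx

theorem val_mlieBracket {A B : VecField d M} {Ac Bc : Eu d → Eu d} (hA : P.Rep x A Ac)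
    (hB : P.Rep x B Bc) (hx : x ∈ P.U) : val (mlieBracket (𝓡 d) A B) x
      = fderiv ℝ Bc (pt x) (Ac (pt x)) - fderiv ℝ Ac (pt x) (Bc (pt x)) := hA.mlieBracket hB hx

theorem tensT_pt (hx : x ∈ P.U) (v w : Eu d) :
    tensT g V x v w = (P.loc g hg x).tor (pt x) v w := by
  have h := val_mlieBracket ((rep_extc (P := P) (x := x) v).hor (g := g) (hg := hg))
    ((rep_extc (P := P) (x := x) w).hor (g := g) (hg := hg)) hx
  have e : tensT g V x v w
    = - pV g V x (val (mlieBracket (𝓡 d) (hor g V (extc x v)) (hor g V (extc x w))) x) := rfl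
  rw [e, pV_pt (hg := hg) hx, h, LocalFoliation.vpart_bracket_hf (S := P.loc g hg x) (pt_mem hx),
    neg_neg]

theorem tensJ_pt (hx : x ∈ P.U) (z v : Eu d) :
    tensJ g V x z v = (P.loc g hg x).Jop (pt x) z v := by
  have e : tensJ g V x z v = (sharp g x fun w => inn g x z (tensT g V x v w) : Eu d) := rfl
  refine e.trans (sharp_eq g fun w => ?_)
  change inn g x z (tensT g V x v w) = _
  rw [← G_pt (P := P) (hg := hg), ← G_pt (P := P) (hg := hg), LocalFoliation.G_Jop (S := P.loc g hg x) (pt_mem hx),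
    ← tensT_pt hx]

/-- At a nearby point J is computed in the preferred chart of that point. Naturality carries it back
to the chart at `c`, which is needed before J can be differentiated. -/
theorem tensJ_C (hu : u ∈ P.W c) (z v : Eu d) :
    tensJ g V ((extChartAt (𝓡 d) c).symm u) (C c u z) (C c u v)
      = C c u ((P.loc g hg c).Jop u z v) := by
  rw [tensJ_pt (P := P) (hg := hg) hu.2, C_eq hu.1]
  exact (P.folMap g hg c ((extChartAt (𝓡 d) c).symm u)).map_Jop ⟨mem_overlap_self hu.1, hu⟩ z v

theorem tensDJ_pt (hx : x ∈ P.U) (v w a : Eu d) :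
    tensDJ g V x v w a = (P.loc g hg x).nablaJop (pt x) v w a := by
  have hJ : P.Rep x (fun y => tensJ g V y (val (extc x w) y) (val (extc x a) y))
      fun u => (P.loc g hg x).Jop u w a := by
    refine ⟨LocalFoliation.smooth_Jop (S := P.loc g hg x) w a, fun u hu => ?_⟩
    have e1 : val (extc x w) ((extChartAt (𝓡 d) x).symm u) = C x u w := (ext_C w hu.1).symm
    have e2 : val (extc x a) ((extChartAt (𝓡 d) x).symm u) = C x u a := (ext_C a hu.1).symm
    have := tensJ_C (g := g) (hg := hg) hu w a
    rw [← e1, ← e2] at this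
    exact this.symm
  have h1 := val_bott (g := g) (hg := hg) (rep_extc (P := P) (x := x) v) hJ hx
  have h2 := val_bott (g := g) (hg := hg) (rep_extc (P := P) (x := x) v) (rep_extc w) hx
  have h3 := val_bott (g := g) (hg := hg) (rep_extc (P := P) (x := x) v) (rep_extc a) hx
  have e : tensDJ g V x v w a
    = val (bott g V (extc x v) (fun y => tensJ g V y (val (extc x w) y) (val (extc x a) y))) x
    - tensJ g V x (val (bott g V (extc x v) (extc x w)) x) a
    - tensJ g V x w (val (bott g V (extc x v) (extc x a)) x) := rfl
  rw [e, h1, h2, h3, tensJ_pt (hg := hg) hx, tensJ_pt (hg := hg) hx]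
  rfl

theorem nablaJ_eq_iff (hx : x ∈ P.U) (ε : ℝ) : (∀ v w a : TangentSpace (𝓡 d) x,
    nablaJ g V x v w a
      = (-(1 / (2 * ε))) • (J g V x v (J g V x w a) - J g V x w (J g V x v a)))
    ↔ (P.loc g hg x).JCondition ε (pt x) := by
  rw [LocalFoliation.jCondition_iff_nablaJop (S := P.loc g hg x) (pt_mem hx)]
  have key : ∀ v w a : Eu d, tensDJ g V x v w a
      = (-(1 / (2 * ε))) • (tensJ g V x v (tensJ g V x w a) - tensJ g V x w (tensJ g V x v a))
      ↔ (P.loc g hg x).nablaJop (pt x) v w a = (-(1 / (2 * ε))) •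
        ((P.loc g hg x).Jop (pt x) v ((P.loc g hg x).Jop (pt x) w a)
        - (P.loc g hg x).Jop (pt x) w ((P.loc g hg x).Jop (pt x) v a)) := fun v w a => by
    simp only [tensDJ_pt (hg := hg) hx, tensJ_pt (hg := hg) hx]
  exact forall_congr' fun v => forall_congr' fun w => forall_congr' fun a => key v w a

/-- The torsion is vertical, so J_v = 0 for horizontal v and both products in the commutator vanish.
-/
theorem nablaJ_of_horizontal (hx : x ∈ P.U) {ε : ℝ} {v w a : TangentSpace (𝓡 d) x}
    (h : nablaJ g V x v w a
      = (-(1 / (2 * ε))) • (J g V x v (J g V x w a) - J g V x w (J g V x v a)))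
    (hg : IsRiemannianTotallyGeodesic g V) (hv : v ∈ horizontal g V x) : nablaJ g V x v w a = 0 := by
  have hv0 : pV g V x v = 0 := by
    have := projV_eq g (zero_mem (V x)) hv
    rwa [zero_add] at this
  have hv' : (P.loc g hg x).vpart (pt x) v = 0 := (pV_pt hx v).symm.trans hv0
  have hu : pt x ∈ (P.loc g hg x).W := pt_mem hx
  have h1 : ∀ b : Eu d, tensJ g V x v b = 0 := fun b =>
    (tensJ_pt (hg := hg) hx v b).trans (LocalFoliation.Jop_of_horizontal hu hv' b)
  have h2 : ∀ w : Eu d, tensJ g V x w 0 = 0 := fun w => by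
    rw [tensJ_pt (hg := hg) hx, LocalFoliation.Jop_zero]
  rw [h]
  have e1 : J g V x v (J g V x w a) = 0 := h1 _
  have e2 : J g V x v a = 0 := h1 _
  have e3 : J g V x w 0 = 0 := h2 w
  rw [e1, e2, e3, sub_zero, smul_zero]

/-! ### The divergence -/

/-- By `bott_sub_tor`, along a horizontal vector ∇^ε is a combination of the connection matrices of
the frame. Both sides are compared on the standard basis, from which the coefficient map is built.
-/
theorem connE_eq (hx : x ∈ P.U) (ε : ℝ) {v : Eu d} (hv : (P.loc g hg x).vpart (pt x) v = 0) :
    connE g V ε x v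
      = ∑ j, (P.loc g hg x).θ j (pt x) v • (P.loc g hg x).conn ε j (pt x) := by
  have hu : pt x ∈ (P.loc g hg x).W := pt_mem hx
  have key : ∀ w : Eu d, val (nablaEps g V ε (extc x v) (extc x w)) x
      = ∑ j, (P.loc g hg x).θ j (pt x) v • (P.loc g hg x).conn ε j (pt x) w := by
    intro w
    have h1 := val_bott (g := g) (hg := hg) (rep_extc (P := P) (x := x) v) (rep_extc w) hx
    have e : val (nablaEps g V ε (extc x v) (extc x w)) x
      = val (bott g V (extc x v) (extc x w)) x
      - tensT g V x (val (extc x v) x) (val (extc x w) x)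
      + ε⁻¹ • tensJ g V x (val (extc x w) x) (val (extc x v) x) := rfl
    rw [e, tensT_pt (hg := hg) hx, tensJ_pt (hg := hg) hx, h1, val_extc, val_extc,
      LocalFoliation.bott_sub_tor hu ε hv]
  have e0 : ∀ j, connE g V ε x v (eb j) = val (nablaEps g V ε (extc x v) (extc x (eb j))) x := by
    intro j
    have := (EuclideanSpace.basisFun (Fin d) ℝ).toBasis.constr_basis ℝ
      (fun j => val (nablaEps g V ε (extc x v) (extc x (eb j))) x) j
    rw [OrthonormalBasis.coe_toBasis] at this
    exact this
  refine ContinuousLinearMap.coe_injective ((EuclideanSpace.basisFun (Fin d) ℝ).toBasis.ext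
    fun j => ?_)
  rw [OrthonormalBasis.coe_toBasis]
  change connE g V ε x v (eb j)
    = (∑ i, (P.loc g hg x).θ i (pt x) v • (P.loc g hg x).conn ε i (pt x)) (eb j)
  rw [e0, key, _root_.sum_apply]
  rfl

theorem fval_eq (η : Form d M k) (x : M) : fval η x = chartForm η x (pt x) := (chartForm_pt η x).symm

theorem nabE_eq (hx : x ∈ P.U) {ε : ℝ} (hε : 0 < ε) (η : Form d M k) {v : Eu d}
    (hv : (P.loc g hg x).vpart (pt x) v = 0) : nabE g V ε η x v
      = ∑ j, (P.loc g hg x).θ j (pt x) v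
        • ((P.loc g hg x).toFrame hε).nab j (chartForm η x) (pt x) := by
  have e : nabE g V ε η x v = fderiv ℝ (chartForm η x) (pt x) v
    - derivn (connE g V ε x v) (fval η x) := rfl
  have hvX : v = ∑ j, (P.loc g hg x).θ j (pt x) v • (P.loc g hg x).X j (pt x) := by
    conv_lhs => rw [← LocalFoliation.hpart_add_vpart (S := P.loc g hg x) (u := pt x) v, hv, add_zero,
      LocalFoliation.hpart]
  have e1 : fderiv ℝ (chartForm η x) (pt x) v = ∑ j, (P.loc g hg x).θ j (pt x) v
      • fderiv ℝ (chartForm η x) (pt x) ((P.loc g hg x).X j (pt x)) := by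
    conv_lhs => rw [hvX]
    simp only [map_sum, ContinuousLinearMap.map_smul]
  rw [e, connE_eq (hg := hg) hx ε hv, derivn_sum_left, e1, ← Finset.sum_sub_distrib]
  refine Finset.sum_congr rfl fun j _ => ?_
  rw [derivn_smul_left, AdaptedFrame.nab, fval_eq]
  exact (smul_sub _ _ _).symm

/-- The metric dual of θ_p is ∑ h_ip X_i; apply θ_q. This converts the trace with the full inverse
metric and projections into the trace with h over the horizontal frame. -/
theorem sum_gram_θ (S : LocalFoliation d n) (hu : u ∈ S.W) (p q : Fin n) :
    ∑ i, ∑ j, (gramE (S.G u))⁻¹ i j * (S.θ p u (eb i) * S.θ q u (eb j)) = S.h p q u := by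
  have h1 : sharpQ (gramE (S.G u))⁻¹ (S.θ p u) = ∑ i, S.h i p u • S.X i u := by
    refine sharpQ_gramE (gramE_det_pos (S.G_symm u hu) (S.G_pos u hu)).ne' fun w => ?_
    simp only [map_sum, map_smul, _root_.sum_apply, _root_.smul_apply,
      LocalFoliation.G_X_apply hu, smul_eq_mul, Finset.mul_sum]
    rw [Finset.sum_comm]
    simp only [LocalFoliation.h_symm hu _ p, ← mul_assoc, ← Finset.sum_mul,
      LocalFoliation.h_mul_H hu]
    simp
  have h2 := congrArg (S.θ q u) h1
  rw [sharpQ] at h2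
  simp only [map_sum, ContinuousLinearMap.map_smul, S.θ_X u hu, smul_eq_mul, mul_ite, mul_one,
    mul_zero, Finset.sum_ite_eq, Finset.mem_univ, if_true] at h2
  rw [LocalFoliation.h_symm hu, ← h2]
  exact Finset.sum_congr rfl fun i _ => Finset.sum_congr rfl fun j _ => by ring

theorem divH_pt (hx : x ∈ P.U) {ε : ℝ} (hε : 0 < ε) (η : Form d M (k + 1)) :
    fval (divH g V ε η) x = - ((P.loc g hg x).toFrame hε).trNab (chartForm η x) (pt x) := by
  have hu : pt x ∈ (P.loc g hg x).W := pt_mem hx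
  have e : fval (divH g V ε η) x = - ∑ i, ∑ j,
      ((gramE (inn g x))⁻¹ i j) • iota (pH g V x (eb j))
        (nabE g V ε η x (pH g V x (eb i))) := rfl
  have hG : (P.loc g hg x).G (pt x) = inn g x := chartMetric_pt g x
  have hp : ∀ j, pH g V x (eb j) = (P.loc g hg x).hpart (pt x) (eb j) := fun j =>
    pH_pt hx (eb j)
  rw [e, neg_inj]
  have hn : ∀ i, nabE g V ε η x (pH g V x (eb i)) = ∑ q, (P.loc g hg x).θ q (pt x) (eb i)
      • ((P.loc g hg x).toFrame hε).nab q (chartForm η x) (pt x) := fun i => by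
    have h1 : (P.loc g hg x).vpart (pt x) (pH g V x (eb i)) = 0 := by
      rw [hp, LocalFoliation.vpart_hpart hu]
    have := nabE_eq hx hε η h1
    rw [this]
    refine Finset.sum_congr rfl fun q _ => ?_
    congr 1
    have h2 := congrArg ((P.loc g hg x).θ q (pt x)) (hp i)
    rw [LocalFoliation.θ_hpart hu] at h2
    exact h2
  have hι : ∀ (j : Fin d) (α : Eu d [⋀^Fin (k + 1)]→L[ℝ] ℝ), iota (pH g V x (eb j)) α
      = ∑ p, (P.loc g hg x).θ p (pt x) (eb j) • iota ((P.loc g hg x).X p (pt x)) α := fun j α => by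
    have : iota (pH g V x (eb j)) α = iota ((P.loc g hg x).hpart (pt x) (eb j)) α :=
      congrArg (fun w => iota w α) (hp j)
    rw [this, LocalFoliation.hpart, map_sum, _root_.sum_apply]
    simp only [ContinuousLinearMap.map_smul, _root_.smul_apply]
  -- Both slots are expanded in the frame with coefficients θ(e_i); summing these against the
  -- inverse metric produces h.
  have hgen : ∀ (Q : Matrix (Fin d) (Fin d) ℝ) (h : Fin n → Fin n → ℝ) (t : Fin n → Fin d → ℝ)
      (A : Fin n → Fin n → Eu d [⋀^Fin k]→L[ℝ] ℝ)
      (_ : ∀ p q, ∑ i, ∑ j, Q i j * (t p i * t q j) = h p q),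
      ∑ i, ∑ j, Q i j • ∑ p, t p j • ∑ q, t q i • A p q = ∑ q, ∑ p, h q p • A p q := by
    intro Q h t A hh
    have : ∀ i j, Q i j • ∑ p, t p j • ∑ q, t q i • A p q
        = ∑ q, ∑ p, (Q i j * (t q i * t p j)) • A p q := fun i j => by
      simp only [Finset.smul_sum, smul_smul]
      rw [Finset.sum_comm]
      exact Finset.sum_congr rfl fun q _ => Finset.sum_congr rfl fun p _ => by
        congr 1; ring
    simp only [this, ← hh, Finset.sum_smul]
    rw [Finset.sum_congr rfl fun i _ => Finset.sum_comm, Finset.sum_comm]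
    refine Finset.sum_congr rfl fun q _ => ?_
    rw [Finset.sum_congr rfl fun i _ => Finset.sum_comm, Finset.sum_comm]
  have hfin := hgen (gramE (inn g x))⁻¹ (fun p q => (P.loc g hg x).h p q (pt x))
    (fun p i => (P.loc g hg x).θ p (pt x) (eb i))
    (fun p q => iota ((P.loc g hg x).X p (pt x))
      (((P.loc g hg x).toFrame hε).nab q (chartForm η x) (pt x))) fun p q => by
      rw [← hG]; exact sum_gram_θ _ hu p q
  have e2 : ((P.loc g hg x).toFrame hε).trNab (chartForm η x) (pt x)
      = ∑ q, ∑ p, (P.loc g hg x).h q p (pt x) • iota ((P.loc g hg x).X p (pt x))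
      (((P.loc g hg x).toFrame hε).nab q (chartForm η x) (pt x)) := by
    rw [AdaptedFrame.trNab, Finset.sum_comm]
    refine Finset.sum_congr rfl fun q _ => Finset.sum_congr rfl fun p _ => ?_
    rw [LocalFoliation.h_symm hu]
    rfl
  rw [e2, ← hfin]
  simp only [hι, hn]
  refine Finset.sum_congr rfl fun i _ => Finset.sum_congr rfl fun j _ => ?_
  congr 1
  refine Finset.sum_congr rfl fun p _ => ?_
  congr 1
  rw [map_sum]
  simp only [ContinuousLinearMap.map_smul]

end Submersion

end Pointwise

end TGFoliation

end

/-! ### Inner products of forms and the horizontal Laplacian in a fixed chart. -/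

open Bundle Manifold MeasureTheory VectorField
open scoped ContDiff Topology

noncomputable section

namespace TGFoliation

set_option synthInstance.maxHeartbeats 200000

section GramMatrices

variable {d k : ℕ}

/-- The matrix of a linear map. -/
def matE (L : Eu d →L[ℝ] Eu d) : Matrix (Fin d) (Fin d) ℝ := Matrix.of fun a i => L (eb i) a

theorem gramE_comp (B : Eu d →L[ℝ] Eu d →L[ℝ] ℝ) (B' : Eu d →L[ℝ] Eu d →L[ℝ] ℝ)
    (L : Eu d →L[ℝ] Eu d) (h : ∀ v w, B v w = B' (L v) (L w)) :
    gramE B = (matE L).transpose * gramE B' * matE L := by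
  ext i j
  rw [Matrix.mul_apply]
  simp only [Matrix.mul_apply, Matrix.transpose_apply, gramE, matE, Matrix.of_apply, h]
  conv_lhs => rw [← sum_eb (L (eb i)), ← sum_eb (L (eb j))]
  simp only [map_sum, map_smul, _root_.sum_apply, _root_.smul_apply, smul_eq_mul, Finset.mul_sum,
    Finset.sum_mul]
  exact Finset.sum_congr rfl fun a _ => Finset.sum_congr rfl fun b _ => by ring

theorem ip_gramE_comp (B : Eu d →L[ℝ] Eu d →L[ℝ] ℝ) (B' : Eu d →L[ℝ] Eu d →L[ℝ] ℝ)
    (L : Eu d →L[ℝ] Eu d) (h : ∀ v w, B v w = B' (L v) (L w)) (hB : (gramE B).det ≠ 0)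
    (α β : Eu d [⋀^Fin k]→L[ℝ] ℝ) :
    ip (gramE B)⁻¹ (α.compContinuousLinearMap L) (β.compContinuousLinearMap L)
      = ip (gramE B')⁻¹ α β := by
  refine ip_comp _ L (fun a b => ?_) α β
  have hg := gramE_comp B B' L h
  have hdet := hB
  rw [hg, Matrix.det_mul, Matrix.det_mul, Matrix.det_transpose] at hdet
  have hL : (matE L).det ≠ 0 := right_ne_zero_of_mul hdet
  have hLt : IsUnit (matE L).transpose.det := by rw [Matrix.det_transpose]; exact hL.isUnit
  have key : matE L * (gramE B)⁻¹ * (matE L).transpose = (gramE B')⁻¹ := by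
    rw [hg, Matrix.mul_inv_rev, Matrix.mul_inv_rev, ← Matrix.mul_assoc,
      Matrix.mul_nonsing_inv _ hL.isUnit, Matrix.one_mul, Matrix.mul_assoc,
      Matrix.nonsing_inv_mul _ hLt, Matrix.mul_one]
  rw [← key, Matrix.mul_apply]
  simp only [Matrix.mul_apply, Matrix.transpose_apply, matE, Matrix.of_apply, Finset.sum_mul]
  rw [Finset.sum_comm]
  exact Finset.sum_congr rfl fun i _ => Finset.sum_congr rfl fun j _ => by ring

/-- Unrolling the recursion: the factors 1/(k + 1) accumulate to 1/k!, and the successive basis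
vectors form the multi-indices. -/
theorem ip_eq_sum (Q : Matrix (Fin d) (Fin d) ℝ) : ∀ {k : ℕ} (α β : Eu d [⋀^Fin k]→L[ℝ] ℝ),
    ip Q α β = (1 / (k.factorial : ℝ)) * ∑ I : Fin k → Fin d, ∑ K : Fin k → Fin d,
      (∏ a, Q (I a) (K a)) * α (fun a => eb (I a)) * β (fun a => eb (K a))
  | 0, α, β => by
    have h : ∀ v : Fin 0 → Eu d, v = 0 := fun v => Subsingleton.elim _ _
    simp [ip, h fun a => eb _]
  | k + 1, α, β => by
    have hc : ∀ (i : Fin d) (I : Fin k → Fin d), (fun a => eb ((Fin.cons i I : Fin (k + 1) → Fin d) a))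
        = Fin.cons (eb i : Eu d) (fun a => eb (I a)) := fun i I => by
      funext a
      refine Fin.cases ?_ (fun b => ?_) a <;> simp
    have hs : ∀ f : (Fin (k + 1) → Fin d) → ℝ, ∑ I, f I = ∑ i, ∑ I : Fin k → Fin d, f (Fin.cons i I) :=
      fun f => by
        rw [← (Fin.consEquiv fun _ => Fin d).sum_comp, Fintype.sum_prod_type]
        rfl
    rw [ip_succ, hs]
    simp only [hs, hc, Fin.prod_univ_succ, Fin.cons_zero, Fin.cons_succ, ip_eq_sum Q,
      iota_apply_apply]
    rw [Nat.factorial_succ]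
    simp only [Finset.mul_sum]
    refine Finset.sum_congr rfl fun i _ => ?_
    rw [Finset.sum_comm]
    refine Finset.sum_congr rfl fun I _ => Finset.sum_congr rfl fun j _ =>
      Finset.sum_congr rfl fun K _ => ?_
    have h1 : ((k : ℝ) + 1) ≠ 0 := by positivity
    have h2 : (k.factorial : ℝ) ≠ 0 := by positivity
    push_cast
    field_simp

end GramMatrices

theorem AdaptedFrame.trNab_congr {d n k : ℕ} (F : AdaptedFrame d n) {u : Eu d}
    {η ζ : Eu d → Eu d [⋀^Fin (k + 1)]→L[ℝ] ℝ} (h : η =ᶠ[𝓝 u] ζ) : F.trNab η u = F.trNab ζ u := by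
  have h1 : ∀ j, F.nab j η u = F.nab j ζ u := fun j => by
    rw [AdaptedFrame.nab, AdaptedFrame.nab, h.fderiv_eq, h.self_of_nhds]
  simp only [AdaptedFrame.trNab, h1]

theorem extDeriv_fun_neg {d k : ℕ} (η : Eu d → Eu d [⋀^Fin k]→L[ℝ] ℝ) (u : Eu d) :
    extDeriv (fun w => - η w) u = - extDeriv η u := by
  rw [extDeriv, extDeriv, fderiv_fun_neg]
  ext v
  simp [ContinuousAlternatingMap.alternatizeUncurryFin_apply]

section ChartFormulas

variable {d n : ℕ} {M : Type*} [TopologicalSpace M] [ChartedSpace (Eu d) M]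
  [IsManifold (𝓡 d) ∞ M] {u : Eu d} {c y z x : M} {k : ℕ} {V : Distribution d M}

theorem two_le_infty : minSmoothness ℝ 2 ≤ (∞ : WithTop ℕ∞) := by
  rw [minSmoothness_of_isRCLikeNormedField]; exact WithTop.coe_le_coe.2 (le_top : (2 : ℕ∞) ≤ ⊤)

/-- At each point d is computed in the preferred chart there. Naturality of d under pullback by the
change of coordinates brings it to the chart at `c`, on the whole target. -/
theorem chartForm_extD {η : Form d M k} (hη : IsSmoothForm η)
    (hu : u ∈ (extChartAt (𝓡 d) c).target) : chartForm (extD η) c u = extDeriv (chartForm η c) u := by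
  obtain ⟨y, hy⟩ : ∃ y, y = (extChartAt (𝓡 d) c).symm u := ⟨_, rfl⟩
  have ho : u ∈ overlap c y := hy ▸ mem_overlap_self hu
  have hpt : trans c y u = pt y := by rw [trans, ← hy]
  have hd : DifferentiableAt ℝ (chartForm η y) (trans c y u) := by
    rw [hpt]
    exact (contDiffOn_chartForm hη y).differentiableAt' (isOpen_target y) (mem_extChartAt_target y)
  have e1 : extDeriv (chartForm η c) u = (extDeriv (chartForm η y) (trans c y u)).compContinuousLinearMap
      (fderiv ℝ (trans c y) u) := by
    rw [← extDeriv_pullback hd ((smooth_trans c y).contDiffAt ((isOpen_overlap c y).mem_nhds ho))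
      two_le_infty]
    refine extDeriv_congr_on (isOpen_overlap c y) ho fun w hw => ?_
    exact chartForm_trans η hw
  rw [e1, hpt]
  have e2 : chartForm (extD η) c u = (fval (extD η) ((extChartAt (𝓡 d) c).symm u)).compContinuousLinearMap
    (C c u) := rfl
  rw [e2, C_eq hu, ← hy]
  rfl

theorem isSmoothForm_of_chartForm {η : Form d M k} {ζ : M → Eu d → Eu d [⋀^Fin k]→L[ℝ] ℝ}
    {W : M → Set (Eu d)} (hW : ∀ x, IsOpen (W x)) (hx : ∀ x, pt x ∈ W x)
    (hζ : ∀ x, ContDiffOn ℝ ∞ (ζ x) (W x)) (h : ∀ x, ∀ u ∈ W x, chartForm η x u = ζ x u) :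
    IsSmoothForm η :=
  isSmoothForm_iff.2 fun x => ((hζ x).contDiffAt ((hW x).mem_nhds (hx x))).congr_of_eventuallyEq (by
    filter_upwards [(hW x).mem_nhds (hx x)] with w hw using h x w hw)

theorem isSmoothForm_extD {η : Form d M k} (hη : IsSmoothForm η) : IsSmoothForm (extD η) :=
  isSmoothForm_of_chartForm isOpen_target mem_extChartAt_target
    (fun x => contDiffOn_extDeriv (isOpen_target x) (contDiffOn_chartForm hη x))
    fun _ _ hu => chartForm_extD hη hu

variable [T2Space M] {P : Submersion n V} {g : Metric d M} {hg : IsRiemannianTotallyGeodesic g V}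
  {ε : ℝ}

namespace Submersion

/-- The adapted frame in the chart at `c`. -/
abbrev frm (P : Submersion n V) (g : Metric d M) (hg : IsRiemannianTotallyGeodesic g V) (c : M)
    (hε : 0 < ε) : AdaptedFrame d n := (P.loc g hg c).toFrame hε

theorem smooth_chartForm_W {η : Form d M k} (hη : IsSmoothForm η) (hε : 0 < ε) :
    ContDiffOn ℝ ∞ (chartForm η c) (P.frm g hg c hε).W :=
  (contDiffOn_chartForm hη c).mono Set.inter_subset_left

/-- The same transport as for d, now with naturality of the horizontal trace (`map_trNab`). Having
the formula on an open set allows the divergence to be differentiated. -/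
theorem chartForm_divH {η : Form d M (k + 1)} (hη : IsSmoothForm η) (hε : 0 < ε) (hu : u ∈ P.W c) :
    chartForm (divH g V ε η) c u = - (P.frm g hg c hε).trNab (chartForm η c) u := by
  obtain ⟨y, hy⟩ : ∃ y, y = (extChartAt (𝓡 d) c).symm u := ⟨_, rfl⟩
  have ho : u ∈ overlap c y := hy ▸ mem_overlap_self hu.1
  have hpt : trans c y u = pt y := by rw [trans, ← hy]
  have hyU : y ∈ P.U := hy ▸ hu.2
  have hd : DifferentiableAt ℝ (chartForm η y) (trans c y u) := by
    rw [hpt]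
    exact (contDiffOn_chartForm hη y).differentiableAt' (isOpen_target y) (mem_extChartAt_target y)
  have e1 := (P.folMap g hg c y).map_trNab (u := u) ⟨ho, hu⟩ hε (η := chartForm η c)
    (η' := chartForm η y) hd (by
      filter_upwards [(isOpen_overlap c y).mem_nhds ho] with w hw using chartForm_trans η hw)
  have e2 : chartForm (divH g V ε η) c u
    = (fval (divH g V ε η) ((extChartAt (𝓡 d) c).symm u)).compContinuousLinearMap (C c u) := rfl
  rw [e2, e1, C_eq hu.1, ← hy, divH_pt (hg := hg) hyU hε]
  have e3 : (P.folMap g hg c y).τ u = pt y := hpt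
  rw [e3]
  rfl

theorem isSmoothForm_divH (hV : IsFoliation n V) (hg : IsRiemannianTotallyGeodesic g V)
    {η : Form d M (k + 1)} (hη : IsSmoothForm η) (hε : 0 < ε) : IsSmoothForm (divH g V ε η) := by
  choose P hP using exists_submersion hV
  exact isSmoothForm_of_chartForm (fun x => (P x).isOpen_W x) (fun x => pt_mem (hP x))
    (fun x => ((P x).frm g hg x hε).smooth_trNab (smooth_chartForm_W hη hε) |>.neg)
    fun x u hu => chartForm_divH hη hε hu

theorem chartForm_lapH_zero {η : Form d M 0} (hη : IsSmoothForm η) (hε : 0 < ε) (hu : u ∈ P.W c) :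
    chartForm (lapH g V ε η) c u = (P.frm g hg c hε).rough (chartForm η c) u := by
  have e : chartForm (lapH g V ε η) c u = - chartForm (divH g V ε (extD η)) c u := rfl
  rw [e, chartForm_divH (hg := hg) (isSmoothForm_extD hη) hε hu, neg_neg,
    ← (P.frm g hg c hε).weitzenboeck_zero (smooth_chartForm_W hη hε) hu]
  have hs : ∀ w ∈ P.W c, chartForm (extD η) c w = extDeriv (chartForm η c) w := fun w hw =>
    chartForm_extD hη hw.1
  have h2 : chartForm (extD η) c =ᶠ[𝓝 u] extDeriv (chartForm η c) := by
    filter_upwards [(P.isOpen_W c).mem_nhds hu] with w hw using hs w hw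
  exact (P.frm g hg c hε).trNab_congr h2

theorem chartForm_lapH_aux (η : Form d M (k + 1)) : chartForm (lapH g V ε η) c u
    = - chartForm (divH g V ε (extD η)) c u - chartForm (extD (divH g V ε η)) c u := by
  have : ∀ y, lapH g V ε η y = - divH g V ε (extD η) y - extD (divH g V ε η) y := fun y => rfl
  rw [chartForm, this]
  rfl

theorem chartForm_lapH_succ (hV : IsFoliation n V) {η : Form d M (k + 1)} (hη : IsSmoothForm η)
    (hε : 0 < ε) (hu : u ∈ P.W c) : chartForm (lapH g V ε η) c u
      = (P.frm g hg c hε).rough (chartForm η c) u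
        + (P.frm g hg c hε).weitz u (chartForm η c u) := by
  have e : chartForm (lapH g V ε η) c u = - chartForm (divH g V ε (extD η)) c u
      - chartForm (extD (divH g V ε η)) c u := chartForm_lapH_aux η
  rw [e, chartForm_divH (hg := hg) (isSmoothForm_extD hη) hε hu, neg_neg,
    ← (P.frm g hg c hε).weitzenboeck (smooth_chartForm_W hη hε) hu]
  have hs : ∀ w ∈ P.W c, chartForm (extD η) c w = extDeriv (chartForm η c) w := fun w hw =>
    chartForm_extD hη hw.1
  have h2 : chartForm (extD η) c =ᶠ[𝓝 u] extDeriv (chartForm η c) := by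
    filter_upwards [(P.isOpen_W c).mem_nhds hu] with w hw using hs w hw
  have h3 : chartForm (extD (divH g V ε η)) c u
      = - extDeriv ((P.frm g hg c hε).trNab (chartForm η c)) u := by
    rw [chartForm_extD (isSmoothForm_divH hV hg hη hε) hu.1]
    rw [extDeriv_congr_on (P.isOpen_W c) hu (ζ := fun w => - (P.frm g hg c hε).trNab (chartForm η c) w)
      fun w hw => chartForm_divH hη hε hw]
    exact extDeriv_fun_neg _ _
  rw [h3, sub_neg_eq_add]
  congr 1
  exact (P.frm g hg c hε).trNab_congr h2

/-! ### The metrics `g_ε` -/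

theorem Geps_C (hu : u ∈ P.W c) (v w : Eu d) : (P.loc g hg c).Geps ε u v w
    = gEps g V ε ((extChartAt (𝓡 d) c).symm u) (C c u v : Eu d) (C c u w : Eu d) := by
  rw [LocalFoliation.Geps_split (S := P.loc g hg c) hu]
  have e : gEps g V ε ((extChartAt (𝓡 d) c).symm u) (C c u v : Eu d) (C c u w : Eu d)
    = inn g ((extChartAt (𝓡 d) c).symm u) (pH g V ((extChartAt (𝓡 d) c).symm u) (C c u v))
        (pH g V ((extChartAt (𝓡 d) c).symm u) (C c u w))
      + ε⁻¹ * inn g ((extChartAt (𝓡 d) c).symm u) (pV g V ((extChartAt (𝓡 d) c).symm u) (C c u v))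
        (pV g V ((extChartAt (𝓡 d) c).symm u) (C c u w)) := rfl
  have h1 : ∀ v, pH g V ((extChartAt (𝓡 d) c).symm u) (C c u v) = C c u ((P.loc g hg c).hpart u v) :=
    fun v => projH_C hu v
  have h2 : ∀ v, pV g V ((extChartAt (𝓡 d) c).symm u) (C c u v) = C c u ((P.loc g hg c).vpart u v) :=
    fun v => projV_C hu v
  rw [e, h1, h1, h2, h2]
  rfl

theorem Geps_pt (hx : x ∈ P.U) (v w : Eu d) :
    (P.loc g hg x).Geps ε (pt x) v w = gEps g V ε x v w := by
  rw [Geps_C (pt_mem hx), C_self, extChartAt_to_inv]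
  rfl

theorem Geps_trans (hu : u ∈ P.W c) (ho : u ∈ overlap c y) (v w : Eu d) :
    (P.loc g hg c).Geps ε u v w = (P.loc g hg y).Geps ε (trans c y u) (fderiv ℝ (trans c y) u v)
      (fderiv ℝ (trans c y) u w) := by
  have hu' : trans c y u ∈ P.W y :=
    ⟨trans_mem_target ho, by rw [Set.mem_preimage, symm_trans ho]; exact hu.2⟩
  rw [Geps_C hu, Geps_C hu', C_comp_apply ho, C_comp_apply ho, symm_trans ho]

theorem chartGram_eq (hu : u ∈ P.W c) :
    chartGram (gEps g V ε) c u = gramE ((P.loc g hg c).Geps ε u) := by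
  ext i j
  exact (Geps_C hu (eb i) (eb j)).symm

/-- At each point the inner product is taken in the preferred frame there. The Gram matrices are
congruent under the change of coordinates, so the product can be computed in the chart at `c`. -/
theorem formInner_eq (hu : u ∈ P.W c) (hε : 0 < ε) (α β : Form d M k) :
    formInner (gEps g V ε ((extChartAt (𝓡 d) c).symm u)) (α ((extChartAt (𝓡 d) c).symm u))
      (β ((extChartAt (𝓡 d) c).symm u))
      = ip ((P.frm g hg c hε).Q u) (chartForm α c u) (chartForm β c u) := by
  obtain ⟨y, hy⟩ : ∃ y, y = (extChartAt (𝓡 d) c).symm u := ⟨_, rfl⟩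
  have ho : u ∈ overlap c y := hy ▸ mem_overlap_self hu.1
  have hpt : trans c y u = pt y := by rw [trans, ← hy]
  have hyU : y ∈ P.U := hy ▸ hu.2
  rw [← hy]
  have hgr : gram (gEps g V ε y) = gramE ((P.loc g hg y).Geps ε (pt y)) := by
    ext i j
    exact (Geps_pt hyU (eb i) (eb j)).symm
  have e1 : formInner (gEps g V ε y) (α y) (β y)
      = ip (gramE ((P.loc g hg y).Geps ε (pt y)))⁻¹ (fval α y) (fval β y) := by
    rw [ip_eq_sum, ← hgr]
    rfl
  rw [e1, chartForm_trans α ho, chartForm_trans β ho, hpt, ← fval_eq, ← fval_eq]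
  refine (ip_gramE_comp _ _ _ (fun v w => ?_) (LocalFoliation.gramE_Geps_det hε hu).ne' _ _).symm
  rw [Geps_trans hu ho, hpt]

theorem rho_eq (hu : u ∈ P.W c) (hε : 0 < ε) :
    (P.frm g hg c hε).rho u = Real.sqrt (chartGram (gEps g V ε) c u).det := by
  have hdet := LocalFoliation.gramE_Geps_det (S := P.loc g hg c) hε hu
  have : (P.frm g hg c hε).Q u = (gramE ((P.loc g hg c).Geps ε u))⁻¹ := rfl
  rw [AdaptedFrame.rho, this, Matrix.nonsing_inv_nonsing_inv _ hdet.ne'.isUnit,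
    chartGram_eq (hg := hg) hu]

/-- The condition on M translates at the base point of each preferred chart; it is then carried to
an arbitrary point of the chart at `c` by a foliated change of coordinates. -/
theorem jCondition_of_symmetryCondition (h : SymmetryCondition g V ε) (hε : 0 < ε) (hu : u ∈ P.W c) :
    (P.loc g hg c).JCondition ε u := by
  have h2 := (nablaJ_eq_iff (hg := hg) (x := (extChartAt (𝓡 d) c).symm u) hu.2 ε).1 (h _)
  exact (P.folMap g hg c ((extChartAt (𝓡 d) c).symm u)).jCondition ⟨mem_overlap_self hu.1, hu⟩ hε h2

end Submersion

end ChartFormulas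

end TGFoliation

end

/-! ### The Riemannian volume measure in charts. -/

open Bundle Manifold MeasureTheory VectorField
open scoped ContDiff Topology

noncomputable section

namespace TGFoliation

set_option synthInstance.maxHeartbeats 200000

theorem det_matE {d : ℕ} (L : Eu d →L[ℝ] Eu d) : (matE L).det = L.det := by
  rw [ContinuousLinearMap.det,
    ← LinearMap.det_toMatrix (EuclideanSpace.basisFun (Fin d) ℝ).toBasis]
  congr 1
  ext i j
  rw [LinearMap.toMatrix_apply]
  simp [matE, eb]

section Volume

variable {d n : ℕ} {M : Type*} [TopologicalSpace M] [ChartedSpace (Eu d) M]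
  [IsManifold (𝓡 d) ∞ M] {u : Eu d} {c y z x : M} {V : Distribution d M}
  [T2Space M] [MeasurableSpace M] [BorelSpace M] {g : Metric d M} {ε : ℝ}

/-- The volume density in the chart at `c`. -/
def dens (g : Metric d M) (V : Distribution d M) (ε : ℝ) (c : M) (u : Eu d) : ℝ :=
  Real.sqrt (chartGram (gEps g V ε) c u).det

theorem dens_nonneg : 0 ≤ dens g V ε c u := Real.sqrt_nonneg _

theorem dens_eq {P : Submersion n V} (hg : IsRiemannianTotallyGeodesic g V) (hu : u ∈ P.W c)
    (hε : 0 < ε) : dens g V ε c u = (P.frm g hg c hε).rho u := (Submersion.rho_eq hu hε).symm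

theorem Q_det_pos {P : Submersion n V} (hg : IsRiemannianTotallyGeodesic g V) (hu : u ∈ P.W c)
    (hε : 0 < ε) : 0 < ((P.frm g hg c hε).Q u).det := by
  have h := LocalFoliation.gramE_Geps_det (S := P.loc g hg c) hε hu
  have : ((P.frm g hg c hε).Q u).det = ((gramE ((P.loc g hg c).Geps ε u)).det)⁻¹ := by
    rw [← Ring.inverse_eq_inv', ← Matrix.det_nonsing_inv]
    rfl
  rw [this]
  exact inv_pos.2 h

theorem continuousOn_dens (hV : IsFoliation n V) (hg : IsRiemannianTotallyGeodesic g V) (hε : 0 < ε)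
    (c : M) : ContinuousOn (dens g V ε c) (extChartAt (𝓡 d) c).target := by
  intro u hu
  obtain ⟨P, hP⟩ := exists_submersion hV ((extChartAt (𝓡 d) c).symm u)
  have hW : u ∈ P.W c := ⟨hu, hP⟩
  have h1 : ContinuousAt (P.frm g hg c hε).rho u :=
    (((P.frm g hg c hε).contDiffOn_rho fun w hw => Q_det_pos hg hw hε).continuousOn).continuousAt
      ((P.isOpen_W c).mem_nhds hW)
  refine (h1.congr ?_).continuousWithinAt
  filter_upwards [(P.isOpen_W c).mem_nhds hW] with w hw using (dens_eq hg hw hε).symm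

/-- The Gram determinant changes by the square of the Jacobian determinant; take square roots. -/
theorem dens_trans (hV : IsFoliation n V) (hg : IsRiemannianTotallyGeodesic g V)
    (ho : u ∈ overlap c y) :
    dens g V ε c u = |(fderiv ℝ (trans c y) u).det| * dens g V ε y (trans c y u) := by
  obtain ⟨P, hP⟩ := exists_submersion hV ((extChartAt (𝓡 d) c).symm u)
  have hW : u ∈ P.W c := ⟨ho.1, hP⟩
  have hW' : trans c y u ∈ P.W y :=
    ⟨trans_mem_target ho, by rw [Set.mem_preimage, symm_trans ho]; exact hP⟩
  rw [dens, dens, Submersion.chartGram_eq (hg := hg) hW, Submersion.chartGram_eq (hg := hg) hW',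
    gramE_comp _ _ _ (Submersion.Geps_trans hW ho), Matrix.det_mul, Matrix.det_mul,
    Matrix.det_transpose, det_matE, ← Real.sqrt_sq_eq_abs, ← Real.sqrt_mul (sq_nonneg _)]
  congr 1
  ring

theorem measurableSet_preimage_symm {A : Set M} (hA : MeasurableSet A) :
    MeasurableSet ((extChartAt (𝓡 d) c).symm ⁻¹' A ∩ (extChartAt (𝓡 d) c).target) := by
  have h1 : Measurable ((extChartAt (𝓡 d) c).target.restrict (extChartAt (𝓡 d) c).symm) :=
    ((continuousOn_extChartAt_symm c).restrict).measurable
  have h2 := (MeasurableEmbedding.subtype_coe (isOpen_target (d := d) c).measurableSet).measurableSet_image.2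
    (h1 hA)
  convert h2 using 1
  ext w
  constructor
  · exact fun h => ⟨⟨w, h.2⟩, h.1, rfl⟩
  · rintro ⟨⟨w, hw⟩, h, rfl⟩
    exact ⟨h, hw⟩

theorem aemeasurable_symm (ρ : Eu d → ENNReal) : AEMeasurable (extChartAt (𝓡 d) c).symm
    ((volume.restrict (extChartAt (𝓡 d) c).target).withDensity ρ) :=
  ((continuousOn_extChartAt_symm c).aemeasurable (isOpen_target c).measurableSet).mono_ac
    (withDensity_absolutelyContinuous _ _)

theorem chartVolume_apply {A : Set M} (hA : MeasurableSet A) :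
    chartVolume (gEps g V ε) c A = ∫⁻ u in (extChartAt (𝓡 d) c).symm ⁻¹' A ∩
      (extChartAt (𝓡 d) c).target, ENNReal.ofReal (dens g V ε c u) := by
  rw [chartVolume, Measure.map_apply_of_aemeasurable (aemeasurable_symm _) hA, withDensity_apply',
    Measure.restrict_restrict' (isOpen_target c).measurableSet]
  rfl

theorem chartVolume_inter {A : Set M} (hA : MeasurableSet A) :
    chartVolume (gEps g V ε) c A = chartVolume (gEps g V ε) c (A ∩ (extChartAt (𝓡 d) c).source) := by
  rw [chartVolume_apply hA, chartVolume_apply (hA.inter (isOpen_extChartAt_source c).measurableSet)]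
  congr 2
  ext w
  simp only [Set.mem_inter_iff, Set.mem_preimage]
  exact ⟨fun h => ⟨⟨h.1, symm_mem_source h.2⟩, h.2⟩, fun h => ⟨h.1.1, h.2⟩⟩

/-- Change of variables, the densities differing by exactly the Jacobian factor. -/
theorem chartVolume_congr (hV : IsFoliation n V) (hg : IsRiemannianTotallyGeodesic g V)
    {A : Set M} (hA : MeasurableSet A) (h1 : A ⊆ (extChartAt (𝓡 d) c).source)
    (h2 : A ⊆ (extChartAt (𝓡 d) y).source) :
    chartVolume (gEps g V ε) c A = chartVolume (gEps g V ε) y A := by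
  rw [chartVolume_apply hA, chartVolume_apply hA]
  obtain ⟨S, hS⟩ : ∃ S, S = (extChartAt (𝓡 d) c).symm ⁻¹' A ∩ (extChartAt (𝓡 d) c).target := ⟨_, rfl⟩
  have hSo : S ⊆ overlap c y := fun w hw => by rw [hS] at hw; exact ⟨hw.2, h2 hw.1⟩
  have himg : (extChartAt (𝓡 d) y).symm ⁻¹' A ∩ (extChartAt (𝓡 d) y).target = trans c y '' S := by
    ext w
    constructor
    · intro hw
      have ho : w ∈ overlap y c := ⟨hw.2, h1 hw.1⟩
      refine ⟨trans y c w, ?_, trans_symm ho⟩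
      rw [hS]
      exact ⟨by rw [Set.mem_preimage, symm_trans ho]; exact hw.1, trans_mem_target ho⟩
    · rintro ⟨w, hw, rfl⟩
      have ho := hSo hw
      rw [hS] at hw
      exact ⟨by rw [Set.mem_preimage, symm_trans ho]; exact hw.1, trans_mem_target ho⟩
  rw [himg, ← hS]
  have hSm : MeasurableSet S := hS ▸ measurableSet_preimage_symm hA
  rw [lintegral_image_eq_lintegral_abs_det_fderiv_mul volume hSm
    (fun w hw => (diff_trans (hSo hw)).hasFDerivAt.hasFDerivWithinAt) (fun a ha b hb hab => by
      rw [← trans_symm (hSo ha), hab, trans_symm (hSo hb)])]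
  refine setLIntegral_congr_fun hSm fun w hw => ?_
  rw [dens_trans hV hg (hSo hw), ENNReal.ofReal_mul (abs_nonneg _)]

/-- The supremum of the chart measures creates no extra mass on a chart domain, because any two of
them agree on the overlap. -/
theorem riemVolume_restrict (hV : IsFoliation n V) (hg : IsRiemannianTotallyGeodesic g V) (c : M) :
    (riemVolume (gEps g V ε)).restrict (extChartAt (𝓡 d) c).source = chartVolume (gEps g V ε) c := by
  have hs : ∀ c : M, MeasurableSet (extChartAt (𝓡 d) c).source := fun c =>
    (isOpen_extChartAt_source c).measurableSet
  have hcv : (chartVolume (gEps g V ε) c).restrict (extChartAt (𝓡 d) c).source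
      = chartVolume (gEps g V ε) c := by
    ext A hA
    rw [Measure.restrict_apply hA, ← chartVolume_inter hA]
  refine le_antisymm ?_ ?_
  · have hle : riemVolume (gEps g V ε) ≤ chartVolume (gEps g V ε) c
        + (riemVolume (gEps g V ε)).restrict (extChartAt (𝓡 d) c).sourceᶜ := by
      refine iSup_le fun x => Measure.le_iff.2 fun A hA => ?_
      rw [← measure_inter_add_sdiff A (hs c), Measure.add_apply, Measure.restrict_apply hA]
      refine add_le_add ?_ ?_
      · rw [chartVolume_inter (hA.inter (hs c)), chartVolume_congr (y := c) hV hg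
          ((hA.inter (hs c)).inter (hs x)) Set.inter_subset_right
          (Set.inter_subset_left.trans Set.inter_subset_right)]
        exact measure_mono (Set.inter_subset_left.trans Set.inter_subset_left)
      · exact le_iSup (fun x : M => chartVolume (gEps g V ε) x) x _
    have := Measure.restrict_mono (le_refl (extChartAt (𝓡 d) c).source) hle
    rw [Measure.restrict_add, Measure.restrict_restrict (hs c), Set.inter_compl_self,
      Measure.restrict_empty, add_zero, hcv] at this
    exact this
  · conv_lhs => rw [← hcv]
    exact Measure.restrict_mono le_rfl (le_iSup (fun x : M => chartVolume (gEps g V ε) x) c)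

/-- Integrals of functions supported in a compact part of a chart. -/
theorem integral_of_support (hV : IsFoliation n V) (hg : IsRiemannianTotallyGeodesic g V)
    (hε : 0 < ε) {W K : Set (Eu d)} (hW : IsOpen W) (hWt : W ⊆ (extChartAt (𝓡 d) c).target)
    (hK : IsCompact K) (hKW : K ⊆ W) {F : M → ℝ}
    (hF : ContinuousOn (fun u => F ((extChartAt (𝓡 d) c).symm u)) W)
    (h0 : ∀ x, x ∉ (extChartAt (𝓡 d) c).symm '' K → F x = 0) :
    Integrable F (riemVolume (gEps g V ε)) ∧ ∫ x, F x ∂(riemVolume (gEps g V ε))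
      = ∫ u in W, F ((extChartAt (𝓡 d) c).symm u) * dens g V ε c u := by
  have hs : MeasurableSet (extChartAt (𝓡 d) c).source := (isOpen_extChartAt_source c).measurableSet
  have ht : MeasurableSet (extChartAt (𝓡 d) c).target := (isOpen_target c).measurableSet
  obtain ⟨Fc, hFc⟩ : ∃ Fc, Fc = fun u => F ((extChartAt (𝓡 d) c).symm u) := ⟨_, rfl⟩
  have hF0 : ∀ u ∈ (extChartAt (𝓡 d) c).target, u ∉ K → Fc u = 0 := by
    intro u hu huK
    rw [hFc]
    refine h0 _ ?_
    rintro ⟨w, hw, he⟩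
    exact huK ((extChartAt (𝓡 d) c).symm.injOn (hWt (hKW hw)) hu he ▸ hw)
  have hsupp : Function.support F ⊆ (extChartAt (𝓡 d) c).source := by
    intro x hx
    by_contra hxs
    refine hx (h0 x ?_)
    rintro ⟨w, hw, rfl⟩
    exact hxs (symm_mem_source (hWt (hKW hw)))
  have hFW : ContinuousOn Fc W := hFc ▸ hF
  have hFt : ContinuousOn Fc (extChartAt (𝓡 d) c).target := by
    intro u hu
    by_cases huW : u ∈ W
    · exact (hFW.continuousAt (hW.mem_nhds huW)).continuousWithinAt
    · have hn : (extChartAt (𝓡 d) c).target ∩ Kᶜ ∈ 𝓝 u :=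
        ((isOpen_target c).inter hK.isClosed.isOpen_compl).mem_nhds ⟨hu, fun h => huW (hKW h)⟩
      refine ContinuousAt.continuousWithinAt ?_
      refine (continuousAt_const (y := (0 : ℝ))).congr ?_
      filter_upwards [hn] with w hw using (hF0 w hw.1 hw.2).symm
  have hdt := continuousOn_dens hV hg hε c
  have hmeas : AEStronglyMeasurable F (chartVolume (gEps g V ε) c) := by
    have hFs : ContinuousOn F (extChartAt (𝓡 d) c).source := by
      have h1 : ContinuousOn (Fc ∘ extChartAt (𝓡 d) c) (extChartAt (𝓡 d) c).source :=
        hFt.comp (continuousOn_extChartAt c) fun x hx => (extChartAt (𝓡 d) c).map_source hx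
      refine h1.congr fun x hx => ?_
      rw [hFc, Function.comp_apply, (extChartAt (𝓡 d) c).left_inv hx]
    rw [← riemVolume_restrict hV hg c]
    exact hFs.aestronglyMeasurable hs
  have hρm : AEMeasurable (fun u => ENNReal.ofReal (dens g V ε c u))
      (volume.restrict (extChartAt (𝓡 d) c).target) :=
    (hdt.aemeasurable ht).ennreal_ofReal
  have hρf : ∀ᵐ u ∂(volume.restrict (extChartAt (𝓡 d) c).target),
      ENNReal.ofReal (dens g V ε c u) < ⊤ := Filter.Eventually.of_forall fun _ => ENNReal.ofReal_lt_top
  have hmeas' : AEStronglyMeasurable F (Measure.map (extChartAt (𝓡 d) c).symm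
      ((volume.restrict (extChartAt (𝓡 d) c).target).withDensity
        fun u => ENNReal.ofReal (dens g V ε c u))) := hmeas
  have hint : IntegrableOn (fun u => dens g V ε c u • Fc u) (extChartAt (𝓡 d) c).target := by
    have h1 : IntegrableOn (fun u => dens g V ε c u • Fc u) K :=
      ((hdt.mono (hKW.trans hWt)).smul (hFW.mono hKW)).integrableOn_compact hK
    refine h1.of_forall_sdiff_eq_zero ht fun u hu => ?_
    rw [hF0 u hu.1 hu.2, smul_zero]
  have hI : Integrable F (chartVolume (gEps g V ε) c) := by
    refine (integrable_map_measure hmeas' (aemeasurable_symm _)).2 ?_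
    refine (integrable_withDensity_iff_integrable_smul₀' hρm hρf).2 ?_
    simp only [ENNReal.toReal_ofReal dens_nonneg, Function.comp_apply]
    rw [hFc] at hint
    exact hint
  have e1 : ∫ x, F x ∂(riemVolume (gEps g V ε)) = ∫ x, F x ∂(chartVolume (gEps g V ε) c) := by
    rw [← riemVolume_restrict hV hg c]
    exact (setIntegral_eq_integral_of_forall_compl_eq_zero fun x hx => by
      by_contra h; exact hx (hsupp h)).symm
  refine ⟨?_, ?_⟩
  · rw [← riemVolume_restrict hV hg c] at hI
    exact (integrableOn_iff_integrable_of_support_subset hsupp).1 hI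
  · rw [e1]
    have e2 : ∫ x, F x ∂(chartVolume (gEps g V ε) c)
        = ∫ u, Fc u ∂((volume.restrict (extChartAt (𝓡 d) c).target).withDensity
          fun u => ENNReal.ofReal (dens g V ε c u)) := by
      rw [hFc]
      exact integral_map (aemeasurable_symm _) hmeas'
    rw [e2, integral_withDensity_eq_integral_toReal_smul₀ hρm hρf]
    simp only [ENNReal.toReal_ofReal dens_nonneg]
    have e3 : ∫ u in W, F ((extChartAt (𝓡 d) c).symm u) * dens g V ε c u
        = ∫ u in W, dens g V ε c u • Fc u := by
      rw [hFc]
      exact integral_congr_ae (Filter.Eventually.of_forall fun u => mul_comm _ _)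
    rw [e3]
    refine (setIntegral_eq_of_subset_of_forall_sdiff_eq_zero ht hWt fun u hu => ?_)
    rw [hF0 u hu.1 fun h => hu.2 (hKW h), smul_zero]

end Volume

end TGFoliation

end

/-! ### Symmetry of the rough Laplacian and Green's formula. -/

open Bundle Manifold MeasureTheory VectorField
open scoped ContDiff Topology

noncomputable section

namespace TGFoliation

set_option synthInstance.maxHeartbeats 200000

theorem integrable_of_support {d : ℕ} {W K : Set (Eu d)} (hK : IsCompact K) (hKW : K ⊆ W)
    {f : Eu d → ℝ} (hf : ContinuousOn f W) (h0 : ∀ u ∉ K, f u = 0) : Integrable f := by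
  have hs : Function.support f ⊆ K := fun u hu => by_contra fun h => hu (h0 u h)
  exact (integrableOn_iff_integrable_of_support_subset hs).1 ((hf.mono hKW).integrableOn_compact hK)

theorem integrableOn_of_support {d : ℕ} {W K : Set (Eu d)} (hW : IsOpen W) (hK : IsCompact K)
    (hKW : K ⊆ W) {f : Eu d → ℝ} (hf : ContinuousOn f W) (h0 : ∀ u ∈ W, u ∉ K → f u = 0) :
    IntegrableOn f W :=
  ((hf.mono hKW).integrableOn_compact hK).of_forall_sdiff_eq_zero hW.measurableSet
    fun u hu => h0 u hu.1 hu.2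

section Linear

variable {E : Type*} [NormedAddCommGroup E] [NormedSpace ℝ E] {k : ℕ}

theorem derivn_zero_right (A : E →L[ℝ] E) : derivn A (0 : E [⋀^Fin k]→L[ℝ] ℝ) = 0 := by
  ext v
  simp [derivn_apply]

theorem derivn_sum_right {ι : Type*} (s : Finset ι) (A : E →L[ℝ] E)
    (α : ι → E [⋀^Fin k]→L[ℝ] ℝ) : derivn A (∑ a ∈ s, α a) = ∑ a ∈ s, derivn A (α a) := by
  ext v
  simp only [derivn_apply, ContinuousAlternatingMap.sum_apply]
  exact Finset.sum_comm

theorem wedge2_sum_right {ι : Type*} (s : Finset ι) (B : E →L[ℝ] E →L[ℝ] ℝ)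
    (α : ι → E [⋀^Fin k]→L[ℝ] ℝ) : wedge2 B (∑ a ∈ s, α a) = ∑ a ∈ s, wedge2 B (α a) := by
  classical
  induction s using Finset.induction_on with
  | empty => simpa using wedge2_smul_right 0 B (0 : E [⋀^Fin k]→L[ℝ] ℝ)
  | insert a s ha ih => rw [Finset.sum_insert ha, Finset.sum_insert ha, wedge2_add_right, ih]

end Linear

namespace AdaptedFrame

variable {d n k : ℕ} (F : AdaptedFrame d n) {u : Eu d}

theorem nab_congr (j : Fin n) {η ζ : Eu d → Eu d [⋀^Fin k]→L[ℝ] ℝ} (h : η =ᶠ[𝓝 u] ζ) :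
    F.nab j η u = F.nab j ζ u := by
  rw [nab, nab, h.fderiv_eq, h.self_of_nhds]

theorem nab_eventuallyEq (j : Fin n) {η ζ : Eu d → Eu d [⋀^Fin k]→L[ℝ] ℝ} (h : η =ᶠ[𝓝 u] ζ) :
    F.nab j η =ᶠ[𝓝 u] F.nab j ζ := by
  filter_upwards [h.eventuallyEq_nhds] with w hw using F.nab_congr j hw

theorem rough_congr {η ζ : Eu d → Eu d [⋀^Fin k]→L[ℝ] ℝ} (h : η =ᶠ[𝓝 u] ζ) :
    F.rough η u = F.rough ζ u := by
  have h1 : ∀ j, F.nab j η u = F.nab j ζ u := fun j => F.nab_congr j h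
  have h2 : ∀ i j, F.nab i (F.nab j η) u = F.nab i (F.nab j ζ) u := fun i j =>
    F.nab_congr i (F.nab_eventuallyEq j h)
  simp only [rough, h1, h2]

theorem nab_sum (j : Fin n) {ι : Type*} (s : Finset ι) {η : ι → Eu d → Eu d [⋀^Fin k]→L[ℝ] ℝ}
    (hη : ∀ a ∈ s, ContDiffOn ℝ ∞ (η a) F.W) (hu : u ∈ F.W) :
    F.nab j (fun u => ∑ a ∈ s, η a u) u = ∑ a ∈ s, F.nab j (η a) u := by
  have hd : ∀ a ∈ s, DifferentiableAt ℝ (η a) u := fun a ha =>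
    (hη a ha).differentiableAt' F.isOpen hu
  simp only [nab]
  rw [fderiv_fun_sum hd, _root_.sum_apply, derivn_sum_right, ← Finset.sum_sub_distrib]

theorem nab_zero_form (j : Fin n) : F.nab (k := k) j (fun _ => 0) = fun _ => 0 := by
  funext u
  rw [nab, fderiv_fun_const, derivn_zero_right]
  simp

theorem rough_zero (u : Eu d) : F.rough (k := k) (fun _ => 0) u = 0 := by
  simp only [rough, nab_zero_form, smul_zero, Finset.sum_const_zero, sub_zero]

theorem rough_sum {ι : Type*} (s : Finset ι) {η : ι → Eu d → Eu d [⋀^Fin k]→L[ℝ] ℝ}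
    (hη : ∀ a ∈ s, ContDiffOn ℝ ∞ (η a) F.W) (hu : u ∈ F.W) :
    F.rough (fun u => ∑ a ∈ s, η a u) u = ∑ a ∈ s, F.rough (η a) u := by
  have h1 : ∀ i j, F.nab i (F.nab j fun u => ∑ a ∈ s, η a u) u
      = ∑ a ∈ s, F.nab i (F.nab j (η a)) u := fun i j => by
    rw [← F.nab_sum i s (fun a ha => F.smooth_nab j (hη a ha)) hu]
    refine F.nab_congr i ?_
    filter_upwards [F.isOpen.mem_nhds hu] with w hw using F.nab_sum j s hη hw
  have h2 : ∀ j, F.nab j (fun u => ∑ a ∈ s, η a u) u = ∑ a ∈ s, F.nab j (η a) u := fun j =>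
    F.nab_sum j s hη hu
  have h3 : F.rough (fun u => ∑ a ∈ s, η a u) u = ∑ i, ∑ j, ∑ a ∈ s, F.h i j u •
      (F.nab i (F.nab j (η a)) u - ∑ l, F.om j l u (F.X i u) • F.nab l (η a) u) := by
    rw [rough]
    refine Finset.sum_congr rfl fun i _ => Finset.sum_congr rfl fun j _ => ?_
    rw [h1, ← Finset.smul_sum, Finset.sum_sub_distrib, Finset.sum_comm]
    simp only [h2, Finset.smul_sum]
  rw [h3, Finset.sum_congr rfl fun i _ => Finset.sum_comm, Finset.sum_comm]
  rfl

theorem weitz_sum {ι : Type*} (s : Finset ι) (α : ι → Eu d [⋀^Fin (k + 1)]→L[ℝ] ℝ) :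
    F.weitz u (∑ a ∈ s, α a) = ∑ a ∈ s, F.weitz u (α a) := by
  have h3 : F.weitz u (∑ a ∈ s, α a) = ∑ i, ∑ j, ∑ a ∈ s, F.h i j u • iota (F.X i u)
      (∑ p, wedge2 (F.B j p u) (iota (F.X p u) (α a))) := by
    rw [weitz]
    refine Finset.sum_congr rfl fun i _ => Finset.sum_congr rfl fun j _ => ?_
    simp only [map_sum, wedge2_sum_right, Finset.smul_sum]
    rw [Finset.sum_comm]
  rw [h3, Finset.sum_congr rfl fun i _ => Finset.sum_comm, Finset.sum_comm]
  rfl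

theorem weitz_smul (c : ℝ) (α : Eu d [⋀^Fin (k + 1)]→L[ℝ] ℝ) :
    F.weitz u (c • α) = c • F.weitz u α := by
  simp only [weitz, Finset.smul_sum]
  refine Finset.sum_congr rfl fun i _ => Finset.sum_congr rfl fun j _ => ?_
  simp only [ContinuousLinearMap.map_smul, wedge2_smul_right, map_sum, Finset.smul_sum]
  exact Finset.sum_congr rfl fun p _ => smul_comm _ _ _

/-- The zeroth order term of the horizontal Laplacian in all degrees. -/
def zeroth (u : Eu d) : {k : ℕ} → (Eu d [⋀^Fin k]→L[ℝ] ℝ) → Eu d [⋀^Fin k]→L[ℝ] ℝ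
  | 0, _ => 0
  | _ + 1, α => F.weitz u α

theorem smooth_zeroth : ∀ {k : ℕ} {η : Eu d → Eu d [⋀^Fin k]→L[ℝ] ℝ}, ContDiffOn ℝ ∞ η F.W →
    ContDiffOn ℝ ∞ (fun u => F.zeroth u (η u)) F.W
  | 0, _, _ => contDiffOn_const
  | _ + 1, _, hη => F.smooth_weitz hη

theorem zeroth_sum {ι : Type*} (s : Finset ι) : ∀ {k : ℕ} (α : ι → Eu d [⋀^Fin k]→L[ℝ] ℝ),
    F.zeroth u (∑ a ∈ s, α a) = ∑ a ∈ s, F.zeroth u (α a)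
  | 0, _ => by simp [zeroth]
  | _ + 1, α => F.weitz_sum s α

theorem zeroth_smul (c : ℝ) : ∀ {k : ℕ} (α : Eu d [⋀^Fin k]→L[ℝ] ℝ),
    F.zeroth u (c • α) = c • F.zeroth u α
  | 0, _ => by simp [zeroth]
  | _ + 1, α => F.weitz_smul c α

theorem zeroth_zero : F.zeroth u (0 : Eu d [⋀^Fin k]→L[ℝ] ℝ) = 0 := by
  have := F.zeroth_smul (u := u) 0 (0 : Eu d [⋀^Fin k]→L[ℝ] ℝ)
  rwa [zero_smul, zero_smul] at this

theorem smooth_rough {η : Eu d → Eu d [⋀^Fin k]→L[ℝ] ℝ} (hη : ContDiffOn ℝ ∞ η F.W) :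
    ContDiffOn ℝ ∞ (F.rough η) F.W := by
  have h1 : ∀ i j, ContDiffOn ℝ ∞ (fun u => F.h i j u • (F.nab i (F.nab j η) u
      - ∑ l, F.om j l u (F.X i u) • F.nab l η u)) F.W := fun i j =>
    (F.smooth_h i j).smul ((F.smooth_nab i (F.smooth_nab j hη)).sub
      (ContDiffOn.sum fun l _ => ((F.smooth_om j l).clm_apply (F.smooth_X i)).smul
        (F.smooth_nab l hη)))
  exact ContDiffOn.sum fun i _ => ContDiffOn.sum fun j _ => h1 i j

/-- The rough Laplacian is symmetric. -/
theorem integral_rough (hpos : ∀ u ∈ F.W, 0 < (F.Q u).det) {K : Set (Eu d)} (hK : IsCompact K)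
    (hKW : K ⊆ F.W) {α β : Eu d → Eu d [⋀^Fin k]→L[ℝ] ℝ} (hα : ContDiffOn ℝ ∞ α F.W)
    (hβ : ContDiffOn ℝ ∞ β F.W) (h0 : ∀ u ∈ F.W, u ∉ K → α u = 0) :
    ∫ u in F.W, (ip (F.Q u) (F.rough α u) (β u) - ip (F.Q u) (α u) (F.rough β u)) * F.rho u = 0 := by
  classical
  -- The flux is set to zero off `W`, where its formula is meaningless, since the divergence theorem
  -- asks for vanishing at every point outside `K`.
  obtain ⟨f, hf⟩ : ∃ f : Fin n → Eu d → ℝ, f = fun i u =>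
    if u ∈ F.W then F.flux α β i u - F.flux β α i u else 0 := ⟨_, rfl⟩
  have hfW : ∀ i, ∀ u ∈ F.W, f i u = F.flux α β i u - F.flux β α i u := fun i u hu => by
    simp [hf, hu]
  have hfs : ∀ i, ContDiffOn ℝ ∞ (f i) F.W := fun i =>
    ((F.smooth_flux hα hβ i).sub (F.smooth_flux hβ hα i)).congr (hfW i)
  have hα0 : ∀ u ∈ F.W, u ∉ K → α =ᶠ[𝓝 u] fun _ => 0 := fun u hu huK => by
    filter_upwards [F.isOpen.mem_nhds hu, hK.isClosed.isOpen_compl.mem_nhds huK] with w h1 h2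
      using h0 w h1 h2
  have hf0 : ∀ i, ∀ u ∉ K, f i u = 0 := by
    intro i u hu
    by_cases huW : u ∈ F.W
    · have h1 : ∀ j, F.nab j α u = 0 := fun j => by
        rw [F.nab_congr j (hα0 u huW hu), nab_zero_form]
      simp only [hfW i u huW, flux, h1, h0 u huW hu, ip_zero_left, ip_zero_right, mul_zero,
        Finset.sum_const_zero, sub_zero]
    · simp [hf, huW]
  have hD0 : ∀ i, ∀ u ∉ K, fderiv ℝ (f i) u (F.X i u) + F.div i u * f i u = 0 := fun i u hu => by
    have : f i =ᶠ[𝓝 u] fun _ => 0 := by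
      filter_upwards [hK.isClosed.isOpen_compl.mem_nhds hu] with w hw using hf0 i w hw
    rw [this.fderiv_eq, hf0 i u hu]
    simp
  have hDs : ∀ i, ContinuousOn (fun u => (fderiv ℝ (f i) u (F.X i u) + F.div i u * f i u) * F.rho u)
      F.W := fun i =>
    ((((contDiffOn_fderiv F.isOpen (hfs i)).clm_apply (F.smooth_X i)).add
      ((F.smooth_div i).mul (hfs i))).mul (F.contDiffOn_rho hpos)).continuousOn
  have hI : ∀ i, Integrable fun u => (fderiv ℝ (f i) u (F.X i u) + F.div i u * f i u) * F.rho u :=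
    fun i => integrable_of_support hK hKW (hDs i) fun u hu => by rw [hD0 i u hu, zero_mul]
  have e1 : ∫ u in F.W, (ip (F.Q u) (F.rough α u) (β u) - ip (F.Q u) (α u) (F.rough β u)) * F.rho u
      = ∫ u in F.W, ∑ i, (fderiv ℝ (f i) u (F.X i u) + F.div i u * f i u) * F.rho u := by
    refine setIntegral_congr_fun F.isOpen.measurableSet fun u hu => ?_
    have e : ∀ i, fderiv ℝ (f i) u (F.X i u) + F.div i u * f i u
        = (fderiv ℝ (F.flux α β i) u (F.X i u) + F.div i u * F.flux α β i u)
          - (fderiv ℝ (F.flux β α i) u (F.X i u) + F.div i u * F.flux β α i u) := fun i => by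
      have h1 : f i =ᶠ[𝓝 u] fun u => F.flux α β i u - F.flux β α i u := by
        filter_upwards [F.isOpen.mem_nhds hu] with w hw using hfW i w hw
      rw [h1.fderiv_eq, fderiv_fun_sub ((F.smooth_flux hα hβ i).differentiableAt' F.isOpen hu)
        ((F.smooth_flux hβ hα i).differentiableAt' F.isOpen hu), _root_.sub_apply, hfW i u hu]
      ring
    simp only [F.ip_rough_sub hα hβ hu, e, ← Finset.sum_mul, Finset.sum_sub_distrib]
  rw [e1, setIntegral_eq_integral_of_forall_compl_eq_zero fun u hu => Finset.sum_eq_zero fun i _ => by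
    rw [hD0 i u fun h => hu (hKW h), zero_mul], integral_finsetSum _ fun i _ => hI i]
  exact Finset.sum_eq_zero fun i _ => F.integral_div hpos hK hKW i (hfs i) (hf0 i)

end AdaptedFrame

section Green

variable {d n : ℕ} {M : Type*} [TopologicalSpace M] [ChartedSpace (Eu d) M]
  [IsManifold (𝓡 d) ∞ M] {u : Eu d} {c y z x : M} {k : ℕ} {V : Distribution d M}
  [T2Space M] {g : Metric d M} {ε : ℝ}

theorem chartForm_eventually_zero {η : Form d M k} (h0 : ∀ᶠ y in 𝓝 x, η y = 0) :
    chartForm η x =ᶠ[𝓝 (pt x)] fun _ => 0 := by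
  have hc := (contMDiffAt_symm (mem_extChartAt_target (I := 𝓡 d) x)).continuousAt
  rw [ContinuousAt, extChartAt_to_inv] at hc
  filter_upwards [hc.eventually h0] with w hw
  rw [chartForm, hw]
  rfl

namespace Submersion

variable {P : Submersion n V} {hg : IsRiemannianTotallyGeodesic g V}

theorem chartForm_lapH (hV : IsFoliation n V) (hε : 0 < ε) (hu : u ∈ P.W c) :
    ∀ {k : ℕ} {η : Form d M k}, IsSmoothForm η → chartForm (lapH g V ε η) c u
      = (P.frm g hg c hε).rough (chartForm η c) u
        + (P.frm g hg c hε).zeroth u (chartForm η c u)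
  | 0, η, hη => by
    rw [chartForm_lapH_zero (hg := hg) hη hε hu]
    exact (add_zero _).symm
  | _ + 1, η, hη => chartForm_lapH_succ hV hη hε hu

/-- Locality: by the chart formula, the value at `x` depends only on the germ of the form there. -/
theorem lapH_eq_zero (hV : IsFoliation n V) (hg : IsRiemannianTotallyGeodesic g V) (hε : 0 < ε)
    {η : Form d M k} (hη : IsSmoothForm η)
    (h0 : ∀ᶠ y in 𝓝 x, η y = 0) : lapH g V ε η x = 0 := by
  obtain ⟨P, hP⟩ := exists_submersion hV x
  have h1 := chartForm_eventually_zero h0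
  have h2 := chartForm_lapH (g := g) (hg := hg) hV hε (pt_mem hP) hη
  rw [chartForm_pt, AdaptedFrame.rough_congr _ h1, AdaptedFrame.rough_zero, h1.self_of_nhds,
    AdaptedFrame.zeroth_zero, add_zero] at h2
  exact h2

theorem isSmoothForm_lapH (hV : IsFoliation n V) (hg : IsRiemannianTotallyGeodesic g V) (hε : 0 < ε)
    {η : Form d M k} (hη : IsSmoothForm η) : IsSmoothForm (lapH g V ε η) := by
  choose P hP using exists_submersion hV
  exact isSmoothForm_of_chartForm (fun x => (P x).isOpen_W x) (fun x => pt_mem (hP x))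
    (fun x => (((P x).frm g hg x hε).smooth_rough (smooth_chartForm_W hη hε)).add
      (((P x).frm g hg x hε).smooth_zeroth (smooth_chartForm_W hη hε)))
    fun x u hu => chartForm_lapH hV hε hu hη

/-- Additivity is read off the chart formula, where it holds for differentiable summands; it serves
the decomposition by a partition of unity. -/
theorem lapH_sum (hV : IsFoliation n V) (hg : IsRiemannianTotallyGeodesic g V) (hε : 0 < ε)
    {ι : Type*} (s : Finset ι) {η : ι → Form d M k} (hη : ∀ a, IsSmoothForm (η a)) {ζ : Form d M k}
    (hζ : IsSmoothForm ζ) (h : ∀ x, ζ x = ∑ a ∈ s, η a x) (x : M) :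
    lapH g V ε ζ x = ∑ a ∈ s, lapH g V ε (η a) x := by
  obtain ⟨P, hP⟩ := exists_submersion hV x
  have hc : chartForm ζ x = fun u => ∑ a ∈ s, chartForm (η a) x u := by
    funext u
    rw [chartForm, h]
    refine ContinuousAlternatingMap.ext fun v => ?_
    rw [ContinuousAlternatingMap.sum_apply]
    exact map_sum (ContinuousAlternatingMap.applyAddHom (R := ℝ)
      (M := TangentSpace (𝓡 d) ((extChartAt (𝓡 d) x).symm u)) (N := ℝ) fun i => C x u (v i))
      (fun a => η a ((extChartAt (𝓡 d) x).symm u)) s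
  have h1 := chartForm_lapH (g := g) (hg := hg) hV hε (pt_mem hP) hζ
  have h2 := fun a => chartForm_lapH (g := g) (hg := hg) hV hε (pt_mem hP) (hη a)
  rw [hc, AdaptedFrame.rough_sum _ s (fun a _ => smooth_chartForm_W (hη a) hε) (pt_mem hP),
    AdaptedFrame.zeroth_sum, ← Finset.sum_add_distrib] at h1
  rw [Finset.sum_congr rfl fun a _ => (h2 a).symm] at h1
  simp only [chartForm_pt] at h1
  exact h1

variable [MeasurableSpace M] [BorelSpace M]

/-- The pointwise inner product of forms. -/
def fip (g : Metric d M) (V : Distribution d M) (ε : ℝ) (α β : Form d M k) (x : M) : ℝ :=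
  formInner (gEps g V ε x) (α x) (β x)

theorem fip_symm_chart (hg : IsRiemannianTotallyGeodesic g V) (hu : u ∈ P.W c) (hε : 0 < ε)
    (α β : Form d M k) : fip g V ε α β ((extChartAt (𝓡 d) c).symm u)
      = ip ((P.frm g hg c hε).Q u) (chartForm α c u) (chartForm β c u) := formInner_eq hu hε α β

theorem fip_zero_left {α : Form d M k} (h : α x = 0) (β : Form d M k) : fip g V ε α β x = 0 := by
  simp [fip, formInner, h]

theorem fip_zero_right {β : Form d M k} (h : β x = 0) (α : Form d M k) : fip g V ε α β x = 0 := by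
  simp [fip, formInner, h]

theorem integral_fip (hV : IsFoliation n V) (hg : IsRiemannianTotallyGeodesic g V) (hε : 0 < ε)
    {K : Set (Eu d)} (hK : IsCompact K) (hKW : K ⊆ P.W c) {α β : Form d M k}
    (hα : IsSmoothForm α) (hβ : IsSmoothForm β)
    (h0 : ∀ x, x ∉ (extChartAt (𝓡 d) c).symm '' K → fip g V ε α β x = 0) :
    Integrable (fip g V ε α β) (riemVolume (gEps g V ε)) ∧
    ∫ x, fip g V ε α β x ∂(riemVolume (gEps g V ε))
      = ∫ u in P.W c, ip ((P.frm g hg c hε).Q u) (chartForm α c u) (chartForm β c u)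
        * (P.frm g hg c hε).rho u := by
  have hF : ContinuousOn (fun u => fip g V ε α β ((extChartAt (𝓡 d) c).symm u)) (P.W c) :=
    (contDiffOn_ip (P.frm g hg c hε).smooth_Q (smooth_chartForm_W hα hε)
      (smooth_chartForm_W hβ hε)).continuousOn.congr fun u hu => fip_symm_chart hg hu hε α β
  have h := integral_of_support hV hg hε (P.isOpen_W c) Set.inter_subset_left hK hKW hF h0
  refine ⟨h.1, h.2.trans ?_⟩
  refine setIntegral_congr_fun (P.isOpen_W c).measurableSet fun u hu => ?_
  rw [fip_symm_chart hg hu hε, dens_eq hg hu hε]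

/-- Green's formula for forms with support in a foliation chart. -/
theorem green (hV : IsFoliation n V) (hg : IsRiemannianTotallyGeodesic g V) (hε : 0 < ε)
    {K : Set (Eu d)} (hK : IsCompact K) (hKW : K ⊆ P.W c) {α β : Form d M k}
    (hα : IsSmoothForm α) (hβ : IsSmoothForm β)
    (h0 : ∀ x, x ∉ (extChartAt (𝓡 d) c).symm '' K → α x = 0) :
    Integrable (fip g V ε (lapH g V ε α) β) (riemVolume (gEps g V ε)) ∧
    Integrable (fip g V ε α (lapH g V ε β)) (riemVolume (gEps g V ε)) ∧
    ∫ x, fip g V ε (lapH g V ε α) β x ∂(riemVolume (gEps g V ε))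
      - ∫ x, fip g V ε α (lapH g V ε β) x ∂(riemVolume (gEps g V ε))
      = ∫ u in P.W c,
        (ip ((P.frm g hg c hε).Q u) ((P.frm g hg c hε).zeroth u (chartForm α c u)) (chartForm β c u)
        - ip ((P.frm g hg c hε).Q u) (chartForm α c u) ((P.frm g hg c hε).zeroth u (chartForm β c u)))
        * (P.frm g hg c hε).rho u := by
  have hWt : P.W c ⊆ (extChartAt (𝓡 d) c).target := Set.inter_subset_left
  have hcl : IsClosed ((extChartAt (𝓡 d) c).symm '' K) :=
    (hK.image_of_continuousOn ((continuousOn_extChartAt_symm c).mono (hKW.trans hWt))).isClosed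
  have hΔ0 : ∀ x, x ∉ (extChartAt (𝓡 d) c).symm '' K → lapH g V ε α x = 0 := fun x hx =>
    lapH_eq_zero hV hg hε hα (by
      filter_upwards [hcl.isOpen_compl.mem_nhds hx] with y hy using h0 y hy)
  have hΔα := isSmoothForm_lapH hV hg hε hα
  have hΔβ := isSmoothForm_lapH hV hg hε hβ
  obtain ⟨i1, e1⟩ := integral_fip (P := P) (c := c) hV hg hε hK hKW hΔα hβ fun x hx =>
    fip_zero_left (hΔ0 x hx) β
  obtain ⟨i2, e2⟩ := integral_fip (P := P) (c := c) hV hg hε hK hKW hα hΔβ fun x hx =>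
    fip_zero_left (h0 x hx) _
  refine ⟨i1, i2, ?_⟩
  have hα0 : ∀ u ∈ P.W c, u ∉ K → chartForm α c u = 0 := by
    intro u hu huK
    have : α ((extChartAt (𝓡 d) c).symm u) = 0 := by
      refine h0 _ ?_
      rintro ⟨w, hw, he⟩
      exact huK ((extChartAt (𝓡 d) c).symm.injOn (hWt (hKW hw)) (hWt hu) he ▸ hw)
    rw [chartForm, this]
    rfl
  obtain ⟨F, hF⟩ : ∃ F, F = P.frm g hg c hε := ⟨_, rfl⟩
  have hFW : F.W = P.W c := by rw [hF]; rfl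
  rw [e1, e2, ← hF]
  have hpos : ∀ u ∈ F.W, 0 < (F.Q u).det := fun u hu => by
    rw [hF]; exact Q_det_pos hg (hFW ▸ hu) hε
  have sα : ContDiffOn ℝ ∞ (chartForm α c) F.W := hF ▸ smooth_chartForm_W hα hε
  have sβ : ContDiffOn ℝ ∞ (chartForm β c) F.W := hF ▸ smooth_chartForm_W hβ hε
  have hl : ∀ {η : Form d M k}, IsSmoothForm η → ∀ u ∈ F.W, chartForm (lapH g V ε η) c u
      = F.rough (chartForm η c) u + F.zeroth u (chartForm η c u) := fun hη u hu => by
    rw [hF]; exact chartForm_lapH hV hε (hFW ▸ hu) hη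
  have hKF : K ⊆ F.W := hFW ▸ hKW
  have hα0' : ∀ u ∈ F.W, u ∉ K → chartForm α c u = 0 := hFW ▸ hα0
  have hr0 : ∀ u ∈ F.W, u ∉ K → F.rough (chartForm α c) u = 0 := fun u hu huK => by
    rw [F.rough_congr (ζ := fun _ => 0) (by
      filter_upwards [F.isOpen.mem_nhds hu, hK.isClosed.isOpen_compl.mem_nhds huK] with w h1 h2
        using hα0' w h1 h2), F.rough_zero]
  have sR : ContinuousOn (fun u => (ip (F.Q u) (F.rough (chartForm α c) u) (chartForm β c u)
      - ip (F.Q u) (chartForm α c u) (F.rough (chartForm β c) u)) * F.rho u) F.W :=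
    (((contDiffOn_ip F.smooth_Q (F.smooth_rough sα) sβ).sub
      (contDiffOn_ip F.smooth_Q sα (F.smooth_rough sβ))).mul (F.contDiffOn_rho hpos)).continuousOn
  have sZ : ContinuousOn (fun u => (ip (F.Q u) (F.zeroth u (chartForm α c u)) (chartForm β c u)
      - ip (F.Q u) (chartForm α c u) (F.zeroth u (chartForm β c u))) * F.rho u) F.W :=
    (((contDiffOn_ip F.smooth_Q (F.smooth_zeroth sα) sβ).sub
      (contDiffOn_ip F.smooth_Q sα (F.smooth_zeroth sβ))).mul (F.contDiffOn_rho hpos)).continuousOn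
  have s1 : ContinuousOn (fun u => ip (F.Q u) (chartForm (lapH g V ε α) c u) (chartForm β c u)
      * F.rho u) F.W :=
    ((contDiffOn_ip F.smooth_Q (hF ▸ smooth_chartForm_W hΔα hε) sβ).mul
      (F.contDiffOn_rho hpos)).continuousOn
  have s2 : ContinuousOn (fun u => ip (F.Q u) (chartForm α c u) (chartForm (lapH g V ε β) c u)
      * F.rho u) F.W :=
    ((contDiffOn_ip F.smooth_Q sα (hF ▸ smooth_chartForm_W hΔβ hε)).mul
      (F.contDiffOn_rho hpos)).continuousOn
  have j1 := integrableOn_of_support F.isOpen hK hKF s1 fun u hu huK => by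
    rw [hl hα u hu, hr0 u hu huK, hα0' u hu huK, F.zeroth_zero, add_zero, ip_zero_left, zero_mul]
  have j2 := integrableOn_of_support F.isOpen hK hKF s2 fun u hu huK => by
    rw [hα0' u hu huK, ip_zero_left, zero_mul]
  have jR := integrableOn_of_support F.isOpen hK hKF sR fun u hu huK => by
    rw [hr0 u hu huK, hα0' u hu huK, ip_zero_left, ip_zero_left, sub_zero, zero_mul]
  have jZ := integrableOn_of_support F.isOpen hK hKF sZ fun u hu huK => by
    rw [hα0' u hu huK, F.zeroth_zero, ip_zero_left, ip_zero_left, sub_zero, zero_mul]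
  rw [← hFW, ← integral_sub j1 j2]
  -- The rough parts contribute nothing to the difference, so only the zeroth order terms remain
  -- under the integral.
  have hR := F.integral_rough hpos hK hKF sα sβ hα0'
  have e := integral_add jR jZ
  rw [hR, zero_add] at e
  rw [← e]
  refine setIntegral_congr_fun F.isOpen.measurableSet fun u hu => ?_
  simp only [hl hα u hu, hl hβ u hu, ip_add_left, ip_add_right]
  ring

end Submersion

end Green

end TGFoliation

end

/-! ### Test forms, partitions of unity and the equivalence. -/

open Bundle Manifold MeasureTheory VectorField
open scoped ContDiff Topology

noncomputable section

namespace TGFoliation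

set_option synthInstance.maxHeartbeats 200000

theorem form_eq_zero_of_lt {d k : ℕ} (h : d < k) (α : Eu d [⋀^Fin k]→L[ℝ] ℝ) : α = 0 := by
  ext v
  refine α.toAlternatingMap.map_linearDependent v fun hv => ?_
  have := hv.fintype_card_le_finrank
  simp only [Fintype.card_fin, finrank_euclideanSpace] at this
  omega

section Lift

variable {d n : ℕ} {M : Type*} [TopologicalSpace M] [ChartedSpace (Eu d) M]
  [IsManifold (𝓡 d) ∞ M] {u : Eu d} {c y z x : M} {k : ℕ}

/-- The form on `M` with prescribed expression in the chart at `c`, zero outside of the chart. -/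
def liftForm (c : M) (ζ : Eu d → Eu d [⋀^Fin k]→L[ℝ] ℝ) : Form d M k := fun y =>
  open scoped Classical in
  if y ∈ (extChartAt (𝓡 d) c).source then
    (ζ (extChartAt (𝓡 d) c y)).compContinuousLinearMap (fderiv ℝ (trans y c) (pt y))
  else (0 : Eu d [⋀^Fin k]→L[ℝ] ℝ)

theorem chartForm_liftForm (ζ : Eu d → Eu d [⋀^Fin k]→L[ℝ] ℝ)
    (hu : u ∈ (extChartAt (𝓡 d) c).target) : chartForm (liftForm c ζ) c u = ζ u := by
  obtain ⟨y, hy⟩ : ∃ y, y = (extChartAt (𝓡 d) c).symm u := ⟨_, rfl⟩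
  have ho : u ∈ overlap c y := hy ▸ mem_overlap_self hu
  have hpt : trans c y u = pt y := by rw [trans, ← hy]
  have hs : y ∈ (extChartAt (𝓡 d) c).source := hy ▸ symm_mem_source hu
  have h1 : liftForm c ζ y
      = (ζ (extChartAt (𝓡 d) c y)).compContinuousLinearMap (fderiv ℝ (trans y c) (pt y)) :=
    if_pos hs
  have h2 : extChartAt (𝓡 d) c y = u := by rw [hy]; exact (extChartAt (𝓡 d) c).right_inv hu
  rw [chartForm_eq, ← hy, h1, h2, C_eq hu, ← hy]
  ext v
  change ζ u (fun i => fderiv ℝ (trans y c) (pt y) (fderiv ℝ (trans c y) u (v i))) = ζ u v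
  simp only [← hpt, fderiv_trans_inv ho]

theorem liftForm_eq_zero {K : Set (Eu d)} {ζ : Eu d → Eu d [⋀^Fin k]→L[ℝ] ℝ}
    (h0 : ∀ u ∉ K, ζ u = 0) (hx : x ∉ (extChartAt (𝓡 d) c).symm '' K) : liftForm c ζ x = 0 := by
  by_cases hs : x ∈ (extChartAt (𝓡 d) c).source
  · refine (if_pos hs).trans ?_
    rw [h0 _ fun h => hx ⟨_, h, (extChartAt (𝓡 d) c).left_inv hs⟩]
    rfl
  · exact if_neg hs

theorem isClosed_symm_image [T2Space M] {K : Set (Eu d)} (hK : IsCompact K)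
    (hKt : K ⊆ (extChartAt (𝓡 d) c).target) : IsClosed ((extChartAt (𝓡 d) c).symm '' K) :=
  (hK.image_of_continuousOn ((continuousOn_extChartAt_symm c).mono hKt)).isClosed

/-- The image of the compact support is closed, as M is Hausdorff, so the extension by zero is
smooth on the complement as well. -/
theorem isSmoothForm_liftForm [T2Space M] {W K : Set (Eu d)} (hW : IsOpen W)
    (hWt : W ⊆ (extChartAt (𝓡 d) c).target) (hK : IsCompact K) (hKW : K ⊆ W)
    {ζ : Eu d → Eu d [⋀^Fin k]→L[ℝ] ℝ} (hζ : ContDiffOn ℝ ∞ ζ W) (h0 : ∀ u ∉ K, ζ u = 0) :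
    IsSmoothForm (liftForm c ζ) := by
  refine isSmoothForm_iff.2 fun x => ?_
  by_cases hx : x ∈ (extChartAt (𝓡 d) c).symm '' K
  · obtain ⟨w, hw, rfl⟩ := hx
    have hwt := hWt (hKW hw)
    obtain ⟨y, hy⟩ : ∃ y, y = (extChartAt (𝓡 d) c).symm w := ⟨_, rfl⟩
    have ho : w ∈ overlap c y := hy ▸ mem_overlap_self hwt
    have hpt : trans c y w = pt y := by rw [trans, ← hy]
    rw [← hy, ← hpt]
    refine contDiffAt_chartForm_of_trans (trans_mem_overlap ho) ?_
    rw [trans_symm ho]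
    refine (hζ.contDiffAt (hW.mem_nhds (hKW hw))).congr_of_eventuallyEq ?_
    filter_upwards [hW.mem_nhds (hKW hw)] with v hv using chartForm_liftForm ζ (hWt hv)
  · refine ContDiffAt.congr_of_eventuallyEq (contDiffAt_const (c := 0)) (chartForm_eventually_zero ?_)
    filter_upwards [(isClosed_symm_image hK (hKW.trans hWt)).isOpen_compl.mem_nhds hx] with y hy
      using liftForm_eq_zero h0 hy

theorem isSmoothForm_smul {f : M → ℝ} (hf : ContMDiff (𝓡 d) 𝓘(ℝ, ℝ) ∞ f) {η : Form d M k}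
    (hη : IsSmoothForm η) : IsSmoothForm (fun x => f x • η x : Form d M k) :=
  isSmoothForm_of_chartForm isOpen_target mem_extChartAt_target
    (fun x => ContDiffOn.smul (f := fun u => f ((extChartAt (𝓡 d) x).symm u))
      (fun _ hu => ((hf.contMDiffAt).comp _ (contMDiffAt_symm hu)).contDiffAt.contDiffWithinAt)
      (contDiffOn_chartForm hη x)) fun _ _ _ => rfl

theorem isSmoothForm_zero : IsSmoothForm (fun _ => 0 : Form d M k) :=
  isSmoothForm_of_chartForm (ζ := fun _ _ => 0) isOpen_target mem_extChartAt_target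
    (fun _ => contDiffOn_const) fun _ _ _ => rfl

end Lift

section Main

variable {d n : ℕ} {M : Type*} [TopologicalSpace M] [ChartedSpace (Eu d) M]
  [IsManifold (𝓡 d) ∞ M] {u : Eu d} {c y z x : M} {k : ℕ} {V : Distribution d M}
  [T2Space M] {g : Metric d M} {ε : ℝ}

theorem AdaptedFrame.rho_pos (F : AdaptedFrame d n) (h : 0 < (F.Q u).det) : 0 < F.rho u := by
  rw [AdaptedFrame.rho, Matrix.det_nonsing_inv, Ring.inverse_eq_inv']
  exact Real.sqrt_pos.2 (inv_pos.2 h)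

namespace Submersion

variable {P : Submersion n V} {hg : IsRiemannianTotallyGeodesic g V} [MeasurableSpace M] [BorelSpace M]

theorem fip_sum_left (hV : IsFoliation n V) (hg : IsRiemannianTotallyGeodesic g V) (hε : 0 < ε)
    {ι : Type*} (s : Finset ι) {η : ι → Form d M k} {ζ : Form d M k}
    (h : ζ x = ∑ a ∈ s, η a x) (β : Form d M k) :
    fip g V ε ζ β x = ∑ a ∈ s, fip g V ε (η a) β x := by
  obtain ⟨P, hP⟩ := exists_submersion hV x
  have e : ∀ α : Form d M k, fip g V ε α β x
      = ip ((P.frm g hg x hε).Q (TGFoliation.pt x)) (fval α x) (fval β x) := fun α => by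
    have := fip_symm_chart hg (pt_mem hP) hε α β
    rwa [extChartAt_to_inv, ← fval_eq, ← fval_eq] at this
  have h' : fval ζ x = ∑ a ∈ s, fval (η a) x := h
  rw [e, h', ip_sum_left]
  exact Finset.sum_congr rfl fun a _ => (e _).symm

theorem ip_zeroth_comm (h : SymmetryCondition g V ε) (hε : 0 < ε) (hu : u ∈ P.W c) :
    ∀ {k : ℕ} (α β : Eu d [⋀^Fin k]→L[ℝ] ℝ),
    ip ((P.frm g hg c hε).Q u) ((P.frm g hg c hε).zeroth u α) β
      = ip ((P.frm g hg c hε).Q u) α ((P.frm g hg c hε).zeroth u β)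
  | 0, _, _ => (ip_zero_left _).trans (ip_zero_right _).symm
  | _ + 1, α, β => LocalFoliation.ip_weitz_comm_of_jCondition hε hu
      (jCondition_of_symmetryCondition h hε hu) α β

/-- A partition of unity splits α into forms supported in foliated charts. For each piece Green's
formula reduces the defect to the zeroth order term, which is symmetric by the condition on J. -/
theorem integral_fip_lapH_comm [CompactSpace M] (hV : IsFoliation n V)
    (hg : IsRiemannianTotallyGeodesic g V) (hε : 0 < ε) (h : SymmetryCondition g V ε)
    {α β : Form d M k} (hα : IsSmoothForm α) (hβ : IsSmoothForm β) :
    ∫ x, fip g V ε (lapH g V ε α) β x ∂(riemVolume (gEps g V ε))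
      = ∫ x, fip g V ε α (lapH g V ε β) x ∂(riemVolume (gEps g V ε)) := by
  choose P hP using exists_submersion hV
  have hUo : ∀ x, IsOpen ((extChartAt (𝓡 d) x).source ∩ (P x).U) := fun x =>
    (isOpen_extChartAt_source x).inter (P x).isOpen
  -- Compactness gives a finite index set, so that Laplacian and integral pass through finite sums.
  obtain ⟨t, ht⟩ := isCompact_univ.elim_finite_subcover
    (fun x => (extChartAt (𝓡 d) x).source ∩ (P x).U) hUo fun x _ =>
      Set.mem_iUnion.2 ⟨x, mem_extChartAt_source x, hP x⟩
  obtain ⟨f, hf⟩ := SmoothPartitionOfUnity.exists_isSubordinate (𝓡 d) (isClosed_univ (X := M))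
    (fun x : t => (extChartAt (𝓡 d) (x : M)).source ∩ (P x).U) (fun x => hUo x) (by
      intro x hx
      obtain ⟨y, hy, hxy⟩ := Set.mem_iUnion₂.1 (ht hx)
      exact Set.mem_iUnion.2 ⟨⟨y, hy⟩, hxy⟩)
  have hsum : ∀ x, ∑ a, f a x = 1 := fun x => by
    rw [← finsum_eq_sum_of_fintype]; exact f.sum_eq_one (Set.mem_univ x)
  have hsm : ∀ a, IsSmoothForm (fun x => f a x • α x : Form d M k) := fun a =>
    isSmoothForm_smul (f a).contMDiff hα
  have hαs : ∀ x, α x = ∑ a, f a x • α x := fun x => by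
    rw [← Finset.sum_smul, hsum, one_smul]
  have hgr : ∀ a, Integrable (fip g V ε (lapH g V ε (fun x => f a x • α x : Form d M k)) β)
        (riemVolume (gEps g V ε)) ∧
      Integrable (fip g V ε (fun x => f a x • α x : Form d M k) (lapH g V ε β))
        (riemVolume (gEps g V ε)) ∧
      ∫ x, fip g V ε (lapH g V ε (fun x => f a x • α x : Form d M k)) β x
          ∂(riemVolume (gEps g V ε))
        = ∫ x, fip g V ε (fun x => f a x • α x : Form d M k) (lapH g V ε β) x
          ∂(riemVolume (gEps g V ε)) := by
    intro a
    have hK : IsCompact (extChartAt (𝓡 d) (a : M) '' tsupport (f a)) :=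
      (isClosed_tsupport _).isCompact.image_of_continuousOn
        ((continuousOn_extChartAt (a : M)).mono ((hf a).trans Set.inter_subset_left))
    have hKW : extChartAt (𝓡 d) (a : M) '' tsupport (f a) ⊆ (P a).W a := by
      rintro _ ⟨x, hx, rfl⟩
      refine ⟨(extChartAt (𝓡 d) (a : M)).map_source (hf a hx).1, ?_⟩
      rw [Set.mem_preimage, (extChartAt (𝓡 d) (a : M)).left_inv (hf a hx).1]
      exact (hf a hx).2
    obtain ⟨i1, i2, e⟩ := green (P := P a) (c := (a : M)) hV hg hε hK hKW (hsm a) hβ fun x hx => by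
      have : x ∉ tsupport (f a) := fun hx' =>
        hx ⟨_, ⟨x, hx', rfl⟩, (extChartAt (𝓡 d) (a : M)).left_inv (hf a hx').1⟩
      change f a x • α x = 0
      rw [image_eq_zero_of_notMem_tsupport this, zero_smul]
    refine ⟨i1, i2, sub_eq_zero.1 (e.trans ?_)⟩
    refine setIntegral_eq_zero_of_forall_eq_zero fun u hu => ?_
    rw [ip_zeroth_comm h hε hu, sub_self, zero_mul]
  have e1 : ∀ x, fip g V ε (lapH g V ε α) β x
      = ∑ a, fip g V ε (lapH g V ε (fun x => f a x • α x : Form d M k)) β x := fun x =>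
    fip_sum_left hV hg hε _ (lapH_sum hV hg hε _ hsm hα hαs x) β
  have e2 : ∀ x, fip g V ε α (lapH g V ε β) x
      = ∑ a, fip g V ε (fun x => f a x • α x : Form d M k) (lapH g V ε β) x := fun x =>
    fip_sum_left hV hg hε _ (hαs x) _
  simp only [e1, e2]
  rw [integral_finsetSum _ fun a _ => (hgr a).1, integral_finsetSum _ fun a _ => (hgr a).2.1]
  exact Finset.sum_congr rfl fun a _ => (hgr a).2.2

/-- Let s be the defect of symmetry for the constant forms α and β, and χ a bump function. Green's
formula for the test forms χ α and χ s β gives ∫ (χ s)² ρ = 0, hence s = 0 where χ = 1. -/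
theorem ip_zeroth_comm_of_integral (hV : IsFoliation n V) (hg : IsRiemannianTotallyGeodesic g V)
    (hε : 0 < ε) (h : ∀ α β : Form d M k, IsSmoothForm α → IsSmoothForm β →
      ∫ x, fip g V ε (lapH g V ε α) β x ∂(riemVolume (gEps g V ε))
        = ∫ x, fip g V ε α (lapH g V ε β) x ∂(riemVolume (gEps g V ε)))
    (hu : u ∈ P.W c) (α β : Eu d [⋀^Fin k]→L[ℝ] ℝ) :
    ip ((P.frm g hg c hε).Q u) ((P.frm g hg c hε).zeroth u α) β
      = ip ((P.frm g hg c hε).Q u) α ((P.frm g hg c hε).zeroth u β) := by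
  obtain ⟨F, hF⟩ : ∃ F, F = P.frm g hg c hε := ⟨_, rfl⟩
  have hFW : F.W = P.W c := by rw [hF]; rfl
  have hpos : ∀ u ∈ F.W, 0 < (F.Q u).det := fun u hu => by
    rw [hF]; exact Q_det_pos hg (hFW ▸ hu) hε
  obtain ⟨s, hs⟩ : ∃ s : Eu d → ℝ, s = fun u =>
    ip (F.Q u) (F.zeroth u α) β - ip (F.Q u) α (F.zeroth u β) := ⟨_, rfl⟩
  have ss : ContDiffOn ℝ ∞ s F.W := hs ▸
    (contDiffOn_ip F.smooth_Q (F.smooth_zeroth contDiffOn_const) contDiffOn_const).sub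
      (contDiffOn_ip F.smooth_Q contDiffOn_const (F.smooth_zeroth contDiffOn_const))
  obtain ⟨χ, hχW, hχc, hχs, -, hχ1⟩ := exists_contDiff_tsupport_subset (n := ⊤)
    ((P.isOpen_W c).mem_nhds hu)
  have hχ0 : ∀ w ∉ tsupport χ, χ w = 0 := fun w hw => image_eq_zero_of_notMem_tsupport hw
  have hχF : tsupport χ ⊆ F.W := hFW ▸ hχW
  have hχo : ContDiffOn ℝ ∞ χ F.W := hχs.contDiffOn
  have hWt : P.W c ⊆ (extChartAt (𝓡 d) c).target := Set.inter_subset_left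
  have z1 : ∀ w ∉ tsupport χ, χ w • α = 0 := fun w hw => by rw [hχ0 w hw, zero_smul]
  have z2 : ∀ w ∉ tsupport χ, (χ w * s w) • β = 0 := fun w hw => by
    rw [hχ0 w hw, zero_mul, zero_smul]
  have s1 := isSmoothForm_liftForm (P.isOpen_W c) hWt hχc hχW
    (ζ := fun w => χ w • α) (hFW ▸ hχo.smul contDiffOn_const) z1
  have s2 := isSmoothForm_liftForm (P.isOpen_W c) hWt hχc hχW
    (ζ := fun w => (χ w * s w) • β) (hFW ▸ (hχo.mul ss).smul contDiffOn_const) z2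
  have e := (green hV hg hε hχc hχW s1 s2 fun x hx => liftForm_eq_zero z1 hx).2.2
  rw [h _ _ s1 s2, sub_self, ← hF, ← hFW] at e
  have e2 : ∫ w in F.W, (χ w * s w) ^ 2 * F.rho w = 0 := by
    refine (setIntegral_congr_fun F.isOpen.measurableSet fun w hw => ?_).trans e.symm
    have hw' := hWt (hFW ▸ hw : w ∈ P.W c)
    simp only [chartForm_liftForm _ hw', F.zeroth_smul, ip_smul_left, ip_smul_right]
    rw [show ip (F.Q w) (F.zeroth w α) β = s w + ip (F.Q w) α (F.zeroth w β) by rw [hs]; ring]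
    ring
  have hc : ContinuousOn (fun w => (χ w * s w) ^ 2 * F.rho w) F.W :=
    (((hχo.mul ss).pow 2).mul (F.contDiffOn_rho hpos)).continuousOn
  have hi := integrableOn_of_support F.isOpen hχc hχF hc fun w _ hw => by
    rw [hχ0 w hw]; ring
  have hz := (setIntegral_eq_zero_iff_of_nonneg_ae (Filter.Eventually.of_forall fun w =>
    mul_nonneg (sq_nonneg _) (Real.sqrt_nonneg _)) hi).1 e2
  have huF : u ∈ F.W := hFW ▸ hu
  -- A continuous function that vanishes almost everywhere on an open set vanishes identically
  -- there, in particular at `u`, where χ = 1 and ρ > 0.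
  have := Measure.eqOn_open_of_ae_eq hz F.isOpen hc continuousOn_const huF
  simp only [hχ1, one_mul, Pi.zero_apply] at this
  have h3 : s u = 0 := by
    rcases mul_eq_zero.1 this with h | h
    · exact pow_eq_zero_iff two_ne_zero |>.1 h
    · exact absurd h (F.rho_pos (hpos u huF)).ne'
  rw [← hF]
  rw [hs] at h3
  exact sub_eq_zero.1 h3

theorem isSymmetricLap_of_symmetryCondition [CompactSpace M] (hV : IsFoliation n V)
    (hg : IsRiemannianTotallyGeodesic g V) (hε : 0 < ε) (h : SymmetryCondition g V ε) :
    IsSymmetricLap g V ε := fun _ _ hα hβ =>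
  Finset.sum_congr rfl fun k _ => integral_fip_lapH_comm hV hg hε h (hα k) (hβ k)

/-- Mixed forms concentrated in one degree: the Laplacian preserves degrees and different degrees
are orthogonal. -/
theorem integral_of_isSymmetricLap (h : IsSymmetricLap g V ε) (k : Fin (d + 1))
    {α β : Form d M k} (hα : IsSmoothForm α) (hβ : IsSmoothForm β) :
    ∫ x, fip g V ε (lapH g V ε α) β x ∂(riemVolume (gEps g V ε))
      = ∫ x, fip g V ε α (lapH g V ε β) x ∂(riemVolume (gEps g V ε)) := by
  have hs : ∀ {γ : Form d M k}, IsSmoothForm γ → ∀ j,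
      IsSmoothForm ((Function.update (fun _ _ => 0) k γ : MixedForm d M) j) := fun {γ} hγ j => by
    by_cases hj : j = k
    · subst hj
      rwa [Function.update_self]
    · rw [Function.update_of_ne hj]
      exact isSmoothForm_zero
  have e := h _ _ (hs hα) (hs hβ)
  have e1 : ∀ A B : MixedForm d M, (∀ j, j ≠ k → (∀ x, A j x = 0) ∨ ∀ x, B j x = 0) →
      l2Inner (gEps g V ε) A B = ∫ x, fip g V ε (A k) (B k) x ∂(riemVolume (gEps g V ε)) := by
    intro A B hAB
    refine Finset.sum_eq_single k (fun j _ hj => ?_) fun hk => absurd (Finset.mem_univ k) hk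
    refine integral_eq_zero_of_ae (Filter.Eventually.of_forall fun x => ?_)
    rcases hAB j hj with h0 | h0
    · exact fip_zero_left (h0 x) _
    · exact fip_zero_right (h0 x) _
  have hz : ∀ (γ : Form d M k) (j), j ≠ k → ∀ x,
      (Function.update (fun _ _ => 0) k γ : MixedForm d M) j x = 0 := fun γ j hj x => by
    rw [Function.update_of_ne hj]
  rw [e1 _ _ fun j hj => Or.inr (hz β j hj), e1 _ _ fun j hj => Or.inl (hz α j hj)] at e
  simpa only [lapMixed, Function.update_self] using e

theorem symmetryCondition_of_isSymmetricLap (hV : IsFoliation n V)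
    (hg : IsRiemannianTotallyGeodesic g V) (hε : 0 < ε) (h : IsSymmetricLap g V ε) :
    SymmetryCondition g V ε := by
  intro x
  obtain ⟨P, hP⟩ := exists_submersion hV x
  have key : ∀ k, ∀ α β : Eu d [⋀^Fin (k + 1)]→L[ℝ] ℝ,
      ip ((P.frm g hg x hε).Q (TGFoliation.pt x))
        ((P.frm g hg x hε).weitz (TGFoliation.pt x) α) β
      = ip ((P.frm g hg x hε).Q (TGFoliation.pt x)) α
        ((P.frm g hg x hε).weitz (TGFoliation.pt x) β) := by
    intro k α β
    -- The hypothesis covers degrees up to `d`. Degree two may exceed this in low dimension, and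
    -- then all forms of that degree vanish.
    by_cases hk : k + 1 < d + 1
    · exact ip_zeroth_comm_of_integral hV hg hε
        (fun _ _ hα hβ => integral_of_isSymmetricLap h ⟨k + 1, hk⟩ hα hβ) (pt_mem hP) α β
    · rw [form_eq_zero_of_lt (by omega) α, form_eq_zero_of_lt (by omega) β, ip_zero_right,
        ip_zero_left]
  exact (nablaJ_eq_iff (hg := hg) hP ε).2
    (LocalFoliation.jCondition_of_ip_weitz_comm hε (pt_mem hP) (key 0) (key 1))

end Submersion

end Main

end TGFoliation

end

theorem proposition2p2 {n m : ℕ} {M : Type*} [TopologicalSpace M] [T2Space M] [CompactSpace M]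
    [ConnectedSpace M] [ChartedSpace (TGFoliation.Eu (n + m)) M] [IsManifold (𝓡 (n + m)) ∞ M]
    [MeasurableSpace M] [BorelSpace M]
    (hori : TGFoliation.IsOrientable (n + m) M)
    (g : TGFoliation.Metric (n + m) M) (V : TGFoliation.Distribution (n + m) M)
    (hV : TGFoliation.IsFoliation n V)
    (hbr : TGFoliation.IsBracketGenerating (TGFoliation.horizontal g V))
    (hg : TGFoliation.IsRiemannianTotallyGeodesic g V)
    (ε : ℝ) (hε : 0 < ε) :
    (TGFoliation.IsSymmetricLap g V ε ↔ TGFoliation.SymmetryCondition g V ε) ∧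
    (TGFoliation.SymmetryCondition g V ε →
      ∀ (x : M) (v w u : TangentSpace (𝓡 (n + m)) x), v ∈ TGFoliation.horizontal g V x →
        TGFoliation.nablaJ g V x v w u = 0) := by
  refine ⟨⟨TGFoliation.Submersion.symmetryCondition_of_isSymmetricLap hV hg hε,
    TGFoliation.Submersion.isSymmetricLap_of_symmetryCondition hV hg hε⟩, fun h x v w u hv => ?_⟩
  obtain ⟨P, hP⟩ := TGFoliation.exists_submersion hV x
  exact TGFoliation.Submersion.nablaJ_of_horizontal hP (h x v w u) hg hv
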